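/- **Kuranishi charts.** Let $X$ be a compact metrizable space. A *Kuranishi chart* $(U,E,\Gamma,s,\psi)$ for $X$ consists of a finite dimensional, Hausdorff, second countable smooth manifold $U$, a finite dimensional real vector space $E$, a finite group $\Gamma$ acting smoothly on $U$ and linearly on $E$, a smooth $\Gamma$-equivariant map $s:U\to E$, and a $\Gamma$-invariant map $\psi:s^{-1}(0)\to X$ that induces a homeomorphism from $s^{-1}(0)/\Gamma$ onto an open set $F\subset X$, the *footprint*. Write $\underline U=U/\Gamma$ and $\underline{U\times E}=(U\times E)/\Gamma$ (diagonal action) with the quotient topologies. **Atlases.** Fix finite groups $\Gamma_i$ with finite dimensional representations $E_i$, $i=1,\dots,N$, put $\Gamma_I=\prod_{i\in I}\Gamma_i$, $E_I=\prod_{i\in I}E_i$ for $I\subset\{1,\dots,N\}$, and fix $d\in\mathbb Z$. A *weak Kuranishi atlas* $\mathcal K$ of dimension $d$ on $X$ consists of an open cover $F_1,\dots,F_N$ of $X$; for each $I$ in the index set $\mathcal I_{\mathcal K}=\{I\neq\emptyset : F_I:=\bigcap_{i\in I}F_i\ne\emptyset\}$ a Kuranishi chart $(U_I,E_I,\Gamma_I,s_I,\psi_I)$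 with footprint $F_I$ and $\dim U_I-\dim E_I=d$, $\partial U_I=\emptyset$; and for $I\subsetneq J$ in $\mathcal I_{\mathcal K}$ a coordinate change, i.e. an open subset $\underline U_{IJ}\subset\underline U_I$, with preimage $U_{IJ}\subset U_I$, such that $U_{IJ}\cap s_I^{-1}(0)=\psi_I^{-1}(F_J)$, a $\Gamma_J$-invariant submanifold $\widetilde U_{IJ}\subset U_J$ on which $\Gamma_{J\smallsetminus I}=\ker(\Gamma_J\to\Gamma_I)$ acts freely, and a map $\rho_{IJ}:\widetilde U_{IJ}\to U_I$ with image $U_{IJ}$ that is equivariant with respect to $\Gamma_J\to\Gamma_I$ and induces a diffeomorphism $\widetilde U_{IJ}/\Gamma_{J\smallsetminus I}\cong U_{IJ}$, with $s_J=s_I\circ\rho_{IJ}$ on $\widetilde U_{IJ}$ (using $E_I\subset E_J$) and $\psi_J=\psi_I\circ\rho_{IJ}$ on $\widetilde U_{IJ}\cap s_J^{-1}(0)$, and satisfying the index condition: at every $u\in\widetilde U_{IJ}$ the inclusions $T_u\widetilde U_{IJ}\subset T_uU_J$ and $E_I\subset E_J$ induce isomorphisms from the kernel and cokernel of $d_u(s_I\circ\rho_{IJ})$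 to those of $d_us_J$. For $I\subsetneq J\subsetneq K$ the weak cocycle condition $\rho_{IK}=\rho_{IJ}\circ\rho_{JK}$ is required on $\widetilde U_{IK}\cap\rho_{JK}^{-1}(\widetilde U_{IJ})$. Let $\underline\phi_{IJ}:\underline U_{IJ}\to\underline U_J$ be the map inverse to the one induced by $\rho_{IJ}$. The realization $|\mathcal K|$ is the quotient of $\bigsqcup_IU_I$ by the equivalence relation generated by the $\Gamma_I$-actions and by $y\sim\rho_{IJ}(y)$ for $y\in\widetilde U_{IJ}$. The realization $|\mathbf E_{\mathcal K}|$ is the quotient of $\bigsqcup_IU_I\times E_I$ by the equivalence relation generated by the diagonal actions and by $(y,e)\sim(\rho_{IJ}(y),e)$ for $y\in\widetilde U_{IJ}$, $e\in E_I\subset E_J$. Both carry the quotient topology. $\mathcal K$ is *tame* if $\underline U_{IJ}\cap\underline U_{IK}=\underline U_{I(J\cup K)}$ for all $I\subset J,K$ and $\underline\phi_{IJ}(\underline U_{IK})=\underline U_{JK}\cap\underline s_J^{-1}(\underline{U_J\times E_I})$ for all $I\subset J\subset K$, where $\underline s_J:\underline U_J\to\underline{U_J\times E_J}$ is the section induced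 by $s_J$, $I,J,K\in\mathcal I_{\mathcal K}$, $\underline U_{II}=\underline U_I$, $\underline\phi_{II}=\mathrm{id}$, and $\underline U_{IL}=\emptyset$ for $L\notin\mathcal I_{\mathcal K}$. A *shrinking* of $\mathcal K$ is a weak atlas $\mathcal K'$ with the same $\Gamma_i,E_i$, with $F_i'\subset F_i$ precompact (closure compact and contained in $F_i$), with $\mathcal I_{\mathcal K'}=\mathcal I_{\mathcal K}$, whose charts are the restrictions of those of $\mathcal K$ to precompact open subsets $\underline U_I'\subset\underline U_I$, and whose coordinate changes are the restrictions of those of $\mathcal K$ to $\underline U_{IJ}'=\underline\phi_{IJ}^{-1}(\underline U_J')\cap\underline U_I'$. A *preshrunk tame shrinking* of $\mathcal K$ is a tame shrinking of $\mathcal K$ which is a shrinking of a tame shrinking of $\mathcal K$. **Cobordisms.** Put $A^0_\varepsilon=[0,\varepsilon)$, $A^1_\varepsilon=(1-\varepsilon,1]$. A *collared cobordism* is a compact metrizable space $Y$ with disjoint closed subsets $\partial^0Y,\partial^1Y$ and, for some $0<\varepsilon<\frac12$, homeomorphisms $\iota^\alpha$ from $A^\alpha_\varepsilon\times\partial^\alpha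 Y$ onto disjoint open subsets of $Y$ that extend $(\alpha,y)\mapsto y$; for example $Y=[0,1]\times X$, the trivial cobordism. A *weak Kuranishi cobordism* $\mathcal K$ of dimension $d+1$ on $Y$ is defined like a weak atlas of dimension $d+1$ on $Y$, except that the domains $U_I$ may have boundary and that it comes with weak atlases $\partial^\alpha\mathcal K$ of dimension $d$ on $\partial^\alpha Y$, $\alpha=0,1$, with the same $\Gamma_i,E_i$ and with charts $(\partial^\alpha U_I,E_I,\Gamma_I,s_I^\alpha,\psi_I^\alpha)$ for $I\in\mathcal I_{\partial^\alpha\mathcal K}\subset\mathcal I_{\mathcal K}$, and with smooth open embeddings (diffeomorphisms onto open subsets) $\iota^\alpha_I:A^\alpha_\varepsilon\times\partial^\alpha U_I\to U_I$, for some $\varepsilon>0$ not larger than the collar width of $Y$, such that: the basic footprints satisfy $\iota^\alpha(t,b)\in F_i\iff b\in\partial^\alpha F_i$ for $t\in A^\alpha_\varepsilon$; the images of $\iota_I^0,\iota_I^1$ are disjoint; the closed tubes $\iota^\alpha_I(\{t:|t-\alpha|\le\delta\}\times\partial^\alpha U_I)$, $0\le\delta<\varepsilon$, are closed in $U_I$;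 the boundary of the manifold $U_I$ is the union of the sets $\iota_I^\alpha(\{\alpha\}\times\partial^\alpha U_I)$; by means of the maps $\iota_I^\alpha,\iota^\alpha$ the actions, sections, footprint maps and coordinate changes of $\mathcal K$ between indices in $\mathcal I_{\partial^\alpha\mathcal K}$ are over $A^\alpha_\varepsilon$ the products with $A^\alpha_\varepsilon$ of those of $\partial^\alpha\mathcal K$; and for $I\in\mathcal I_{\partial^\alpha\mathcal K}$ and $I\subsetneq J\in\mathcal I_{\mathcal K}\smallsetminus\mathcal I_{\partial^\alpha\mathcal K}$ the set $U_{IJ}$ is disjoint from the image of $\iota_I^\alpha$. Realizations, tameness, shrinkings and preshrunk tame shrinkings are defined as for atlases, where for shrinkings the subsets $U_I'\subset U_I$ are required to be collared: for some $\delta>0$ and all $I\in\mathcal I_{\partial^\alpha\mathcal K}$, either $U_I'\cap\iota_I^\alpha(A^\alpha_\delta\times\partial^\alpha U_I)=\iota_I^\alpha(A_\delta^\alpha\times\partial^\alpha U_I')$ for a nonempty open $\partial^\alpha U'_I\subset\partial^\alpha U_I$, which is the domain of the chart of $\partial^\alpha\mathcal K'$, with the restricted collar, or $U_I'$ is disjoint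 from $\iota_I^\alpha(A^\alpha_\delta\times\partial^\alpha U_I)$ and $I\notin\mathcal I_{\partial^\alpha\mathcal K'}$. **Metrics.** An *admissible metric* on $|\mathcal K|$ is a bounded metric on this set whose pullback to $\underline U_I$ under $\underline U_I\to|\mathcal K|$ induces the quotient topology of $\underline U_I$, for every $I\in\mathcal I_{\mathcal K}$. An admissible metric $D$ on the realization of a cobordism is *collared* if for some $\varepsilon>0$ and each $\alpha$, with the collar maps $A^\alpha_\varepsilon\times|\partial^\alpha\mathcal K|\to|\mathcal K|$, $(t,p)\mapsto t*p$, induced by the $\iota_I^\alpha$, one has $D(t*p,t'*p')=|t-t'|+D(\alpha*p,\alpha*p')$, and $D(z,t*p)\ge\varepsilon-|t-\alpha|$ for all $z$ outside the image of this collar map. Pairs $(\mathcal K^0,d_0),(\mathcal K^1,d_1)$ of weak atlases on $X$ with admissible metrics on their realizations are *metric tame concordant* if there is a tame Kuranishi cobordism $\mathcal L$ on $[0,1]\times X$ with a collared admissible metric $D$ such that $\partial^\alpha\mathcal L=\mathcal K^\alpha$ and such that $D$ restricts to $d_\alpha$ on $|\partial^\alpha\mathcal L|$, for $\alpha=0,1$.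 **Theorem.** Let $X$ be a compact metrizable space and let $Y$ be a collared cobordism. (i) Every weak Kuranishi atlas on $X$ and every weak Kuranishi cobordism on $Y$ has a preshrunk tame shrinking. (ii) For every tame Kuranishi atlas on $X$ or cobordism on $Y$, $\mathcal K$, the realizations $|\mathcal K|$ and $|\mathbf E_{\mathcal K}|$ are Hausdorff in the quotient topology, and for each $I\in\mathcal I_{\mathcal K}$ the projections $\underline U_I\to|\mathcal K|$ and $\underline{U_I\times E_I}\to|\mathbf E_{\mathcal K}|$ are homeomorphisms onto their images. (iii) If $\mathcal K'$ is a preshrunk tame shrinking of a weak Kuranishi atlas or cobordism, then there is an admissible metric on $|\mathcal K'|$; in the case of a cobordism it can be taken to be collared. (iv) If $\mathcal K^0,\mathcal K^1$ are preshrunk tame shrinkings of one weak Kuranishi atlas on $X$ and $d_0,d_1$ are admissible metrics on $|\mathcal K^0|,|\mathcal K^1|$, then $(\mathcal K^0,d_0)$ and $(\mathcal K^1,d_1)$ are metric tame concordant. -/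

import Mathlib

open Set Topology TopologicalSpace Manifold
open scoped ContDiff

universe u v w

noncomputable section

namespace Kuranishi

/-! ### Smooth structures and group quotients -/

/-- A smooth (`C^∞`), finite dimensional structure on a topological space `M`, possibly with
boundary.  The dimension is `Module.finrank ℝ V`. -/
structure SmoothStr (M : Type v) [TopologicalSpace M] where
  V : Type
  [normedV : NormedAddCommGroup V]
  [spaceV : NormedSpace ℝ V]
  [finV : FiniteDimensional ℝ V]
  H : Type
  [topH : TopologicalSpace H]
  I : ModelWithCorners ℝ V H
  [charted : ChartedSpace H M]
  [manifold : IsManifold I ∞ M]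

attribute [instance] SmoothStr.normedV SmoothStr.spaceV SmoothStr.finV SmoothStr.topH
  SmoothStr.charted SmoothStr.manifold

/-- The product smooth structure on `[0,1] × M`. -/
def SmoothStr.unitProd {M : Type v} [TopologicalSpace M] (S : SmoothStr M) :
    SmoothStr (Icc (0 : ℝ) 1 × M) where
  V := EuclideanSpace ℝ (Fin 1) × S.V
  H := ModelProd (EuclideanHalfSpace 1) S.H
  I := (𝓡∂ 1).prod S.I

/-- The equivalence relation on `U × E` whose classes are the orbits of the diagonal action. -/
def diagSetoid {G : Type w} [Group G] {E : Type w} [AddCommGroup E] [Module ℝ E]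
    (τ : Representation ℝ G E) (U : Type v) [MulAction G U] : Setoid (U × E) where
  r p q := ∃ g : G, g • p.1 = q.1 ∧ τ g p.2 = q.2
  iseqv :=
    { refl := fun p => ⟨1, by simp⟩
      symm := by
        rintro p q ⟨g, h1, h2⟩
        refine ⟨g⁻¹, by rw [← h1, inv_smul_smul], ?_⟩
        rw [← h2, ← Module.End.mul_apply, ← map_mul, inv_mul_cancel, map_one,
          Module.End.one_apply]
      trans := by
        rintro p q r ⟨g, h1, h2⟩ ⟨k, h3, h4⟩
        refine ⟨k * g, by rw [mul_smul, h1, h3], ?_⟩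
        rw [map_mul, Module.End.mul_apply, h2, h4] }

/-! ### Kuranishi charts -/

/-- A Kuranishi chart `(U, E, Γ, s, ψ)` for `X` with isotropy group `G = Γ` acting linearly on the
obstruction space `E` by `τ`.  (The norm on `E` only serves to express smoothness.)  The domain is
allowed to have boundary; this is excluded separately for charts of an atlas. -/
structure Chart (X : Type u) [TopologicalSpace X] {G : Type w} [Group G] {E : Type w}
    [NormedAddCommGroup E] [NormedSpace ℝ E] (τ : Representation ℝ G E) where
  /-- the domain: a Hausdorff, second countable smooth manifold -/
  U : Type v
  [top : TopologicalSpace U]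
  [t2 : T2Space U]
  [secondCountable : SecondCountableTopology U]
  smooth : SmoothStr U
  /-- the smooth action of the isotropy group on the domain -/
  [act : MulAction G U]
  smooth_smul : ∀ g : G, ContMDiff smooth.I smooth.I ∞ (fun u : U => g • u)
  /-- the section, smooth and equivariant -/
  s : U → E
  s_smooth : ContMDiff smooth.I 𝓘(ℝ, E) ∞ s
  s_equiv : ∀ (g : G) (u : U), s (g • u) = τ g (s u)
  /-- the footprint map on the zero set of the section -/
  ψ : {u : U // s u = 0} → X
  ψ_inv : ∀ x y : {u : U // s u = 0},
    (MulAction.orbitRel G U).comap Subtype.val x y → ψ x = ψ y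
  /-- the induced map from the quotient of the zero set is a homeomorphism onto an open set -/
  ψ_homeo : IsOpenEmbedding
    (Quotient.lift ψ ψ_inv :
      Quotient ((MulAction.orbitRel G U).comap (Subtype.val : {u : U // s u = 0} → U)) → X)

attribute [instance] Chart.top Chart.t2 Chart.secondCountable Chart.act

/-- The footprint of a chart. -/
def Chart.footprint {X : Type u} [TopologicalSpace X] {G : Type w} [Group G] {E : Type w}
    [NormedAddCommGroup E] [NormedSpace ℝ E] {τ : Representation ℝ G E}
    (K : Chart.{u, v, w} X τ) : Set X :=
  range K.ψ

/-- A coordinate change from `K` to `K'`, relative to a group homomorphism `pr : Γ' → Γ` and a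
linear map `inc : E → E'`.  Open subsets of the quotient `U/Γ` are represented by the
corresponding invariant open subsets of `U`. -/
structure CoordChange {X : Type u} [TopologicalSpace X]
    {G : Type w} [Group G] {E : Type w} [NormedAddCommGroup E] [NormedSpace ℝ E]
    {τ : Representation ℝ G E}
    {G' : Type w} [Group G'] {E' : Type w} [NormedAddCommGroup E'] [NormedSpace ℝ E']
    {τ' : Representation ℝ G' E'}
    (K : Chart.{u, v, w} X τ) (K' : Chart.{u, v, w} X τ') (pr : G' →* G) (inc : E →ₗ[ℝ] E') where
  /-- the (preimage in `U` of the) domain: an invariant open subset that defines a restriction of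
  `K` to the footprint of `K'` -/
  dom : Set K.U
  dom_open : IsOpen dom
  dom_smul : ∀ (g : G), ∀ u ∈ dom, g • u ∈ dom
  dom_foot : ∀ z : {u : K.U // K.s u = 0}, z.1 ∈ dom ↔ K.ψ z ∈ K'.footprint
  /-- the lifted domain, an invariant subset of `U'` on which `ker pr` acts freely -/
  lift : Set K'.U
  lift_smul : ∀ (g : G'), ∀ u ∈ lift, g • u ∈ lift
  lift_free : ∀ g ∈ pr.ker, ∀ u ∈ lift, g • u = u → g = 1
  /-- the covering map: equivariant, with image the domain, and with fibres the `ker pr`-orbits -/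
  ρ : lift → K.U
  ρ_range : range ρ = dom
  ρ_equiv : ∀ (g : G') (u : lift), ρ ⟨g • u.1, lift_smul g u.1 u.2⟩ = pr g • ρ u
  ρ_fiber : ∀ u u' : lift, ρ u = ρ u' ↔ ∃ g ∈ pr.ker, g • u.1 = u'.1
  /-- the sections and footprint maps are intertwined -/
  ρ_s : ∀ u : lift, K'.s u.1 = inc (K.s (ρ u))
  ρ_ψ : ∀ (u : lift) (h' : K'.s u.1 = 0) (h : K.s (ρ u) = 0), K'.ψ ⟨u.1, h'⟩ = K.ψ ⟨ρ u, h⟩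
  /-- the lifted domain is a submanifold, `ρ` is a local diffeomorphism (so that the bijection
  `lift / ker pr → dom` that it induces is a diffeomorphism), and the index condition holds: the
  inclusions of `lift` and of `E` identify the kernels and cokernels of the differentials of
  `s ∘ ρ` and of `s'` -/
  smooth_lift : ∃ S : SmoothStr lift,
    IsSmoothEmbedding S.I K'.smooth.I ∞ (Subtype.val : lift → K'.U) ∧
    IsLocalDiffeomorph S.I K.smooth.I ∞ ρ ∧
    ∀ u : lift,
      (∀ ξ : TangentSpace K'.smooth.I u.1,
        mfderiv K'.smooth.I 𝓘(ℝ, E') K'.s u.1 ξ = 0 ↔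
          ∃ η : TangentSpace S.I u,
            mfderiv S.I 𝓘(ℝ, E) (fun y => K.s (ρ y)) u η = 0 ∧
            mfderiv S.I K'.smooth.I (Subtype.val : lift → K'.U) u η = ξ) ∧
      (∀ C : Submodule ℝ E,
        IsCompl (LinearMap.range
          (mfderiv S.I 𝓘(ℝ, E) (fun y => K.s (ρ y)) u : S.V →L[ℝ] E).toLinearMap) C →
        IsCompl (LinearMap.range
          (mfderiv K'.smooth.I 𝓘(ℝ, E') K'.s u.1 : K'.smooth.V →L[ℝ] E').toLinearMap) (C.map inc))

/-! ### Weak Kuranishi atlases -/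

/-- The isotropy groups and obstruction spaces of `N` basic charts. -/
structure BasicData (N : ℕ) where
  Γ : Fin N → Type w
  [group : ∀ i, Group (Γ i)]
  [finite : ∀ i, Finite (Γ i)]
  E : Fin N → Type w
  [normedE : ∀ i, NormedAddCommGroup (E i)]
  [spaceE : ∀ i, NormedSpace ℝ (E i)]
  [finE : ∀ i, FiniteDimensional ℝ (E i)]
  τ : ∀ i, Representation ℝ (Γ i) (E i)

attribute [instance] BasicData.group BasicData.finite BasicData.normedE BasicData.spaceE
  BasicData.finE

namespace BasicData

variable {N : ℕ} (P : BasicData.{w} N)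

/-- `Γ_I = ∏_{i ∈ I} Γ_i`. -/
abbrev ΓI (I : Finset (Fin N)) : Type w := ∀ i : I, P.Γ i

/-- `E_I = ∏_{i ∈ I} E_i`. -/
abbrev EI (I : Finset (Fin N)) : Type w := ∀ i : I, P.E i

/-- The product action of `Γ_I` on `E_I`. -/
def τI (I : Finset (Fin N)) : Representation ℝ (P.ΓI I) (P.EI I) where
  toFun g := LinearMap.pi fun i => P.τ i (g i) ∘ₗ LinearMap.proj i
  map_one' := by ext; simp
  map_mul' g h := by ext; simp

/-- The natural projection `Γ_J → Γ_I` for `I ⊆ J`. -/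
def proj {I J : Finset (Fin N)} (h : I ⊆ J) : P.ΓI J →* P.ΓI I where
  toFun g i := g ⟨i.1, h i.2⟩
  map_one' := rfl
  map_mul' _ _ := rfl

/-- The natural inclusion `E_I → E_J` for `I ⊆ J`, extending by zero. -/
def incl {I J : Finset (Fin N)} (_h : I ⊆ J) : P.EI I →ₗ[ℝ] P.EI J where
  toFun e j := if hj : j.1 ∈ I then e ⟨j.1, hj⟩ else 0
  map_add' e f := by
    ext j
    by_cases hj : j.1 ∈ I <;> simp [hj]
  map_smul' c e := by
    ext j
    by_cases hj : j.1 ∈ I <;> simp [hj]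

end BasicData

/-- `I` is a nonempty index set with nonempty footprint `F_I = ⋂_{i ∈ I} F_i`. -/
def IsIdx {N : ℕ} {X : Type u} (F : Fin N → Set X) (I : Finset (Fin N)) : Prop :=
  I.Nonempty ∧ (⋂ i ∈ I, F i).Nonempty

/-- The index set `𝓘_𝒦` of an atlas with basic footprints `F`. -/
abbrev Idx {N : ℕ} {X : Type u} (F : Fin N → Set X) : Type :=
  {I : Finset (Fin N) // IsIdx F I}

/-- A covering family of basic charts with transition data of dimension `d` that satisfies the weak
cocycle condition.  The chart domains may have boundary. -/
structure WeakSystem {N : ℕ} (P : BasicData.{w} N) (X : Type u) [TopologicalSpace X] (d : ℤ) where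
  /-- the footprints of the basic charts -/
  F : Fin N → Set X
  cover : ⋃ i, F i = univ
  F_open : ∀ i, IsOpen (F i)
  chart : ∀ I : Idx F, Chart.{u, v, w} X (P.τI I.1)
  chart_foot : ∀ I : Idx F, (chart I).footprint = ⋂ i ∈ I.1, F i
  chart_dim : ∀ I : Idx F,
    (Module.finrank ℝ (chart I).smooth.V : ℤ) - Module.finrank ℝ (P.EI I.1) = d
  change : ∀ (I J : Idx F) (h : I.1 ⊂ J.1),
    CoordChange (chart I) (chart J) (P.proj h.subset) (P.incl h.subset)
  /-- the weak cocycle condition -/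
  cocycle : ∀ (I J K : Idx F) (hIJ : I.1 ⊂ J.1) (hJK : J.1 ⊂ K.1) (z : (chart K).U)
    (hIK : z ∈ (change I K (hIJ.trans hJK)).lift) (hz : z ∈ (change J K hJK).lift)
    (hy : (change J K hJK).ρ ⟨z, hz⟩ ∈ (change I J hIJ).lift),
    (change I K (hIJ.trans hJK)).ρ ⟨z, hIK⟩ = (change I J hIJ).ρ ⟨(change J K hJK).ρ ⟨z, hz⟩, hy⟩

/-- A weak Kuranishi atlas: no chart domain has boundary. -/
structure WeakAtlas {N : ℕ} (P : BasicData.{w} N) (X : Type u) [TopologicalSpace X] (d : ℤ) extends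
    WeakSystem.{u, v, w} P X d where
  boundaryless : ∀ I : Idx F, (chart I).smooth.I.boundary (chart I).U = ∅

namespace WeakSystem

variable {N : ℕ} {P : BasicData.{w} N} {X : Type u} [TopologicalSpace X] {d : ℤ}
  (K : WeakSystem.{u, v, w} P X d)

/-- The domain `U_I` of the chart with index `I`. -/
abbrev U (I : Idx K.F) : Type v := (K.chart I).U

/-! #### Realizations -/

/-- The morphisms of the domain category `𝐁_𝒦`, as a relation on its objects `⨆_I U_I`. -/
inductive Mor : (Σ I : Idx K.F, K.U I) → (Σ I : Idx K.F, K.U I) → Prop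
  | act (I : Idx K.F) (γ : P.ΓI I.1) (x : K.U I) : Mor ⟨I, γ⁻¹ • x⟩ ⟨I, x⟩
  | change (I J : Idx K.F) (h : I.1 ⊂ J.1) (y : (K.change I J h).lift) (γ : P.ΓI I.1) :
      Mor ⟨I, γ⁻¹ • (K.change I J h).ρ y⟩ ⟨J, y.1⟩

/-- The realization `|𝒦|`: the quotient of `⨆_I U_I` by the equivalence relation generated by the
morphisms, with the quotient topology. -/
def Real : Type v := Quot K.Mor

instance : TopologicalSpace K.Real := inferInstanceAs (TopologicalSpace (Quot K.Mor))

/-- The morphisms of the obstruction category `𝐄_𝒦`, as a relation on its objects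
`⨆_I U_I × E_I`. -/
inductive MorE : (Σ I : Idx K.F, K.U I × P.EI I.1) → (Σ I : Idx K.F, K.U I × P.EI I.1) → Prop
  | act (I : Idx K.F) (γ : P.ΓI I.1) (x : K.U I) (e : P.EI I.1) :
      MorE ⟨I, (γ⁻¹ • x, P.τI I.1 γ⁻¹ e)⟩ ⟨I, (x, e)⟩
  | change (I J : Idx K.F) (h : I.1 ⊂ J.1) (y : (K.change I J h).lift) (e : P.EI I.1)
      (γ : P.ΓI I.1) :
      MorE ⟨I, (γ⁻¹ • (K.change I J h).ρ y, P.τI I.1 γ⁻¹ e)⟩ ⟨J, (y.1, P.incl h.subset e)⟩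

/-- The realization `|𝐄_𝒦|` of the obstruction category. -/
def RealE : Type (max v w) := Quot K.MorE

instance : TopologicalSpace K.RealE := inferInstanceAs (TopologicalSpace (Quot K.MorE))

/-- The projection `U_I → |𝒦|`. -/
def π (I : Idx K.F) (x : K.U I) : K.Real := Quot.mk _ ⟨I, x⟩

/-- The intermediate domain `U_I / Γ_I` with the quotient topology. -/
abbrev Ubar (I : Idx K.F) : Type v := Quotient (MulAction.orbitRel (P.ΓI I.1) (K.U I))

/-- The total space `(U_I × E_I) / Γ_I` of the intermediate obstruction bundle. -/
abbrev Ebar (I : Idx K.F) : Type (max v w) := Quotient (diagSetoid (P.τI I.1) (K.U I))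

/-- The projection `U_I / Γ_I → |𝒦|`. -/
def πbar (I : Idx K.F) : K.Ubar I → K.Real :=
  Quotient.lift (K.π I) (by
    rintro x y ⟨g, hg⟩
    have h := Quot.sound (Mor.act (K := K) I g⁻¹ y)
    rw [inv_inv] at h
    have hg' : g • y = x := hg
    rw [hg'] at h
    exact h)

/-- The projection `(U_I × E_I) / Γ_I → |𝐄_𝒦|`. -/
def πEbar (I : Idx K.F) : K.Ebar I → K.RealE :=
  Quotient.lift (fun p : K.U I × P.EI I.1 => (Quot.mk K.MorE ⟨I, p⟩ : K.RealE)) (by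
    rintro ⟨x, e⟩ ⟨y, f⟩ ⟨g, hg, hf⟩
    have h := Quot.sound (MorE.act (K := K) I g⁻¹ x e)
    rw [inv_inv] at h
    simp only at hg hf
    rw [hg, hf] at h
    exact h.symm)

/-! #### Tameness -/

/-- The preimage in `U_I` of the domain of the coordinate change from `I` to `J`, with the
conventions `U_{II} = U_I`, and `U_{IJ} = ∅` if `J` is not an index of the atlas. -/
def UIJ (I : Idx K.F) (J : Finset (Fin N)) : Set (K.U I) :=
  {x | J = I.1 ∨ ∃ (hJ : IsIdx K.F J) (h : I.1 ⊂ J), x ∈ (K.change I ⟨J, hJ⟩ h).dom}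

/-- Tameness.  All sets involved are invariant, and the two identities are those between subsets of
the intermediate domains, pulled back to the chart domains:
`U_{IJ} ∩ U_{IK} = U_{I(J ∪ K)}` for `I ⊆ J, K`, and
`φ_{IJ}(U_{IK}) = U_{JK} ∩ s_J⁻¹(E_I)` for `I ⊆ J ⊆ K`, where the preimage of `φ_{IJ}(U_{IK})`
consists of the points of the lifted domain that `ρ_{IJ}` maps to `U_{IK}`.
(The second one is void for `I = J`.) -/
structure IsTame : Prop where
  inter : ∀ (I J K' : Idx K.F), I.1 ⊆ J.1 → I.1 ⊆ K'.1 →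
    K.UIJ I J.1 ∩ K.UIJ I K'.1 = K.UIJ I (J.1 ∪ K'.1)
  image : ∀ (I J K' : Idx K.F) (h : I.1 ⊂ J.1), J.1 ⊆ K'.1 → ∀ y : K.U J,
    (∃ hy : y ∈ (K.change I J h).lift, (K.change I J h).ρ ⟨y, hy⟩ ∈ K.UIJ I K'.1) ↔
      y ∈ K.UIJ J K'.1 ∧ (K.chart J).s y ∈ LinearMap.range (P.incl h.subset)

/-! #### Shrinkings -/

variable {K}

/-- The data that exhibit `K'` as a shrinking of `K`: equivariant open embeddings of the chart
domains of `K'` onto precompact open subsets of the chart domains of `K`, that identify the charts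
and coordinate changes of `K'` with the restrictions of those of `K`. -/
structure ShrinkMaps (K' K : WeakSystem.{u, v, w} P X d) where
  /-- `F'_i` is precompact in `F_i` -/
  F_precompact : ∀ i, IsCompact (closure (K'.F i)) ∧ closure (K'.F i) ⊆ K.F i
  idx_iff : ∀ I, IsIdx K.F I ↔ IsIdx K'.F I
  j : ∀ (I : Idx K'.F), K'.U I → K.U ⟨I.1, (idx_iff I.1).2 I.2⟩
  j_embedding : ∀ I, IsOpenEmbedding (j I)
  j_diffeo : ∀ I : Idx K'.F, IsLocalDiffeomorph (K'.chart I).smooth.I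
    (K.chart ⟨I.1, (idx_iff I.1).2 I.2⟩).smooth.I ∞ (j I)
  j_equiv : ∀ I (g : P.ΓI I.1) x, j I (g • x) = g • j I x
  j_s : ∀ I x, (K.chart _).s (j I x) = (K'.chart I).s x
  j_ψ : ∀ I x (h' : (K'.chart I).s x = 0) (h : (K.chart _).s (j I x) = 0),
    (K.chart _).ψ ⟨j I x, h⟩ = (K'.chart I).ψ ⟨x, h'⟩
  j_precompact : ∀ I, IsCompact (closure (range (j I)))
  /-- the domain of the coordinate change is `φ_{IJ}⁻¹(U'_J) ∩ U'_I`, expressed by its lift -/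
  j_lift : ∀ (I J : Idx K'.F) (h : I.1 ⊂ J.1) (y : K'.U J),
    y ∈ (K'.change I J h).lift ↔
      ∃ hy : j J y ∈ (K.change ⟨I.1, (idx_iff I.1).2 I.2⟩ ⟨J.1, (idx_iff J.1).2 J.2⟩ h).lift,
        (K.change _ _ h).ρ ⟨j J y, hy⟩ ∈ range (j I)
  j_ρ : ∀ (I J : Idx K'.F) (h : I.1 ⊂ J.1) (y : (K'.change I J h).lift)
    (hy : j J y.1 ∈ (K.change ⟨I.1, (idx_iff I.1).2 I.2⟩ ⟨J.1, (idx_iff J.1).2 J.2⟩ h).lift),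
    (K.change _ _ h).ρ ⟨j J y.1, hy⟩ = j I ((K'.change I J h).ρ y)

/-! #### Admissible metrics -/

variable (K)

/-- An admissible metric on `|𝒦|`: a bounded metric on this set whose pullback to each
intermediate domain induces the quotient topology. -/
structure IsAdmissible (D : K.Real → K.Real → ℝ) : Prop where
  eq_zero_iff : ∀ p q, D p q = 0 ↔ p = q
  symm : ∀ p q, D p q = D q p
  triangle : ∀ p q r, D p r ≤ D p q + D q r
  bounded : ∃ C, ∀ p q, D p q ≤ C
  topology : ∀ (I : Idx K.F) (x : K.Ubar I),
    (𝓝 x).HasBasis (fun r : ℝ => 0 < r) (fun r => {y | D (K.πbar I x) (K.πbar I y) < r})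

end WeakSystem

namespace WeakAtlas

variable {N : ℕ} {P : BasicData.{w} N} {X : Type u} [TopologicalSpace X] {d : ℤ}

/-- `K'` is a shrinking of the weak atlas `K`. -/
def IsShrinking (K' K : WeakAtlas.{u, v, w} P X d) : Prop :=
  Nonempty (WeakSystem.ShrinkMaps K'.toWeakSystem K.toWeakSystem)

/-- `K'` is a preshrunk tame shrinking of `K`: tame, and a shrinking of a tame shrinking of `K`. -/
def IsPreshrunkTame (K' K : WeakAtlas.{u, v, w} P X d) : Prop :=
  K'.IsTame ∧ ∃ K'' : WeakAtlas.{u, v, w} P X d,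
    K''.IsTame ∧ K''.IsShrinking K ∧ K'.IsShrinking K''

end WeakAtlas

/-! ### Collared cobordisms -/

/-- The endpoints `0, 1` of the unit interval, indexed by `false, true`. -/
def endpt (α : Bool) : Icc (0 : ℝ) 1 := if α then 1 else 0

/-- `A^0_ε = [0, ε)` and `A^1_ε = (1 - ε, 1]`. -/
def A (α : Bool) (ε : ℝ) : Set (Icc (0 : ℝ) 1) := {t | |(t : ℝ) - endpt α| < ε}

theorem endpt_mem_A (α : Bool) {ε : ℝ} (hε : 0 < ε) : endpt α ∈ A α ε := by
  simpa [A] using hε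

/-- Collars of width `ε` in `Y` around closed, disjoint boundary components that are identified with
spaces `B α`.  The values `collar α (t, b)` are meaningful for `t ∈ A α ε` only, and
`b ↦ collar α (endpt α, b)` is the inclusion of the boundary component.  The last condition, that
closed tubes are closed in `Y`, holds automatically if the boundary components are compact, and
gives for the trivial tube that the boundary components are closed. -/
structure IsCollar {Y : Type u} [TopologicalSpace Y] {B : Bool → Type v}
    [∀ α, TopologicalSpace (B α)] (ε : ℝ) (collar : ∀ α, Icc (0 : ℝ) 1 × B α → Y) : Prop where
  isOpenEmbedding : ∀ α, IsOpenEmbedding ((A α ε ×ˢ (univ : Set (B α))).domRestrict (collar α))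
  disjoint : Disjoint (collar false '' (A false ε ×ˢ univ)) (collar true '' (A true ε ×ˢ univ))
  isClosed : ∀ α (δ : ℝ), 0 ≤ δ → δ < ε →
    IsClosed (collar α '' {p | |(p.1 : ℝ) - endpt α| ≤ δ})

/-- A collared cobordism structure on `Y` with boundary components `B α`. -/
structure CollaredCobordism (Y : Type u) [TopologicalSpace Y] (B : Bool → Type u)
    [∀ α, TopologicalSpace (B α)] where
  width : ℝ
  width_pos : 0 < width
  width_lt : width < 1 / 2
  collar : ∀ α, Icc (0 : ℝ) 1 × B α → Y
  isCollar : IsCollar width collar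

theorem isOpen_A (α : Bool) (ε : ℝ) : IsOpen (A α ε) :=
  isOpen_lt (by fun_prop) continuous_const

/-- The trivial cobordism `[0,1] × X`. -/
def trivialCobordism (X : Type u) [TopologicalSpace X] :
    CollaredCobordism (Icc (0 : ℝ) 1 × X) (fun _ => X) where
  width := 1 / 4
  width_pos := by norm_num
  width_lt := by norm_num
  collar _ := id
  isCollar :=
    { isOpenEmbedding := fun α => by
        have h : IsOpen (A α (1 / 4) ×ˢ (univ : Set X)) := (isOpen_A α _).prod isOpen_univ
        exact h.isOpenEmbedding_subtypeVal
      disjoint := by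
        rw [Set.disjoint_left]
        rintro _ ⟨p, ⟨hp, -⟩, rfl⟩ ⟨q, ⟨hq, -⟩, h⟩
        have h' : q = p := h
        subst h'
        simp only [A, endpt, mem_ofPred_eq] at hp hq
        norm_num at hp hq
        have h1 := (abs_lt.1 hp).2
        have h2 := (abs_lt.1 hq).1
        linarith
      isClosed := fun α δ _ _ => by
        simp only [image_id]
        exact isClosed_le (by fun_prop) continuous_const }

/-! ### Weak Kuranishi cobordisms -/

/-- An index of the boundary restriction is an index. -/
theorem IsIdx.of_map {N : ℕ} {Y B : Type u} {F : Fin N → Set Y} {G : Fin N → Set B} (e : B → Y)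
    (h : ∀ i b, e b ∈ F i ↔ b ∈ G i) {I : Finset (Fin N)} (hI : IsIdx G I) : IsIdx F I := by
  obtain ⟨h1, b, hb⟩ := hI
  refine ⟨h1, e b, ?_⟩
  simp only [mem_iInter] at hb ⊢
  exact fun i hi => (h i b).2 (hb i hi)

section Cobordism

variable {N : ℕ} (P : BasicData.{w} N) {Y : Type u} [TopologicalSpace Y] {B : Bool → Type u}
  [∀ α, TopologicalSpace (B α)] (C : CollaredCobordism Y B) (d : ℤ)

/-- A weak system of charts of dimension `d + 1` on `Y` with collared footprints, together with weak
atlases of dimension `d` on the boundary components, whose footprints are the boundaries of those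
on `Y`. -/
structure CobordismFrame extends WeakSystem.{u, v, w} P Y (d + 1) where
  /-- the boundary restrictions `∂^α 𝒦` -/
  bd : ∀ α, WeakAtlas.{u, v, w} P (B α) d
  /-- the collar width -/
  width : ℝ
  width_pos : 0 < width
  width_le : width ≤ C.width
  F_collar : ∀ α, ∀ t ∈ A α width, ∀ i b, C.collar α (t, b) ∈ F i ↔ b ∈ (bd α).F i

variable {P C d}

/-- The inclusion `𝓘_{∂^α 𝒦} ⊆ 𝓘_𝒦` of index sets. -/
abbrev CobordismFrame.idx (K : CobordismFrame.{u, v, w} P C d) {α : Bool} (I : Idx (K.bd α).F) :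
    Idx K.F :=
  ⟨I.1, IsIdx.of_map (fun b => C.collar α (endpt α, b))
    (K.F_collar α (endpt α) (endpt_mem_A α K.width_pos)) I.2⟩

variable (P C d)

/-- A weak Kuranishi cobordism on the collared cobordism `Y`, with boundary restrictions `bd α`.
All collar requirements hold over `A α width`.  A chart whose index is not an index of `bd α` has
no boundary in direction `α`; in particular it is a standard chart if this holds for both `α`. -/
structure WeakCobordism extends CobordismFrame.{u, v, w} P C d where
  /-- the collars of the chart domains, with values that are meaningful for `t ∈ A α width` only -/
  collar : ∀ α (I : Idx (bd α).F),
    Icc (0 : ℝ) 1 × (bd α).U I → toCobordismFrame.U (toCobordismFrame.idx I)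
  collar_embedding : ∀ α I,
    IsOpenEmbedding ((A α width ×ˢ (univ : Set ((bd α).U I))).domRestrict (collar α I))
  /-- the collars are diffeomorphisms onto their images -/
  collar_diffeo : ∀ α (I : Idx (bd α).F),
    IsLocalDiffeomorphOn ((bd α).chart I).smooth.unitProd.I
      (chart (toCobordismFrame.idx I)).smooth.I ∞
      (collar α I) (A α width ×ˢ univ)
  collar_disjoint : ∀ (I : Finset (Fin N)) (h0 : IsIdx (bd false).F I) (h1 : IsIdx (bd true).F I),
    Disjoint (collar false ⟨I, h0⟩ '' (A false width ×ˢ univ))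
      (collar true ⟨I, h1⟩ '' (A true width ×ˢ univ))
  /-- closed tubes are closed -/
  collar_closed : ∀ α I (δ : ℝ), 0 ≤ δ → δ < width →
    IsClosed (collar α I '' {p | |(p.1 : ℝ) - endpt α| ≤ δ})
  /-- the boundary of the manifold `U_I` is the union of its boundary components -/
  boundary : ∀ (I : Idx F) (u : toCobordismFrame.U I),
    u ∈ (chart I).smooth.I.boundary (chart I).U ↔
      ∃ (α : Bool) (h : IsIdx (bd α).F I.1) (x : (bd α).U ⟨I.1, h⟩),
        u = collar α ⟨I.1, h⟩ (endpt α, x)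
  /-- over the collars the charts are product charts -/
  collar_smul : ∀ α (I : Idx (bd α).F), ∀ t ∈ A α width, ∀ (g : P.ΓI I.1) x,
    collar α I (t, g • x) = g • collar α I (t, x)
  collar_s : ∀ α (I : Idx (bd α).F), ∀ t ∈ A α width, ∀ x,
    (chart _).s (collar α I (t, x)) = ((bd α).chart I).s x
  collar_ψ : ∀ α (I : Idx (bd α).F), ∀ t ∈ A α width, ∀ x (h : ((bd α).chart I).s x = 0)
    (h' : (chart _).s (collar α I (t, x)) = 0),
    (chart _).ψ ⟨collar α I (t, x), h'⟩ = C.collar α (t, ((bd α).chart I).ψ ⟨x, h⟩)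
  /-- over the collars the coordinate changes are product coordinate changes -/
  collar_dom : ∀ α (I J : Idx (bd α).F) (h : I.1 ⊂ J.1), ∀ t ∈ A α width, ∀ x,
    collar α I (t, x) ∈ (change (toCobordismFrame.idx I) (toCobordismFrame.idx J) h).dom ↔
      x ∈ ((bd α).change I J h).dom
  collar_lift : ∀ α (I J : Idx (bd α).F) (h : I.1 ⊂ J.1), ∀ t ∈ A α width, ∀ y,
    collar α J (t, y) ∈ (change (toCobordismFrame.idx I) (toCobordismFrame.idx J) h).lift ↔
      y ∈ ((bd α).change I J h).lift
  collar_ρ : ∀ α (I J : Idx (bd α).F) (h : I.1 ⊂ J.1), ∀ t ∈ A α width, ∀ y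
    (hy : y ∈ ((bd α).change I J h).lift)
    (hy' : collar α J (t, y) ∈ (change (toCobordismFrame.idx I) (toCobordismFrame.idx J) h).lift),
    (change (toCobordismFrame.idx I) (toCobordismFrame.idx J) h).ρ ⟨collar α J (t, y), hy'⟩ =
      collar α I (t, ((bd α).change I J h).ρ ⟨y, hy⟩)
  /-- domains of coordinate changes to charts without boundary in direction `α` avoid the collar -/
  collar_avoid : ∀ α (I : Idx (bd α).F) (J : Idx F) (h : I.1 ⊂ J.1), ¬ IsIdx (bd α).F J.1 →
    ∀ t ∈ A α width, ∀ x, collar α I (t, x) ∉ (change (toCobordismFrame.idx I) J h).dom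

end Cobordism

namespace WeakCobordism

variable {N : ℕ} {P : BasicData.{w} N} {Y : Type u} [TopologicalSpace Y] {B : Bool → Type u}
  [∀ α, TopologicalSpace (B α)] {C : CollaredCobordism Y B} {d : ℤ}

/-- `K'` is a shrinking of the weak cobordism `K`: the underlying systems are related by a shrinking
whose domains are collared subsets, with the restricted collars. -/
def IsShrinking (K' K : WeakCobordism.{u, v, w} P C d) : Prop :=
  ∃ (m : WeakSystem.ShrinkMaps K'.toWeakSystem K.toWeakSystem) (δ : ℝ),
    0 < δ ∧ δ ≤ K.width ∧ δ ≤ K'.width ∧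
    ∀ (α : Bool) (I : Idx (K.bd α).F),
      /- if `∂^α U'_I` is nonempty, then `U'_I` is of product form in the collar of `U_I` -/
      (∀ h : IsIdx (K'.bd α).F I.1, ∃ j : (K'.bd α).U ⟨I.1, h⟩ → (K.bd α).U I,
        ∀ t ∈ A α δ,
          (∀ x, m.j (K'.idx ⟨I.1, h⟩) (K'.collar α ⟨I.1, h⟩ (t, x)) = K.collar α I (t, j x)) ∧
          ∀ x, K.collar α I (t, x) ∈ range (m.j (K'.idx ⟨I.1, h⟩)) ↔ x ∈ range j) ∧
      /- otherwise `U'_I` avoids the collar of `U_I` -/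
      (¬ IsIdx (K'.bd α).F I.1 → ∀ t ∈ A α δ, ∀ x,
        K.collar α I (t, x) ∉ range (m.j ⟨I.1, (m.idx_iff I.1).1 (K.idx I).2⟩))

/-- `K'` is a preshrunk tame shrinking of `K`: tame, and a shrinking of a tame shrinking of `K`. -/
def IsPreshrunkTame (K' K : WeakCobordism.{u, v, w} P C d) : Prop :=
  K'.IsTame ∧ ∃ K'' : WeakCobordism.{u, v, w} P C d,
    K''.IsTame ∧ K''.IsShrinking K ∧ K'.IsShrinking K''

variable (K : WeakCobordism.{u, v, w} P C d)

/-- The collar map of the realization at time `t`, from `|∂^α 𝒦|` to `|𝒦|`. -/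
def realCollar (α : Bool) (t : Icc (0 : ℝ) 1) (ht : t ∈ A α K.width) :
    (K.bd α).Real → K.Real :=
  Quot.map (fun p => ⟨K.idx p.1, K.collar α p.1 (t, p.2)⟩) (by
    rintro _ _ (⟨I, γ, x⟩ | ⟨I, J, h, y, γ⟩)
    · simp only
      rw [K.collar_smul α I t ht]
      exact WeakSystem.Mor.act (K := K.toWeakSystem) (K.idx I) γ (K.collar α I (t, x))
    · simp only
      have hy := (K.collar_lift α I J h t ht y.1).2 y.2
      rw [K.collar_smul α I t ht, ← K.collar_ρ α I J h t ht y.1 y.2 hy]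
      exact WeakSystem.Mor.change (K := K.toWeakSystem) (K.idx I) (K.idx J) h ⟨_, hy⟩ γ)

/-- The restriction of a metric on `|𝒦|` to the boundary component `|∂^α 𝒦|`. -/
def bdDist (D : K.Real → K.Real → ℝ) (α : Bool) : (K.bd α).Real → (K.bd α).Real → ℝ :=
  fun p q =>
    D (K.realCollar α (endpt α) (endpt_mem_A α K.width_pos) p)
      (K.realCollar α (endpt α) (endpt_mem_A α K.width_pos) q)

/-- An admissible collared metric on `|𝒦|`: an admissible metric which for some `ε > 0` is the
product metric on the collars of width `ε`, and for which points outside such a collar have distance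
at least `ε - |t - α|` from the points at time `t` in it. -/
structure IsCollaredAdmissible (D : K.Real → K.Real → ℝ) : Prop where
  admissible : K.IsAdmissible D
  collared : ∃ ε, 0 < ε ∧ ε ≤ K.width ∧ ∀ α,
    (∀ t ∈ A α ε, ∀ t' ∈ A α ε, ∀ (ht : t ∈ A α K.width) (ht' : t' ∈ A α K.width) p q,
      D (K.realCollar α t ht p) (K.realCollar α t' ht' q) = |(t : ℝ) - t'| + K.bdDist D α p q) ∧
    ∀ z, (∀ t ∈ A α ε, ∀ (ht : t ∈ A α K.width) p, z ≠ K.realCollar α t ht p) →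
      ∀ t ∈ A α ε, ∀ (ht : t ∈ A α K.width) p,
        ε - |(t : ℝ) - endpt α| ≤ D z (K.realCollar α t ht p)

end WeakCobordism

/-- Two weak atlases on `X` with metrics on their realizations are metric tame concordant: there is
a tame cobordism on `[0,1] × X` with an admissible collared metric, whose boundary restrictions
are the given pairs. -/
def MetricTameConcordant {N : ℕ} {P : BasicData.{w} N} {X : Type u} [TopologicalSpace X] {d : ℤ}
    (K : Bool → Σ K : WeakAtlas.{u, v, w} P X d, (K.Real → K.Real → ℝ)) : Prop :=
  ∃ (L : WeakCobordism.{u, v, w} P (trivialCobordism X) d) (D : L.Real → L.Real → ℝ),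
    L.IsTame ∧ L.IsCollaredAdmissible D ∧ ∀ α, (⟨L.bd α, L.bdDist D α⟩ : Σ K : WeakAtlas.{u, v, w}
      P X d, (K.Real → K.Real → ℝ)) = K α

end Kuranishi

end

/-!
**Realizations of tame atlases.** Let `K` be tame.  Then the lifted domain of a coordinate change
`I ⊂ J` is the whole closed set `K.deep J I` of points of `U_J` at which the section takes values in
`E_I`, and the maps `ρ` compose without restriction.  Hence a point with nonzero section comes from
a point, unique up to the group, of the domain whose index is the smallest possible one, and points
with zero section are classified by their images in the base (`TameSpaces.exists_minimal`).  So the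
equivalence relation that defines the realization, a priori only generated by the morphisms, is
explicit (`TameSpaces.rel_iff_equ`) and closed.  The quotient of a locally compact, σ-compact
Hausdorff space by a closed relation is Hausdorff (`t2Space_quotient_of_isClosed`), and the
explicit form also shows that each `U_I / Γ_I` is embedded.  `TameSpaces` collects what this
argument uses, so that it applies to the realizations of both the domains and the obstruction
bundle.

**Tame shrinkings.** The index condition and the inverse function theorem show that a lifted domain
is relatively open in `K.deep J I` (`WeakSystem.HasOpenLifts`).  At boundary points of a cobordism
this is deduced from the boundary atlases by means of the collars.  Consequently a continuous
function on the base extends to all chart domains, compatibly with the coordinate changes near the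
zero sets (`exists_isExtension`).  Let `ϑ i` be functions whose positivity sets shrink the basic
footprints `F i`, with extensions `θ i`.  For small `ε` the sets where `θ i > c` for `i ∈ I` and
the section is smaller than `ε` form a tame family (`eventually_tameFam`): both tameness conditions
hold on the zero sets by the properties of footprints, and they persist nearby by compactness.
Using two pairs `(c, ε)` gives a tame shrinking of a tame shrinking.  For a cobordism the
subdomains also have to be products over collars.  This is achieved by taking preimages under a
self map that is compatible with the whole structure and collapses part of each collar to the
boundary (`WeakCobordism.SelfMap`, `WeakCobordism.collapseBoth`).

**Metrics.** If `K'` is a tame shrinking of a tame `K`, its realization injects into that of `K`,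
and its image lies in the union of the images of the compact closures of the subdomains.  This
union is compact, Hausdorff and second countable, hence metrizable, and its metric restricts to an
admissible one (`WeakSystem.ShrinkMaps.exists_isAdmissible`).  On a cobordism an admissible metric
is made into a product on collars by combining it with pseudometrics that are products on the
collars and forget the boundary coordinate outside them (`WeakCobordism.glueDist`).  The result may
be prescribed on the two boundary components (`WeakCobordism.exists_isCollaredAdmissible`).

**Concordances.** A subdomain of the product cobordism `[0,1] × K` is tame as soon as all its
slices are tame subdomains of `K` (`WeakAtlas.tameFam_sliceSubdomain`).  Between two tame shrinkings
`D false` and `D true` one chooses tame subdomains `Q α` inside `D α` and one `M` that contains both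
`Q false` and `Q true`, and uses the slices `D false`, `Q false`, `M`, `Q true`, `D true` over
successive intervals.  These slices shrink or grow in such a way that their union over `[0,1]` is
open (`interpolate`).  Doing this for two nested levels produces a tame cobordism that is a
shrinking of a tame system, and thus has a collared admissible metric with the given restrictions
to the boundary.
-/

noncomputable section

namespace Kuranishi

/-! ### Quotients of locally compact and of compact spaces -/

/-- Two compact sets no points of which are related by a closed relation can be enlarged to compact
sets with this property, that contain all points of a given compact set `K` near or related to the
original sets. -/
theorem exists_compact_enlargement {Z : Type*} [TopologicalSpace Z] [T2Space Z]
    [LocallyCompactSpace Z] (r : Setoid Z) (hr : IsClosed {p : Z × Z | r p.1 p.2})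
    {K A B : Set Z} (hK : IsCompact K) (hA : IsCompact A) (hB : IsCompact B)
    (hAB : ∀ a ∈ A, ∀ b ∈ B, ¬ r a b) :
    ∃ A' B' : Set Z, IsCompact A' ∧ IsCompact B' ∧ (∀ a ∈ A', ∀ b ∈ B', ¬ r a b) ∧
      A' ⊆ K ∧ B' ⊆ K ∧
      (∃ U, IsOpen U ∧ A ⊆ U ∧ U ∩ K ⊆ A') ∧ (∃ U, IsOpen U ∧ B ⊆ U ∧ U ∩ K ⊆ B') ∧
      (∀ z ∈ K, ∀ a ∈ A, r a z → z ∈ A') ∧ (∀ z ∈ K, ∀ b ∈ B, r b z → z ∈ B') := by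
  have sat : ∀ C : Set Z, IsCompact C → IsCompact {z ∈ K | ∃ c ∈ C, r c z} := by
    intro C hC
    have h1 : IsCompact ((C ×ˢ K) ∩ {p : Z × Z | r p.1 p.2}) := (hC.prod hK).inter_right hr
    have h2 := h1.image continuous_snd
    convert h2 using 1
    ext z
    constructor
    · rintro ⟨hz, c, hc, h⟩
      exact ⟨(c, z), ⟨⟨hc, hz⟩, h⟩, rfl⟩
    · rintro ⟨p, ⟨⟨hc, hz⟩, h⟩, rfl⟩
      exact ⟨hz, p.1, hc, h⟩
  set SA := A ∪ {z ∈ K | ∃ c ∈ A, r c z}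
  set SB := B ∪ {z ∈ K | ∃ c ∈ B, r c z}
  have hSA : IsCompact SA := hA.union (sat A hA)
  have hSB : IsCompact SB := hB.union (sat B hB)
  have hd : SA ×ˢ SB ⊆ {p : Z × Z | r p.1 p.2}ᶜ := by
    rintro ⟨x, y⟩ ⟨hx, hy⟩ hxy
    have hx' : ∃ a ∈ A, r a x := by
      rcases hx with hx | ⟨-, a, ha, h⟩
      exacts [⟨x, hx, r.refl x⟩, ⟨a, ha, h⟩]
    have hy' : ∃ b ∈ B, r b y := by
      rcases hy with hy | ⟨-, a, ha, h⟩
      exacts [⟨y, hy, r.refl y⟩, ⟨a, ha, h⟩]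
    obtain ⟨a, ha, h1⟩ := hx'
    obtain ⟨b, hb, h2⟩ := hy'
    exact hAB a ha b hb (r.trans h1 (r.trans hxy (r.symm h2)))
  obtain ⟨U, V, hU, hV, hAU, hBV, hUV⟩ := generalized_tube_lemma hSA hSB hr.isOpen_compl hd
  obtain ⟨LA, hLA, h1, h2⟩ := exists_compact_between hSA hU hAU
  obtain ⟨LB, hLB, h3, h4⟩ := exists_compact_between hSB hV hBV
  refine ⟨LA ∩ K, LB ∩ K, hLA.inter hK, hLB.inter hK, ?_, inter_subset_right, inter_subset_right,
    ⟨interior LA, isOpen_interior, subset_union_left.trans h1,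
      inter_subset_inter_left _ interior_subset⟩,
    ⟨interior LB, isOpen_interior, subset_union_left.trans h3,
      inter_subset_inter_left _ interior_subset⟩, ?_, ?_⟩
  · intro a ha b hb hab
    exact hUV (show (a, b) ∈ U ×ˢ V from ⟨h2 ha.1, h4 hb.1⟩) hab
  · intro z hz a ha h
    exact ⟨interior_subset (h1 (Or.inr ⟨hz, a, ha, h⟩)), hz⟩
  · intro z hz a ha h
    exact ⟨interior_subset (h3 (Or.inr ⟨hz, a, ha, h⟩)), hz⟩

/-- The quotient of a locally compact, σ-compact Hausdorff space by a closed equivalence relation is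
Hausdorff: disjoint neighbourhoods are built along a compact exhaustion. -/
theorem t2Space_quotient_of_isClosed {Z : Type*} [TopologicalSpace Z] [T2Space Z]
    [LocallyCompactSpace Z] [SigmaCompactSpace Z] (r : Setoid Z)
    (hr : IsClosed {p : Z × Z | r p.1 p.2}) : T2Space (Quotient r) := by
  refine ⟨fun p q => ?_⟩
  induction p using Quotient.inductionOn with | _ a => ?_
  induction q using Quotient.inductionOn with | _ b => ?_
  intro hne
  have hab : ¬ r a b := fun h => hne (Quotient.sound h)
  let E : CompactExhaustion Z := CompactExhaustion.choice Z
  let K : ℕ → Set Z := fun n => E (n + max (E.find a) (E.find b))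
  have haK : a ∈ K 0 := E.subset (by simp) (E.mem_find a)
  have hbK : b ∈ K 0 := E.subset (by simp) (E.mem_find b)
  have hKc : ∀ n, IsCompact (K n) := fun n => E.isCompact _
  have hKi : ∀ n, K n ⊆ interior (K (n + 1)) := fun n => by
    have := E.subset_interior_succ (n + max (E.find a) (E.find b))
    simp only [K]
    rwa [add_right_comm]
  have hKm : ∀ {m n}, m ≤ n → K m ⊆ K n := fun h => E.subset (by lia)
  have hKex : ∀ z, ∃ n, z ∈ K n := fun z => ⟨E.find z, E.subset (by lia) (E.mem_find z)⟩
  let S : ℕ → Type _ := fun n => {p : Set Z × Set Z // IsCompact p.1 ∧ IsCompact p.2 ∧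
    (∀ a ∈ p.1, ∀ b ∈ p.2, ¬ r a b) ∧ p.1 ⊆ K n ∧ p.2 ⊆ K n}
  have step : ∀ n (s : S n), ∃ t : S (n + 1),
      (∃ U, IsOpen U ∧ s.1.1 ⊆ U ∧ U ∩ K (n + 1) ⊆ t.1.1) ∧
      (∃ U, IsOpen U ∧ s.1.2 ⊆ U ∧ U ∩ K (n + 1) ⊆ t.1.2) ∧
      (∀ z ∈ K (n + 1), ∀ a ∈ s.1.1, r a z → z ∈ t.1.1) ∧
      (∀ z ∈ K (n + 1), ∀ a ∈ s.1.2, r a z → z ∈ t.1.2) := by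
    rintro n ⟨⟨A, B⟩, hA, hB, hAB, -, -⟩
    obtain ⟨A', B', h1, h2, h3, h4, h5, h⟩ :=
      exists_compact_enlargement r hr (hKc (n + 1)) hA hB hAB
    exact ⟨⟨(A', B'), h1, h2, h3, h4, h5⟩, h⟩
  choose f hf1 hf2 hf3 hf4 using step
  let s0 : S 0 := ⟨({a}, {b}), isCompact_singleton, isCompact_singleton, by simpa using hab,
    by simpa using haK, by simpa using hbK⟩
  let s : ∀ n, S n := fun n => Nat.rec s0 (fun n t => f n t) n
  have hs : ∀ n, s (n + 1) = f n (s n) := fun n => rfl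
  -- a monotone sequence of sets that absorb related points has an open, saturated union
  have key : ∀ A : ℕ → Set Z, (∀ n, A n ⊆ K n) →
      (∀ n, ∃ U, IsOpen U ∧ A n ⊆ U ∧ U ∩ K (n + 1) ⊆ A (n + 1)) →
      (∀ n, ∀ z ∈ K (n + 1), ∀ a ∈ A n, r a z → z ∈ A (n + 1)) →
      Monotone A ∧ IsOpen (⋃ n, A n) ∧ ∀ x y, r x y → x ∈ ⋃ n, A n → y ∈ ⋃ n, A n := by
    intro A hA1 hA2 hA3
    have hmono : Monotone A := monotone_nat_of_le_succ fun n z hz =>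
      hA3 n z (hKm (Nat.le_succ n) (hA1 n hz)) z hz (r.refl z)
    refine ⟨hmono, ?_, ?_⟩
    · rw [isOpen_iff_mem_nhds]
      intro x hx
      obtain ⟨n, hn⟩ := mem_iUnion.1 hx
      obtain ⟨U, hU, h1, h2⟩ := hA2 n
      filter_upwards [hU.mem_nhds (h1 hn), isOpen_interior.mem_nhds (hKi n (hA1 n hn))] with y h3 h4
      exact mem_iUnion.2 ⟨n + 1, h2 ⟨h3, interior_subset h4⟩⟩
    · intro x y hxy hx
      obtain ⟨n, hn⟩ := mem_iUnion.1 hx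
      obtain ⟨m, hm⟩ := hKex y
      exact mem_iUnion.2 ⟨max n m + 1, hA3 _ y (hKm (by lia) hm) x (hmono (by lia) hn) hxy⟩
  obtain ⟨mA, oA, sA⟩ := key (fun n => (s n).1.1) (fun n => (s n).2.2.2.2.1)
    (fun n => hs n ▸ hf1 n (s n)) (fun n => hs n ▸ hf3 n (s n))
  obtain ⟨mB, oB, sB⟩ := key (fun n => (s n).1.2) (fun n => (s n).2.2.2.2.2)
    (fun n => hs n ▸ hf2 n (s n)) (fun n => hs n ▸ hf4 n (s n))
  have pre : ∀ G : Set Z, (∀ x y, r x y → x ∈ G → y ∈ G) →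
      Quotient.mk r ⁻¹' (Quotient.mk r '' G) = G := by
    intro G hG
    refine Subset.antisymm ?_ (subset_preimage_image _ _)
    rintro x ⟨y, hy, hxy⟩
    exact hG y x (Quotient.exact hxy) hy
  refine ⟨Quotient.mk r '' ⋃ n, (s n).1.1, Quotient.mk r '' ⋃ n, (s n).1.2, ?_, ?_,
    ⟨a, mem_iUnion.2 ⟨0, rfl⟩, rfl⟩, ⟨b, mem_iUnion.2 ⟨0, rfl⟩, rfl⟩, ?_⟩
  · exact isQuotientMap_quotient_mk'.isOpen_preimage.1 ((pre _ sA).symm ▸ oA)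
  · exact isQuotientMap_quotient_mk'.isOpen_preimage.1 ((pre _ sB).symm ▸ oB)
  · rw [disjoint_left]
    rintro _ ⟨x, hx, rfl⟩ ⟨y, hy, hxy⟩
    obtain ⟨n, hn⟩ := mem_iUnion.1 hx
    obtain ⟨m, hm⟩ := mem_iUnion.1 hy
    exact (s (max n m)).2.2.2.1 x (mA (le_max_left n m) hn) y (mB (le_max_right n m) hm)
      (r.symm (Quotient.exact hxy))

/-- A Hausdorff space that is a continuous image of a second countable compact space is second
countable. -/
theorem secondCountableTopology_of_surjective {X Y : Type*} [TopologicalSpace X] [CompactSpace X]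
    [SecondCountableTopology X] [TopologicalSpace Y] [T2Space Y] {f : X → Y} (hf : Continuous f)
    (hs : Function.Surjective f) : SecondCountableTopology Y := by
  have hc : IsClosedMap f := hf.isClosedMap
  let b := countableBasis X
  let c : Set (Set Y) := (fun s : Set (Set X) => (f '' (⋃₀ s)ᶜ)ᶜ) '' {s | s ⊆ b ∧ s.Finite}
  refine (isTopologicalBasis_of_isOpen_of_nhds (s := c) ?_ ?_).secondCountableTopology ?_
  · rintro _ ⟨s, ⟨hs, -⟩, rfl⟩
    refine (hc _ ?_).isOpen_compl
    exact (isOpen_sUnion fun t ht => isOpen_of_mem_countableBasis (hs ht)).isClosed_compl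
  · intro y V hy hV
    have hK : IsCompact (f ⁻¹' {y}) := (isClosed_singleton.preimage hf).isCompact
    have hcov : f ⁻¹' {y} ⊆ ⋃ t : {t : Set X // t ∈ b ∧ t ⊆ f ⁻¹' V}, t.1 := by
      intro x hx
      obtain ⟨t, ht, hxt, htV⟩ := (isBasis_countableBasis X).exists_subset_of_mem_open
        (show x ∈ f ⁻¹' V by rw [mem_preimage, show f x = y from hx]; exact hy) (hV.preimage hf)
      exact mem_iUnion.2 ⟨⟨t, ht, htV⟩, hxt⟩
    obtain ⟨F, hF⟩ := hK.elim_finite_subcover _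
      (fun t => isOpen_of_mem_countableBasis t.2.1) hcov
    refine ⟨_, ⟨Subtype.val '' (F : Set {t : Set X // t ∈ b ∧ t ⊆ f ⁻¹' V}),
      ⟨?_, F.finite_toSet.image _⟩, rfl⟩, ?_, ?_⟩
    · rintro _ ⟨t, -, rfl⟩
      exact t.2.1
    · rintro ⟨x, hx, hxy⟩
      obtain ⟨t, ht, hxt⟩ := mem_iUnion₂.1 (hF hxy)
      exact hx (mem_sUnion.2 ⟨t.1, ⟨t, ht, rfl⟩, hxt⟩)
    · intro z hz
      obtain ⟨x, rfl⟩ := hs z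
      by_contra hzV
      refine hz ⟨x, fun hx => ?_, rfl⟩
      obtain ⟨_, ⟨t, -, rfl⟩, hxt⟩ := mem_sUnion.1 hx
      exact hzV (t.2.2 hxt)
  · refine Countable.image (Countable.mono ?_
      (countable_ofPred_finite_subset (countable_countableBasis X))) _
    exact fun s hs => ⟨hs.2, hs.1⟩

/-- On a compact set, the sublevel sets `{n ≤ ε}` shrink into any neighbourhood of `{n ≤ 0}`. -/
theorem eventually_sublevel_subset {Z : Type*} [TopologicalSpace Z] {A Q : Set Z}
    (hA : IsCompact A) (hQ : IsOpen Q) {n : Z → ℝ} (hn : Continuous n)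
    (h : ∀ x ∈ A, n x ≤ 0 → x ∈ Q) : ∀ᶠ ε in 𝓝[>] (0 : ℝ), ∀ x ∈ A, n x ≤ ε → x ∈ Q := by
  rcases (A \ Q).eq_empty_or_nonempty with he | hne
  · exact Filter.Eventually.of_forall fun ε x hx _ => by
      by_contra hxQ
      exact he.subset ⟨hx, hxQ⟩
  · obtain ⟨x0, hx0, hmin⟩ := (hA.diff hQ).exists_isMinOn hne hn.continuousOn
    have hpos : 0 < n x0 := by
      by_contra hle
      exact hx0.2 (h x0 hx0.1 (not_lt.1 hle))
    filter_upwards [Ioo_mem_nhdsGT hpos] with ε hε x hx hxε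
    by_contra hxQ
    have : n x0 ≤ n x := hmin ⟨hx, hxQ⟩
    linarith [hε.2]

/-! ### Realizations of tame systems of spaces -/

theorem IsIdx.mono {N : ℕ} {X : Type u} {F : Fin N → Set X} {I J : Finset (Fin N)}
    (hJ : IsIdx F J) (h : I ⊆ J) (hI : I.Nonempty) : IsIdx F I :=
  ⟨hI, hJ.2.mono (biInter_subset_biInter_left h)⟩

/-- The topological data of a tame atlas that determine its realization: spaces `W I` with finite
group actions, closed subsets `deep I H` (the points at which a section lies in `E_H`), and maps
`ρ` from `deep J I` to `W I` whose fibres are orbits.  It abstracts both from the domain category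
and from the obstruction category of a tame atlas. -/
structure TameSpaces {N : ℕ} {X : Type u} [TopologicalSpace X] (F : Fin N → Set X) where
  W : Idx F → Type v
  [top : ∀ I, TopologicalSpace (W I)]
  G : Idx F → Type w
  [group : ∀ I, Group (G I)]
  [finite : ∀ I, Finite (G I)]
  [act : ∀ I, MulAction (G I) (W I)]
  continuous_smul : ∀ I (g : G I), Continuous fun x : W I => g • x
  deep : ∀ I, Finset (Fin N) → Set (W I)
  deep_closed : ∀ I H, IsClosed (deep I H)
  deep_inter : ∀ I H H' x, x ∈ deep I (H ∩ H') ↔ x ∈ deep I H ∧ x ∈ deep I H'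
  deep_self : ∀ I x, x ∈ deep I I.1
  deep_smul : ∀ I H (g : G I) x, g • x ∈ deep I H ↔ x ∈ deep I H
  pr : ∀ I J : Idx F, I.1 ⊂ J.1 → G J →* G I
  pr_surj : ∀ I J h, Function.Surjective (pr I J h)
  lift : ∀ I J : Idx F, I.1 ⊂ J.1 → Set (W J)
  mem_lift : ∀ I J h y, y ∈ lift I J h ↔ y ∈ deep J I.1
  ρ : ∀ I J h, lift I J h → W I
  ρ_continuous : ∀ I J h, Continuous (ρ I J h)
  ρ_open : ∀ I J h, IsOpenMap (ρ I J h)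
  ρ_deep : ∀ I J h y H, ρ I J h y ∈ deep I H ↔ y.1 ∈ deep J H
  ρ_equiv : ∀ I J h (g : G J) (y : lift I J h) (hy : g • y.1 ∈ lift I J h),
    ρ I J h ⟨g • y.1, hy⟩ = pr I J h g • ρ I J h y
  ρ_fiber : ∀ I J h (y y' : lift I J h), ρ I J h y = ρ I J h y' → ∃ g : G J, g • y.1 = y'.1
  cocycle : ∀ (I J K : Idx F) (h : I.1 ⊂ J.1) (h' : J.1 ⊂ K.1) z hz hz' hz'',
    ρ I K (h.trans h') ⟨z, hz⟩ = ρ I J h ⟨ρ J K h' ⟨z, hz'⟩, hz''⟩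
  ψ : ∀ I, deep I ∅ → X
  ψ_continuous : ∀ I, Continuous (ψ I)
  ψ_open : ∀ I, IsOpenMap (ψ I)
  ψ_mem : ∀ I p, (∃ x, ψ I x = p) ↔ p ∈ ⋂ i ∈ I.1, F i
  ψ_orbit : ∀ I x y, ψ I x = ψ I y ↔ ∃ g : G I, g • x.1 = y.1
  ψ_ρ : ∀ I J h y hy hy', ψ I ⟨ρ I J h y, hy⟩ = ψ J ⟨y.1, hy'⟩

attribute [instance] TameSpaces.top TameSpaces.group TameSpaces.finite TameSpaces.act

namespace TameSpaces

variable {N : ℕ} {X : Type u} [TopologicalSpace X] {F : Fin N → Set X}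
  (T : TameSpaces.{u, v, w} F)

/-- The identifications by the group actions and the maps `ρ`. -/
inductive Mor : (Σ I, T.W I) → (Σ I, T.W I) → Prop
  | act (I : Idx F) (g : T.G I) (x : T.W I) : Mor ⟨I, g⁻¹ • x⟩ ⟨I, x⟩
  | change (I J : Idx F) (h : I.1 ⊂ J.1) (y : T.lift I J h) (g : T.G I) :
      Mor ⟨I, g⁻¹ • T.ρ I J h y⟩ ⟨J, y.1⟩

/-- The equivalence relation generated by the identifications. -/
abbrev rel (p q : Σ I, T.W I) : Prop := Relation.EqvGen T.Mor p q

variable {T}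

theorem deep_mono {I : Idx F} {H H' : Finset (Fin N)} (h : H ⊆ H') {x : T.W I}
    (hx : x ∈ T.deep I H) : x ∈ T.deep I H' := by
  rw [← Finset.inter_eq_left.2 h, T.deep_inter] at hx
  exact hx.2

theorem rel_smul (I : Idx F) (g : T.G I) (x : T.W I) : T.rel ⟨I, g • x⟩ ⟨I, x⟩ := by
  have := Relation.EqvGen.rel _ _ (Mor.act (T := T) I g⁻¹ x)
  rwa [inv_inv] at this

theorem rel_ρ (I J : Idx F) (h : I.1 ⊂ J.1) (y : T.lift I J h) :
    T.rel ⟨I, T.ρ I J h y⟩ ⟨J, y.1⟩ := by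
  have := Relation.EqvGen.rel _ _ (Mor.change (T := T) I J h y 1)
  rwa [inv_one, one_smul] at this

variable (T) in
/-- `v ∈ W H` is, up to the group action, the image of `x ∈ W I` under `ρ` (or `H = I` and the two
points are in one orbit). -/
def Down (H I : Idx F) (v : T.W H) (x : T.W I) : Prop :=
  (∃ e : I = H, ∃ g : T.G H, g • (e ▸ x) = v) ∨
    ∃ (h : H.1 ⊂ I.1) (hx : x ∈ T.lift H I h) (g : T.G H), g • T.ρ H I h ⟨x, hx⟩ = v

theorem Down.rel {H I : Idx F} {v : T.W H} {x : T.W I} (h : T.Down H I v x) :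
    T.rel ⟨H, v⟩ ⟨I, x⟩ := by
  rcases h with ⟨rfl, g, rfl⟩ | ⟨h, hx, g, rfl⟩
  · exact rel_smul _ _ _
  · exact (rel_smul _ _ _).trans _ _ _ (rel_ρ _ _ _ _)

theorem Down.deep_iff {H I : Idx F} {v : T.W H} {x : T.W I} (h : T.Down H I v x)
    (S : Finset (Fin N)) : v ∈ T.deep H S ↔ x ∈ T.deep I S := by
  rcases h with ⟨rfl, g, rfl⟩ | ⟨h, hx, g, rfl⟩
  · exact T.deep_smul _ _ _ _
  · rw [T.deep_smul, T.ρ_deep]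

theorem Down.mem_deep {H I : Idx F} {v : T.W H} {x : T.W I} (h : T.Down H I v x) :
    x ∈ T.deep I H.1 :=
  (h.deep_iff _).1 (T.deep_self H v)

theorem Down.subset {H I : Idx F} {v : T.W H} {x : T.W I} (h : T.Down H I v x) : H.1 ⊆ I.1 := by
  rcases h with ⟨rfl, g, rfl⟩ | ⟨h, hx, g, rfl⟩
  exacts [subset_rfl, h.subset]

theorem Down.smul {H I : Idx F} {v : T.W H} {x : T.W I} (h : T.Down H I v x) (g : T.G H) :
    T.Down H I (g • v) x := by
  rcases h with ⟨rfl, k, rfl⟩ | ⟨h, hx, k, rfl⟩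
  · exact Or.inl ⟨rfl, g * k, mul_smul _ _ _⟩
  · exact Or.inr ⟨h, hx, g * k, mul_smul _ _ _⟩

theorem exists_down {H I : Idx F} (hHI : H.1 ⊆ I.1) {x : T.W I} (hx : x ∈ T.deep I H.1) :
    ∃ v, T.Down H I v x := by
  by_cases e : I = H
  · subst e
    exact ⟨x, Or.inl ⟨rfl, 1, one_smul _ _⟩⟩
  · have h : H.1 ⊂ I.1 := hHI.ssubset_of_ne fun h => e (Subtype.ext h.symm)
    exact ⟨_, Or.inr ⟨h, (T.mem_lift _ _ _ _).2 hx, 1, rfl⟩⟩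

theorem Down.orbit {H I : Idx F} {v v' : T.W H} {x : T.W I} (h : T.Down H I v x)
    (h' : T.Down H I v' x) : ∃ g : T.G H, g • v = v' := by
  rcases h with ⟨e, g, rfl⟩ | ⟨h, hx, g, rfl⟩
  · subst e
    rcases h' with ⟨e', g', rfl⟩ | ⟨h', -⟩
    · exact ⟨g' * g⁻¹, by rw [mul_smul, inv_smul_smul]⟩
    · exact absurd rfl h'.ne
  · rcases h' with ⟨e', -⟩ | ⟨h', hx', g', rfl⟩
    · subst e'
      exact absurd rfl h.ne
    · exact ⟨g' * g⁻¹, by rw [mul_smul, inv_smul_smul]⟩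

theorem Down.of_smul {H I : Idx F} {v : T.W H} {x : T.W I} {g : T.G I}
    (h : T.Down H I v (g • x)) : T.Down H I v x := by
  rcases h with ⟨rfl, k, rfl⟩ | ⟨h, hx, k, rfl⟩
  · exact Or.inl ⟨rfl, k * g, mul_smul _ _ _⟩
  · have hx' : x ∈ T.lift H I h := by
      rw [T.mem_lift] at hx ⊢
      exact (T.deep_smul _ _ _ _).1 hx
    exact Or.inr ⟨h, hx', k * T.pr H I h g, by rw [T.ρ_equiv H I h g ⟨x, hx'⟩, mul_smul]⟩

/-- Points with a common image under `ρ` lie in one orbit. -/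
theorem Down.inj {H I : Idx F} {v : T.W H} {x y : T.W I} (hx : T.Down H I v x)
    (hy : T.Down H I v y) : ∃ g : T.G I, g • x = y := by
  rcases hx with ⟨rfl, g, rfl⟩ | ⟨h, hx, g, rfl⟩
  · rcases hy with ⟨e', g', hg⟩ | ⟨h', -⟩
    · exact ⟨g'⁻¹ * g, by rw [mul_smul, ← hg, inv_smul_smul]⟩
    · exact absurd rfl h'.ne
  · rcases hy with ⟨e', -⟩ | ⟨h', hy, g', hg⟩
    · subst e'
      exact absurd rfl h.ne
    · obtain ⟨k, hk⟩ := T.pr_surj H I h (g'⁻¹ * g)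
      have hkx : k • x ∈ T.lift H I h := by
        rw [T.mem_lift] at hx ⊢
        exact (T.deep_smul _ _ _ _).2 hx
      have h1 : T.ρ H I h ⟨k • x, hkx⟩ = T.ρ H I h ⟨y, hy⟩ := by
        rw [T.ρ_equiv H I h k ⟨x, hx⟩ hkx, hk, mul_smul, ← hg, inv_smul_smul]
      obtain ⟨l, hl⟩ := T.ρ_fiber H I h _ _ h1
      exact ⟨l * k, by rw [mul_smul]; exact hl⟩

theorem Down.trans {H I J : Idx F} {v : T.W H} {x : T.W I} {y : T.W J} (h : T.Down H I v x)
    (h' : T.Down I J x y) : T.Down H J v y := by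
  rcases h' with ⟨rfl, g, rfl⟩ | ⟨h', hy, g, rfl⟩
  · exact h.of_smul
  · have h2 := h.of_smul
    rcases h2 with ⟨rfl, k, rfl⟩ | ⟨h2, hx, k, rfl⟩
    · exact Or.inr ⟨h', hy, k, rfl⟩
    · have hy' : y ∈ T.lift H J (h2.trans h') := by
        rw [T.mem_lift, ← T.ρ_deep I J h' ⟨y, hy⟩, ← T.mem_lift H I h2]
        exact hx
      exact Or.inr ⟨h2.trans h', hy', k, by rw [T.cocycle H I J h2 h' y hy' hy hx]⟩

/-- The explicit form of the equivalence relation: either both points lie over one point of the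
footprint, or they have a common image in the space whose index is the smallest one possible. -/
def Equ (p q : Σ I, T.W I) : Prop :=
  (∃ hp hq, T.ψ p.1 ⟨p.2, hp⟩ = T.ψ q.1 ⟨q.2, hq⟩) ∨
    ∃ (S : Idx F) (v : T.W S), (∀ H, v ∈ T.deep S H → S.1 ⊆ H) ∧
      T.Down S p.1 v p.2 ∧ T.Down S q.1 v q.2

/-- A point that does not come from a smaller index is not in the zero set. -/
theorem not_mem_deep_empty {S : Idx F} {v : T.W S} (h : ∀ H, v ∈ T.deep S H → S.1 ⊆ H) :
    v ∉ T.deep S ∅ := fun hv => by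
  obtain ⟨i, hi⟩ := S.2.1
  simpa using h _ hv hi

variable (T) in
/-- Every point lies in the zero set or comes from a point of the space with the smallest possible
index.  It exists because the sets `deep I H` are compatible with intersections of the `H`. -/
theorem exists_minimal (I : Idx F) (x : T.W I) : x ∈ T.deep I ∅ ∨
    ∃ (S : Idx F) (v : T.W S), (∀ H, v ∈ T.deep S H → S.1 ⊆ H) ∧ T.Down S I v x := by
  classical
  let S : Finset (Fin N) := Finset.univ.filter fun i => ∀ H, x ∈ T.deep I H → i ∈ H
  have hS : ∀ H, x ∈ T.deep I H → S ⊆ H := fun H hH i hi => (Finset.mem_filter.1 hi).2 H hH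
  have hxS : x ∈ T.deep I S := by
    have : ∃ A : Finset (Fin N), x ∈ T.deep I A ∧ ∀ B, x ∈ T.deep I B → A.card ≤ B.card := by
      obtain ⟨A, hA, hmin⟩ := (Set.toFinite {A | x ∈ T.deep I A}).exists_minimalFor
        Finset.card _ ⟨I.1, T.deep_self I x⟩
      exact ⟨A, hA, fun B hB => (le_total _ _).elim id fun h => hmin hB h⟩
    obtain ⟨A, hA, hmin⟩ := this
    refine deep_mono (fun i hi => Finset.mem_filter.2 ⟨Finset.mem_univ _, fun H hH => ?_⟩) hA
    have h1 := hmin _ ((T.deep_inter I A H x).2 ⟨hA, hH⟩)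
    have h2 : A ∩ H = A := Finset.eq_of_subset_of_card_le Finset.inter_subset_left h1
    rw [← h2] at hi
    exact (Finset.mem_inter.1 hi).2
  rcases S.eq_empty_or_nonempty with h0 | hne
  · exact Or.inl (h0 ▸ hxS)
  · have hSI : S ⊆ I.1 := hS _ (T.deep_self I x)
    obtain ⟨v, hv⟩ := exists_down (H := ⟨S, I.2.mono hSI hne⟩) hSI hxS
    exact Or.inr ⟨_, v, fun H hH => hS H ((hv.deep_iff H).1 hH), hv⟩

theorem Equ.symm {p q : Σ I, T.W I} (h : Equ p q) : Equ q p := by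
  rcases h with ⟨hp, hq, h⟩ | ⟨S, v, hS, h1, h2⟩
  exacts [Or.inl ⟨hq, hp, h.symm⟩, Or.inr ⟨S, v, hS, h2, h1⟩]

theorem Equ.trans {p q r : Σ I, T.W I} (h : Equ p q) (h' : Equ q r) : Equ p r := by
  rcases h with ⟨hp, hq, h⟩ | ⟨S, v, hS, h1, h2⟩
  · rcases h' with ⟨hq', hr, h'⟩ | ⟨S', v', hS', h1', h2'⟩
    · exact Or.inl ⟨hp, hr, h.trans h'⟩
    · exact absurd ((h1'.deep_iff _).2 hq) (not_mem_deep_empty hS')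
  · rcases h' with ⟨hq', hr, h'⟩ | ⟨S', v', hS', h1', h2'⟩
    · exact absurd ((h2.deep_iff _).2 hq') (not_mem_deep_empty hS)
    · have e : S = S' := Subtype.ext (Finset.Subset.antisymm
        (hS _ ((h2.deep_iff _).2 h1'.mem_deep)) (hS' _ ((h1'.deep_iff _).2 h2.mem_deep)))
      subst e
      obtain ⟨g, rfl⟩ := h2.orbit h1'
      exact Or.inr ⟨S, g • v, hS', h1.smul g, h2'⟩

theorem Equ.of_down {H I : Idx F} {v : T.W H} {x : T.W I} (h : T.Down H I v x) :
    Equ (T := T) ⟨H, v⟩ ⟨I, x⟩ := by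
  rcases T.exists_minimal H v with hv | ⟨S, v', hS, h'⟩
  · refine Or.inl ⟨hv, (h.deep_iff _).1 hv, ?_⟩
    rcases h with ⟨rfl, g, rfl⟩ | ⟨h, hx, g, rfl⟩
    · exact ((T.ψ_orbit _ _ _).2 ⟨g, rfl⟩).symm
    · have hv' : T.ρ H I h ⟨x, hx⟩ ∈ T.deep H ∅ := (T.deep_smul _ _ g _).1 hv
      rw [← T.ψ_ρ H I h ⟨x, hx⟩ hv']
      exact ((T.ψ_orbit _ _ _).2 ⟨g, rfl⟩).symm
  · exact Or.inr ⟨S, v', hS, h', h'.trans h⟩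

/-- Zero points with the same image in the base are identified: both come from zero points over
that image in the space with index `I ∪ J`. -/
theorem rel_of_ψ {I J : Idx F} {x : T.W I} {y : T.W J} (hx : x ∈ T.deep I ∅)
    (hy : y ∈ T.deep J ∅) (h : T.ψ I ⟨x, hx⟩ = T.ψ J ⟨y, hy⟩) : T.rel ⟨I, x⟩ ⟨J, y⟩ := by
  classical
  have h1 := (T.ψ_mem I _).1 ⟨⟨x, hx⟩, rfl⟩
  have h2 := (T.ψ_mem J _).1 ⟨⟨y, hy⟩, rfl⟩
  have hM : T.ψ I ⟨x, hx⟩ ∈ ⋂ i ∈ I.1 ∪ J.1, F i := by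
    simp only [mem_iInter, Finset.mem_union] at h1 h2 ⊢
    rintro i (hi | hi)
    exacts [h1 i hi, h ▸ h2 i hi]
  let M : Idx F := ⟨I.1 ∪ J.1, I.2.1.mono Finset.subset_union_left, _, hM⟩
  obtain ⟨⟨z, hz⟩, hzx⟩ := (T.ψ_mem M _).2 hM
  have aux : ∀ (L : Idx F) (u : T.W L) (hu : u ∈ T.deep L ∅), L.1 ⊆ M.1 →
      T.ψ M ⟨z, hz⟩ = T.ψ L ⟨u, hu⟩ → T.rel ⟨L, u⟩ ⟨M, z⟩ := by
    intro L u hu hLM hzu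
    obtain ⟨v, hv⟩ := exists_down hLM (deep_mono (Finset.empty_subset L.1) hz)
    rcases Equ.of_down hv with ⟨hp, hq, he⟩ | ⟨S, v', hS, -, h2⟩
    · obtain ⟨g, hg⟩ := (T.ψ_orbit L _ _).1 ((he.trans hzu).symm)
      have := rel_smul L g u
      rw [show g • u = v from hg] at this
      exact (this.symm _ _).trans _ _ _ hv.rel
    · exact absurd ((h2.deep_iff _).2 hz) (not_mem_deep_empty hS)
  exact (aux I x hx Finset.subset_union_left hzx).trans _ _ _
    ((aux J y hy Finset.subset_union_right (hzx.trans h)).symm _ _)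

theorem rel_iff_equ {p q : Σ I, T.W I} : T.rel p q ↔ Equ p q := by
  constructor
  · intro h
    induction h with
    | rel p q h =>
      rcases h with ⟨I, g, x⟩ | ⟨I, J, h, y, g⟩
      · exact Equ.of_down (Or.inl ⟨rfl, g⁻¹, rfl⟩)
      · exact Equ.of_down (Or.inr ⟨h, y.2, g⁻¹, rfl⟩)
    | refl p => exact Equ.of_down (Or.inl ⟨rfl, 1, one_smul _ _⟩)
    | symm p q _ ih => exact ih.symm
    | trans p q r _ _ ih ih' => exact ih.trans ih'
  · rintro (⟨hp, hq, h⟩ | ⟨S, v, hS, h1, h2⟩)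
    · exact rel_of_ψ hp hq h
    · exact (h1.rel.symm _ _).trans _ _ _ h2.rel

theorem Equ.deep_iff {p q : Σ I, T.W I} (h : Equ p q) (H : Finset (Fin N)) :
    p.2 ∈ T.deep p.1 H ↔ q.2 ∈ T.deep q.1 H := by
  rcases h with ⟨hp, hq, -⟩ | ⟨S, v, hS, h1, h2⟩
  · exact iff_of_true (deep_mono (Finset.empty_subset H) hp) (deep_mono (Finset.empty_subset H) hq)
  · rw [← h1.deep_iff, h2.deep_iff]

theorem Equ.mem_inter {I J : Idx F} {x : T.W I} {y : T.W J} (h : Equ (T := T) ⟨I, x⟩ ⟨J, y⟩) :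
    x ∈ T.deep I (I.1 ∩ J.1) ∧ y ∈ T.deep J (I.1 ∩ J.1) := by
  rw [T.deep_inter, T.deep_inter]
  exact ⟨⟨T.deep_self _ _, (h.deep_iff J.1).2 (T.deep_self _ _)⟩,
    (h.deep_iff I.1).1 (T.deep_self _ _), T.deep_self _ _⟩

/-- Each space injects, modulo its group, into the realization. -/
theorem Equ.orbit {I : Idx F} {x y : T.W I} (h : Equ (T := T) ⟨I, x⟩ ⟨I, y⟩) :
    ∃ g : T.G I, g • x = y := by
  rcases h with ⟨hp, hq, h⟩ | ⟨S, v, hS, h1, h2⟩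
  · exact (T.ψ_orbit I _ _).1 h
  · exact h1.inj h2

/-- Equivalent points have a common image in the space indexed by `I ∩ J`. -/
theorem Equ.exists_down_inter {I J L : Idx F} (hL : L.1 = I.1 ∩ J.1) {x : T.W I} {y : T.W J}
    (h : Equ (T := T) ⟨I, x⟩ ⟨J, y⟩) : ∃ v, T.Down L I v x ∧ T.Down L J v y := by
  have hI : L.1 ⊆ I.1 := hL ▸ Finset.inter_subset_left
  have hJ : L.1 ⊆ J.1 := hL ▸ Finset.inter_subset_right
  obtain ⟨v, hv⟩ := exists_down hI (x := x) (hL ▸ h.mem_inter.1)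
  obtain ⟨w, hw⟩ := exists_down hJ (x := y) (hL ▸ h.mem_inter.2)
  have : T.rel ⟨L, v⟩ ⟨L, w⟩ :=
    hv.rel.trans _ _ _ ((rel_iff_equ.2 h).trans _ _ _ (hw.rel.symm _ _))
  obtain ⟨g, rfl⟩ := (rel_iff_equ.1 this).orbit
  exact ⟨g • v, hv.smul g, hw⟩

/-- The set of images of an open set is open. -/
theorem isOpen_down {L I : Idx F} (O : Set (T.W I)) (hO : IsOpen O) :
    IsOpen {v : T.W L | ∃ x ∈ O, T.Down L I v x} := by
  by_cases e : I = L
  · subst e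
    have : {v : T.W I | ∃ x ∈ O, T.Down I I v x} = ⋃ g : T.G I, (fun x => g • x) ⁻¹' O := by
      ext v
      simp only [mem_iUnion, mem_preimage]
      constructor
      · rintro ⟨x, hx, ⟨e, g, rfl⟩ | ⟨h, -⟩⟩
        · exact ⟨g⁻¹, by rwa [inv_smul_smul]⟩
        · exact absurd rfl h.ne
      · rintro ⟨g, hg⟩
        exact ⟨g • v, hg, Or.inl ⟨rfl, g⁻¹, inv_smul_smul _ _⟩⟩
    rw [this]
    exact isOpen_iUnion fun g => hO.preimage (T.continuous_smul I g)
  · by_cases hLI : L.1 ⊂ I.1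
    · have : {v : T.W L | ∃ x ∈ O, T.Down L I v x} =
          ⋃ g : T.G L, (fun x => g • x) ⁻¹' (T.ρ L I hLI '' (Subtype.val ⁻¹' O)) := by
        ext v
        simp only [mem_iUnion, mem_preimage]
        constructor
        · rintro ⟨x, hx, ⟨e', -⟩ | ⟨h, hx', g, rfl⟩⟩
          · exact absurd e' e
          · exact ⟨g⁻¹, ⟨x, hx'⟩, hx, (inv_smul_smul _ _).symm⟩
        · rintro ⟨g, y, hy, hg⟩
          exact ⟨y.1, hy, Or.inr ⟨hLI, y.2, g⁻¹, by rw [hg, inv_smul_smul]⟩⟩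
      rw [this]
      exact isOpen_iUnion fun g => ((T.ρ_open L I hLI) _
        (hO.preimage continuous_subtype_val)).preimage (T.continuous_smul L g)
    · convert isOpen_empty using 1
      rw [eq_empty_iff_forall_notMem]
      rintro v ⟨x, -, hx⟩
      rcases hx with ⟨e', -⟩ | ⟨h', -⟩
      · exact e e'
      · exact hLI h'

/-- Images of nearby points: the set of points some image of which lies in an open set `Q` is
relatively open. -/
theorem Down.eventually {L J : Idx F} {v : T.W L} {y : T.W J} (h : T.Down L J v y)
    {Q : Set (T.W L)} (hQ : IsOpen Q) (hv : v ∈ Q) :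
    ∀ᶠ y' in 𝓝 y, y' ∈ T.deep J L.1 → ∃ v' ∈ Q, T.Down L J v' y' := by
  rcases h with ⟨rfl, g, rfl⟩ | ⟨h, hy, g, rfl⟩
  · filter_upwards [(T.continuous_smul J g).continuousAt (hQ.mem_nhds hv)] with y' hy' _
    exact ⟨_, hy', Or.inl ⟨rfl, g, rfl⟩⟩
  · have hc : ContinuousAt (fun y : T.lift L J h => g • T.ρ L J h y) ⟨y, hy⟩ :=
      ((T.continuous_smul L g).comp (T.ρ_continuous L J h)).continuousAt
    have h1 := hc (hQ.mem_nhds hv)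
    rw [Filter.mem_map, nhds_subtype_eq_comap, Filter.mem_comap] at h1
    obtain ⟨O, hO, hOQ⟩ := h1
    filter_upwards [hO] with y' hy' hdeep
    have hl := (T.mem_lift L J h y').2 hdeep
    exact ⟨_, hOQ (show (⟨y', hl⟩ : T.lift L J h) ∈ Subtype.val ⁻¹' O from hy'),
      Or.inr ⟨h, hl, g, rfl⟩⟩

/-- Equivalences persist: near a point equivalent to a point of an open subset `O` of `W I`, all
points that are deep with respect to `I` are equivalent to points of `O`. -/
theorem Equ.eventually {I J : Idx F} {x : T.W I} {y : T.W J} (h : Equ (T := T) ⟨I, x⟩ ⟨J, y⟩)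
    {O : Set (T.W I)} (hO : IsOpen O) (hx : x ∈ O) :
    ∀ᶠ y' in 𝓝 y, y' ∈ T.deep J I.1 → ∃ x' ∈ O, Equ (T := T) ⟨I, x'⟩ ⟨J, y'⟩ := by
  classical
  rcases (I.1 ∩ J.1).eq_empty_or_nonempty with h0 | hne
  · have hd := h.mem_inter
    rw [h0] at hd
    have hψ : T.ψ I ⟨x, hd.1⟩ = T.ψ J ⟨y, hd.2⟩ := by
      rcases h with ⟨_, _, h⟩ | ⟨S, v, hS, h1, _⟩
      · exact h
      · exact absurd ((h1.deep_iff _).2 hd.1) (not_mem_deep_empty hS)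
    have hQ := T.ψ_open I _ (hO.preimage continuous_subtype_val)
    have h1 := (T.ψ_continuous J).continuousAt (x := ⟨y, hd.2⟩)
      (hQ.mem_nhds ⟨⟨x, hd.1⟩, hx, hψ⟩)
    rw [Filter.mem_map, nhds_subtype_eq_comap, Filter.mem_comap] at h1
    obtain ⟨V, hV, hVQ⟩ := h1
    filter_upwards [hV] with y' hy' hdeep
    have hd' : y' ∈ T.deep J ∅ := by
      rw [← h0, T.deep_inter]
      exact ⟨hdeep, T.deep_self _ _⟩
    obtain ⟨x', hx', he⟩ := hVQ (show (⟨y', hd'⟩ : T.deep J ∅) ∈ Subtype.val ⁻¹' V from hy')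
    exact ⟨x'.1, hx', Or.inl ⟨x'.2, hd', he⟩⟩
  · let L : Idx F := ⟨I.1 ∩ J.1, I.2.mono Finset.inter_subset_left hne⟩
    obtain ⟨v, h1, h2⟩ := h.exists_down_inter (L := L) rfl
    filter_upwards [h2.eventually (isOpen_down (L := L) O hO) ⟨x, hx, h1⟩] with y' hy' hdeep
    obtain ⟨v', ⟨x', hx', h3⟩, h4⟩ := hy' ((T.deep_inter _ _ _ _).2 ⟨hdeep, T.deep_self _ _⟩)
    exact ⟨x', hx', (Equ.of_down h3).symm.trans (Equ.of_down h4)⟩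

theorem isClosed_orbit (I : Idx F) [T2Space (T.W I)] :
    IsClosed {p : T.W I × T.W I | ∃ g : T.G I, g • p.1 = p.2} := by
  have : {p : T.W I × T.W I | ∃ g : T.G I, g • p.1 = p.2} =
      ⋃ g : T.G I, {p | g • p.1 = p.2} := by
    ext p; simp
  rw [this]
  exact isClosed_iUnion_of_finite fun g =>
    isClosed_eq ((T.continuous_smul I g).comp continuous_fst) continuous_snd

/-- The equivalence relation is closed. -/
theorem isClosed_equ [T2Space X] [∀ I, T2Space (T.W I)] :
    IsClosed {p : (Σ I, T.W I) × (Σ I, T.W I) | Equ p.1 p.2} := by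
  classical
  rw [← isOpen_compl_iff, isOpen_iff_mem_nhds]
  rintro ⟨⟨I, x⟩, ⟨J, y⟩⟩ hxy
  have hxy' : ¬ Equ (T := T) ⟨I, x⟩ ⟨J, y⟩ := hxy
  suffices hs : ∀ᶠ p in 𝓝 (x, y), ¬ Equ (T := T) ⟨I, p.1⟩ ⟨J, p.2⟩ by
    rw [nhds_prod_eq, Sigma.nhds_mk, Sigma.nhds_mk, Filter.prod_map_map_eq, Filter.mem_map,
      ← nhds_prod_eq]
    exact hs
  rw [nhds_prod_eq]
  by_cases hx : x ∈ T.deep I (I.1 ∩ J.1)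
  swap
  · filter_upwards [Filter.prod_mem_prod ((T.deep_closed I (I.1 ∩ J.1)).isOpen_compl.mem_nhds hx)
      Filter.univ_mem] with p hp h
    exact hp.1 h.mem_inter.1
  by_cases hy : y ∈ T.deep J (I.1 ∩ J.1)
  swap
  · filter_upwards [Filter.prod_mem_prod Filter.univ_mem
      ((T.deep_closed J (I.1 ∩ J.1)).isOpen_compl.mem_nhds hy)] with p hp h
    exact hp.2 h.mem_inter.2
  rcases (I.1 ∩ J.1).eq_empty_or_nonempty with h0 | hne
  · rw [h0] at hx hy
    have hne : T.ψ I ⟨x, hx⟩ ≠ T.ψ J ⟨y, hy⟩ := fun h => hxy' (Or.inl ⟨hx, hy, h⟩)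
    obtain ⟨A, B, hA, hB, hxA, hyB, hAB⟩ := t2_separation hne
    have h1 := (T.ψ_continuous I).continuousAt (x := ⟨x, hx⟩) (hA.mem_nhds hxA)
    have h2 := (T.ψ_continuous J).continuousAt (x := ⟨y, hy⟩) (hB.mem_nhds hyB)
    rw [Filter.mem_map, nhds_subtype_eq_comap, Filter.mem_comap] at h1 h2
    obtain ⟨V, hV, hVA⟩ := h1
    obtain ⟨V', hV', hVB⟩ := h2
    filter_upwards [Filter.prod_mem_prod hV hV'] with p hp h
    have hd := h.mem_inter
    rw [h0] at hd
    rcases h with ⟨hp1, hq1, h⟩ | ⟨S, v, hS, h1, -⟩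
    · exact disjoint_left.1 hAB
        (hVA (show (⟨p.1, hp1⟩ : T.deep I ∅) ∈ Subtype.val ⁻¹' V from hp.1))
        (h ▸ hVB (show (⟨p.2, hq1⟩ : T.deep J ∅) ∈ Subtype.val ⁻¹' V' from hp.2))
    · exact absurd ((h1.deep_iff _).2 hd.1) (not_mem_deep_empty hS)
  · let L : Idx F := ⟨I.1 ∩ J.1, I.2.mono Finset.inter_subset_left hne⟩
    obtain ⟨v, hv⟩ := exists_down (H := L) Finset.inter_subset_left hx
    obtain ⟨w, hw⟩ := exists_down (H := L) Finset.inter_subset_right hy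
    have hvw : ¬ ∃ g : T.G L, g • v = w := by
      rintro ⟨g, rfl⟩
      exact hxy' ((Equ.of_down (hv.smul g)).symm.trans (Equ.of_down hw))
    obtain ⟨A, B, hA, hB, hvA, hwB, hAB⟩ :=
      isOpen_prod_iff.1 (isClosed_orbit (T := T) L).isOpen_compl v w hvw
    filter_upwards [Filter.prod_mem_prod (hv.eventually hA hvA) (hw.eventually hB hwB)]
      with p hp h
    obtain ⟨v', hv', h1⟩ := hp.1 h.mem_inter.1
    obtain ⟨w', hw', h2⟩ := hp.2 h.mem_inter.2
    exact hAB (show (v', w') ∈ A ×ˢ B from ⟨hv', hw'⟩)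
      ((Equ.of_down h1).trans (h.trans (Equ.of_down h2).symm)).orbit

/-- The realization is Hausdorff. -/
theorem t2Space_realization [T2Space X] [∀ I, T2Space (T.W I)]
    [∀ I, LocallyCompactSpace (T.W I)] [∀ I, SigmaCompactSpace (T.W I)] :
    T2Space (Quot T.Mor) := by
  have : LocallyCompactSpace (Σ I, T.W I) := by
    refine ⟨?_⟩
    rintro ⟨I, x⟩ n hn
    rw [Sigma.nhds_mk, Filter.mem_map] at hn
    obtain ⟨s, hs, hsn, hsc⟩ := LocallyCompactSpace.local_compact_nhds x _ hn
    refine ⟨Sigma.mk I '' s, ?_, image_subset_iff.2 hsn, hsc.image continuous_sigmaMk⟩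
    rw [Sigma.nhds_mk]
    exact Filter.image_mem_map hs
  let r : Setoid (Σ I, T.W I) := Relation.EqvGen.setoid T.Mor
  have hr : IsClosed {p : (Σ I, T.W I) × (Σ I, T.W I) | r p.1 p.2} := by
    convert isClosed_equ (T := T) using 2
    ext p
    exact rel_iff_equ
  have := t2Space_quotient_of_isClosed r hr
  have hc : Continuous (Quot.lift (Quotient.mk r) fun a b h =>
      Quotient.sound (Relation.EqvGen.rel a b h) : Quot T.Mor → Quotient r) :=
    continuous_quot_lift _ continuous_quotient_mk'
  refine T2Space.of_injective_continuous ?_ hc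
  rintro ⟨p⟩ ⟨q⟩ h
  exact Quot.eqvGen_sound (Quotient.exact h)

/-- Every invariant open subset of `W I` is the trace of an open, saturated set: remove from the
whole space those points that are deep with respect to `I` and not equivalent to points of `O`. -/
theorem exists_isOpen_realization {I : Idx F} {O : Set (T.W I)} (hO : IsOpen O)
    (hinv : ∀ (g : T.G I), ∀ x ∈ O, g • x ∈ O) :
    ∃ G : Set (Quot T.Mor), IsOpen G ∧ ∀ x : T.W I, Quot.mk T.Mor ⟨I, x⟩ ∈ G ↔ x ∈ O := by
  let G : Set (Σ J, T.W J) := {p | p.2 ∈ T.deep p.1 I.1 → ∃ x ∈ O, Equ (T := T) ⟨I, x⟩ p}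
  have hG : IsOpen G := by
    rw [isOpen_sigma_iff]
    intro J
    rw [isOpen_iff_mem_nhds]
    intro y hy
    by_cases hd : y ∈ T.deep J I.1
    · obtain ⟨x, hx, h⟩ := hy hd
      exact h.eventually hO hx
    · filter_upwards [(T.deep_closed J I.1).isOpen_compl.mem_nhds hd] with y' hy' hd'
      exact absurd hd' hy'
  have hsat : ∀ p q, Equ p q → p ∈ G → q ∈ G := by
    intro p q h hp hq
    obtain ⟨x, hx, h'⟩ := hp ((h.deep_iff _).2 hq)
    exact ⟨x, hx, h'.trans h⟩
  have hmem : ∀ p, Quot.mk T.Mor p ∈ Quot.mk T.Mor '' G ↔ p ∈ G := by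
    refine fun p => ⟨?_, fun h => ⟨p, h, rfl⟩⟩
    rintro ⟨q, hq, h⟩
    exact hsat q p (rel_iff_equ.1 (Quot.eqvGen_exact h)) hq
  refine ⟨Quot.mk T.Mor '' G, ?_, fun x => ?_⟩
  · refine isQuotientMap_quot_mk.isOpen_preimage.1 ?_
    convert hG using 1
    ext p
    exact hmem p
  · rw [hmem]
    constructor
    · intro h
      obtain ⟨x', hx', h'⟩ := h (T.deep_self I x)
      obtain ⟨g, rfl⟩ := h'.orbit
      exact hinv g x' hx'
    · intro hx _
      exact ⟨x, hx, Equ.of_down (Or.inl ⟨rfl, 1, one_smul _ _⟩)⟩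

/-- The orbit space of each `W I` is embedded in the realization.  The orbit relation `s` and the
morphisms `m` are arguments, so that the lemma applies to realizations that are defined in terms of
other, equivalent relations. -/
theorem isEmbedding_of_orbits {I : Idx F} (s : Setoid (T.W I))
    (hs : ∀ x y, s x y ↔ ∃ g : T.G I, g • x = y) {m : (Σ I, T.W I) → (Σ I, T.W I) → Prop}
    (hm : ∀ p q, m p q ↔ T.Mor p q) (f : Quotient s → Quot m)
    (hf : ∀ x, f (Quotient.mk s x) = Quot.mk m ⟨I, x⟩) : IsEmbedding f := by
  obtain rfl : m = T.Mor := by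
    funext p q
    exact propext (hm p q)
  have hc : Continuous f := by
    refine isQuotientMap_quotient_mk'.continuous_iff.2 ?_
    have : f ∘ Quotient.mk' = fun x => Quot.mk T.Mor ⟨I, x⟩ := funext hf
    rw [this]
    exact continuous_quot_mk.comp continuous_sigmaMk
  refine ⟨⟨le_antisymm hc.le_induced ?_⟩, ?_⟩
  · intro O hO
    obtain ⟨G, hG, h⟩ := exists_isOpen_realization (T := T) (I := I)
      (hO.preimage continuous_quotient_mk') (fun g x hx => by
        have : (Quotient.mk' (g • x) : Quotient s) = Quotient.mk' x :=
          Quotient.sound (s.symm ((hs _ _).2 ⟨g, rfl⟩))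
        rw [mem_preimage, this]
        exact hx)
    refine ⟨G, hG, ?_⟩
    ext q
    induction q using Quotient.inductionOn with | _ x => ?_
    rw [mem_preimage, hf, h]
    rfl
  · intro p q h
    induction p using Quotient.inductionOn with | _ x => ?_
    induction q using Quotient.inductionOn with | _ y => ?_
    rw [hf, hf] at h
    exact Quotient.sound ((hs _ _).2 (rel_iff_equ.1 (Quot.eqvGen_exact h)).orbit)

end TameSpaces

/-! ### Elementary properties of charts and coordinate changes -/

namespace BasicData

variable {N : ℕ} (P : BasicData.{w} N)

theorem incl_apply {I J : Finset (Fin N)} (h : I ⊆ J) (e : P.EI I) (j : J) (hj : j.1 ∈ I) :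
    P.incl h e j = e ⟨j.1, hj⟩ := dif_pos hj

theorem incl_apply_of_notMem {I J : Finset (Fin N)} (h : I ⊆ J) (e : P.EI I) (j : J)
    (hj : j.1 ∉ I) : P.incl h e j = 0 := dif_neg hj

theorem mem_range_incl {I J : Finset (Fin N)} (h : I ⊆ J) (e : P.EI J) :
    e ∈ LinearMap.range (P.incl h) ↔ ∀ j : J, j.1 ∉ I → e j = 0 := by
  constructor
  · rintro ⟨f, rfl⟩ j hj
    exact P.incl_apply_of_notMem h f j hj
  · intro he
    refine ⟨fun i => e ⟨i.1, h i.2⟩, ?_⟩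
    ext j
    by_cases hj : j.1 ∈ I
    · rw [P.incl_apply h _ j hj]
    · rw [P.incl_apply_of_notMem h _ j hj, he j hj]

theorem proj_surjective {I J : Finset (Fin N)} (h : I ⊆ J) : Function.Surjective (P.proj h) := by
  intro g
  refine ⟨fun j => if hj : j.1 ∈ I then g ⟨j.1, hj⟩ else 1, ?_⟩
  funext i
  exact dif_pos i.2

theorem τI_apply (I : Finset (Fin N)) (g : P.ΓI I) (e : P.EI I) (i : I) :
    P.τI I g e i = P.τ i (g i) (e i) := rfl

theorem τ_eq_zero_iff (i : Fin N) (g : P.Γ i) (e : P.E i) : P.τ i g e = 0 ↔ e = 0 := by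
  constructor
  · intro h
    have := congrArg (P.τ i g⁻¹) h
    rwa [← Module.End.mul_apply, ← map_mul, inv_mul_cancel, map_one, Module.End.one_apply,
      map_zero] at this
  · rintro rfl
    exact map_zero _

end BasicData

namespace Chart

variable {X : Type u} [TopologicalSpace X] {G : Type w} [Group G] {E : Type w}
  [NormedAddCommGroup E] [NormedSpace ℝ E] {τ : Representation ℝ G E} (c : Chart.{u, v, w} X τ)

theorem continuous_s : Continuous c.s := c.s_smooth.continuous

theorem continuous_smul (g : G) : Continuous fun u : c.U => g • u := (c.smooth_smul g).continuous

theorem locallyCompactSpace : LocallyCompactSpace c.U :=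
  Manifold.locallyCompact_of_finiteDimensional c.smooth.I

theorem sigmaCompactSpace : SigmaCompactSpace c.U :=
  have := c.locallyCompactSpace
  inferInstance

theorem ψ_eq_iff (x y : {u : c.U // c.s u = 0}) : c.ψ x = c.ψ y ↔ ∃ g : G, g • x.1 = y.1 := by
  constructor
  · intro h
    have h1 := Quotient.exact (@c.ψ_homeo.injective (Quotient.mk _ x) (Quotient.mk _ y) h)
    obtain ⟨g, hg⟩ : x.1 ∈ MulAction.orbit G y.1 := h1
    exact ⟨g⁻¹, by rw [← hg, inv_smul_smul]⟩
  · rintro ⟨g, hg⟩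
    exact c.ψ_inv x y ⟨g⁻¹, by rw [← hg]; exact inv_smul_smul _ _⟩

theorem s_smul_eq_zero {g : G} {u : c.U} : c.s (g • u) = 0 ↔ c.s u = 0 := by
  have key : ∀ (g : G) (u : c.U), c.s u = 0 → c.s (g • u) = 0 := fun g u h => by
    rw [c.s_equiv, h, map_zero]
  exact ⟨fun h => by simpa using key g⁻¹ _ h, key g u⟩

theorem continuous_ψ : Continuous c.ψ := c.ψ_homeo.continuous.comp continuous_quotient_mk'

theorem isOpenMap_ψ : IsOpenMap c.ψ := by
  intro O hO
  let r := (MulAction.orbitRel G c.U).comap (Subtype.val : {u : c.U // c.s u = 0} → c.U)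
  have h1 : IsOpen (Quotient.mk r '' O) := by
    refine isQuotientMap_quotient_mk'.isOpen_preimage.1 ?_
    have : Quotient.mk' ⁻¹' (Quotient.mk r '' O) = ⋃ g : G,
        (fun x : {u : c.U // c.s u = 0} => (⟨g • x.1, c.s_smul_eq_zero.2 x.2⟩ :
          {u : c.U // c.s u = 0})) ⁻¹' O := by
      ext x
      simp only [mem_preimage, mem_iUnion, mem_image]
      constructor
      · rintro ⟨y, hy, h⟩
        obtain ⟨g, hg⟩ : y.1 ∈ MulAction.orbit G x.1 := Quotient.exact h
        refine ⟨g, ?_⟩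
        convert hy
      · rintro ⟨g, hg⟩
        exact ⟨_, hg, Quotient.sound (show r _ x from ⟨g, rfl⟩)⟩
    rw [this]
    exact isOpen_iUnion fun g : G => hO.preimage (Continuous.subtype_mk
        ((c.continuous_smul g).comp continuous_subtype_val) _)
  have h2 := c.ψ_homeo.isOpenMap _ h1
  rwa [image_image] at h2

end Chart

namespace WeakSystem

variable {N : ℕ} {P : BasicData.{w} N} {X : Type u} [TopologicalSpace X] {d : ℤ}
  (K : WeakSystem.{u, v, w} P X d)

/-- The points of `U_J` at which the section takes values in `E_H`. -/
def deep (J : Idx K.F) (H : Finset (Fin N)) : Set (K.U J) :=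
  {y | ∀ j : J.1, j.1 ∉ H → (K.chart J).s y j = 0}

variable {K}

theorem isClosed_deep (J : Idx K.F) (H : Finset (Fin N)) : IsClosed (K.deep J H) := by
  have : K.deep J H = ⋂ j : J.1, ⋂ _ : j.1 ∉ H, {y | (K.chart J).s y j = 0} := by
    ext; simp [deep]
  rw [this]
  exact isClosed_iInter fun j => isClosed_iInter fun _ =>
    isClosed_eq ((continuous_apply j).comp (K.chart J).continuous_s) continuous_const

theorem deep_inter {J : Idx K.F} {H H' : Finset (Fin N)} {y : K.U J} :
    y ∈ K.deep J (H ∩ H') ↔ y ∈ K.deep J H ∧ y ∈ K.deep J H' := by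
  constructor
  · exact fun h => ⟨fun j hj => h j fun h' => hj (Finset.mem_inter.1 h').1,
      fun j hj => h j fun h' => hj (Finset.mem_inter.1 h').2⟩
  · rintro ⟨h, h'⟩ j hj
    by_cases hH : j.1 ∈ H
    · exact h' j fun hH' => hj (Finset.mem_inter.2 ⟨hH, hH'⟩)
    · exact h j hH

theorem deep_mono {J : Idx K.F} {H H' : Finset (Fin N)} (h : H ⊆ H') {y : K.U J}
    (hy : y ∈ K.deep J H) : y ∈ K.deep J H' := fun j hj => hy j fun h' => hj (h h')

theorem deep_self {J : Idx K.F} (y : K.U J) : y ∈ K.deep J J.1 := fun j hj => absurd j.2 hj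

theorem mem_deep_smul {J : Idx K.F} {H : Finset (Fin N)} {g : P.ΓI J.1} {y : K.U J} :
    g • y ∈ K.deep J H ↔ y ∈ K.deep J H := by
  refine forall₂_congr fun j _ => ?_
  rw [(K.chart J).s_equiv, P.τI_apply, P.τ_eq_zero_iff]

theorem mem_deep_empty {J : Idx K.F} {y : K.U J} : y ∈ K.deep J ∅ ↔ (K.chart J).s y = 0 :=
  ⟨fun h => funext fun j => h j (Finset.notMem_empty _), fun h j _ => congrFun h j⟩

theorem mem_deep_iff {I J : Idx K.F} (h : I.1 ⊆ J.1) {y : K.U J} :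
    y ∈ K.deep J I.1 ↔ (K.chart J).s y ∈ LinearMap.range (P.incl h) :=
  (P.mem_range_incl h _).symm

variable {I J : Idx K.F} (h : I.1 ⊂ J.1)

theorem lift_subset_deep : (K.change I J h).lift ⊆ K.deep J I.1 := fun y hy => by
  rw [mem_deep_iff h.subset, (K.change I J h).ρ_s ⟨y, hy⟩]
  exact ⟨_, rfl⟩

theorem s_ρ_apply (y : (K.change I J h).lift) (i : I.1) :
    (K.chart I).s ((K.change I J h).ρ y) i = (K.chart J).s y.1 ⟨i.1, h.subset i.2⟩ := by
  rw [(K.change I J h).ρ_s y, P.incl_apply _ _ ⟨i.1, h.subset i.2⟩ i.2]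

theorem ρ_mem_deep (y : (K.change I J h).lift) {H : Finset (Fin N)} :
    (K.change I J h).ρ y ∈ K.deep I H ↔ y.1 ∈ K.deep J H := by
  constructor
  · intro hy j hj
    by_cases hI : j.1 ∈ I.1
    · rw [← s_ρ_apply h y ⟨j.1, hI⟩]
      exact hy _ hj
    · exact lift_subset_deep h y.2 j hI
  · intro hy i hi
    rw [s_ρ_apply]
    exact hy _ hi

theorem continuous_ρ : Continuous (K.change I J h).ρ := by
  obtain ⟨S, -, h1, -⟩ := (K.change I J h).smooth_lift
  exact h1.contMDiff.continuous

theorem isOpenMap_ρ : IsOpenMap (K.change I J h).ρ := by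
  obtain ⟨S, -, h1, -⟩ := (K.change I J h).smooth_lift
  exact h1.isOpenMap

theorem ρ_mem_dom (y : (K.change I J h).lift) : (K.change I J h).ρ y ∈ (K.change I J h).dom := by
  rw [← (K.change I J h).ρ_range]
  exact mem_range_self y

theorem mem_footprint {I : Idx K.F} {p : X} :
    (∃ z, (K.chart I).ψ z = p) ↔ ∀ i ∈ I.1, p ∈ K.F i := by
  have h : p ∈ range (K.chart I).ψ ↔ p ∈ ⋂ i ∈ I.1, K.F i := by rw [← K.chart_foot I]; rfl
  simpa using h

theorem ψ_mem {I : Idx K.F} (z : {u : K.U I // (K.chart I).s u = 0}) {i : Fin N} (hi : i ∈ I.1) :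
    (K.chart I).ψ z ∈ K.F i := mem_footprint.1 ⟨z, rfl⟩ i hi

/-- The zero set of `U_J` is contained in the lifted domains of all coordinate changes to `U_J`. -/
theorem mem_lift_of_s_eq_zero {y : K.U J} (hy : (K.chart J).s y = 0) :
    y ∈ (K.change I J h).lift := by
  obtain ⟨z, hz⟩ := mem_footprint.2 fun i hi => ψ_mem ⟨y, hy⟩ (h.subset hi)
  have hzd : z.1 ∈ (K.change I J h).dom :=
    ((K.change I J h).dom_foot z).2 ⟨⟨y, hy⟩, hz.symm⟩
  rw [← (K.change I J h).ρ_range] at hzd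
  obtain ⟨y', hy'⟩ := hzd
  have hsy' : (K.chart J).s y'.1 = 0 := by
    rw [← mem_deep_empty, ← ρ_mem_deep h y', hy', mem_deep_empty]
    exact z.2
  have h1 : (K.chart J).ψ ⟨y'.1, hsy'⟩ = (K.chart J).ψ ⟨y, hy⟩ := by
    rw [(K.change I J h).ρ_ψ y' hsy' (by rw [hy']; exact z.2), ← hz]
    congr 1
    exact Subtype.ext hy'
  obtain ⟨g, hg⟩ := ((K.chart J).ψ_eq_iff _ _).1 h1
  have hg' : g • y'.1 = y := hg
  rw [← hg']
  exact (K.change I J h).lift_smul g _ y'.2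

theorem IsTame.mem_lift (hK : K.IsTame) {y : K.U J} :
    y ∈ (K.change I J h).lift ↔ y ∈ K.deep J I.1 := by
  refine ⟨fun hy => lift_subset_deep h hy, fun hy => ?_⟩
  exact ((hK.image I J J h subset_rfl y).2 ⟨Or.inl rfl, (mem_deep_iff h.subset).1 hy⟩).1

/-! ### Realizations of tame atlases and cobordisms -/

variable (K) in
/-- The domain category of a tame system. -/
def tameSpaces (hK : K.IsTame) : TameSpaces.{u, v, w} K.F where
  W := K.U
  G I := P.ΓI I.1
  continuous_smul I g := (K.chart I).continuous_smul g
  deep := K.deep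
  deep_closed := isClosed_deep
  deep_inter _ _ _ _ := deep_inter
  deep_self _ := deep_self
  deep_smul _ _ _ _ := mem_deep_smul
  pr _ _ h := P.proj h.subset
  pr_surj _ _ h := P.proj_surjective h.subset
  lift I J h := (K.change I J h).lift
  mem_lift _ _ h _ := hK.mem_lift h
  ρ I J h := (K.change I J h).ρ
  ρ_continuous _ _ h := continuous_ρ h
  ρ_open _ _ h := isOpenMap_ρ h
  ρ_deep _ _ h y _ := ρ_mem_deep h y
  ρ_equiv I J h g y hy := (K.change I J h).ρ_equiv g y
  ρ_fiber I J h y y' hy := by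
    obtain ⟨g, -, hg⟩ := ((K.change I J h).ρ_fiber y y').1 hy
    exact ⟨g, hg⟩
  cocycle I J L h h' z hz hz' hz'' := K.cocycle I J L h h' z hz hz' hz''
  ψ I x := (K.chart I).ψ ⟨x.1, mem_deep_empty.1 x.2⟩
  ψ_continuous I := (K.chart I).continuous_ψ.comp (by fun_prop)
  ψ_open I := by
    have e : K.deep I ∅ = {u | (K.chart I).s u = 0} := ext fun _ => mem_deep_empty
    exact (K.chart I).isOpenMap_ψ.comp (Homeomorph.setCongr e).isOpenMap
  ψ_mem I p := by
    rw [mem_iInter₂, ← mem_footprint]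
    exact ⟨fun ⟨x, hx⟩ => ⟨_, hx⟩, fun ⟨z, hz⟩ => ⟨⟨z.1, mem_deep_empty.2 z.2⟩, hz⟩⟩
  ψ_orbit I x y := (K.chart I).ψ_eq_iff _ _
  ψ_ρ I J h y hy hy' := ((K.change I J h).ρ_ψ y (mem_deep_empty.1 hy') (mem_deep_empty.1 hy)).symm

theorem mor_iff (hK : K.IsTame) (p q : Σ I, K.U I) : K.Mor p q ↔ (K.tameSpaces hK).Mor p q := by
  constructor
  · rintro (⟨I, g, x⟩ | ⟨I, J, h, y, g⟩)
    · exact TameSpaces.Mor.act (T := K.tameSpaces hK) I g x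
    · exact TameSpaces.Mor.change (T := K.tameSpaces hK) I J h y g
  · rintro (⟨I, g, x⟩ | ⟨I, J, h, y, g⟩)
    · exact Mor.act (K := K) I g x
    · exact Mor.change (K := K) I J h y g

theorem IsTame.isEmbedding_πbar (hK : K.IsTame) (I : Idx K.F) : IsEmbedding (K.πbar I) := by
  refine TameSpaces.isEmbedding_of_orbits (T := K.tameSpaces hK)
    (MulAction.orbitRel (P.ΓI I.1) (K.U I)) (fun x y => ?_) (mor_iff hK) (K.πbar I) (fun _ => rfl)
  constructor
  · rintro ⟨g, hg⟩
    exact ⟨g⁻¹, by rw [← hg]; exact inv_smul_smul _ _⟩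
  · rintro ⟨g, hg⟩
    exact ⟨g⁻¹, by rw [← hg]; exact inv_smul_smul _ _⟩

theorem IsTame.t2Space_real [T2Space X] (hK : K.IsTame) : T2Space K.Real := by
  have e : K.Mor = (K.tameSpaces hK).Mor := by
    funext p q
    exact propext (mor_iff hK p q)
  have h1 : ∀ I, T2Space ((K.tameSpaces hK).W I) := fun I => (K.chart I).t2
  have h2 : ∀ I, LocallyCompactSpace ((K.tameSpaces hK).W I) :=
    fun I => (K.chart I).locallyCompactSpace
  have h3 : ∀ I, SigmaCompactSpace ((K.tameSpaces hK).W I) := fun I => (K.chart I).sigmaCompactSpace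
  have := TameSpaces.t2Space_realization (T := K.tameSpaces hK)
  change T2Space (Quot K.Mor)
  rw [e]
  exact this

variable (K) in
/-- The diagonal action on `U_I × E_I`. -/
abbrev diagAction (I : Idx K.F) : MulAction (P.ΓI I.1) (K.U I × P.EI I.1) where
  smul g p := (g • p.1, P.τI I.1 g p.2)
  one_smul p := Prod.ext (one_smul _ p.1) (by
    change P.τI I.1 1 p.2 = p.2
    rw [map_one, Module.End.one_apply])
  mul_smul g g' p := Prod.ext (mul_smul g g' p.1) (by
    change P.τI I.1 (g * g') p.2 = P.τI I.1 g (P.τI I.1 g' p.2)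
    rw [map_mul, Module.End.mul_apply])

variable (K) in
/-- The restriction of the projection `E_J → E_I` and of `ρ_{IJ}` to a map on
`{(y, e) | y ∈ lift, e ∈ E_I}`. -/
def ρE (I J : Idx K.F) (h : I.1 ⊂ J.1)
    (p : {p : K.U J × P.EI J.1 | p.1 ∈ (K.change I J h).lift ∧ ∀ j : J.1, j.1 ∉ I.1 → p.2 j = 0}) :
    K.U I × P.EI I.1 :=
  ((K.change I J h).ρ ⟨p.1.1, p.2.1⟩, fun i => p.1.2 ⟨i.1, h.subset i.2⟩)

theorem continuous_τI (I : Finset (Fin N)) (g : P.ΓI I) : Continuous (P.τI I g) :=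
  (P.τI I g).continuous_of_finiteDimensional

variable (K) in
/-- The obstruction category of a tame system. -/
def tameSpacesE (hK : K.IsTame) : TameSpaces.{u, max v w, w} K.F where
  W I := K.U I × P.EI I.1
  G I := P.ΓI I.1
  act := K.diagAction
  continuous_smul I g := by
    change Continuous fun p : K.U I × P.EI I.1 => (g • p.1, P.τI I.1 g p.2)
    exact (((K.chart I).continuous_smul g).comp continuous_fst).prodMk
      ((continuous_τI I.1 g).comp continuous_snd)
  deep I H := {p | p.1 ∈ K.deep I H ∧ ∀ i : I.1, i.1 ∉ H → p.2 i = 0}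
  deep_closed I H := by
    have hcl : IsClosed {p : K.U I × P.EI I.1 | ∀ i : I.1, i.1 ∉ H → p.2 i = 0} := by
      have : {p : K.U I × P.EI I.1 | ∀ i : I.1, i.1 ∉ H → p.2 i = 0} =
          ⋂ i : I.1, ⋂ _ : i.1 ∉ H, {p | p.2 i = 0} := by
        ext; simp
      rw [this]
      exact isClosed_iInter fun i => isClosed_iInter fun _ =>
        isClosed_eq ((continuous_apply i).comp continuous_snd) continuous_const
    exact ((isClosed_deep I H).preimage continuous_fst).inter hcl
  deep_inter I H H' p := by
    constructor
    · rintro ⟨h1, h2⟩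
      rw [K.deep_inter] at h1
      exact ⟨⟨h1.1, fun j hj => h2 j fun h' => hj (Finset.mem_inter.1 h').1⟩,
        h1.2, fun j hj => h2 j fun h' => hj (Finset.mem_inter.1 h').2⟩
    · rintro ⟨⟨h1, h2⟩, h3, h4⟩
      refine ⟨K.deep_inter.2 ⟨h1, h3⟩, fun j hj => ?_⟩
      by_cases hH : j.1 ∈ H
      · exact h4 j fun hH' => hj (Finset.mem_inter.2 ⟨hH, hH'⟩)
      · exact h2 j hH
  deep_self I p := ⟨deep_self p.1, fun i hi => absurd i.2 hi⟩
  deep_smul I H g p := by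
    refine and_congr mem_deep_smul (forall₂_congr fun i _ => ?_)
    exact P.τ_eq_zero_iff _ _ _
  pr _ _ h := P.proj h.subset
  pr_surj _ _ h := P.proj_surjective h.subset
  lift I J h := {p | p.1 ∈ (K.change I J h).lift ∧ ∀ j : J.1, j.1 ∉ I.1 → p.2 j = 0}
  mem_lift I J h p := and_congr (hK.mem_lift h) Iff.rfl
  ρ := K.ρE
  ρ_continuous I J h := by
    refine ((continuous_ρ h).comp (by fun_prop)).prodMk ?_
    exact continuous_pi fun i => (continuous_apply _).comp
      (continuous_snd.comp continuous_subtype_val)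
  ρ_open I J h := by
    intro O hO
    obtain ⟨O', hO', rfl⟩ := isOpen_induced_iff.1 hO
    let f : (K.change I J h).lift × P.EI I.1 → K.U J × P.EI J.1 :=
      fun q => (q.1.1, P.incl h.subset q.2)
    have hf : Continuous f := (continuous_subtype_val.comp continuous_fst).prodMk
      ((P.incl h.subset).continuous_of_finiteDimensional.comp continuous_snd)
    have h1 := ((isOpenMap_ρ h).prodMap IsOpenMap.id) _ (hO'.preimage hf)
    convert h1 using 1
    ext q
    constructor
    · rintro ⟨p, hp, rfl⟩
      refine ⟨(⟨p.1.1, p.2.1⟩, fun i => p.1.2 ⟨i.1, h.subset i.2⟩), ?_, rfl⟩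
      rw [mem_preimage] at hp ⊢
      convert hp using 1
      refine Prod.ext rfl (funext fun j => ?_)
      by_cases hj : j.1 ∈ I.1
      · exact P.incl_apply _ _ j hj
      · exact (P.incl_apply_of_notMem _ _ j hj).trans (p.2.2 j hj).symm
    · rintro ⟨⟨y, e⟩, hp, rfl⟩
      refine ⟨⟨f (y, e), y.2, fun j hj => P.incl_apply_of_notMem _ _ j hj⟩, hp, ?_⟩
      exact Prod.ext rfl (funext fun i =>
        P.incl_apply h.subset e ⟨i.1, h.subset i.2⟩ i.2)
  ρ_deep I J h p H := by
    constructor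
    · rintro ⟨h1, h2⟩
      refine ⟨(ρ_mem_deep h _).1 h1, fun j hj => ?_⟩
      by_cases hI : j.1 ∈ I.1
      · exact h2 ⟨j.1, hI⟩ hj
      · exact p.2.2 j hI
    · rintro ⟨h1, h2⟩
      exact ⟨(ρ_mem_deep h _).2 h1, fun i hi => h2 _ hi⟩
  ρ_equiv I J h g p hp := Prod.ext ((K.change I J h).ρ_equiv g ⟨p.1.1, p.2.1⟩) rfl
  ρ_fiber I J h p p' hp := by
    have h1 : (K.change I J h).ρ ⟨p.1.1, p.2.1⟩ = (K.change I J h).ρ ⟨p'.1.1, p'.2.1⟩ :=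
      congrArg Prod.fst hp
    have h2 : (fun i : I.1 => p.1.2 ⟨i.1, h.subset i.2⟩) =
      fun i : I.1 => p'.1.2 ⟨i.1, h.subset i.2⟩ := congrArg Prod.snd hp
    obtain ⟨g, hg, hgp⟩ := ((K.change I J h).ρ_fiber _ _).1 h1
    refine ⟨g, Prod.ext hgp (funext fun j => ?_)⟩
    change P.τ j (g j) (p.1.2 j) = p'.1.2 j
    by_cases hj : j.1 ∈ I.1
    · have h3 : g j = 1 := congrFun (MonoidHom.mem_ker.1 hg) ⟨j.1, hj⟩
      rw [h3, map_one]
      exact congrFun h2 ⟨j.1, hj⟩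
    · rw [p.2.2 j hj, p'.2.2 j hj, map_zero]
  cocycle I J L h h' p hp hp' hp'' :=
    Prod.ext (K.cocycle I J L h h' p.1 hp.1 hp'.1 hp''.1) rfl
  ψ I p := (K.chart I).ψ ⟨p.1.1, mem_deep_empty.1 p.2.1⟩
  ψ_continuous I := (K.chart I).continuous_ψ.comp (by fun_prop)
  ψ_open I := by
    intro O hO
    obtain ⟨O', hO', rfl⟩ := isOpen_induced_iff.1 hO
    have hf : Continuous fun u : {u : K.U I // (K.chart I).s u = 0} => (u.1, (0 : P.EI I.1)) :=
      continuous_subtype_val.prodMk continuous_const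
    convert (K.chart I).isOpenMap_ψ _ (hO'.preimage hf) using 1
    ext q
    constructor
    · rintro ⟨p, hp, rfl⟩
      refine ⟨⟨p.1.1, mem_deep_empty.1 p.2.1⟩, ?_, rfl⟩
      rw [mem_preimage] at hp ⊢
      convert hp using 1
      exact Prod.ext rfl (funext fun j => (p.2.2 j (Finset.notMem_empty _)).symm)
    · rintro ⟨u, hu, rfl⟩
      exact ⟨⟨(u.1, 0), mem_deep_empty.2 u.2, fun _ _ => rfl⟩, hu, rfl⟩
  ψ_mem I p := by
    rw [mem_iInter₂, ← mem_footprint]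
    exact ⟨fun ⟨x, hx⟩ => ⟨_, hx⟩,
      fun ⟨z, hz⟩ => ⟨⟨(z.1, 0), mem_deep_empty.2 z.2, fun _ _ => rfl⟩, hz⟩⟩
  ψ_orbit I p q := by
    refine ((K.chart I).ψ_eq_iff _ _).trans (exists_congr fun g => ⟨fun hg => ?_, fun hg => ?_⟩)
    · refine Prod.ext hg (funext fun j => ?_)
      change P.τ j (g j) (p.1.2 j) = q.1.2 j
      rw [p.2.2 j (Finset.notMem_empty _), q.2.2 j (Finset.notMem_empty _), map_zero]
    · exact congrArg Prod.fst hg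
  ψ_ρ I J h p hp hp' := ((K.change I J h).ρ_ψ ⟨p.1.1, p.2.1⟩
    (mem_deep_empty.1 hp'.1) (mem_deep_empty.1 hp.1)).symm

theorem morE_iff (hK : K.IsTame) (p q : Σ I : Idx K.F, K.U I × P.EI I.1) :
    K.MorE p q ↔ (K.tameSpacesE hK).Mor p q := by
  constructor
  · rintro (⟨I, g, x, e⟩ | ⟨I, J, h, y, e, g⟩)
    · exact TameSpaces.Mor.act (T := K.tameSpacesE hK) I g (x, e)
    · have h1 := TameSpaces.Mor.change (T := K.tameSpacesE hK) I J h
        ⟨(y.1, P.incl h.subset e), y.2, fun j hj => P.incl_apply_of_notMem _ _ j hj⟩ g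
      have h2 : (fun i : I.1 => P.incl h.subset e ⟨i.1, h.subset i.2⟩) = e :=
        funext fun i => P.incl_apply h.subset e ⟨i.1, h.subset i.2⟩ i.2
      have h3 : K.ρE I J h ⟨(y.1, P.incl h.subset e), y.2,
          fun j hj => P.incl_apply_of_notMem _ _ j hj⟩ = ((K.change I J h).ρ y, e) :=
        Prod.ext rfl h2
      exact Eq.mp (congrArg (fun q : K.U I × P.EI I.1 => (K.tameSpacesE hK).Mor
        ⟨I, (g⁻¹ • q.1, P.τI I.1 g⁻¹ q.2)⟩ ⟨J, (y.1, P.incl h.subset e)⟩) h3) h1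
  · rintro (⟨I, g, x⟩ | ⟨I, J, h, y, g⟩)
    · exact MorE.act (K := K) I g x.1 x.2
    · have h1 := MorE.change (K := K) I J h ⟨y.1.1, y.2.1⟩
        (fun i => y.1.2 ⟨i.1, h.subset i.2⟩) g
      have h2 : P.incl h.subset (fun i => y.1.2 ⟨i.1, h.subset i.2⟩) = y.1.2 := by
        funext j
        by_cases hj : j.1 ∈ I.1
        · exact P.incl_apply h.subset _ j hj
        · exact (P.incl_apply_of_notMem _ _ j hj).trans (y.2.2 j hj).symm
      rw [h2] at h1
      exact h1

theorem IsTame.isEmbedding_πEbar (hK : K.IsTame) (I : Idx K.F) : IsEmbedding (K.πEbar I) :=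
  TameSpaces.isEmbedding_of_orbits (T := K.tameSpacesE hK)
    (diagSetoid (P.τI I.1) (K.U I)) (fun p q => exists_congr fun g =>
      (Prod.ext_iff (x := (g • p.1, P.τI I.1 g p.2)) (y := q)).symm)
    (morE_iff hK) (K.πEbar I) (fun _ => rfl)

theorem IsTame.t2Space_realE [T2Space X] (hK : K.IsTame) : T2Space K.RealE := by
  have e : K.MorE = (K.tameSpacesE hK).Mor := by
    funext p q
    exact propext (morE_iff hK p q)
  have hl := fun I => (K.chart I).locallyCompactSpace
  have hs := fun I => (K.chart I).sigmaCompactSpace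
  have hp : ∀ I : Idx K.F, ProperSpace (P.EI I.1) := fun I => FiniteDimensional.proper ℝ _
  have h1 : ∀ I, T2Space ((K.tameSpacesE hK).W I) :=
    fun I => inferInstanceAs (T2Space (K.U I × P.EI I.1))
  have h2 : ∀ I, LocallyCompactSpace ((K.tameSpacesE hK).W I) :=
    fun I => inferInstanceAs (LocallyCompactSpace (K.U I × P.EI I.1))
  have h3 : ∀ I, SigmaCompactSpace ((K.tameSpacesE hK).W I) :=
    fun I => inferInstanceAs (SigmaCompactSpace (K.U I × P.EI I.1))
  have := TameSpaces.t2Space_realization (T := K.tameSpacesE hK)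
  change T2Space (Quot K.MorE)
  rw [e]
  exact this

end WeakSystem

/-! ### Lifted domains are open in the locus where the section takes values in `E_I` -/

/-- Let `h ∘ g = 0`, where `h` is submersive at `g a` and the kernel of its differential consists of
images under the differential of `g`.  Then `g` is locally onto the zero set of `h`. -/
theorem eventually_mem_image_of_eq_zero {V V' F : Type*} [NormedAddCommGroup V] [NormedSpace ℝ V]
    [FiniteDimensional ℝ V] [NormedAddCommGroup V'] [NormedSpace ℝ V'] [FiniteDimensional ℝ V']
    [NormedAddCommGroup F] [NormedSpace ℝ F] [FiniteDimensional ℝ F] {g : V → V'} {h : V' → F}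
    {g' : V →L[ℝ] V'} {h' : V' →L[ℝ] F} {a : V} (hg : HasStrictFDerivAt g g' a)
    (hh : HasStrictFDerivAt h h' (g a)) (hgh : ∀ᶠ x in 𝓝 a, h (g x) = 0)
    (hsurj : Function.Surjective h') (hker : ∀ ξ, h' ξ = 0 → ∃ η, g' η = ξ) {W : Set V}
    (hW : W ∈ 𝓝 a) : ∀ᶠ y in 𝓝 (g a), h y = 0 → y ∈ g '' W := by
  have := FiniteDimensional.complete ℝ V
  have := FiniteDimensional.complete ℝ V'
  have := FiniteDimensional.complete ℝ F
  obtain ⟨L, hL⟩ := h'.exists_rightInverse_of_surjective (LinearMap.range_eq_top.2 hsurj)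
  have hL' : ∀ f, h' (L f) = f := fun f => congrArg (fun T : F →L[ℝ] F => T f) hL
  -- transversally to the image of `g`, the space is filled by translates along `L`
  let G : V × F → V' := fun p => g p.1 + L p.2
  have hG : HasStrictFDerivAt G
      (g'.comp (ContinuousLinearMap.fst ℝ V F) + L.comp (ContinuousLinearMap.snd ℝ V F))
        (a, 0) := by
    have h1 : HasStrictFDerivAt (fun p : V × F => g p.1)
        (g'.comp (ContinuousLinearMap.fst ℝ V F)) (a, 0) :=
      HasStrictFDerivAt.comp (g := g) (f := Prod.fst) (a, (0 : F)) hg hasStrictFDerivAt_fst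
    exact h1.add (L.comp (ContinuousLinearMap.snd ℝ V F)).hasStrictFDerivAt
  have hGa : G (a, 0) = g a := by simp [G]
  have hmap := hG.map_nhds_eq_of_surj (by
    refine LinearMap.range_eq_top.2 fun ξ => ?_
    obtain ⟨η, hη⟩ := hker (ξ - L (h' ξ)) (by rw [map_sub, hL', sub_self])
    exact ⟨(η, h' ξ), by simp [hη]⟩)
  rw [hGa] at hmap
  have hc : 0 < 1 / (2 * (‖L‖ + 1)) := by positivity
  have hlit := hh.isLittleO.def hc
  have hcG : Filter.Tendsto (fun p : V × F => (G p, g p.1)) (𝓝 (a, 0)) (𝓝 (g a, g a)) := by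
    refine Filter.Tendsto.prodMk_nhds (hmap ▸ Filter.tendsto_map) ?_
    exact hg.continuousAt.tendsto.comp (continuous_fst.tendsto (a, (0 : F)))
  have hev : ∀ᶠ p in 𝓝 (a, (0 : F)), p.1 ∈ W ∧ h (g p.1) = 0 ∧
      ‖h (G p) - h (g p.1) - h' (G p - g p.1)‖ ≤ 1 / (2 * (‖L‖ + 1)) * ‖G p - g p.1‖ := by
    have h1 : Filter.Tendsto Prod.fst (𝓝 (a, (0 : F))) (𝓝 a) := continuous_fst.tendsto (a, (0 : F))
    exact (h1.eventually hW).and ((h1.eventually hgh).and (hcG.eventually hlit))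
  rw [← hmap, Filter.eventually_map]
  filter_upwards [hev] with p hp h0
  obtain ⟨h1, h2, h3⟩ := hp
  have h4 : G p - g p.1 = L p.2 := by simp [G]
  rw [h4, h0, h2, hL', sub_self, zero_sub, norm_neg] at h3
  have h5 : ‖L p.2‖ ≤ ‖L‖ * ‖p.2‖ := L.le_opNorm _
  have h6 : p.2 = 0 := by
    by_contra hne
    have hpos : 0 < ‖p.2‖ := norm_pos_iff.2 hne
    have h7 : ‖p.2‖ ≤ 1 / (2 * (‖L‖ + 1)) * (‖L‖ * ‖p.2‖) := h3.trans (by gcongr)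
    have h8 : 1 / (2 * (‖L‖ + 1)) * (‖L‖ * ‖p.2‖) ≤ ‖p.2‖ / 2 := by
      rw [div_mul_eq_mul_div, one_mul, div_le_div_iff₀ (by positivity) two_pos]
      nlinarith [norm_nonneg L]
    linarith
  exact ⟨p.1, h1, by simp [G, h6]⟩

section

variable {X : Type u} [TopologicalSpace X] {G : Type w} [Group G] {E : Type w}
  [NormedAddCommGroup E] [NormedSpace ℝ E] {τ : Representation ℝ G E} {G' : Type w} [Group G']
  {E' : Type w} [NormedAddCommGroup E'] [NormedSpace ℝ E'] {τ' : Representation ℝ G' E'}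
  {K : Chart.{u, v, w} X τ} {K' : Chart.{u, v, w} X τ'} {pr : G' →* G} {inc : E →ₗ[ℝ] E'}

/-- In the interior, the index condition makes the lifted domain of a coordinate change an open
subset of the preimage of `E` under the section. -/
theorem CoordChange.eventually_mem_lift [FiniteDimensional ℝ E] [FiniteDimensional ℝ E']
    (c : CoordChange K K' pr inc) (u : c.lift)
    (hu : K'.smooth.I.IsInteriorPoint u.1) (hx : K.smooth.I.IsInteriorPoint (c.ρ u)) :
    ∀ᶠ y in 𝓝 u.1, K'.s y ∈ LinearMap.range inc → y ∈ c.lift := by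
  obtain ⟨S, hemb, hloc, hidx⟩ := c.smooth_lift
  obtain ⟨hidx1, hidx2⟩ := hidx u
  have h0 : (∞ : WithTop ℕ∞) ≠ 0 := by simp
  have hval : ContMDiff S.I K'.smooth.I ∞ (Subtype.val : c.lift → K'.U) := hemb.contMDiff
  have hval' := (hval u).mdifferentiableAt h0
  have hρ := (hloc u).mdifferentiableAt h0
  have hs' := (K'.s_smooth u.1).mdifferentiableAt h0
  have hsρ : MDifferentiableAt S.I 𝓘(ℝ, E) (fun y => K.s (c.ρ y)) u :=
    MDifferentiableAt.comp u ((K.s_smooth (c.ρ u)).mdifferentiableAt h0) hρ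
  obtain ⟨Φ, huΦ, hΦ⟩ := hloc u
  let g : K.U → K'.U := fun x => (Φ.symm x).1
  have hgρ : ∀ y ∈ Φ.source, g (c.ρ y) = y.1 := fun y hy => by
    have h1 : Φ.symm (Φ y) = y := Φ.left_inv' hy
    simp only [g]
    rw [hΦ hy, h1]
  have hxt : c.ρ u ∈ Φ.target := by rw [hΦ huΦ]; exact Φ.map_source' huΦ
  have hgx : g (c.ρ u) = u.1 := hgρ u huΦ
  have hgsm : ContMDiffAt K.smooth.I K'.smooth.I ∞ g (c.ρ u) :=
    (hval _).comp (c.ρ u) (Φ.symm.contMDiffOn.contMDiffAt (Φ.open_target.mem_nhds hxt))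
  have hgs : ∀ x ∈ Φ.target, K'.s (g x) = inc (K.s x) := by
    intro x hx
    have h1 := c.ρ_s (Φ.symm x)
    have h2 : c.ρ (Φ.symm x) = x := by
      exact (hΦ (Φ.map_target' hx)).trans (Φ.right_inv' hx)
    rwa [h2] at h1
  -- differentials on the lifted domain
  let A : S.V →L[ℝ] E := mfderiv S.I 𝓘(ℝ, E) (fun y => K.s (c.ρ y)) u
  let B : K'.smooth.V →L[ℝ] E' := mfderiv K'.smooth.I 𝓘(ℝ, E') K'.s u.1
  let D : S.V →L[ℝ] K'.smooth.V := mfderiv S.I K'.smooth.I (Subtype.val : c.lift → K'.U) u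
  let R' : S.V →L[ℝ] K.smooth.V := mfderiv S.I K.smooth.I c.ρ u
  let g' : K.smooth.V →L[ℝ] K'.smooth.V := mfderiv K.smooth.I K'.smooth.I g (c.ρ u)
  have hidx1' : ∀ ξ : K'.smooth.V, B ξ = 0 → ∃ η : S.V, D η = ξ := fun ξ hξ =>
    ((hidx1 ξ).1 hξ).imp fun _ h => h.2
  have hidx2' : ∀ C : Submodule ℝ E, IsCompl (LinearMap.range A.toLinearMap) C →
      IsCompl (LinearMap.range B.toLinearMap) (C.map inc) := hidx2
  have hd1 : D = g'.comp R' := by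
    refine Eq.trans ?_ (mfderiv_comp u (hgsm.mdifferentiableAt h0) hρ)
    refine Filter.EventuallyEq.mfderiv_eq ?_
    filter_upwards [Φ.open_source.mem_nhds huΦ] with y hy
    exact (hgρ y hy).symm
  have hd2 : ∀ η, B (D η) = inc (A η) := by
    intro η
    let incL : E →L[ℝ] E' := LinearMap.toContinuousLinearMap inc
    have h1 := mfderiv_comp u hs' hval'
    have h2 := mfderiv_comp (I' := 𝓘(ℝ, E)) u
      (incL.differentiableAt.mdifferentiableAt (x := K.s (c.ρ u))) hsρ
    have h3 : K'.s ∘ (Subtype.val : c.lift → K'.U) = incL ∘ fun y => K.s (c.ρ y) :=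
      funext fun y => c.ρ_s y
    rw [h3, h2, mfderiv_eq_fderiv, incL.fderiv] at h1
    exact (congrArg (fun T => T η) h1).symm
  -- pass to coordinates around the two interior points
  let φ := extChartAt K.smooth.I (c.ρ u)
  let φ' := extChartAt K'.smooth.I u.1
  have hr : range K.smooth.I ∈ 𝓝 (φ (c.ρ u)) := range_mem_nhds_isInteriorPoint hx
  have hr' : range K'.smooth.I ∈ 𝓝 (φ' u.1) := range_mem_nhds_isInteriorPoint hu
  let gc : K.smooth.V → K'.smooth.V := writtenInExtChartAt K.smooth.I K'.smooth.I (c.ρ u) g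
  let sc : K'.smooth.V → E' := writtenInExtChartAt K'.smooth.I 𝓘(ℝ, E') u.1 K'.s
  have hgc : ContDiffAt ℝ ∞ gc (φ (c.ρ u)) :=
    (contMDiffAt_iff.1 hgsm).2.contDiffAt hr
  have hsc : ContDiffAt ℝ ∞ sc (φ' u.1) :=
    (contMDiffAt_iff.1 (K'.s_smooth u.1)).2.contDiffAt hr'
  have hgd : g' = fderiv ℝ gc (φ (c.ρ u)) := by
    exact (hgsm.mdifferentiableAt h0).mfderiv.trans (fderivWithin_of_mem_nhds hr)
  have hsd : B = fderiv ℝ sc (φ' u.1) := by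
    exact hs'.mfderiv.trans (fderivWithin_of_mem_nhds hr')
  have hgca : gc (φ (c.ρ u)) = φ' u.1 := by
    simp only [gc, writtenInExtChartAt, Function.comp_apply, φ, φ']
    rw [extChartAt_to_inv, hgx]
  have hscs : ∀ z ∈ φ'.source, sc (φ' z) = K'.s z := by
    intro z hz
    change K'.s (φ'.symm (φ' z)) = K'.s z
    rw [φ'.left_inv hz]
  let R := LinearMap.range inc
  have hRc : IsClosed (R : Set E') := R.closed_of_finiteDimensional
  let q : E' →L[ℝ] E' ⧸ R := LinearMap.toContinuousLinearMap R.mkQ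
  have hq : ∀ e, q e = 0 ↔ e ∈ R := fun e => Submodule.Quotient.mk_eq_zero R
  -- a neighbourhood in which the parametrization by `g` makes sense
  let W : Set K.smooth.V := φ.target ∩ φ.symm ⁻¹' (Φ.target ∩ g ⁻¹' φ'.source)
  have hW : W ∈ 𝓝 (φ (c.ρ u)) := by
    have h1 : φ.target ∈ 𝓝 (φ (c.ρ u)) := by
      have := extChartAt_target_mem_nhdsWithin (I := K.smooth.I) (c.ρ u)
      rwa [nhdsWithin_eq_nhds.2 hr] at this
    refine Filter.inter_mem h1 ?_
    refine (continuousAt_extChartAt_symm (I := K.smooth.I) (c.ρ u)).preimage_mem_nhds ?_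
    rw [extChartAt_to_inv]
    refine Filter.inter_mem (Φ.open_target.mem_nhds hxt) (hgsm.continuousAt.preimage_mem_nhds ?_)
    rw [hgx]
    exact extChartAt_source_mem_nhds u.1
  have hgcW : ∀ v ∈ W, gc v = φ' (g (φ.symm v)) := by
    intro v hv
    simp only [gc, writtenInExtChartAt, Function.comp_apply, hgx, φ', φ]
  have hgc' : HasStrictFDerivAt gc (fderiv ℝ gc (φ (c.ρ u))) (φ (c.ρ u)) :=
    hgc.hasStrictFDerivAt h0
  have hsc' : HasStrictFDerivAt (fun y => q (sc y)) (q.comp (fderiv ℝ sc (φ' u.1)))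
      (gc (φ (c.ρ u))) := by
    rw [hgca]
    exact q.hasStrictFDerivAt.comp _ (hsc.hasStrictFDerivAt h0)
  obtain ⟨C, hC⟩ := Submodule.exists_isCompl (LinearMap.range A.toLinearMap)
  have hC' := hidx2' C hC
  have key := eventually_mem_image_of_eq_zero hgc' hsc' (by
      filter_upwards [hW] with v hv
      rw [hgcW v hv, hscs _ hv.2.2, hq, hgs _ hv.2.1]
      exact ⟨_, rfl⟩) (by
      intro f
      obtain ⟨e, rfl⟩ := R.mkQ_surjective f
      obtain ⟨_, ⟨ξ, rfl⟩, _, ⟨f, -, rfl⟩, hef⟩ :=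
        Submodule.mem_sup.1 (hC'.sup_eq_top.symm ▸ Submodule.mem_top : e ∈ _)
      refine ⟨ξ, ?_⟩
      rw [← hsd, ← hef]
      change q _ = q _
      rw [map_add, (hq (inc f)).2 ⟨f, rfl⟩, add_zero]) (by
      intro ξ hξ
      rw [ContinuousLinearMap.comp_apply, hq, ← hsd] at hξ
      obtain ⟨e, he⟩ := hξ
      obtain ⟨_, ⟨η, rfl⟩, f, hf, hef⟩ :=
        Submodule.mem_sup.1 (hC.sup_eq_top.symm ▸ Submodule.mem_top : e ∈ _)
      have h1 : B (ξ - D η) = inc f := by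
        have h2 : inc e = inc (A η) + inc f := by rw [← map_add]; exact congrArg inc hef.symm
        rw [map_sub, hd2, ← he, h2, add_sub_cancel_left]
      have h2 : inc f = 0 := (Submodule.disjoint_def.1 hC'.disjoint) _ ⟨_, h1⟩ ⟨f, hf, rfl⟩
      obtain ⟨η', hη'⟩ := hidx1' _ (h1.trans h2)
      refine ⟨R' (η + η'), ?_⟩
      rw [← hgd]
      change g'.comp R' (η + η') = ξ
      rw [← hd1, map_add, hη', add_sub_cancel]) hW
  rw [hgca] at key
  have hcont : Filter.Tendsto φ' (𝓝 u.1) (𝓝 (φ' u.1)) := continuousAt_extChartAt u.1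
  filter_upwards [hcont.eventually key, extChartAt_source_mem_nhds (I := K'.smooth.I) u.1]
    with z hz hzs hsz
  obtain ⟨v, hv, hvz⟩ := hz (by rw [hscs z hzs, hq]; exact hsz)
  rw [hgcW v hv] at hvz
  rw [← φ'.injOn hv.2.2 hzs hvz]
  exact (Φ.symm (φ.symm v)).2

end

namespace WeakSystem

variable {N : ℕ} {P : BasicData.{w} N} {X : Type u} [TopologicalSpace X] {d : ℤ}

/-- The lifted domains of coordinate changes are relatively open in the loci where the sections
take values in the smaller obstruction spaces. -/
def HasOpenLifts (K : WeakSystem.{u, v, w} P X d) : Prop :=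
  ∀ (I J : Idx K.F) (h : I.1 ⊂ J.1), ∀ u ∈ (K.change I J h).lift,
    ∀ᶠ y in 𝓝 u, y ∈ K.deep J I.1 → y ∈ (K.change I J h).lift

/-- Lifted domains are relatively open in the locus where the section takes values in `E_I`, at
points that, together with their images under `ρ`, are interior. -/
theorem eventually_mem_lift (K : WeakSystem.{u, v, w} P X d) {I J : Idx K.F} (h : I.1 ⊂ J.1)
    (u : (K.change I J h).lift) (hu : (K.chart J).smooth.I.IsInteriorPoint u.1)
    (hx : (K.chart I).smooth.I.IsInteriorPoint ((K.change I J h).ρ u)) :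
    ∀ᶠ y in 𝓝 u.1, y ∈ K.deep J I.1 → y ∈ (K.change I J h).lift := by
  filter_upwards [(K.change I J h).eventually_mem_lift u hu hx] with y hy hyd
  exact hy ((mem_deep_iff h.subset).1 hyd)

end WeakSystem

variable {N : ℕ} {P : BasicData.{w} N}

/-- The domains of an atlas have no boundary, so all points are interior. -/
theorem WeakAtlas.hasOpenLifts {X : Type u} [TopologicalSpace X] {d : ℤ}
    (K : WeakAtlas.{u, v, w} P X d) : K.HasOpenLifts := by
  have hint : ∀ (I : Idx K.F) (x : K.U I), (K.chart I).smooth.I.IsInteriorPoint x := fun I x => by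
    rcases (K.chart I).smooth.I.isInteriorPoint_or_isBoundaryPoint x with h | h
    · exact h
    · have h1 : x ∈ (K.chart I).smooth.I.boundary (K.U I) := h
      rw [K.boundaryless I] at h1
      exact h1.elim
  exact fun I J h u hu => K.eventually_mem_lift h ⟨u, hu⟩ (hint _ _) (hint _ _)

namespace WeakCobordism

variable {Y : Type u} [TopologicalSpace Y] {B : Bool → Type u} [∀ α, TopologicalSpace (B α)]
  {C : CollaredCobordism Y B} {d : ℤ} (K : WeakCobordism.{u, v, w} P C d)

/-- A property of points near a collar point can be tested at collar points. -/
theorem eventually_collar {α : Bool} {I : Idx (K.bd α).F} {t : Icc (0 : ℝ) 1} (ht : t ∈ A α K.width)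
    {x : (K.bd α).U I} {p : K.U (K.idx I) → Prop}
    (h : ∀ᶠ q : Icc (0 : ℝ) 1 × (K.bd α).U I in 𝓝 (t, x), q.1 ∈ A α K.width → p (K.collar α I q)) :
    ∀ᶠ y in 𝓝 (K.collar α I (t, x)), p y := by
  have h1 := (K.collar_embedding α I).map_nhds_eq ⟨(t, x), ht, mem_univ _⟩
  have h2 : (A α K.width ×ˢ (univ : Set ((K.bd α).U I))).domRestrict (K.collar α I)
    ⟨(t, x), ht, mem_univ _⟩ = K.collar α I (t, x) := rfl
  rw [h2] at h1
  rw [← h1, Filter.eventually_map]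
  have h3 := (continuous_subtype_val.tendsto
    (⟨(t, x), ht, mem_univ _⟩ : (A α K.width ×ˢ (univ : Set ((K.bd α).U I)) : Set _))).eventually h
  filter_upwards [h3] with q hq
  exact hq q.2.1

/-- Only charts whose index occurs on the boundary have points that `ρ` maps into a collar. -/
theorem idx_of_mem_lift {α : Bool} {I : Idx (K.bd α).F} {J : Idx K.F} {h : I.1 ⊂ J.1}
    {y : (K.change (K.idx I) J h).lift} {t : Icc (0 : ℝ) 1} (ht : t ∈ A α K.width)
    {x : (K.bd α).U I} (hy : (K.change (K.idx I) J h).ρ y = K.collar α I (t, x)) :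
    IsIdx (K.bd α).F J.1 := by
  by_contra hJ
  exact K.collar_avoid α I J h hJ t ht x (hy ▸ WeakSystem.ρ_mem_dom h y)

/-- Points of a lifted domain that `ρ` maps to a point of a collar lie in the collar, at the same
time. -/
theorem exists_collar_of_ρ_eq {α : Bool} {I J : Idx (K.bd α).F} {h : I.1 ⊂ J.1}
    {y : (K.change (K.idx I) (K.idx J) h).lift} {t : Icc (0 : ℝ) 1} (ht : t ∈ A α K.width)
    {x : (K.bd α).U I} (hy : (K.change (K.idx I) (K.idx J) h).ρ y = K.collar α I (t, x)) :
    ∃ z : ((K.bd α).change I J h).lift, y.1 = K.collar α J (t, z.1) ∧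
      ((K.bd α).change I J h).ρ z = x := by
  have hx : x ∈ ((K.bd α).change I J h).dom := by
    rw [← K.collar_dom α I J h t ht, ← hy]
    exact WeakSystem.ρ_mem_dom (I := K.idx I) (J := K.idx J) h y
  rw [← ((K.bd α).change I J h).ρ_range] at hx
  obtain ⟨z, hz⟩ := hx
  have hz' := (K.collar_lift α I J h t ht z.1).2 z.2
  have h1 : (K.change (K.idx I) (K.idx J) h).ρ ⟨_, hz'⟩ =
      (K.change (K.idx I) (K.idx J) h).ρ y := by
    rw [K.collar_ρ α I J h t ht z.1 z.2, hy]
    exact congrArg (fun x => K.collar α I (t, x)) hz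
  obtain ⟨g, hg, hgy⟩ := ((K.change (K.idx I) (K.idx J) h).ρ_fiber _ _).1 h1
  have h2 := K.collar_smul α J t ht g z.1
  refine ⟨⟨g • z.1, ((K.bd α).change I J h).lift_smul g _ z.2⟩, (h2.trans hgy).symm, ?_⟩
  rw [((K.bd α).change I J h).ρ_equiv g z, MonoidHom.mem_ker.1 hg, one_smul, hz]

/-- Interior points are covered by the inverse function theorem, and boundary points lie in collars,
where the claim is the one for the boundary atlas. -/
theorem hasOpenLifts : K.HasOpenLifts := by
  intro I J h u hu
  -- the claim at points of collars follows from the claim for the boundary atlases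
  have key : ∀ (α : Bool) (I' J' : Idx (K.bd α).F) (e : K.idx I' = I) (e' : K.idx J' = J)
      (x : (K.bd α).U J'), u = e' ▸ K.collar α J' (endpt α, x) →
      ∀ᶠ y in 𝓝 u, y ∈ K.deep J I.1 → y ∈ (K.change I J h).lift := by
    rintro α I' J' rfl rfl x rfl
    have h0 := endpt_mem_A α K.width_pos
    have hx := (K.collar_lift α I' J' h _ h0 x).1 hu
    have h1 := (K.bd α).hasOpenLifts I' J' h x hx
    refine K.eventually_collar h0 ?_
    filter_upwards [(continuous_snd.tendsto (endpt α, x)).eventually h1] with q hq hqt hqd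
    refine (K.collar_lift α I' J' h q.1 hqt q.2).2 (hq fun j hj => ?_)
    rw [← K.collar_s α J' q.1 hqt]
    exact hqd j hj
  by_cases hub : (K.chart J).smooth.I.IsInteriorPoint u
  · by_cases hxb : (K.chart I).smooth.I.IsInteriorPoint ((K.change I J h).ρ ⟨u, hu⟩)
    · exact K.eventually_mem_lift h ⟨u, hu⟩ hub hxb
    · obtain ⟨α, hI, x, hx⟩ := (K.boundary I _).1
        (((K.chart I).smooth.I.isInteriorPoint_or_isBoundaryPoint _).resolve_left hxb)
      have h0 := endpt_mem_A α K.width_pos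
      have hJ := K.idx_of_mem_lift (I := ⟨I.1, hI⟩) (J := J) (h := h) (y := ⟨u, hu⟩) h0 hx
      obtain ⟨z, hz, -⟩ := K.exists_collar_of_ρ_eq (I := ⟨I.1, hI⟩) (J := ⟨J.1, hJ⟩) (h := h)
        (y := ⟨u, hu⟩) h0 hx
      exact key α ⟨I.1, hI⟩ ⟨J.1, hJ⟩ rfl rfl z.1 hz
  · obtain ⟨α, hJ, x, hx⟩ := (K.boundary J _).1
      (((K.chart J).smooth.I.isInteriorPoint_or_isBoundaryPoint _).resolve_left hub)
    exact key α ⟨I.1, hJ.mono h.subset I.2.1⟩ ⟨J.1, hJ⟩ rfl rfl x hx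

end WeakCobordism

/-! ### Extension of functions from `X` to the chart domains -/

/-- Functions on finitely many closed sets that agree on overlaps have a common extension. -/
theorem exists_continuous_extension {Y ι : Type*} [TopologicalSpace Y] [NormalSpace Y] [Finite ι]
    (C : ι → Set Y) (hC : ∀ i, IsClosed (C i)) (f : ι → Y → ℝ)
    (hf : ∀ i, ContinuousOn (f i) (C i)) (hfg : ∀ i j, ∀ y ∈ C i, y ∈ C j → f i y = f j y) :
    ∃ g : C(Y, ℝ), ∀ i, ∀ y ∈ C i, g y = f i y := by
  classical
  let f₀ : Y → ℝ := fun y => if h : ∃ i, y ∈ C i then f h.choose y else 0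
  have h0 : ∀ i, ∀ y ∈ C i, f₀ y = f i y := fun i y hy => by
    have h : ∃ i, y ∈ C i := ⟨i, hy⟩
    simp only [f₀, dif_pos h]
    exact hfg _ _ _ h.choose_spec hy
  have hfin : LocallyFinite C := locallyFinite_of_finite C
  have hcont : ContinuousOn f₀ (⋃ i, C i) :=
    hfin.continuousOn_iUnion hC fun i => (hf i).congr (h0 i)
  obtain ⟨g, hg⟩ := ContinuousMap.exists_restrict_eq (hfin.isClosed_iUnion hC)
    ⟨_, continuousOn_iff_continuous_domRestrict.1 hcont⟩
  refine ⟨g, fun i y hy => ?_⟩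
  rw [← h0 i y hy]
  exact congrArg (fun k : C(↥(⋃ i, C i), ℝ) => k ⟨y, mem_iUnion.2 ⟨i, hy⟩⟩) hg

namespace WeakSystem

variable {N : ℕ} {P : BasicData.{w} N} {X : Type u} [TopologicalSpace X] {d : ℤ}
  {K : WeakSystem.{u, v, w} P X d}

open Classical in
/-- The pullback of a function on `U_I` under `ρ_{IJ}`, extended by zero. -/
def pull {I J : Idx K.F} (h : I.1 ⊂ J.1) (f : K.U I → ℝ) (y : K.U J) : ℝ :=
  if hy : y ∈ (K.change I J h).lift then f ((K.change I J h).ρ ⟨y, hy⟩) else 0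

theorem pull_apply {I J : Idx K.F} {h : I.1 ⊂ J.1} {f : K.U I → ℝ}
    (y : (K.change I J h).lift) : pull h f y = f ((K.change I J h).ρ y) := dif_pos y.2

theorem continuousOn_pull {I J : Idx K.F} {h : I.1 ⊂ J.1} {f : K.U I → ℝ} (hf : Continuous f) :
    ContinuousOn (pull h f) (K.change I J h).lift := by
  rw [continuousOn_iff_continuous_domRestrict]
  exact (hf.comp (continuous_ρ h)).congr fun y => (pull_apply y).symm

theorem pull_smul {I J : Idx K.F} {h : I.1 ⊂ J.1} {f : K.U I → ℝ}
    (hf : ∀ (g : P.ΓI I.1) x, f (g • x) = f x) (g : P.ΓI J.1) {y : K.U J}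
    (hy : y ∈ (K.change I J h).lift) : pull h f (g • y) = pull h f y := by
  rw [pull_apply ⟨y, hy⟩, pull_apply ⟨g • y, (K.change I J h).lift_smul g y hy⟩,
    (K.change I J h).ρ_equiv g ⟨y, hy⟩, hf]

theorem pull_pull {H I J : Idx K.F} {h : H.1 ⊂ I.1} {h' : I.1 ⊂ J.1} {f : K.U H → ℝ}
    (y : (K.change I J h').lift) (hy : (K.change I J h').ρ y ∈ (K.change H I h).lift)
    (hy' : y.1 ∈ (K.change H J (h.trans h')).lift) :
    pull h f ((K.change I J h').ρ y) = pull (h.trans h') f y := by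
  rw [pull_apply ⟨_, hy⟩, pull_apply ⟨y.1, hy'⟩, K.cocycle H I J h h' y.1 hy' y.2 hy]

/-- `θ_J` is an invariant extension of the function `ϑ ∘ ψ_J` on the zero set, and is compatible
near this set with the functions `θ_H` for `H ⊂ J`. -/
structure IsExtension (ϑ : X → ℝ) (θ : ∀ I : Idx K.F, K.U I → ℝ) (J : Idx K.F) : Prop where
  continuous : Continuous (θ J)
  smul : ∀ (g : P.ΓI J.1) y, θ J (g • y) = θ J y
  zero : ∀ z : {u : K.U J // (K.chart J).s u = 0}, θ J z.1 = ϑ ((K.chart J).ψ z)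
  germ : ∀ z : {u : K.U J // (K.chart J).s u = 0}, ∀ᶠ y in 𝓝 z.1, ∀ (H : Idx K.F) (h : H.1 ⊂ J.1),
    y ∈ K.deep J H.1 → y ∈ (K.change H J h).lift ∧ θ J y = pull h (θ H) y

theorem IsExtension.pull_zero {ϑ : X → ℝ} {θ : ∀ I : Idx K.F, K.U I → ℝ} {H J : Idx K.F}
    (hθ : IsExtension ϑ θ H) (h : H.1 ⊂ J.1) (z : {u : K.U J // (K.chart J).s u = 0}) :
    pull h (θ H) z.1 = ϑ ((K.chart J).ψ z) := by
  have hz := mem_lift_of_s_eq_zero h z.2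
  have hz' : (K.chart H).s ((K.change H J h).ρ ⟨z.1, hz⟩) = 0 := by
    rw [← mem_deep_empty, ρ_mem_deep h, mem_deep_empty]
    exact z.2
  rw [pull_apply ⟨z.1, hz⟩, (K.change H J h).ρ_ψ ⟨z.1, hz⟩ z.2 hz']
  exact hθ.zero ⟨_, hz'⟩

/-- Near the zero set, the pullbacks of the functions `θ_H` are defined on the loci where the
section lies in `E_H`, and agree with each other. -/
theorem eventually_pull_eq (hK : K.HasOpenLifts) {ϑ : X → ℝ} {θ : ∀ I : Idx K.F, K.U I → ℝ}
    {J : Idx K.F} (hθ : ∀ H : Idx K.F, H.1 ⊂ J.1 → IsExtension ϑ θ H)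
    (z : {u : K.U J // (K.chart J).s u = 0}) :
    ∀ᶠ y in 𝓝 z.1, ∀ (H : Idx K.F) (h : H.1 ⊂ J.1), y ∈ K.deep J H.1 →
      y ∈ (K.change H J h).lift ∧ ∀ (L : Idx K.F) (h' : L.1 ⊂ H.1), y ∈ K.deep J L.1 →
        pull h (θ H) y = pull (h'.trans h) (θ L) y := by
  rw [Filter.eventually_all]
  intro H
  by_cases h : H.1 ⊂ J.1
  swap
  · exact Filter.Eventually.of_forall fun y h' => absurd h' h
  have hz := mem_lift_of_s_eq_zero h z.2
  have hz' : (K.chart H).s ((K.change H J h).ρ ⟨z.1, hz⟩) = 0 := by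
    rw [← mem_deep_empty, ρ_mem_deep h, mem_deep_empty]
    exact z.2
  have h1 := (continuous_ρ h).continuousAt.eventually ((hθ H h).germ ⟨_, hz'⟩)
  rw [nhds_subtype_eq_comap, Filter.eventually_comap] at h1
  have h2 : ∀ᶠ y in 𝓝 z.1, ∀ (L : Idx K.F) (hL : L.1 ⊂ J.1), y ∈ K.deep J L.1 →
      y ∈ (K.change L J hL).lift := by
    rw [Filter.eventually_all]
    intro L
    by_cases hL : L.1 ⊂ J.1
    · filter_upwards [hK L J hL z.1 (mem_lift_of_s_eq_zero hL z.2)] with y hy _ using hy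
    · exact Filter.Eventually.of_forall fun y h' => absurd h' hL
  filter_upwards [h1, h2] with y hy1 hy2 h hyd
  have hyl := hy2 H h hyd
  refine ⟨hyl, fun L h' hyL => ?_⟩
  obtain ⟨h3, h4⟩ := hy1 ⟨y, hyl⟩ rfl L h' ((ρ_mem_deep h _).2 hyL)
  have h5 : y ∈ (K.change L J (h'.trans h)).lift := hy2 L (h'.trans h) hyL
  rw [pull_apply ⟨y, hyl⟩, h4]
  exact pull_pull ⟨y, hyl⟩ h3 h5

/-- The extension of the functions `θ_H`, `H ⊂ J`, to `U_J`. -/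
theorem exists_isExtension_step [T2Space X] (hK : K.HasOpenLifts) {ϑ : X → ℝ} (hϑ : Continuous ϑ)
    {θ : ∀ I : Idx K.F, K.U I → ℝ} {J : Idx K.F}
    (hθ : ∀ H : Idx K.F, H.1 ⊂ J.1 → IsExtension ϑ θ H) :
    ∃ f : K.U J → ℝ, IsExtension ϑ (Function.update θ J f) J := by
  classical
  have := (K.chart J).locallyCompactSpace
  let Z : Set (K.U J) := K.deep J ∅
  have hZ : IsClosed Z := isClosed_deep J ∅
  let Q : Set (K.U J) := {y | ∀ (H : Idx K.F) (h : H.1 ⊂ J.1), y ∈ K.deep J H.1 →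
    y ∈ (K.change H J h).lift ∧ ∀ (L : Idx K.F) (h' : L.1 ⊂ H.1), y ∈ K.deep J L.1 →
      pull h (θ H) y = pull (h'.trans h) (θ L) y}
  have hQ : Z ⊆ interior Q := fun z hz => mem_interior_iff_mem_nhds.2
    (eventually_pull_eq hK hθ ⟨z, mem_deep_empty.1 hz⟩)
  obtain ⟨O, hO, hZO, hOQ⟩ := normal_exists_closure_subset hZ isOpen_interior hQ
  replace hOQ : ∀ y ∈ closure O, y ∈ Q := fun y hy => interior_subset (hOQ hy)
  -- the functions to be extended: the pullbacks, and `ϑ ∘ ψ` on the zero set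
  let C : Option {H : Idx K.F // H.1 ⊂ J.1} → Set (K.U J) := fun o =>
    o.elim Z fun H => closure O ∩ K.deep J H.1.1
  let F : Option {H : Idx K.F // H.1 ⊂ J.1} → K.U J → ℝ := fun o =>
    o.elim (fun y => if hy : (K.chart J).s y = 0 then ϑ ((K.chart J).ψ ⟨y, hy⟩) else 0)
      fun H => pull H.2 (θ H.1)
  have hF0 : ∀ z : {u : K.U J // (K.chart J).s u = 0}, F none z.1 = ϑ ((K.chart J).ψ z) :=
    fun z => dif_pos z.2
  have hFZ : ∀ o, ∀ y ∈ Z, F o y = F none y := by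
    rintro (_ | H) y hy
    · rfl
    · have hy' := mem_deep_empty.1 hy
      exact ((hθ H.1 H.2).pull_zero H.2 ⟨y, hy'⟩).trans (hF0 ⟨y, hy'⟩).symm
  obtain ⟨g, hg⟩ := exists_continuous_extension C (by
      rintro (_ | H)
      exacts [hZ, isClosed_closure.inter (isClosed_deep J _)]) F (by
      rintro (_ | H)
      · rw [continuousOn_iff_continuous_domRestrict]
        have h1 : Continuous fun z : Z => ϑ ((K.chart J).ψ ⟨z.1, mem_deep_empty.1 z.2⟩) :=
          hϑ.comp ((K.chart J).continuous_ψ.comp (by fun_prop))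
        exact h1.congr fun z => (hF0 ⟨z.1, mem_deep_empty.1 z.2⟩).symm
      · exact (continuousOn_pull (hθ H.1 H.2).continuous).mono fun y hy => (hOQ y hy.1 _ H.2
          hy.2).1)
    (by
      rintro (_ | H) (_ | H') y hy hy'
      · rfl
      · exact (hFZ _ y hy).symm
      · exact hFZ _ y hy'
      · rcases (H.1.1 ∩ H'.1.1).eq_empty_or_nonempty with h0 | hne
        · have hyZ : y ∈ Z := by
            have h2 := K.deep_inter.2 ⟨hy.2, hy'.2⟩
            rwa [h0] at h2
          exact (hFZ _ y hyZ).trans (hFZ _ y hyZ).symm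
        · have hyL := K.deep_inter.2 ⟨hy.2, hy'.2⟩
          have key : ∀ H : {H : Idx K.F // H.1 ⊂ J.1}, y ∈ K.deep J H.1.1 → ∀ (L : Idx K.F)
              (hL : L.1 ⊆ H.1.1), y ∈ K.deep J L.1 →
              pull H.2 (θ H.1) y = pull (hL.trans_ssubset H.2) (θ L) y := by
            intro H hyH L hL hyL
            by_cases e : H.1 = L
            · obtain ⟨H, h⟩ := H
              subst e
              rfl
            · exact (hOQ y hy.1 _ H.2 hyH).2 L
                (hL.ssubset_of_ne fun h => e (Subtype.ext h.symm)) hyL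
          let L : Idx K.F := ⟨H.1.1 ∩ H'.1.1, H.1.2.mono Finset.inter_subset_left hne⟩
          exact (key H hy.2 L Finset.inter_subset_left hyL).trans
            (key H' hy'.2 L Finset.inter_subset_right hyL).symm)
  -- averaging makes the extension invariant
  have := Fintype.ofFinite (P.ΓI J.1)
  have hcard : (Fintype.card (P.ΓI J.1) : ℝ) ≠ 0 := Nat.cast_ne_zero.2 Fintype.card_ne_zero
  let f : K.U J → ℝ := fun y => (∑ γ : P.ΓI J.1, g (γ • y)) / Fintype.card (P.ΓI J.1)
  have hf : ∀ y c, (∀ γ : P.ΓI J.1, g (γ • y) = c) → f y = c := fun y c h => by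
    simp only [f]
    rw [Finset.sum_congr rfl fun γ _ => h γ, Finset.sum_const, Finset.card_univ, nsmul_eq_mul,
      mul_div_cancel_left₀ _ hcard]
  have hsame : Function.update θ J f J = f := Function.update_self _ _ _
  have hdiff : ∀ H : Idx K.F, H.1 ⊂ J.1 → Function.update θ J f H = θ H := fun H h =>
    Function.update_of_ne (fun e => h.ne (congrArg Subtype.val e)) _ _
  refine ⟨f, ?_, ?_, ?_, ?_⟩
  · rw [hsame]
    exact (continuous_finsetSum _ fun γ _ =>
      g.continuous.comp ((K.chart J).continuous_smul γ)).div_const _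
  · intro γ y
    rw [hsame]
    simp only [f, ← mul_smul]
    congr 1
    exact Fintype.sum_equiv (Equiv.mulRight γ) _ _ fun γ' => rfl
  · intro z
    rw [hsame]
    refine hf _ _ fun γ => ?_
    have hz := ((K.chart J).s_smul_eq_zero (g := γ)).2 z.2
    rw [hg none _ (mem_deep_empty.2 hz), hF0 ⟨_, hz⟩]
    congr 1
    exact ((K.chart J).ψ_eq_iff _ _).2 ⟨γ⁻¹, inv_smul_smul _ _⟩
  · intro z
    have h1 : ∀ᶠ y in 𝓝 z.1, ∀ γ : P.ΓI J.1, γ • y ∈ O := by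
      rw [Filter.eventually_all]
      intro γ
      refine ((K.chart J).continuous_smul γ).continuousAt.eventually (hO.mem_nhds (hZO ?_))
      exact mem_deep_empty.2 (((K.chart J).s_smul_eq_zero (g := γ)).2 z.2)
    filter_upwards [h1] with y hy H h hyH
    have hyQ := hOQ y (by simpa using subset_closure (hy 1)) H h hyH
    refine ⟨hyQ.1, ?_⟩
    rw [hsame, hdiff H h]
    refine hf _ _ fun γ => ?_
    rw [hg (some ⟨H, h⟩) _ ⟨subset_closure (hy γ), mem_deep_smul.2 hyH⟩]
    exact pull_smul (hθ H h).smul γ hyQ.1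

/-- Continuous functions on `X` extend compatibly to all chart domains. -/
theorem exists_isExtension [T2Space X] (hK : K.HasOpenLifts) {ϑ : X → ℝ} (hϑ : Continuous ϑ) :
    ∃ θ : ∀ I : Idx K.F, K.U I → ℝ, ∀ J, IsExtension ϑ θ J := by
  classical
  have key : ∀ n : ℕ, ∃ θ : ∀ I : Idx K.F, K.U I → ℝ, ∀ J : Idx K.F, J.1.card < n →
      IsExtension ϑ θ J := by
    intro n
    induction n with
    | zero => exact ⟨fun _ _ => 0, fun J hJ => absurd hJ (Nat.not_lt_zero _)⟩
    | succ n ih =>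
      obtain ⟨θ, hθ⟩ := ih
      have hlt : ∀ {H J : Idx K.F}, H.1 ⊂ J.1 → J.1.card < n + 1 → H.1.card < n := fun h hJ =>
        lt_of_lt_of_le (Finset.card_lt_card h) (Nat.lt_succ_iff.1 hJ)
      have hstep : ∀ J : Idx K.F, ∃ f : K.U J → ℝ, J.1.card < n + 1 →
          IsExtension ϑ (Function.update θ J f) J := fun J => by
        by_cases hJ : J.1.card < n + 1
        · obtain ⟨f, hf⟩ := exists_isExtension_step hK hϑ fun H h => hθ H (hlt h hJ)
          exact ⟨f, fun _ => hf⟩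
        · exact ⟨0, fun h => absurd h hJ⟩
      choose f hf using hstep
      let θ' : ∀ I : Idx K.F, K.U I → ℝ := fun I => if I.1.card < n then θ I else f I
      -- being an extension at `J` depends on the functions with index contained in `J` only
      have hcongr : ∀ (J : Idx K.F) (η : ∀ I : Idx K.F, K.U I → ℝ), IsExtension ϑ η J →
          θ' J = η J → (∀ H : Idx K.F, H.1 ⊂ J.1 → θ' H = η H) → IsExtension ϑ θ' J := by
        intro J η h h1 h2
        refine ⟨h1 ▸ h.continuous, fun g y => ?_, fun z => ?_, fun z => ?_⟩
        · rw [h1, h.smul]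
        · rw [h1, h.zero]
        · filter_upwards [h.germ z] with y hy H hH hyd
          rw [h1, h2 H hH]
          exact hy H hH hyd
      refine ⟨θ', fun J hJ => ?_⟩
      by_cases hJn : J.1.card < n
      · refine hcongr J θ (hθ J hJn) (if_pos hJn) fun H hH => if_pos ?_
        exact (Finset.card_lt_card hH).trans hJn
      · refine hcongr J _ (hf J hJ) ?_ fun H hH => ?_
        · rw [Function.update_self]
          exact if_neg hJn
        · rw [Function.update_of_ne fun e => hH.ne (congrArg Subtype.val e)]
          exact if_pos (hlt hH hJ)
  obtain ⟨θ, hθ⟩ := key (N + 1)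
  exact ⟨θ, fun J => hθ J (Nat.lt_succ_of_le (by simpa using J.1.card_le_univ))⟩

end WeakSystem

/-! ### Tame families of subdomains -/

/-- Preimages under `ψ` of compact subsets of the footprint are compact. -/
theorem Chart.isCompact_zero_preimage {X : Type u} [TopologicalSpace X] [T2Space X] {G : Type w}
    [Group G] [Finite G] {E : Type w} [NormedAddCommGroup E] [NormedSpace ℝ E]
    {τ : Representation ℝ G E} (c : Chart.{u, v, w} X τ) {A : Set X} (hA : IsCompact A)
    (hAF : A ⊆ c.footprint) : IsCompact {u : c.U | ∃ h : c.s u = 0, c.ψ ⟨u, h⟩ ∈ A} := by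
  have := c.locallyCompactSpace
  have hZ : IsClosed {u : c.U | c.s u = 0} := isClosed_eq c.continuous_s continuous_const
  have : LocallyCompactSpace {u : c.U // c.s u = 0} :=
    hZ.isClosedEmbedding_subtypeVal.locallyCompactSpace
  have h1 : ∀ p ∈ A, ∃ L : Set {u : c.U // c.s u = 0}, IsCompact L ∧ c.ψ '' L ∈ 𝓝 p := by
    intro p hp
    obtain ⟨z, rfl⟩ := hAF hp
    obtain ⟨L, hL, hLz⟩ := exists_compact_mem_nhds z
    exact ⟨L, hL, c.isOpenMap_ψ.image_mem_nhds hLz⟩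
  choose! L hL hLA using h1
  obtain ⟨t, ht, htA⟩ := hA.elim_nhds_subcover (fun p => c.ψ '' L p) hLA
  have hact : ∀ g : G, Continuous fun z : {u : c.U // c.s u = 0} =>
      (⟨g • z.1, c.s_smul_eq_zero.2 z.2⟩ : {u : c.U // c.s u = 0}) := fun g =>
    ((c.continuous_smul g).comp continuous_subtype_val).subtype_mk _
  have hc : IsCompact (⋃ p ∈ t, ⋃ g : G, (fun z : {u : c.U // c.s u = 0} =>
      (⟨g • z.1, c.s_smul_eq_zero.2 z.2⟩ : {u : c.U // c.s u = 0})) '' L p) :=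
    t.isCompact_biUnion fun p hp => isCompact_iUnion fun g => (hL p (ht p hp)).image (hact g)
  have hcl : IsCompact (c.ψ ⁻¹' A) := by
    refine hc.of_isClosed_subset (hA.isClosed.preimage c.continuous_ψ) fun z hz => ?_
    obtain ⟨p, hp, y, hy, hyz⟩ := mem_iUnion₂.1 (htA hz)
    obtain ⟨g, hg⟩ := (c.ψ_eq_iff y z).1 hyz
    exact mem_iUnion₂.2 ⟨p, hp, mem_iUnion.2 ⟨g, y, hy, Subtype.ext hg⟩⟩
  convert hcl.image continuous_subtype_val using 1
  ext u
  constructor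
  · rintro ⟨h, hu⟩
    exact ⟨⟨u, h⟩, hu, rfl⟩
  · rintro ⟨z, hz, rfl⟩
    exact ⟨z.2, hz⟩

namespace WeakSystem

variable {N : ℕ} {P : BasicData.{w} N} {X : Type u} [TopologicalSpace X] {d : ℤ}
  {K : WeakSystem.{u, v, w} P X d}

/-- The conditions on a family of invariant open subsets `V_I ⊆ U_I` that make the restriction of
the system to these subsets tame. -/
structure TameFam (K : WeakSystem.{u, v, w} P X d) (V : ∀ I : Idx K.F, Set (K.U I)) : Prop where
  isOpen : ∀ I, IsOpen (V I)
  smul : ∀ I (g : P.ΓI I.1), ∀ x ∈ V I, g • x ∈ V I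
  image : ∀ (I J : Idx K.F) (h : I.1 ⊂ J.1), ∀ y ∈ V J, y ∈ K.deep J I.1 →
    ∃ hy : y ∈ (K.change I J h).lift, (K.change I J h).ρ ⟨y, hy⟩ ∈ V I
  inter : ∀ (I J L : Idx K.F) (h : I.1 ⊂ J.1) (h' : I.1 ⊂ L.1) (y : (K.change I J h).lift)
    (z : (K.change I L h').lift), y.1 ∈ V J → z.1 ∈ V L →
    (K.change I J h).ρ y = (K.change I L h').ρ z →
    ∃ (M : Idx K.F) (_ : M.1 = J.1 ∪ L.1) (hM : I.1 ⊂ M.1) (w : (K.change I M hM).lift),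
      w.1 ∈ V M ∧ (K.change I M hM).ρ w = (K.change I J h).ρ y

/-- An invariant norm of the section. -/
def nrm (I : Idx K.F) (x : K.U I) : ℝ :=
  ∑ i : I.1, ∑ᶠ γ : P.Γ i, ‖P.τ i γ ((K.chart I).s x i)‖

theorem continuous_nrm (I : Idx K.F) : Continuous (nrm (K := K) I) := by
  refine continuous_finsetSum _ fun i _ => ?_
  have := Fintype.ofFinite (P.Γ i)
  simp only [finsum_eq_sum_of_fintype]
  refine continuous_finsetSum _ fun γ _ => ?_
  exact ((P.τ i γ).continuous_of_finiteDimensional.comp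
    ((continuous_apply i).comp (K.chart I).continuous_s)).norm

theorem nrm_smul (I : Idx K.F) (g : P.ΓI I.1) (x : K.U I) : nrm I (g • x) = nrm I x := by
  refine Finset.sum_congr rfl fun i _ => ?_
  have := Fintype.ofFinite (P.Γ i)
  simp only [finsum_eq_sum_of_fintype]
  refine Fintype.sum_equiv (Equiv.mulRight (g i)) _ _ fun γ => ?_
  rw [(K.chart I).s_equiv, P.τI_apply, Equiv.coe_mulRight, map_mul, Module.End.mul_apply]

theorem nrm_le_zero_iff {I : Idx K.F} {x : K.U I} : nrm I x ≤ 0 ↔ (K.chart I).s x = 0 := by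
  have hnn : ∀ i : I.1, 0 ≤ ∑ᶠ γ : P.Γ i, ‖P.τ i γ ((K.chart I).s x i)‖ := fun i =>
    finsum_nonneg fun γ => norm_nonneg _
  constructor
  · intro h
    have h1 := (Finset.sum_eq_zero_iff_of_nonneg fun i _ => hnn i).1
      (le_antisymm h (Finset.sum_nonneg fun i _ => hnn i))
    funext i
    have h2 := h1 i (Finset.mem_univ i)
    have := Fintype.ofFinite (P.Γ i)
    rw [finsum_eq_sum_of_fintype, Finset.sum_eq_zero_iff_of_nonneg fun γ _ => norm_nonneg _] at h2
    have h3 := h2 1 (Finset.mem_univ _)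
    rw [map_one, Module.End.one_apply, norm_eq_zero] at h3
    exact h3
  · intro h
    simp [nrm, h]

theorem nrm_ρ {I J : Idx K.F} (h : I.1 ⊂ J.1) (y : (K.change I J h).lift) :
    nrm I ((K.change I J h).ρ y) = nrm J y.1 := by
  unfold nrm
  simp only [s_ρ_apply]
  refine Finset.sum_of_injOn (fun i : I.1 => (⟨i.1, h.subset i.2⟩ : J.1)) ?_ ?_ ?_ ?_
  · intro i _ j _ e
    exact Subtype.ext (congrArg (fun k : J.1 => k.1) e)
  · intro i _
    exact Finset.mem_coe.2 (Finset.mem_univ _)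
  · intro j _ hj
    have hjI : j.1 ∉ I.1 := fun hjI => hj ⟨⟨j.1, hjI⟩, Finset.mem_coe.2 (Finset.mem_univ _), rfl⟩
    simp [lift_subset_deep h y.2 j hjI]
  · intro i _
    rfl

/-- Neighbourhoods `U0` of parts of the zero sets of the chart domains, on which given extensions
`θ` of functions on `X` are compatible. -/
structure IsBase {κ : Type} (K : WeakSystem.{u, v, w} P X d) (A : Fin N → Set X)
    (θ : κ → ∀ I : Idx K.F, K.U I → ℝ) (U0 : ∀ I : Idx K.F, Set (K.U I)) : Prop where
  isOpen : ∀ I, IsOpen (U0 I)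
  smul : ∀ I (g : P.ΓI I.1), ∀ x ∈ U0 I, g • x ∈ U0 I
  compact : ∀ I, IsCompact (closure (U0 I))
  lift : ∀ J, ∀ y ∈ closure (U0 J), ∀ (I : Idx K.F) (h : I.1 ⊂ J.1), y ∈ K.deep J I.1 →
    y ∈ (K.change I J h).lift ∧ ∀ k, θ k J y = pull h (θ k I) y
  lift_lift : ∀ J, ∀ y ∈ closure (U0 J), ∀ (I H : Idx K.F) (h : I.1 ⊂ J.1) (h' : H.1 ⊂ I.1),
    y ∈ K.deep J H.1 → ∀ hy : y ∈ (K.change I J h).lift,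
      (K.change I J h).ρ ⟨y, hy⟩ ∈ (K.change H I h').lift
  zero : ∀ I (z : {u : K.U I // (K.chart I).s u = 0}), (∀ i ∈ I.1, (K.chart I).ψ z ∈ A i) →
    z.1 ∈ U0 I

/-- Sufficiently small invariant neighbourhoods of the compact parts of the zero sets over the sets
`A i` have the required properties, because these hold near each zero. -/
theorem exists_isBase [CompactSpace X] [T2Space X] (hK : K.HasOpenLifts) {κ : Type} [Finite κ]
    {ϑ : κ → X → ℝ} {θ : κ → ∀ I : Idx K.F, K.U I → ℝ} (hθ : ∀ k I, IsExtension (ϑ k) (θ k) I)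
    {A : Fin N → Set X} (hA : ∀ i, IsClosed (A i)) (hAF : ∀ i, A i ⊆ K.F i) :
    ∃ U0, IsBase K A θ U0 := by
  have key : ∀ J : Idx K.F, ∃ U0 : Set (K.U J), IsOpen U0 ∧
      (∀ (g : P.ΓI J.1), ∀ x ∈ U0, g • x ∈ U0) ∧
      IsCompact (closure U0) ∧
      (∀ y ∈ closure U0, (∀ (I : Idx K.F) (h : I.1 ⊂ J.1), y ∈ K.deep J I.1 →
        y ∈ (K.change I J h).lift ∧ ∀ k, θ k J y = pull h (θ k I) y) ∧
        ∀ (I H : Idx K.F) (h : I.1 ⊂ J.1) (h' : H.1 ⊂ I.1),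
          y ∈ K.deep J H.1 → ∀ hy : y ∈ (K.change I J h).lift,
          (K.change I J h).ρ ⟨y, hy⟩ ∈ (K.change H I h').lift) ∧
      (∀ (z : {u : K.U J // (K.chart J).s u = 0}), (∀ i ∈ J.1, (K.chart J).ψ z ∈ A i) →
        z.1 ∈ U0) := by
    intro J
    have := (K.chart J).locallyCompactSpace
    let Q : Set (K.U J) := {y | (∀ (I : Idx K.F) (h : I.1 ⊂ J.1), y ∈ K.deep J I.1 →
        y ∈ (K.change I J h).lift ∧ ∀ k, θ k J y = pull h (θ k I) y) ∧
        ∀ (I H : Idx K.F) (h : I.1 ⊂ J.1) (h' : H.1 ⊂ I.1),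
          y ∈ K.deep J H.1 → ∀ hy : y ∈ (K.change I J h).lift,
          (K.change I J h).ρ ⟨y, hy⟩ ∈ (K.change H I h').lift}
    have hQ : ∀ z : {u : K.U J // (K.chart J).s u = 0}, z.1 ∈ interior Q := by
      intro z
      rw [mem_interior_iff_mem_nhds]
      refine Filter.Eventually.and (?_ : ∀ᶠ y in 𝓝 z.1, _) (?_ : ∀ᶠ y in 𝓝 z.1, _)
      · have h1 : ∀ᶠ y in 𝓝 z.1, ∀ (I : Idx K.F) (h : I.1 ⊂ J.1), y ∈ K.deep J I.1 →
            y ∈ (K.change I J h).lift := by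
          rw [Filter.eventually_all]
          intro L
          by_cases hL : L.1 ⊂ J.1
          · filter_upwards [hK L J hL z.1 (mem_lift_of_s_eq_zero hL z.2)] with y hy _ using hy
          · exact Filter.Eventually.of_forall fun y h' => absurd h' hL
        filter_upwards [h1, Filter.eventually_all.2 fun k => (hθ k J).germ z] with y hy hyk I h hyd
        exact ⟨hy I h hyd, fun k => (hyk k I h hyd).2⟩
      · rw [Filter.eventually_all]
        intro I
        rw [Filter.eventually_all]
        intro H
        by_cases h : I.1 ⊂ J.1
        swap
        · exact Filter.Eventually.of_forall fun y h' => absurd h' h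
        by_cases h' : H.1 ⊂ I.1
        swap
        · exact Filter.Eventually.of_forall fun y _ h'' => absurd h'' h'
        have hz := mem_lift_of_s_eq_zero h z.2
        have hz' : (K.chart I).s ((K.change I J h).ρ ⟨z.1, hz⟩) = 0 := by
          rw [← mem_deep_empty, ρ_mem_deep h, mem_deep_empty]
          exact z.2
        have h1 := (continuous_ρ h).continuousAt.eventually
          (hK H I h' _ (mem_lift_of_s_eq_zero h' hz'))
        rw [nhds_subtype_eq_comap, Filter.eventually_comap] at h1
        filter_upwards [h1] with y hy _ _ hyH hyl
        exact hy ⟨y, hyl⟩ rfl ((ρ_mem_deep h _).2 hyH)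
    have hAc : IsCompact (⋂ i ∈ J.1, A i) :=
      (isClosed_biInter fun i _ => hA i).isCompact
    have hZ := (K.chart J).isCompact_zero_preimage hAc (by
      rw [K.chart_foot]
      exact biInter_mono subset_rfl fun i _ => hAF i)
    obtain ⟨L, hL, hZL, hLQ⟩ := exists_compact_between hZ isOpen_interior (by
      rintro u ⟨h, -⟩
      exact hQ ⟨u, h⟩)
    refine ⟨{x | ∀ g : P.ΓI J.1, g • x ∈ interior L}, ?_, ?_, ?_, ?_, ?_⟩
    · simp only [ofPred_forall]
      exact isOpen_iInter_of_finite fun g =>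
        isOpen_interior.preimage ((K.chart J).continuous_smul g)
    · intro g x hx g'
      rw [← mul_smul]
      exact hx _
    · refine hL.of_isClosed_subset isClosed_closure (closure_minimal (fun x hx => ?_) hL.isClosed)
      have := interior_subset (hx 1)
      rwa [one_smul] at this
    · intro y hy
      have : y ∈ L := closure_minimal (fun x hx => by
        have := interior_subset (hx 1)
        rwa [one_smul] at this) hL.isClosed hy
      have hyQ : y ∈ Q := interior_subset (hLQ this)
      exact hyQ
    · intro z hz g
      have hgz := ((K.chart J).s_smul_eq_zero (g := g)).2 z.2
      refine hZL ⟨hgz, mem_iInter₂.2 fun i hi => ?_⟩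
      have : (K.chart J).ψ ⟨g • z.1, hgz⟩ = (K.chart J).ψ z :=
        ((K.chart J).ψ_eq_iff _ _).2 ⟨g⁻¹, inv_smul_smul _ _⟩
      rw [this]
      exact hz i hi
  choose U0 h1 h2 h3 h4 h5 using key
  exact ⟨U0, h1, h2, h3, fun J y hy => (h4 J y hy).1, fun J y hy => (h4 J y hy).2, h5⟩

/-- The subdomains `{θ_i > c for i ∈ I, |s| < ε}` of `U0`. -/
def fam (θ : Fin N → ∀ I : Idx K.F, K.U I → ℝ) (U0 : ∀ I : Idx K.F, Set (K.U I)) (c ε : ℝ)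
    (I : Idx K.F) : Set (K.U I) :=
  {x | x ∈ U0 I ∧ (∀ i ∈ I.1, c < θ i I x) ∧ nrm I x < ε}

/-- Compact sets that contain the closures of the subdomains `fam`. -/
def famClosure (θ : Fin N → ∀ I : Idx K.F, K.U I → ℝ) (U0 : ∀ I : Idx K.F, Set (K.U I)) (c : ℝ)
    (I : Idx K.F) : Set (K.U I) :=
  {x | x ∈ closure (U0 I) ∧ ∀ i ∈ I.1, c ≤ θ i I x}

section Fam

variable {ϑ : Fin N → X → ℝ} {θ : Fin N → ∀ I : Idx K.F, K.U I → ℝ}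
  {U0 : ∀ I : Idx K.F, Set (K.U I)}

theorem fam_subset_famClosure {c c' ε : ℝ} (h : c' ≤ c) (I : Idx K.F) :
    fam θ U0 c ε I ⊆ famClosure θ U0 c' I :=
  fun _ hx => ⟨subset_closure hx.1, fun i hi => h.trans (hx.2.1 i hi).le⟩

theorem isCompact_famClosure {A : Fin N → Set X} (hθ : ∀ i I, IsExtension (ϑ i) (θ i) I)
    (hb : IsBase K A θ U0) (c : ℝ) (I : Idx K.F) : IsCompact (famClosure θ U0 c I) := by
  have e : famClosure θ U0 c I = closure (U0 I) ∩ ⋂ i ∈ I.1, {x | c ≤ θ i I x} := by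
    ext x
    simp [famClosure]
  rw [e]
  exact (hb.compact I).inter_right
    (isClosed_biInter fun i _ => isClosed_le continuous_const (hθ i I).continuous)

theorem isOpen_fam {A : Fin N → Set X} (hθ : ∀ i I, IsExtension (ϑ i) (θ i) I)
    (hb : IsBase K A θ U0) (c ε : ℝ) (I : Idx K.F) : IsOpen (fam θ U0 c ε I) := by
  have e : fam θ U0 c ε I = U0 I ∩ ((⋂ i ∈ I.1, {x | c < θ i I x}) ∩ {x | nrm I x < ε}) := by
    ext x
    simp only [fam, mem_inter_iff, mem_iInter]
    rfl
  rw [e]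
  exact (hb.isOpen I).inter (((isOpen_biInter_finset fun i _ =>
    isOpen_lt continuous_const (hθ i I).continuous)).inter
    (isOpen_lt (continuous_nrm I) continuous_const))

/-- Near its zero set, a set `famClosure` is contained in any given neighbourhood of the zeros. -/
theorem eventually_famClosure_subset {A : Fin N → Set X} (hθ : ∀ i I, IsExtension (ϑ i) (θ i) I)
    (hb : IsBase K A θ U0) (c : ℝ) (I : Idx K.F) {Q : Set (K.U I)} (hQ : IsOpen Q)
    (h : ∀ z : {u : K.U I // (K.chart I).s u = 0}, (∀ i ∈ I.1, c ≤ ϑ i ((K.chart I).ψ z)) →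
      z.1 ∈ Q) :
    ∀ᶠ ε in 𝓝[>] (0 : ℝ), ∀ x ∈ famClosure θ U0 c I, nrm I x ≤ ε → x ∈ Q := by
  refine eventually_sublevel_subset (isCompact_famClosure hθ hb c I) hQ (continuous_nrm I) ?_
  intro x hx hx0
  have hz := nrm_le_zero_iff.1 hx0
  refine h ⟨x, hz⟩ fun i hi => ?_
  rw [← (hθ i I).zero ⟨x, hz⟩]
  exact hx.2 i hi

/-- On the zero set the family is given by the functions on the base. -/
theorem mem_fam_zero {hU : IsBase K (fun i => {p | 0 ≤ ϑ i p}) θ U0}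
    (hθ : ∀ i I, IsExtension (ϑ i) (θ i) I) {c ε : ℝ} (hc : 0 ≤ c) (hε : 0 < ε) {I : Idx K.F}
    (z : {u : K.U I // (K.chart I).s u = 0}) :
    z.1 ∈ fam θ U0 c ε I ↔ ∀ i ∈ I.1, c < ϑ i ((K.chart I).ψ z) := by
  constructor
  · intro h i hi
    rw [← (hθ i I).zero z]
    exact h.2.1 i hi
  · intro h
    refine ⟨hU.zero I z fun i hi => hc.trans (h i hi).le, fun i hi => ?_, ?_⟩
    · rw [(hθ i I).zero z]
      exact h i hi
    · exact (nrm_le_zero_iff.2 z.2).trans_lt hε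

/-- A `Γ_J`-translate of a zero point of `U_J` over `p ∈ F_J` is mapped by `ρ` to a given zero point
over `p`. -/
theorem exists_lift_zero {I J : Idx K.F} (h : I.1 ⊂ J.1) (z : {u : K.U I // (K.chart I).s u = 0})
    (hz : ∀ i ∈ J.1, (K.chart I).ψ z ∈ K.F i) :
    ∃ w : (K.change I J h).lift, ∃ hw : (K.chart J).s w.1 = 0,
      (K.change I J h).ρ w = z.1 ∧ (K.chart J).ψ ⟨w.1, hw⟩ = (K.chart I).ψ z := by
  obtain ⟨y, hy⟩ := mem_footprint.2 hz
  have hzd : z.1 ∈ (K.change I J h).dom := ((K.change I J h).dom_foot z).2 ⟨y, hy⟩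
  rw [← (K.change I J h).ρ_range] at hzd
  obtain ⟨w, hw⟩ := hzd
  have hw0 : (K.chart I).s ((K.change I J h).ρ w) = 0 := by rw [hw]; exact z.2
  have hw1 : (K.chart J).s w.1 = 0 := by
    rw [← mem_deep_empty, ← ρ_mem_deep h, mem_deep_empty]
    exact hw0
  refine ⟨w, hw1, hw, ?_⟩
  rw [(K.change I J h).ρ_ψ w hw1 hw0]
  congr 1
  exact Subtype.ext hw

/-- For small `ε` the subdomains `fam` satisfy the second tameness condition. -/
theorem eventually_fam_image (hθ : ∀ i I, IsExtension (ϑ i) (θ i) I)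
    (hb : IsBase K (fun i => {p | 0 ≤ ϑ i p}) θ U0) (I J : Idx K.F) (h : I.1 ⊂ J.1) :
    ∀ᶠ ε in 𝓝[>] (0 : ℝ), ∀ c, 0 ≤ c → ∀ y ∈ fam θ U0 c ε J, y ∈ K.deep J I.1 →
      ∃ hy : y ∈ (K.change I J h).lift, (K.change I J h).ρ ⟨y, hy⟩ ∈ fam θ U0 c ε I := by
  obtain ⟨Q, hQ, hQU⟩ := isOpen_induced_iff.1 ((hb.isOpen I).preimage (continuous_ρ h))
  have hQ' : ∀ y (hy : y ∈ (K.change I J h).lift), y ∈ Q ↔ (K.change I J h).ρ ⟨y, hy⟩ ∈ U0 I :=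
    fun y hy => Set.ext_iff.1 hQU ⟨y, hy⟩
  have h1 := eventually_famClosure_subset hθ hb 0 J hQ (fun z hz => by
    have hzl := mem_lift_of_s_eq_zero h z.2
    rw [hQ' z.1 hzl]
    have hz' : (K.chart I).s ((K.change I J h).ρ ⟨z.1, hzl⟩) = 0 := by
      rw [← mem_deep_empty, ρ_mem_deep h, mem_deep_empty]
      exact z.2
    refine hb.zero I ⟨_, hz'⟩ fun i hi => ?_
    rw [← (K.change I J h).ρ_ψ ⟨z.1, hzl⟩ z.2 hz']
    exact hz i (h.subset hi))
  filter_upwards [h1] with ε hε c hc y hy hyd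
  have hyC := fam_subset_famClosure hc J hy
  obtain ⟨hyl, hyθ⟩ := hb.lift J y hyC.1 I h hyd
  refine ⟨hyl, (hQ' y hyl).1 (hε y hyC hy.2.2.le), fun i hi => ?_, ?_⟩
  · have h2 := hyθ i
    rw [pull_apply ⟨y, hyl⟩] at h2
    rw [← h2]
    exact hy.2.1 i (h.subset hi)
  · rw [nrm_ρ h ⟨y, hyl⟩]
    exact hy.2.2

/-- For small `ε` the subdomains `fam` satisfy the first tameness condition. -/
theorem eventually_fam_inter [T2Space X] (hθ : ∀ i I, IsExtension (ϑ i) (θ i) I)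
    (hF : ∀ i p, 0 ≤ ϑ i p → p ∈ K.F i) (hb : IsBase K (fun i => {p | 0 ≤ ϑ i p}) θ U0)
    (I J L : Idx K.F) (h : I.1 ⊂ J.1) (h' : I.1 ⊂ L.1) :
    ∀ᶠ ε in 𝓝[>] (0 : ℝ), ∀ c, 0 ≤ c → ∀ (y : (K.change I J h).lift)
    (z : (K.change I L h').lift), y.1 ∈ fam θ U0 c ε J → z.1 ∈ fam θ U0 c ε L →
    (K.change I J h).ρ y = (K.change I L h').ρ z →
    ∃ (M : Idx K.F) (_ : M.1 = J.1 ∪ L.1) (hM : I.1 ⊂ M.1) (w : (K.change I M hM).lift),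
      w.1 ∈ fam θ U0 c ε M ∧ (K.change I M hM).ρ w = (K.change I J h).ρ y := by
  -- one of the two indices contains the other
  by_cases hLJ : L.1 ⊆ J.1
  · exact Filter.Eventually.of_forall fun ε c hc y z hy hz hyz =>
      ⟨J, (Finset.union_eq_left.2 hLJ).symm, h, y, hy, rfl⟩
  by_cases hJL : J.1 ⊆ L.1
  · exact Filter.Eventually.of_forall fun ε c hc y z hy hz hyz =>
      ⟨L, (Finset.union_eq_right.2 hJL).symm, h', z, hz, hyz.symm⟩
  have hJM : J.1 ⊂ J.1 ∪ L.1 := Finset.subset_union_left.ssubset_of_ne fun e =>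
    hLJ (Finset.union_eq_left.1 e.symm)
  have hLM : L.1 ⊂ J.1 ∪ L.1 := Finset.subset_union_right.ssubset_of_ne fun e =>
    hJL (Finset.union_eq_right.1 e.symm)
  -- the compact set of pairs of points with the same image
  let AJ : Set (K.U J) := famClosure θ U0 0 J ∩ K.deep J I.1
  let AL : Set (K.U L) := famClosure θ U0 0 L ∩ K.deep L I.1
  have hAJ : IsCompact AJ := (isCompact_famClosure hθ hb 0 J).inter_right (isClosed_deep J _)
  have hAL : IsCompact AL := (isCompact_famClosure hθ hb 0 L).inter_right (isClosed_deep L _)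
  have hAJl : ∀ y ∈ AJ, y ∈ (K.change I J h).lift := fun y hy => (hb.lift J y hy.1.1 I h hy.2).1
  have hALl : ∀ y ∈ AL, y ∈ (K.change I L h').lift := fun y hy => (hb.lift L y hy.1.1 I h' hy.2).1
  have hAJc := isCompact_iff_compactSpace.1 hAJ
  have hALc := isCompact_iff_compactSpace.1 hAL
  let A : Set (AJ × AL) := {p | (K.change I J h).ρ ⟨p.1.1, hAJl _ p.1.2⟩ =
    (K.change I L h').ρ ⟨p.2.1, hALl _ p.2.2⟩}
  have hA : IsCompact A := by
    refine IsClosed.isCompact (isClosed_eq ((continuous_ρ h).comp ?_) ((continuous_ρ h').comp ?_))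
    · exact (continuous_subtype_val.comp continuous_fst).subtype_mk _
    · exact (continuous_subtype_val.comp continuous_snd).subtype_mk _
  by_cases hMi : IsIdx K.F (J.1 ∪ L.1)
  · let M : Idx K.F := ⟨J.1 ∪ L.1, hMi⟩
    have hIM : I.1 ⊂ M.1 := h.trans hJM
    obtain ⟨Q, hQ, hQU⟩ := isOpen_induced_iff.1 ((isOpenMap_ρ hIM _
      ((hb.isOpen M).preimage continuous_subtype_val)).preimage (continuous_ρ h))
    have hQ' : ∀ y (hy : y ∈ (K.change I J h).lift), y ∈ Q ↔ ∃ w : (K.change I M hIM).lift,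
        w.1 ∈ U0 M ∧ (K.change I M hIM).ρ w = (K.change I J h).ρ ⟨y, hy⟩ :=
      fun y hy => Set.ext_iff.1 hQU ⟨y, hy⟩
    have h1 := eventually_sublevel_subset hA
      (hQ.preimage (continuous_subtype_val.comp continuous_fst))
      (n := fun p : AJ × AL => nrm J p.1.1) ((continuous_nrm J).comp (by fun_prop)) (by
        rintro ⟨y, z⟩ hyz h0
        have hyz' : (K.change I J h).ρ ⟨y.1, hAJl _ y.2⟩ =
          (K.change I L h').ρ ⟨z.1, hALl _ z.2⟩ := hyz
        have hy0 := nrm_le_zero_iff.1 h0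
        have hx0 : (K.chart I).s ((K.change I J h).ρ ⟨y.1, hAJl _ y.2⟩) = 0 := by
          rw [← mem_deep_empty, ρ_mem_deep h, mem_deep_empty]
          exact hy0
        have hx0' : (K.chart I).s ((K.change I L h').ρ ⟨z.1, hALl _ z.2⟩) = 0 := hyz' ▸ hx0
        have hz0 : (K.chart L).s z.1 = 0 := by
          rw [← mem_deep_empty, ← ρ_mem_deep h' ⟨z.1, hALl _ z.2⟩, mem_deep_empty]
          exact hx0'
        have hp : ∀ i ∈ M.1, 0 ≤ ϑ i ((K.chart I).ψ ⟨_, hx0⟩) := by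
          intro i hi
          rcases Finset.mem_union.1 hi with hi | hi
          · rw [← (K.change I J h).ρ_ψ ⟨y.1, hAJl _ y.2⟩ hy0 hx0, ← (hθ i J).zero ⟨y.1, hy0⟩]
            exact y.2.1.2 i hi
          · have e : (K.chart I).ψ ⟨_, hx0⟩ = (K.chart I).ψ ⟨_, hx0'⟩ := by
              congr 1
              exact Subtype.ext hyz'
            rw [e, ← (K.change I L h').ρ_ψ ⟨z.1, hALl _ z.2⟩ hz0 hx0', ← (hθ i L).zero ⟨z.1, hz0⟩]
            exact z.2.1.2 i hi
        obtain ⟨w, hw0, hw, hwψ⟩ := exists_lift_zero hIM ⟨_, hx0⟩ fun i hi => hF i _ (hp i hi)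
        refine (hQ' y.1 (hAJl _ y.2)).2 ⟨w, hb.zero M ⟨w.1, hw0⟩ fun i hi => ?_, hw⟩
        change 0 ≤ ϑ i _
        rw [hwψ]
        exact hp i hi)
    filter_upwards [h1] with ε hε c hc y z hy hz hyz
    have hyA : y.1 ∈ AJ := ⟨fam_subset_famClosure hc J hy, lift_subset_deep h y.2⟩
    have hzA : z.1 ∈ AL := ⟨fam_subset_famClosure hc L hz, lift_subset_deep h' z.2⟩
    obtain ⟨w, hwU, hw⟩ := (hQ' y.1 y.2).1 (hε (⟨y.1, hyA⟩, ⟨z.1, hzA⟩) hyz hy.2.2.le)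
    refine ⟨M, rfl, hIM, w, ⟨hwU, ?_, ?_⟩, hw⟩
    · -- the values of `θ_i` are those at `y` for `i ∈ J`, and those at `z` for `i ∈ L`
      have hwI : w.1 ∈ K.deep M I.1 := lift_subset_deep hIM w.2
      have key : ∀ (H : Idx K.F) (hI : I.1 ⊂ H.1) (hH : H.1 ⊂ M.1) (v : (K.change I H hI).lift),
          (K.change I M hIM).ρ w = (K.change I H hI).ρ v → ∀ i, θ i M w.1 = θ i H v.1 := by
        intro H hI hH v hv i
        obtain ⟨hwH, hwθ⟩ := hb.lift M w.1 (subset_closure hwU) H hH (deep_mono hI.subset hwI)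
        have hwl := hb.lift_lift M w.1 (subset_closure hwU) H I hH hI hwI hwH
        have h2 := K.cocycle I H M hI hH w.1 w.2 hwH hwl
        obtain ⟨g, -, hg⟩ := ((K.change I H hI).ρ_fiber _ v).1 (h2.symm.trans hv)
        rw [hwθ i, pull_apply ⟨w.1, hwH⟩, ← hg, (hθ i H).smul]
      intro i hi
      rcases Finset.mem_union.1 hi with hi | hi
      · rw [key J h hJM y hw]
        exact hy.2.1 i hi
      · rw [key L h' hLM z (hw.trans hyz)]
        exact hz.2.1 i hi
    · rw [← nrm_ρ hIM w, hw, nrm_ρ h y]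
      exact hy.2.2
  · -- if `J ∪ L` is not an index then there are no pairs in the zero set
    have h1 := eventually_sublevel_subset hA isOpen_empty
      (n := fun p : AJ × AL => nrm J p.1.1) ((continuous_nrm J).comp (by fun_prop)) (by
        rintro ⟨y, z⟩ hyz h0
        have hyz' : (K.change I J h).ρ ⟨y.1, hAJl _ y.2⟩ =
          (K.change I L h').ρ ⟨z.1, hALl _ z.2⟩ := hyz
        have hy0 := nrm_le_zero_iff.1 h0
        have hx0 : (K.chart I).s ((K.change I J h).ρ ⟨y.1, hAJl _ y.2⟩) = 0 := by
          rw [← mem_deep_empty, ρ_mem_deep h, mem_deep_empty]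
          exact hy0
        have hx0' : (K.chart I).s ((K.change I L h').ρ ⟨z.1, hALl _ z.2⟩) = 0 := hyz' ▸ hx0
        have hz0 : (K.chart L).s z.1 = 0 := by
          rw [← mem_deep_empty, ← ρ_mem_deep h' ⟨z.1, hALl _ z.2⟩, mem_deep_empty]
          exact hx0'
        refine hMi ⟨J.2.1.mono hJM.subset, (K.chart I).ψ ⟨_, hx0⟩, mem_iInter₂.2 fun i hi => ?_⟩
        rcases Finset.mem_union.1 hi with hi | hi
        · rw [← (K.change I J h).ρ_ψ ⟨y.1, hAJl _ y.2⟩ hy0 hx0]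
          exact ψ_mem _ hi
        · have e : (K.chart I).ψ ⟨_, hx0⟩ = (K.chart I).ψ ⟨_, hx0'⟩ := by
            congr 1
            exact Subtype.ext hyz'
          rw [e, ← (K.change I L h').ρ_ψ ⟨z.1, hALl _ z.2⟩ hz0 hx0']
          exact ψ_mem _ hi)
    filter_upwards [h1] with ε hε c hc y z hy hz hyz
    have hyA : y.1 ∈ AJ := ⟨fam_subset_famClosure hc J hy, lift_subset_deep h y.2⟩
    have hzA : z.1 ∈ AL := ⟨fam_subset_famClosure hc L hz, lift_subset_deep h' z.2⟩
    exact (hε (⟨y.1, hyA⟩, ⟨z.1, hzA⟩) hyz hy.2.2.le).elim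

/-- Tameness for all small `ε`: each condition holds near the zero set, and the closed sets that
bound the family shrink to a compact subset of the zero set as `ε` tends to `0`. -/
theorem eventually_tameFam [T2Space X] (hθ : ∀ i I, IsExtension (ϑ i) (θ i) I)
    (hF : ∀ i p, 0 ≤ ϑ i p → p ∈ K.F i) (hb : IsBase K (fun i => {p | 0 ≤ ϑ i p}) θ U0) :
    ∀ᶠ ε in 𝓝[>] (0 : ℝ), ∀ c, 0 ≤ c → TameFam K (fam θ U0 c ε) := by
  have h1 : ∀ᶠ ε in 𝓝[>] (0 : ℝ), ∀ (I J : Idx K.F) (h : I.1 ⊂ J.1), ∀ c, 0 ≤ c →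
      ∀ y ∈ fam θ U0 c ε J, y ∈ K.deep J I.1 →
      ∃ hy : y ∈ (K.change I J h).lift, (K.change I J h).ρ ⟨y, hy⟩ ∈ fam θ U0 c ε I := by
    rw [Filter.eventually_all]
    intro I
    rw [Filter.eventually_all]
    intro J
    rw [Filter.eventually_all]
    exact fun h => eventually_fam_image hθ hb I J h
  have h2 : ∀ᶠ ε in 𝓝[>] (0 : ℝ), ∀ (I J L : Idx K.F) (h : I.1 ⊂ J.1) (h' : I.1 ⊂ L.1),
      ∀ c, 0 ≤ c → ∀ (y : (K.change I J h).lift)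
      (z : (K.change I L h').lift), y.1 ∈ fam θ U0 c ε J → z.1 ∈ fam θ U0 c ε L →
      (K.change I J h).ρ y = (K.change I L h').ρ z →
      ∃ (M : Idx K.F) (_ : M.1 = J.1 ∪ L.1) (hM : I.1 ⊂ M.1) (w : (K.change I M hM).lift),
        w.1 ∈ fam θ U0 c ε M ∧ (K.change I M hM).ρ w = (K.change I J h).ρ y := by
    rw [Filter.eventually_all]
    intro I
    rw [Filter.eventually_all]
    intro J
    rw [Filter.eventually_all]
    intro L
    rw [Filter.eventually_all]
    intro h
    rw [Filter.eventually_all]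
    exact fun h' => eventually_fam_inter hθ hF hb I J L h h'
  filter_upwards [h1, h2] with ε hε1 hε2 c hc
  refine ⟨isOpen_fam hθ hb c ε, fun I g x hx => ⟨hb.smul I g x hx.1, fun i hi => ?_, ?_⟩,
    fun I J h => hε1 I J h c hc, fun I J L h h' => hε2 I J L h h' c hc⟩
  · rw [(hθ i I).smul]
    exact hx.2.1 i hi
  · rw [nrm_smul]
    exact hx.2.2

end Fam

end WeakSystem

/-! ### Smooth structures pulled back along open embeddings -/

section Pullback

variable {M : Type*} {M' : Type*} [TopologicalSpace M] [TopologicalSpace M']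

/-- The charts of `M'`, composed with an open embedding `f : M → M'`. -/
abbrev pullbackCharted {H : Type*} [TopologicalSpace H] [ChartedSpace H M'] (f : M → M')
    (hf : IsOpenEmbedding f) : ChartedSpace H M where
  atlas := range fun x : M =>
    (@IsOpenEmbedding.toOpenPartialHomeomorph _ _ _ _ f hf ⟨x⟩) ≫ₕ chartAt H (f x)
  chartAt x := (@IsOpenEmbedding.toOpenPartialHomeomorph _ _ _ _ f hf ⟨x⟩) ≫ₕ chartAt H (f x)
  mem_chart_source x := by simp
  chart_mem_atlas x := mem_range_self x

theorem isManifold_pullbackCharted {V : Type*} [NormedAddCommGroup V] [NormedSpace ℝ V]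
    {H : Type*} [TopologicalSpace H] (I : ModelWithCorners ℝ V H) [ChartedSpace H M']
    [IsManifold I ∞ M'] (f : M → M') (hf : IsOpenEmbedding f) :
    @IsManifold ℝ _ V _ _ H _ I ∞ M _ (pullbackCharted f hf) := by
  let _ : ChartedSpace H M := pullbackCharted f hf
  refine @IsManifold.mk ℝ _ V _ _ H _ I ∞ M _ (pullbackCharted f hf) ⟨?_⟩
  rintro _ _ ⟨x, rfl⟩ ⟨y, rfl⟩
  have : Nonempty M := ⟨x⟩
  let F := hf.toOpenPartialHomeomorph f
  change (F ≫ₕ chartAt H (f x)).symm ≫ₕ (F ≫ₕ chartAt H (f y)) ∈ contDiffGroupoid ∞ I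
  have hG := HasGroupoid.compatible (G := contDiffGroupoid ∞ I) (chart_mem_atlas H (f x))
    (chart_mem_atlas H (f y))
  have hopen : IsOpen ((chartAt H (f x)).target ∩ (chartAt H (f x)).symm ⁻¹' range f) :=
    (chartAt H (f x)).isOpen_inter_preimage_symm hf.isOpen_range
  refine (contDiffGroupoid ∞ I).mem_of_eqOnSource (closedUnderRestriction' hG hopen) ?_
  refine ⟨?_, ?_⟩
  · ext v
    simp only [F, hopen.interior_eq, mfld_simps]
    constructor
    · rintro ⟨⟨h1, z, hz⟩, h2⟩
      rw [← hz, hf.toOpenPartialHomeomorph_left_inv] at h2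
      exact ⟨⟨h1, by rwa [← hz]⟩, h1, z, hz⟩
    · rintro ⟨⟨h1, h2⟩, -, z, hz⟩
      refine ⟨⟨h1, z, hz⟩, ?_⟩
      rw [← hz, hf.toOpenPartialHomeomorph_left_inv, hz]
      exact h2
  · intro v hv
    simp only [F, mfld_simps] at hv ⊢
    obtain ⟨⟨h1, z, hz⟩, h2⟩ := hv
    rw [← hz, hf.toOpenPartialHomeomorph_left_inv]

/-- The smooth structure pulled back along an open embedding. -/
def SmoothStr.pullback (S : SmoothStr M') (f : M → M') (hf : IsOpenEmbedding f) : SmoothStr M where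
  V := S.V
  H := S.H
  I := S.I
  charted := pullbackCharted f hf
  manifold := isManifold_pullbackCharted S.I f hf

theorem SmoothStr.isLocalDiffeomorph_pullback (S : SmoothStr M') (f : M → M')
    (hf : IsOpenEmbedding f) : IsLocalDiffeomorph (S.pullback f hf).I S.I ∞ f := by
  intro x
  have : Nonempty M := ⟨x⟩
  let T := S.pullback f hf
  let F := hf.toOpenPartialHomeomorph f
  have hchart : ∀ y : M, chartAt T.H y = F ≫ₕ chartAt S.H (f y) := fun y => rfl
  have hFx : ∀ y, F y = f y := fun y => rfl
  have hFs : ∀ y, F.symm (f y) = y := fun y => hf.toOpenPartialHomeomorph_left_inv f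
  have hsrc : ∀ y, (chartAt T.H y).source = f ⁻¹' (chartAt S.H (f y)).source := fun y => by
    rw [hchart]
    simp [F]
  -- both `f` and its inverse are compositions of a chart and the inverse of a chart
  have h1 : ContMDiff T.I S.I ∞ f := by
    intro y
    have h2 : ContMDiffOn T.I S.I ∞ ((chartAt S.H (f y)).symm ∘ chartAt T.H y)
        (chartAt T.H y).source := by
      refine contMDiffOn_chart_symm.comp contMDiffOn_chart fun z hz => ?_
      rw [hsrc] at hz
      exact (chartAt S.H (f y)).map_source hz
    refine (h2.contMDiffAt ((chartAt T.H y).open_source.mem_nhds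
      (mem_chart_source T.H y))).congr_of_eventuallyEq ?_
    filter_upwards [(chartAt T.H y).open_source.mem_nhds (mem_chart_source T.H y)] with z hz
    rw [hsrc] at hz
    exact ((chartAt S.H (f y)).left_inv hz).symm
  have h2 : ContMDiffOn S.I T.I ∞ F.symm (range f) := by
    rintro _ ⟨y, rfl⟩
    refine ContMDiffAt.contMDiffWithinAt ?_
    have hmem : (chartAt S.H (f y)).source ∩ range f ∈ 𝓝 (f y) := Filter.inter_mem
      ((chartAt S.H (f y)).open_source.mem_nhds (mem_chart_source S.H (f y)))
      (hf.isOpen_range.mem_nhds ⟨y, rfl⟩)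
    have h2 : ContMDiffOn S.I T.I ∞ ((chartAt T.H y).symm ∘ chartAt S.H (f y))
        ((chartAt S.H (f y)).source ∩ range f) := by
      refine contMDiffOn_chart_symm.comp (contMDiffOn_chart.mono inter_subset_left) ?_
      rintro _ ⟨hz, z, rfl⟩
      exact (chartAt T.H y).map_source (by rwa [hsrc])
    refine (h2.contMDiffAt hmem).congr_of_eventuallyEq ?_
    filter_upwards [hmem]
    rintro _ ⟨hz, z, rfl⟩
    rw [hFs]
    exact ((chartAt T.H y).left_inv (by rwa [hsrc])).symm
  refine ⟨{ toPartialEquiv := F.toPartialEquiv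
            open_source := F.open_source
            open_target := F.open_target
            contMDiffOn_toFun := h1.contMDiffOn
            contMDiffOn_invFun := ?_ }, mem_univ x, fun y _ => rfl⟩
  have ht : F.target = range f := hf.toOpenPartialHomeomorph_target f
  exact ht ▸ h2

end Pullback

section LocalDiffeomorph

variable {V V' V₁ : Type} [NormedAddCommGroup V] [NormedSpace ℝ V]
  [NormedAddCommGroup V'] [NormedSpace ℝ V'] [NormedAddCommGroup V₁] [NormedSpace ℝ V₁]
  {H H' H₁ : Type} [TopologicalSpace H]
  [TopologicalSpace H'] [TopologicalSpace H₁]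
  {I : ModelWithCorners ℝ V H} {I' : ModelWithCorners ℝ V' H'}
  {M M' M₁ M₁' : Type*} [TopologicalSpace M] [TopologicalSpace M'] [TopologicalSpace M₁]
  [TopologicalSpace M₁'] [ChartedSpace H M] [ChartedSpace H' M'] [ChartedSpace H M₁]
  [ChartedSpace H' M₁']

/-- A continuous map is smooth if its composition with a local diffeomorphism is. -/
theorem contMDiff_of_comp_isLocalDiffeomorph {I'' : ModelWithCorners ℝ V₁ H₁}
    {j : M → M'} (hj : IsLocalDiffeomorph I I' ∞ j)
    {Q : Type*} [TopologicalSpace Q] [ChartedSpace H₁ Q] {f : Q → M} (hf : Continuous f)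
    (h : ContMDiff I'' I' ∞ (j ∘ f)) : ContMDiff I'' I ∞ f := by
  intro x
  have h1 := (hj (f x)).localInverse_contMDiffAt.comp x (h x)
  refine h1.congr_of_eventuallyEq ?_
  have h2 := hf.continuousAt.eventually (hj (f x)).localInverse_eventuallyEq_left
  filter_upwards [h2] with y hy
  exact hy.symm

/-- Being a local diffeomorphism at a point is a local property. -/
theorem IsLocalDiffeomorphAt.congr_of_eventuallyEq {f g : M → M'} {x : M}
    (hg : IsLocalDiffeomorphAt I I' ∞ g x) (h : f =ᶠ[𝓝 x] g) :
    IsLocalDiffeomorphAt I I' ∞ f x := by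
  obtain ⟨Φ, hx, hΦ⟩ := hg
  obtain ⟨O, hO, hOo, hxO⟩ := eventually_nhds_iff.1 h
  let Ψ := Φ.toOpenPartialHomeomorph.restrOpen O hOo
  refine ⟨{ toPartialEquiv := Ψ.toPartialEquiv
            open_source := Ψ.open_source
            open_target := Ψ.open_target
            contMDiffOn_toFun := Φ.contMDiffOn_toFun.mono inter_subset_left
            contMDiffOn_invFun := Φ.contMDiffOn_invFun.mono inter_subset_left }, ⟨hx, hxO⟩, ?_⟩
  rintro y ⟨hy, hyO⟩
  exact (hO y hyO).trans (hΦ hy)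

/-- Local diffeomorphisms can be cancelled from the left. -/
theorem IsLocalDiffeomorphAt.of_comp_left {I'' : ModelWithCorners ℝ V₁ H₁} {j : M → M'}
    {Q : Type*} [TopologicalSpace Q] [ChartedSpace H₁ Q] {f : Q → M} {x : Q}
    (hj : IsLocalDiffeomorphAt I I' ∞ j (f x)) (hf : ContinuousAt f x)
    (h : IsLocalDiffeomorphAt I'' I' ∞ (j ∘ f) x) : IsLocalDiffeomorphAt I'' I ∞ f x := by
  have h1 := IsLocalDiffeomorphAt.comp (hf := h) (hg := hj.localInverse_isLocalDiffeomorphAt)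
  refine IsLocalDiffeomorphAt.congr_of_eventuallyEq h1 ?_
  filter_upwards [hf.eventually hj.localInverse_eventuallyEq_left] with y hy
  exact hy.symm

/-- Local diffeomorphisms can be cancelled from the left. -/
theorem IsLocalDiffeomorph.of_comp_left {I'' : ModelWithCorners ℝ V₁ H₁}
    {j : M → M'} (hj : IsLocalDiffeomorph I I' ∞ j)
    {Q : Type*} [TopologicalSpace Q] [ChartedSpace H₁ Q] {f : Q → M} (hf : Continuous f)
    (h : IsLocalDiffeomorph I'' I' ∞ (j ∘ f)) : IsLocalDiffeomorph I'' I ∞ f := fun x =>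
  IsLocalDiffeomorphAt.of_comp_left (hj (f x)) hf.continuousAt (h x)

/-- The product of the identity and a local diffeomorphism is a local diffeomorphism. -/
theorem IsLocalDiffeomorph.id_prodMap {V₀ : Type} [NormedAddCommGroup V₀] [NormedSpace ℝ V₀]
    {H₀ : Type} [TopologicalSpace H₀] (I₀ : ModelWithCorners ℝ V₀ H₀) (M₀ : Type*)
    [TopologicalSpace M₀] [ChartedSpace H₀ M₀] {j : M → M'} (hj : IsLocalDiffeomorph I I' ∞ j) :
    IsLocalDiffeomorph (I₀.prod I) (I₀.prod I') ∞ (Prod.map (id : M₀ → M₀) j) := by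
  intro p
  obtain ⟨Φ, hx, hΦ⟩ := hj p.2
  let Ψ := (OpenPartialHomeomorph.refl M₀).prod Φ.toOpenPartialHomeomorph
  refine ⟨{ toPartialEquiv := Ψ.toPartialEquiv
            open_source := Ψ.open_source
            open_target := Ψ.open_target
            contMDiffOn_toFun := contMDiffOn_id.prodMap Φ.contMDiffOn_toFun
            contMDiffOn_invFun := contMDiffOn_id.prodMap Φ.contMDiffOn_invFun },
    ⟨mem_univ _, hx⟩, ?_⟩
  rintro ⟨t, y⟩ ⟨-, hy⟩
  exact Prod.ext rfl (hΦ hy)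

/-- Immersions are invariant under local diffeomorphisms of source and target. -/
theorem isImmersionAtOfComplement_of_isLocalDiffeomorphAt {F : Type*} [NormedAddCommGroup F]
    [NormedSpace ℝ F] [IsManifold I ∞ M] [IsManifold I' ∞ M']
    [IsManifold I ∞ M₁]
    [IsManifold I' ∞ M₁'] {f : M → M'} {f₁ : M₁ → M₁'} {k : M₁ → M} {j : M₁' → M'} {x : M₁}
    (hk : IsLocalDiffeomorphAt I I ∞ k x) (hj : IsLocalDiffeomorphAt I' I' ∞ j (f₁ x))
    (hf₁ : ContinuousAt f₁ x) (hc : ∀ y, f (k y) = j (f₁ y))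
    (hF : IsImmersionAtOfComplement F I I' ∞ f (k x)) :
    IsImmersionAtOfComplement F I I' ∞ f₁ x := by
  obtain ⟨Φ, hxΦ, hΦ⟩ := hk
  obtain ⟨Ψ, hxΨ, hΨ⟩ := hj
  obtain ⟨O, hO, hOo, hxO⟩ := eventually_nhds_iff.1 (hf₁.eventually (Ψ.open_source.mem_nhds hxΨ))
  let e := (Φ.toOpenPartialHomeomorph.restrOpen O hOo) ≫ₕ hF.domChart
  let e' := Ψ.toOpenPartialHomeomorph ≫ₕ hF.codChart
  have hkx : Φ x = k x := (hΦ hxΦ).symm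
  have hjx : Ψ (f₁ x) = f (k x) := (hΨ hxΨ).symm.trans (hc x).symm
  refine IsImmersionAtOfComplement.mk_of_continuousAt hf₁ hF.equiv e e' ?_ ?_ ?_ ?_ ?_
  · refine ⟨⟨hxΦ, hxO⟩, ?_⟩
    change Φ x ∈ hF.domChart.source
    rw [hkx]
    exact hF.mem_domChart_source
  · refine ⟨hxΨ, ?_⟩
    change Ψ (f₁ x) ∈ hF.codChart.source
    rw [hjx]
    exact hF.mem_codChart_source
  · refine OpenPartialHomeomorph.mem_maximalAtlas_of_contMDiffOn _ ?_ ?_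
    · exact (contMDiffOn_of_mem_maximalAtlas hF.domChart_mem_maximalAtlas).comp
        (Φ.contMDiffOn_toFun.mono fun y hy => hy.1.1) fun y hy => hy.2
    · exact (Φ.contMDiffOn_invFun.mono inter_subset_left).comp
        ((contMDiffOn_symm_of_mem_maximalAtlas hF.domChart_mem_maximalAtlas).mono
          fun y hy => hy.1) fun y hy => hy.2
  · refine OpenPartialHomeomorph.mem_maximalAtlas_of_contMDiffOn _ ?_ ?_
    · exact (contMDiffOn_of_mem_maximalAtlas hF.codChart_mem_maximalAtlas).comp
        (Ψ.contMDiffOn_toFun.mono fun y hy => hy.1) fun y hy => hy.2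
    · exact Ψ.contMDiffOn_invFun.comp
        ((contMDiffOn_symm_of_mem_maximalAtlas hF.codChart_mem_maximalAtlas).mono
          fun y hy => hy.1) fun y hy => hy.2
  · intro v hv
    rw [OpenPartialHomeomorph.extend_target] at hv
    have hve : I.symm v ∈ e.target := hv.1
    have h2 : e.symm (I.symm v) ∈ e.source := e.map_target hve
    have h3 : Ψ (f₁ (e.symm (I.symm v))) = f (k (e.symm (I.symm v))) :=
      (hΨ (hO _ h2.1.2)).symm.trans (hc _).symm
    have h4 : k (e.symm (I.symm v)) = hF.domChart.symm (I.symm v) :=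
      (hΦ h2.1.1).trans (Φ.right_inv' hve.2.1)
    have h5 : v ∈ (hF.domChart.extend I).target := by
      rw [OpenPartialHomeomorph.extend_target]
      exact ⟨hve.1, hv.2⟩
    refine Eq.trans ?_ (hF.writtenInCharts h5)
    change I' (hF.codChart (Ψ (f₁ (e.symm (I.symm v))))) =
      I' (hF.codChart (f (hF.domChart.symm (I.symm v))))
    rw [h3, h4]

end LocalDiffeomorph

/-! ### The smoothness conditions on coordinate changes -/

section SmoothLift

variable {V V' W : Type} [NormedAddCommGroup V] [NormedSpace ℝ V]
  [NormedAddCommGroup V'] [NormedSpace ℝ V'] [NormedAddCommGroup W] [NormedSpace ℝ W]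
  {H H' G : Type} [TopologicalSpace H] [TopologicalSpace H'] [TopologicalSpace G]
  {J : ModelWithCorners ℝ W G} {I : ModelWithCorners ℝ V H} {I' : ModelWithCorners ℝ V' H'}
  {L M M' L₁ M₁ M₁' : Type*} [TopologicalSpace L] [TopologicalSpace M] [TopologicalSpace M']
  [ChartedSpace G L] [ChartedSpace H M] [ChartedSpace H' M']
  {E E' : Type*} [NormedAddCommGroup E] [NormedSpace ℝ E] [NormedAddCommGroup E'] [NormedSpace ℝ E']

variable (J I I') in
/-- The smoothness requirements on a coordinate change, for a lifted domain that is given by a map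
`ι` to the domain of the larger chart. -/
structure IsSmoothLift (inc : E →ₗ[ℝ] E') (ι : L → M') (ρ : L → M) (s : M → E) (s' : M' → E') :
    Prop where
  emb : IsSmoothEmbedding J I' ∞ ι
  loc : IsLocalDiffeomorph J I ∞ ρ
  ker : ∀ (u : L) (ξ : V'), (mfderiv I' 𝓘(ℝ, E') s' (ι u) : V' →L[ℝ] E') ξ = 0 ↔
    ∃ η : W, (mfderiv J 𝓘(ℝ, E) (fun y => s (ρ y)) u : W →L[ℝ] E) η = 0 ∧
      (mfderiv J I' ι u : W →L[ℝ] V') η = ξ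
  coker : ∀ (u : L) (C : Submodule ℝ E),
    IsCompl (LinearMap.range (mfderiv J 𝓘(ℝ, E) (fun y => s (ρ y)) u : W →L[ℝ] E).toLinearMap) C →
    IsCompl (LinearMap.range (mfderiv I' 𝓘(ℝ, E') s' (ι u) : V' →L[ℝ] E').toLinearMap) (C.map inc)

/-- The smoothness conditions are invariant under local diffeomorphisms. -/
theorem IsSmoothLift.of_isLocalDiffeomorph [TopologicalSpace L₁] [TopologicalSpace M₁]
    [TopologicalSpace M₁'] [ChartedSpace G L₁] [ChartedSpace H M₁] [ChartedSpace H' M₁']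
    [IsManifold J ∞ L] [IsManifold I' ∞ M'] [IsManifold J ∞ L₁] [IsManifold I' ∞ M₁']
    {inc : E →ₗ[ℝ] E'} {ι : L → M'} {ρ : L → M} {s : M → E} {s' : M' → E'}
    (h : IsSmoothLift J I I' inc ι ρ s s') (hs : ContMDiff I 𝓘(ℝ, E) ∞ s)
    (hs' : ContMDiff I' 𝓘(ℝ, E') ∞ s') {k : L₁ → L} {j : M₁ → M} {j' : M₁' → M'}
    (hk : IsLocalDiffeomorph J J ∞ k) (hj : IsLocalDiffeomorph I I ∞ j)
    (hj' : IsLocalDiffeomorph I' I' ∞ j') {ι₁ : L₁ → M₁'} {ρ₁ : L₁ → M₁} {s₁ : M₁ → E}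
    {s₁' : M₁' → E'} (hι₁ : IsEmbedding ι₁) (hρ₁ : Continuous ρ₁)
    (hι : ∀ y, ι (k y) = j' (ι₁ y)) (hρ : ∀ y, ρ (k y) = j (ρ₁ y)) (hss : ∀ x, s₁ x = s (j x))
    (hss' : ∀ x, s₁' x = s' (j' x)) : IsSmoothLift J I I' inc ι₁ ρ₁ s₁ s₁' := by
  have h0 : (∞ : WithTop ℕ∞) ≠ 0 := by simp
  refine ⟨⟨?_, hι₁⟩, ?_, ?_, ?_⟩
  · obtain ⟨F, i1, i2, hF⟩ := h.emb.isImmersion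
    exact ⟨F, i1, i2, fun x => isImmersionAtOfComplement_of_isLocalDiffeomorphAt (hk x) (hj' (ι₁ x))
      hι₁.continuous.continuousAt hι (hF (k x))⟩
  · refine IsLocalDiffeomorph.of_comp_left hj hρ₁ fun x => ?_
    have h1 := IsLocalDiffeomorphAt.comp (hf := hk x) (hg := h.loc (k x))
    have h2 : ρ ∘ k = j ∘ ρ₁ := funext hρ
    rwa [h2] at h1
  all_goals
    intro u
    have hk' : MDifferentiableAt J J k u := hk.mdifferentiable h0 u
    have hj'' : MDifferentiableAt I' I' j' (ι₁ u) := hj'.mdifferentiable h0 _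
    have hsd : MDifferentiableAt I' 𝓘(ℝ, E') s' (j' (ι₁ u)) := hs'.mdifferentiable h0 _
    have hιd : MDifferentiableAt J I' ι (k u) := h.emb.contMDiff.mdifferentiable h0 _
    have hρd : MDifferentiableAt J 𝓘(ℝ, E) (fun y => s (ρ y)) (k u) :=
      (hs.comp h.loc.contMDiff).mdifferentiable h0 _
    have hι₁d : MDifferentiableAt J I' ι₁ u := by
      have h1 : ContMDiff J I' ∞ ι₁ := by
        refine contMDiff_of_comp_isLocalDiffeomorph hj' hι₁.continuous ?_
        have h2 : j' ∘ ι₁ = ι ∘ k := funext fun y => (hι y).symm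
        rw [h2]
        exact h.emb.contMDiff.comp hk.contMDiff
      exact h1.mdifferentiable h0 u
    -- the differentials are conjugate under those of `k` and `j'`
    let A : W →L[ℝ] E := mfderiv J 𝓘(ℝ, E) (fun y => s (ρ y)) (k u)
    let B : V' →L[ℝ] E' := mfderiv I' 𝓘(ℝ, E') s' (ι (k u))
    let D : W →L[ℝ] V' := mfderiv J I' ι (k u)
    let A₁ : W →L[ℝ] E := mfderiv J 𝓘(ℝ, E) (fun y => s₁ (ρ₁ y)) u
    let B₁ : V' →L[ℝ] E' := mfderiv I' 𝓘(ℝ, E') s₁' (ι₁ u)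
    let D₁ : W →L[ℝ] V' := mfderiv J I' ι₁ u
    let κ : W ≃L[ℝ] W := hk.mfderivToContinuousLinearEquiv h0 u
    let χ : V' ≃L[ℝ] V' := hj'.mfderivToContinuousLinearEquiv h0 (ι₁ u)
    have hA : ∀ η, A₁ η = A (κ η) := fun η => by
      have h1 : (fun y => s₁ (ρ₁ y)) = (fun y => s (ρ y)) ∘ k := funext fun y => by
        rw [Function.comp_apply, hss, hρ]
      have h2 : (mfderiv J 𝓘(ℝ, E) ((fun y => s (ρ y)) ∘ k) u : W →L[ℝ] E) =
        A.comp (κ : W →L[ℝ] W) := mfderiv_comp u hρd hk'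
      rw [← h1] at h2
      exact congrArg (fun T : W →L[ℝ] E => T η) h2
    have hB : ∀ ξ, B₁ ξ = B (χ ξ) := fun ξ => by
      have h1 : s₁' = s' ∘ j' := funext hss'
      have h2 : (mfderiv I' 𝓘(ℝ, E') (s' ∘ j') (ι₁ u) : V' →L[ℝ] E') =
        (mfderiv I' 𝓘(ℝ, E') s' (j' (ι₁ u)) : V' →L[ℝ] E').comp (χ : V' →L[ℝ] V') :=
        mfderiv_comp (ι₁ u) hsd hj''
      rw [← h1] at h2
      let Bf : M' → (V' →L[ℝ] E') := fun x => mfderiv I' 𝓘(ℝ, E') s' x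
      have h3 : B = Bf (j' (ι₁ u)) := congrArg Bf (hι u)
      rw [h3]
      exact congrArg (fun T : V' →L[ℝ] E' => T ξ) h2
    have hD : ∀ η, χ (D₁ η) = D (κ η) := fun η => by
      have h1 : j' ∘ ι₁ = ι ∘ k := funext fun y => (hι y).symm
      have h2 : (mfderiv J I' (j' ∘ ι₁) u : W →L[ℝ] V') = (χ : V' →L[ℝ] V').comp D₁ :=
        mfderiv_comp u hj'' hι₁d
      have h3 : (mfderiv J I' (ι ∘ k) u : W →L[ℝ] V') = D.comp (κ : W →L[ℝ] W) :=
        mfderiv_comp u hιd hk'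
      rw [h1, h3] at h2
      exact (congrArg (fun T : W →L[ℝ] V' => T η) h2).symm
  · intro ξ
    change B₁ ξ = 0 ↔ ∃ η, A₁ η = 0 ∧ D₁ η = ξ
    rw [hB]
    refine (h.ker (k u) (χ ξ)).trans ?_
    constructor
    · rintro ⟨η, h1, h2⟩
      refine ⟨κ.symm η, ?_, χ.injective ?_⟩
      · rw [hA, κ.apply_symm_apply]
        exact h1
      · rw [hD, κ.apply_symm_apply]
        exact h2
    · rintro ⟨η, h1, h2⟩
      exact ⟨κ η, (hA η).symm.trans h1, (hD η).symm.trans (congrArg χ h2)⟩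
  · intro C hC
    have hrA : LinearMap.range A₁.toLinearMap = LinearMap.range A.toLinearMap := by
      ext e
      constructor
      · rintro ⟨η, rfl⟩
        exact ⟨κ η, (hA η).symm⟩
      · rintro ⟨η, rfl⟩
        exact ⟨κ.symm η, (hA _).trans (congrArg A (κ.apply_symm_apply η))⟩
    have hrB : LinearMap.range B₁.toLinearMap = LinearMap.range B.toLinearMap := by
      ext e
      constructor
      · rintro ⟨η, rfl⟩
        exact ⟨χ η, (hB η).symm⟩
      · rintro ⟨η, rfl⟩
        exact ⟨χ.symm η, (hB _).trans (congrArg B (χ.apply_symm_apply η))⟩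
    change IsCompl (LinearMap.range B₁.toLinearMap) _
    rw [hrB]
    refine h.coker (k u) C ?_
    change IsCompl (LinearMap.range A.toLinearMap) C
    rw [← hrA]
    exact hC

theorem mfderiv_comp_snd {V₀ : Type} [NormedAddCommGroup V₀] [NormedSpace ℝ V₀] {H₀ : Type}
    [TopologicalSpace H₀] {I₀ : ModelWithCorners ℝ V₀ H₀} {M₀ : Type*} [TopologicalSpace M₀]
    [ChartedSpace H₀ M₀] {f : M → E} (p : M₀ × M) (hf : MDifferentiableAt I 𝓘(ℝ, E) f p.2)
    (η : V₀ × V) :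
    (mfderiv (I₀.prod I) 𝓘(ℝ, E) (fun q : M₀ × M => f q.2) p : V₀ × V →L[ℝ] E) η =
      (mfderiv I 𝓘(ℝ, E) f p.2 : V →L[ℝ] E) η.2 := by
  have h1 := mfderiv_comp (I := I₀.prod I) (f := fun q : M₀ × M => q.2) (g := f) p hf
    mdifferentiableAt_snd
  have h2 := congrArg (fun T : V₀ × V →L[ℝ] E => T η) h1
  refine h2.trans ?_
  have h3 : (mfderiv (I₀.prod I) I (fun q : M₀ × M => q.2) p : V₀ × V →L[ℝ] V) η = η.2 :=
    congrArg (fun T : V₀ × V →L[ℝ] V => T η) (mfderiv_snd (I := I₀) (I' := I) (x := p))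
  exact congrArg (mfderiv I 𝓘(ℝ, E) f p.2 : V →L[ℝ] E) h3

/-- The product of a coordinate change with a manifold satisfies the smoothness conditions. -/
theorem IsSmoothLift.prod {V₀ : Type} [NormedAddCommGroup V₀] [NormedSpace ℝ V₀] {H₀ : Type}
    [TopologicalSpace H₀] (I₀ : ModelWithCorners ℝ V₀ H₀) (M₀ : Type*) [TopologicalSpace M₀]
    [ChartedSpace H₀ M₀] [IsManifold I₀ ∞ M₀] [IsManifold J ∞ L] [IsManifold I' ∞ M']
    {inc : E →ₗ[ℝ] E'} {ι : L → M'} {ρ : L → M} {s : M → E} {s' : M' → E'}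
    (h : IsSmoothLift J I I' inc ι ρ s s') (hs : ContMDiff I 𝓘(ℝ, E) ∞ s)
    (hs' : ContMDiff I' 𝓘(ℝ, E') ∞ s') :
    IsSmoothLift (I₀.prod J) (I₀.prod I) (I₀.prod I') inc (Prod.map (id : M₀ → M₀) ι)
      (Prod.map (id : M₀ → M₀) ρ) (fun p => s p.2) (fun p => s' p.2) := by
  have h0 : (∞ : WithTop ℕ∞) ≠ 0 := by simp
  refine ⟨IsSmoothEmbedding.id.prodMap h.emb, IsLocalDiffeomorph.id_prodMap I₀ M₀ h.loc, ?_, ?_⟩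
  all_goals
    rintro p
    have hρd : MDifferentiableAt J 𝓘(ℝ, E) (fun y => s (ρ y)) p.2 :=
      (hs.comp h.loc.contMDiff).mdifferentiable h0 _
    have hsd : MDifferentiableAt I' 𝓘(ℝ, E') s' (ι p.2) := hs'.mdifferentiable h0 _
    have hιd : MDifferentiableAt J I' ι p.2 := h.emb.contMDiff.mdifferentiable h0 _
    let A : W →L[ℝ] E := mfderiv J 𝓘(ℝ, E) (fun y => s (ρ y)) p.2
    let B : V' →L[ℝ] E' := mfderiv I' 𝓘(ℝ, E') s' (ι p.2)
    let D : W →L[ℝ] V' := mfderiv J I' ι p.2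
    let A₁ : V₀ × W →L[ℝ] E := mfderiv (I₀.prod J) 𝓘(ℝ, E) (fun q : M₀ × L => s (ρ q.2)) p
    let B₁ : V₀ × V' →L[ℝ] E' := mfderiv (I₀.prod I') 𝓘(ℝ, E') (fun q : M₀ × M' => s' q.2)
      (Prod.map id ι p)
    let D₁ : V₀ × W →L[ℝ] V₀ × V' := mfderiv (I₀.prod J) (I₀.prod I') (Prod.map (id : M₀ → M₀) ι) p
    have hA : ∀ η, A₁ η = A η.2 := fun η => mfderiv_comp_snd (f := fun y => s (ρ y)) p hρd η
    have hB : ∀ ξ, B₁ ξ = B ξ.2 := fun ξ => mfderiv_comp_snd (Prod.map id ι p) hsd ξ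
    have hD : ∀ η, D₁ η = (η.1, D η.2) := fun η => by
      have h1 := mfderiv_prodMap (p := p) (mdifferentiableAt_id (I := I₀)) hιd
      refine (congrArg (fun T : V₀ × W →L[ℝ] V₀ × V' => T η) h1).trans ?_
      refine Prod.ext ?_ rfl
      exact congrArg (fun T : V₀ →L[ℝ] V₀ => T η.1) (mfderiv_id (I := I₀) (x := p.1))
  · intro ξ
    change B₁ ξ = 0 ↔ ∃ η, A₁ η = 0 ∧ D₁ η = ξ
    rw [hB]
    refine (h.ker p.2 ξ.2).trans ?_
    constructor
    · rintro ⟨η, h1, h2⟩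
      refine ⟨(ξ.1, η), (hA _).trans h1, (hD _).trans (Prod.ext rfl h2)⟩
    · rintro ⟨η, h1, h2⟩
      refine ⟨η.2, (hA η).symm.trans h1, ?_⟩
      rw [← h2, hD]
      rfl
  · intro C hC
    have hrA : LinearMap.range A₁.toLinearMap = LinearMap.range A.toLinearMap := by
      ext e
      constructor
      · rintro ⟨η, rfl⟩
        exact ⟨η.2, (hA η).symm⟩
      · rintro ⟨η, rfl⟩
        exact ⟨(0, η), hA _⟩
    have hrB : LinearMap.range B₁.toLinearMap = LinearMap.range B.toLinearMap := by
      ext e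
      constructor
      · rintro ⟨η, rfl⟩
        exact ⟨η.2, (hB η).symm⟩
      · rintro ⟨η, rfl⟩
        exact ⟨(0, η), hB _⟩
    change IsCompl (LinearMap.range B₁.toLinearMap) _
    rw [hrB]
    refine h.coker p.2 C ?_
    change IsCompl (LinearMap.range A.toLinearMap) C
    rw [← hrA]
    exact hC

end SmoothLift

/-! ### Restrictions of charts and systems to subdomains -/

section

variable {X : Type u} [TopologicalSpace X] {G : Type w} [Group G] {E : Type w}
  [NormedAddCommGroup E] [NormedSpace ℝ E] {τ : Representation ℝ G E}

/-- An open continuous map whose fibres are the classes of an equivalence relation induces an open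
embedding of the quotient. -/
theorem isOpenEmbedding_quotient_lift {Z Y : Type*} [TopologicalSpace Z] [TopologicalSpace Y]
    {r : Setoid Z} {f : Z → Y} (hf : Continuous f) (hf' : IsOpenMap f)
    (h : ∀ x y, r x y ↔ f x = f y) :
    IsOpenEmbedding (Quotient.lift f fun x y hxy => (h x y).1 hxy) := by
  refine .of_continuous_injective_isOpenMap (hf.quotient_lift _) ?_ fun O hO => ?_
  · rintro ⟨x⟩ ⟨y⟩ hxy
    exact Quotient.sound ((h x y).2 hxy)
  · have h1 := hf' _ (hO.preimage (continuous_quotient_mk' (s := r)))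
    convert h1 using 1
    ext p
    constructor
    · rintro ⟨⟨x⟩, hx, rfl⟩
      exact ⟨x, hx, rfl⟩
    · rintro ⟨x, hx, rfl⟩
      exact ⟨_, hx, rfl⟩

namespace Chart

variable (c : Chart.{u, v, w} X τ)

/-- The restriction of a chart to an invariant open subset of its domain. -/
def restrict (V : Set c.U) (hV : IsOpen V) (hVs : ∀ (g : G), ∀ x ∈ V, g • x ∈ V) :
    Chart.{u, v, w} X τ :=
  have hloc := c.smooth.isLocalDiffeomorph_pullback Subtype.val hV.isOpenEmbedding_subtypeVal
  let _ : MulAction G V :=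
    { smul := fun g x => ⟨g • x.1, hVs g x.1 x.2⟩
      one_smul := fun x => Subtype.ext (one_smul G x.1)
      mul_smul := fun g h x => Subtype.ext (mul_smul g h x.1) }
  have hψ : ∀ x y : {u : V // c.s u.1 = 0},
      (MulAction.orbitRel G V).comap Subtype.val x y ↔ c.ψ ⟨x.1.1, x.2⟩ = c.ψ ⟨y.1.1, y.2⟩ :=
    fun x y => by
      rw [c.ψ_eq_iff]
      constructor
      · rintro ⟨g, hg⟩
        exact ⟨g⁻¹, by rw [← congrArg Subtype.val hg]; exact inv_smul_smul _ _⟩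
      · rintro ⟨g, hg⟩
        exact ⟨g⁻¹, Subtype.ext (by
          change g⁻¹ • y.1.1 = x.1.1
          rw [← hg]
          exact inv_smul_smul _ _)⟩
  { U := V
    smooth := c.smooth.pullback Subtype.val hV.isOpenEmbedding_subtypeVal
    smooth_smul := fun g => by
      refine contMDiff_of_comp_isLocalDiffeomorph hloc ?_
        ((c.smooth_smul g).comp hloc.contMDiff)
      exact ((c.continuous_smul g).comp continuous_subtype_val).subtype_mk _
    s := fun x => c.s x.1
    s_smooth := c.s_smooth.comp hloc.contMDiff
    s_equiv := fun g x => c.s_equiv g x.1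
    ψ := fun x => c.ψ ⟨x.1.1, x.2⟩
    ψ_inv := fun x y h => (hψ x y).1 h
    ψ_homeo := by
      refine isOpenEmbedding_quotient_lift (c.continuous_ψ.comp (by fun_prop)) ?_ hψ
      refine c.isOpenMap_ψ.comp ?_
      rintro O hO
      obtain ⟨O', hO', rfl⟩ := isOpen_induced_iff.1 hO
      have h1 := (hV.isOpenEmbedding_subtypeVal.isOpenMap O' hO').preimage
        (continuous_subtype_val (p := fun u : c.U => c.s u = 0))
      convert h1 using 1
      ext z
      constructor
      · rintro ⟨x, hx, rfl⟩
        exact ⟨x.1, hx, rfl⟩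
      · rintro ⟨x, hx, hxz⟩
        exact ⟨⟨x, (congrArg c.s hxz).trans z.2⟩, hx, Subtype.ext hxz⟩ }

/-- The product of a chart with the unit interval. -/
def unitProd : Chart.{u, v, w} (Icc (0 : ℝ) 1 × X) τ :=
  let _ : MulAction G (Icc (0 : ℝ) 1 × c.U) :=
    { smul := fun g p => (p.1, g • p.2)
      one_smul := fun p => Prod.ext rfl (one_smul G p.2)
      mul_smul := fun g h p => Prod.ext rfl (mul_smul g h p.2) }
  have hψ : ∀ x y : {u : Icc (0 : ℝ) 1 × c.U // c.s u.2 = 0},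
      (MulAction.orbitRel G (Icc (0 : ℝ) 1 × c.U)).comap Subtype.val x y ↔
        ((x.1.1, c.ψ ⟨x.1.2, x.2⟩) : Icc (0 : ℝ) 1 × X) = (y.1.1, c.ψ ⟨y.1.2, y.2⟩) :=
    fun x y => by
      rw [Prod.mk.injEq, c.ψ_eq_iff]
      constructor
      · rintro ⟨g, hg⟩
        have h2 : g • y.1.2 = x.1.2 := congrArg Prod.snd hg
        exact ⟨(congrArg Prod.fst hg).symm, g⁻¹,
          (congrArg (g⁻¹ • ·) h2.symm).trans (inv_smul_smul g y.1.2)⟩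
      · rintro ⟨ht, g, hg⟩
        have h2 : g • x.1.2 = y.1.2 := hg
        exact ⟨g⁻¹, Prod.ext ht.symm
          ((congrArg (g⁻¹ • ·) h2.symm).trans (inv_smul_smul g x.1.2))⟩
  { U := Icc (0 : ℝ) 1 × c.U
    smooth := c.smooth.unitProd
    smooth_smul := fun g => contMDiff_id.prodMap (c.smooth_smul g)
    s := fun p => c.s p.2
    s_smooth := c.s_smooth.comp contMDiff_snd
    s_equiv := fun g p => c.s_equiv g p.2
    ψ := fun x => (x.1.1, c.ψ ⟨x.1.2, x.2⟩)
    ψ_inv := fun x y h => (hψ x y).1 h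
    ψ_homeo := by
      refine isOpenEmbedding_quotient_lift ?_ ?_ hψ
      · exact (continuous_fst.comp continuous_subtype_val).prodMk
          (c.continuous_ψ.comp (by fun_prop))
      · intro O hO
        let e : Icc (0 : ℝ) 1 × {u : c.U // c.s u = 0} → {u : Icc (0 : ℝ) 1 × c.U // c.s u.2 = 0} :=
          fun q => ⟨(q.1, q.2.1), q.2.2⟩
        have he : Continuous e := by fun_prop
        have h1 := (IsOpenMap.id.prodMap c.isOpenMap_ψ) _ (hO.preimage he)
        convert h1 using 1
        ext p
        constructor
        · rintro ⟨x, hx, rfl⟩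
          exact ⟨(x.1.1, ⟨x.1.2, x.2⟩), hx, rfl⟩
        · rintro ⟨q, hq, rfl⟩
          exact ⟨_, hq, rfl⟩ }

end Chart

namespace CoordChange

variable {G' : Type w} [Group G'] {E' : Type w} [NormedAddCommGroup E'] [NormedSpace ℝ E']
  {τ' : Representation ℝ G' E'} {K : Chart.{u, v, w} X τ} {K' : Chart.{u, v, w} X τ'}
  {pr : G' →* G} {inc : E →ₗ[ℝ] E'} (c : CoordChange K K' pr inc)

theorem exists_isSmoothLift : ∃ S : SmoothStr c.lift, IsSmoothLift S.I K.smooth.I K'.smooth.I inc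
    (Subtype.val : c.lift → K'.U) c.ρ K.s K'.s := by
  obtain ⟨S, h1, h2, h3⟩ := c.smooth_lift
  exact ⟨S, h1, h2, fun u => (h3 u).1, fun u => (h3 u).2⟩

theorem continuous_ρ : Continuous c.ρ := by
  obtain ⟨S, h⟩ := c.exists_isSmoothLift
  exact h.loc.contMDiff.continuous

/-- The restriction of a coordinate change to subdomains. -/
def restrict (hpr : Function.Surjective pr) {V : Set K.U} (hV : IsOpen V)
    (hVs : ∀ (g : G), ∀ x ∈ V, g • x ∈ V)
    {V' : Set K'.U} (hV' : IsOpen V') (hVs' : ∀ (g : G'), ∀ x ∈ V', g • x ∈ V') :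
    CoordChange (K.restrict V hV hVs) (K'.restrict V' hV' hVs') pr inc where
  dom := {x : V | ∃ y : c.lift, y.1 ∈ V' ∧ c.ρ y = x.1}
  dom_open := by
    obtain ⟨S, h⟩ := c.exists_isSmoothLift
    have h1 := (h.loc.isOpenMap _ (hV'.preimage continuous_subtype_val)).preimage
      (continuous_subtype_val (p := fun x => x ∈ V))
    exact h1
  dom_smul := by
    rintro g x ⟨y, hy, hyx⟩
    obtain ⟨g', rfl⟩ := hpr g
    exact ⟨⟨g' • y.1, c.lift_smul g' y.1 y.2⟩, hVs' _ _ hy,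
      (c.ρ_equiv g' y).trans (congrArg (pr g' • ·) hyx)⟩
  dom_foot := by
    intro z
    constructor
    · rintro ⟨y, hy, hyz⟩
      have hy0 : K'.s y.1 = 0 := by
        rw [c.ρ_s, hyz]
        exact (congrArg inc z.2).trans (map_zero inc)
      have hs : K.s (c.ρ y) = 0 := (congrArg K.s hyz).trans z.2
      refine ⟨⟨⟨y.1, hy⟩, hy0⟩, (c.ρ_ψ y hy0 hs).trans ?_⟩
      exact congrArg K.ψ (Subtype.ext hyz)
    · rintro ⟨y, hy⟩
      have h1 : z.1.1 ∈ c.dom := (c.dom_foot ⟨z.1.1, z.2⟩).2 ⟨⟨y.1.1, y.2⟩, hy⟩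
      rw [← c.ρ_range] at h1
      obtain ⟨y₁, h2⟩ := h1
      have hs : K.s (c.ρ y₁) = 0 := (congrArg K.s h2).trans z.2
      have hy0 : K'.s y₁.1 = 0 := by
        rw [c.ρ_s, hs, map_zero]
      have h3 : K'.ψ ⟨y.1.1, y.2⟩ = K'.ψ ⟨y₁.1, hy0⟩ := by
        rw [c.ρ_ψ y₁ hy0 hs]
        exact Eq.trans hy (congrArg K.ψ (Subtype.ext h2.symm))
      obtain ⟨g, hg⟩ := (K'.ψ_eq_iff _ _).1 h3
      refine ⟨y₁, ?_, h2⟩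
      have h4 : g • y.1.1 = y₁.1 := hg
      rw [← h4]
      exact hVs' _ _ y.1.2
  lift := {y : V' | ∃ hy : y.1 ∈ c.lift, c.ρ ⟨y.1, hy⟩ ∈ V}
  lift_smul := by
    rintro g y ⟨hy, hyV⟩
    exact ⟨c.lift_smul g _ hy,
      Eq.mpr (congrArg (· ∈ V) (c.ρ_equiv g ⟨y.1, hy⟩)) (hVs _ _ hyV)⟩
  lift_free := by
    rintro g hg y ⟨hy, -⟩ h
    exact c.lift_free g hg y.1 hy (congrArg Subtype.val h)
  ρ y := ⟨c.ρ ⟨y.1.1, y.2.choose⟩, y.2.choose_spec⟩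
  ρ_range := by
    ext x
    constructor
    · rintro ⟨y, rfl⟩
      exact ⟨⟨y.1.1, y.2.choose⟩, y.1.2, rfl⟩
    · rintro ⟨y, hy, hyx⟩
      exact ⟨⟨⟨y.1, hy⟩, y.2, by rw [hyx]; exact x.2⟩, Subtype.ext hyx⟩
  ρ_equiv g y := Subtype.ext (c.ρ_equiv g ⟨y.1.1, y.2.choose⟩)
  ρ_fiber y y' := by
    refine Subtype.ext_iff.trans ((c.ρ_fiber _ _).trans (exists_congr fun g => and_congr Iff.rfl
      ?_))
    exact ⟨fun h => Subtype.ext h, fun h => congrArg Subtype.val h⟩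
  ρ_s y := c.ρ_s ⟨y.1.1, y.2.choose⟩
  ρ_ψ y h' h := c.ρ_ψ ⟨y.1.1, y.2.choose⟩ h' h
  smooth_lift := by
    obtain ⟨S, h⟩ := c.exists_isSmoothLift
    let L₁ : Set V' := {y : V' | ∃ hy : y.1 ∈ c.lift, c.ρ ⟨y.1, hy⟩ ∈ V}
    let k : L₁ → c.lift := fun y => ⟨y.1.1, y.2.choose⟩
    have hkc : Continuous k := (continuous_subtype_val.comp continuous_subtype_val).subtype_mk _
    have hk : IsOpenEmbedding k := by
      have hvv : IsEmbedding ((Subtype.val : c.lift → K'.U) ∘ k) :=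
        (IsEmbedding.subtypeVal (p := fun x => x ∈ V')).comp
          (IsEmbedding.subtypeVal (p := fun x => x ∈ L₁))
      refine ⟨.of_comp hkc continuous_subtype_val hvv, ?_⟩
      have e : range k = Subtype.val ⁻¹' V' ∩ c.ρ ⁻¹' V := by
        ext y
        constructor
        · rintro ⟨y, rfl⟩
          exact ⟨y.1.2, y.2.choose_spec⟩
        · rintro ⟨h1, h2⟩
          exact ⟨⟨⟨y.1, h1⟩, y.2, h2⟩, rfl⟩
      rw [e]
      exact (hV'.preimage continuous_subtype_val).inter (hV.preimage c.continuous_ρ)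
    have hj := K.smooth.isLocalDiffeomorph_pullback Subtype.val hV.isOpenEmbedding_subtypeVal
    have hj' := K'.smooth.isLocalDiffeomorph_pullback Subtype.val hV'.isOpenEmbedding_subtypeVal
    let S₁ := S.pullback k hk
    let T := K.smooth.pullback Subtype.val hV.isOpenEmbedding_subtypeVal
    let T' := K'.smooth.pullback Subtype.val hV'.isOpenEmbedding_subtypeVal
    let _ : ChartedSpace S.H L₁ := S₁.charted
    let _ : ChartedSpace K.smooth.H V := T.charted
    let _ : ChartedSpace K'.smooth.H V' := T'.charted
    have _ : IsManifold S.I ∞ L₁ := S₁.manifold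
    have _ : IsManifold K'.smooth.I ∞ V' := T'.manifold
    have h1 := h.of_isLocalDiffeomorph K.s_smooth K'.s_smooth
      (S.isLocalDiffeomorph_pullback k hk) hj hj' (ι₁ := (Subtype.val : L₁ → V'))
      (ρ₁ := fun y : L₁ => (⟨c.ρ (k y), y.2.choose_spec⟩ : V)) (s₁ := fun x => K.s x.1)
      (s₁' := fun x => K'.s x.1) .subtypeVal ((c.continuous_ρ.comp hkc).subtype_mk _)
      (fun _ => rfl) (fun _ => rfl) (fun _ => rfl) (fun _ => rfl)
    exact ⟨S₁, h1.emb, h1.loc, fun u => ⟨h1.ker u, h1.coker u⟩⟩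

/-- The product of a coordinate change with the unit interval. -/
def unitProd : CoordChange K.unitProd K'.unitProd pr inc where
  dom := {p : Icc (0 : ℝ) 1 × K.U | p.2 ∈ c.dom}
  dom_open := c.dom_open.preimage continuous_snd
  dom_smul g p hp := c.dom_smul g p.2 hp
  dom_foot z := by
    refine (c.dom_foot ⟨z.1.2, z.2⟩).trans ?_
    constructor
    · rintro ⟨y, hy⟩
      exact ⟨⟨(z.1.1, y.1), y.2⟩, Prod.ext rfl hy⟩
    · rintro ⟨y, hy⟩
      exact ⟨⟨y.1.2, y.2⟩, congrArg Prod.snd hy⟩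
  lift := {p : Icc (0 : ℝ) 1 × K'.U | p.2 ∈ c.lift}
  lift_smul g p hp := c.lift_smul g p.2 hp
  lift_free g hg p hp h := c.lift_free g hg p.2 hp (congrArg Prod.snd h)
  ρ p := (p.1.1, c.ρ ⟨p.1.2, p.2⟩)
  ρ_range := by
    ext p
    constructor
    · rintro ⟨q, rfl⟩
      exact c.ρ_range ▸ mem_range_self (f := c.ρ) ⟨q.1.2, q.2⟩
    · intro hp
      have hp' : p.2 ∈ range c.ρ := c.ρ_range.symm ▸ hp
      obtain ⟨y, hy⟩ := hp'
      exact ⟨⟨(p.1, y.1), y.2⟩, Prod.ext rfl hy⟩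
  ρ_equiv g p := Prod.ext rfl (c.ρ_equiv g ⟨p.1.2, p.2⟩)
  ρ_fiber p q := by
    constructor
    · intro h
      obtain ⟨g, hg, hgp⟩ := (c.ρ_fiber _ _).1 (congrArg Prod.snd h)
      exact ⟨g, hg, Prod.ext (congrArg Prod.fst h :) hgp⟩
    · rintro ⟨g, hg, hgp⟩
      exact Prod.ext (congrArg Prod.fst hgp :)
        ((c.ρ_fiber ⟨p.1.2, p.2⟩ ⟨q.1.2, q.2⟩).2 ⟨g, hg, congrArg Prod.snd hgp⟩)
  ρ_s p := c.ρ_s ⟨p.1.2, p.2⟩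
  ρ_ψ p h' h := Prod.ext rfl (c.ρ_ψ ⟨p.1.2, p.2⟩ h' h)
  smooth_lift := by
    obtain ⟨S, h⟩ := c.exists_isSmoothLift
    let L₁ : Set (Icc (0 : ℝ) 1 × K'.U) := {p | p.2 ∈ c.lift}
    let e : L₁ ≃ₜ Icc (0 : ℝ) 1 × c.lift :=
      { toFun := fun p => (p.1.1, ⟨p.1.2, p.2⟩)
        invFun := fun q => ⟨(q.1, q.2.1), q.2.2⟩
        left_inv := fun _ => rfl
        right_inv := fun _ => rfl
        continuous_toFun := by fun_prop
        continuous_invFun := by fun_prop }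
    have h1 := h.prod (𝓡∂ 1) (Icc (0 : ℝ) 1) K.s_smooth K'.s_smooth
    let S₁ := S.unitProd.pullback e e.isOpenEmbedding
    let _ : ChartedSpace (ModelProd (EuclideanHalfSpace 1) S.H) L₁ := S₁.charted
    have _ : IsManifold ((𝓡∂ 1).prod S.I) ∞ L₁ := S₁.manifold
    have _ : IsManifold ((𝓡∂ 1).prod K.smooth.I) ∞ (Icc (0 : ℝ) 1 × K.U) :=
      K.smooth.unitProd.manifold
    have _ : IsManifold ((𝓡∂ 1).prod K'.smooth.I) ∞ (Icc (0 : ℝ) 1 × K'.U) :=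
      K'.smooth.unitProd.manifold
    have _ : IsManifold ((𝓡∂ 1).prod S.I) ∞ (Icc (0 : ℝ) 1 × c.lift) := S.unitProd.manifold
    have hid : ∀ {M : Type v} [TopologicalSpace M] (S : SmoothStr M),
        IsLocalDiffeomorph S.I S.I ∞ (id : M → M) := fun S =>
      (Diffeomorph.refl S.I _ ∞).isLocalDiffeomorph
    have e₁ : IsLocalDiffeomorph ((𝓡∂ 1).prod K.smooth.I) ((𝓡∂ 1).prod K.smooth.I) ∞
        (id : Icc (0 : ℝ) 1 × K.U → Icc (0 : ℝ) 1 × K.U) := hid K.smooth.unitProd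
    have e₂ : IsLocalDiffeomorph ((𝓡∂ 1).prod K'.smooth.I) ((𝓡∂ 1).prod K'.smooth.I) ∞
        (id : Icc (0 : ℝ) 1 × K'.U → Icc (0 : ℝ) 1 × K'.U) := hid K'.smooth.unitProd
    have h2 := IsSmoothLift.of_isLocalDiffeomorph (J := (𝓡∂ 1).prod S.I) (I := (𝓡∂ 1).prod
      K.smooth.I)
      (I' := (𝓡∂ 1).prod K'.smooth.I) h1
      (K.unitProd.s_smooth) (K'.unitProd.s_smooth) (S.unitProd.isLocalDiffeomorph_pullback e
        e.isOpenEmbedding) e₁ e₂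
      (ι₁ := (Subtype.val : L₁ → Icc (0 : ℝ) 1 × K'.U))
      (ρ₁ := fun p => (p.1.1, c.ρ ⟨p.1.2, p.2⟩)) (s₁ := fun p => K.s p.2)
      (s₁' := fun p => K'.s p.2) .subtypeVal
      ((continuous_fst.comp continuous_subtype_val).prodMk (c.continuous_ρ.comp (by fun_prop)))
      (fun _ => rfl) (fun _ => rfl) (fun _ => rfl) (fun _ => rfl)
    exact ⟨S₁, h2.emb, h2.loc, fun u => ⟨h2.ker u, h2.coker u⟩⟩

end CoordChange

end

/-! ### Restrictions of systems to subdomains -/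

section

variable {N : ℕ} {P : BasicData.{w} N} {X : Type u} [TopologicalSpace X] {d : ℤ}
  {K : WeakSystem.{u, v, w} P X d}

theorem IsIdx.of_subset {N : ℕ} {X : Type u} {F F' : Fin N → Set X} {I : Finset (Fin N)}
    (hI : IsIdx F I)
    (h : ∀ i, F i ⊆ F' i) : IsIdx F' I :=
  ⟨hI.1, hI.2.mono (iInter₂_mono fun i _ => h i)⟩

/-- Invariant open subsets of the chart domains of a system to which it can be restricted without
changing the index set. -/
structure Subdomain (K : WeakSystem.{u, v, w} P X d) where
  /-- the footprints of the restricted basic charts -/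
  F : Fin N → Set X
  cover : ⋃ i, F i = univ
  F_open : ∀ i, IsOpen (F i)
  F_subset : ∀ i, F i ⊆ K.F i
  idx : ∀ I, IsIdx K.F I → IsIdx F I
  V : ∀ I : Idx K.F, Set (K.U I)
  isOpen : ∀ I, IsOpen (V I)
  smul : ∀ I (g : P.ΓI I.1), ∀ x ∈ V I, g • x ∈ V I
  zero : ∀ I (z : {u : K.U I // (K.chart I).s u = 0}),
    z.1 ∈ V I ↔ ∀ i ∈ I.1, (K.chart I).ψ z ∈ F i

namespace Subdomain

/-- The index in the larger system. -/
abbrev up (S : Subdomain K) (I : Idx S.F) : Idx K.F := ⟨I.1, I.2.of_subset S.F_subset⟩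

theorem idx_iff (S : Subdomain K) (I : Finset (Fin N)) : IsIdx K.F I ↔ IsIdx S.F I :=
  ⟨S.idx I, fun h => h.of_subset S.F_subset⟩

end Subdomain

namespace WeakSystem

variable (K) in
/-- The restriction of a system to a subdomain. -/
def restrict (S : Subdomain K) : WeakSystem.{u, v, w} P X d where
  F := S.F
  cover := S.cover
  F_open := S.F_open
  chart I := (K.chart (S.up I)).restrict (S.V (S.up I)) (S.isOpen _) (S.smul (S.up I))
  chart_foot I := by
    ext p
    simp only [mem_iInter]
    constructor
    · rintro ⟨z, rfl⟩ i hi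
      exact (S.zero (S.up I) ⟨z.1.1, z.2⟩).1 z.1.2 i hi
    · intro hp
      obtain ⟨z, hz⟩ := (mem_footprint (K := K) (I := S.up I)).2 fun i hi => S.F_subset i (hp i hi)
      have hzV : z.1 ∈ S.V (S.up I) := (S.zero (S.up I) z).2 fun i hi => hz ▸ hp i hi
      exact ⟨⟨⟨z.1, hzV⟩, z.2⟩, hz⟩
  chart_dim I := K.chart_dim (S.up I)
  change I J h := (K.change (S.up I) (S.up J) h).restrict (P.proj_surjective h.subset)
    (S.isOpen _) (S.smul (S.up I)) (S.isOpen _) (S.smul (S.up J))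
  cocycle I J L hIJ hJL z hIL hz hy := Subtype.ext
    (K.cocycle (S.up I) (S.up J) (S.up L) hIJ hJL z.1 hIL.choose hz.choose hy.choose)

variable {S : Subdomain K}

theorem UIJ_self {I : Idx K.F} {x : K.U I} : x ∈ K.UIJ I I.1 := Or.inl rfl

theorem mem_UIJ {I J : Idx K.F} (h : I.1 ⊂ J.1) {x : K.U I} :
    x ∈ K.UIJ I J.1 ↔ x ∈ (K.change I J h).dom := by
  constructor
  · rintro (e | ⟨_, _, hx⟩)
    · exact absurd e.symm h.ne
    · exact hx
  · exact fun hx => Or.inr ⟨J.2, h, hx⟩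

/-- Tameness of a restriction is implied by the conditions on a tame family: the identities that
define tameness are consequences of their essential halves and the weak cocycle condition. -/
theorem TameFam.isTame_restrict (hV : TameFam K S.V) : (K.restrict S).IsTame := by
  have key : ∀ (I J L : Idx K.F) (hIJ : I.1 ⊂ J.1) (hJL : J.1 ⊂ L.1)
      (w : (K.change I L (hIJ.trans hJL)).lift), w.1 ∈ S.V L →
      ∃ (h1 : w.1 ∈ (K.change J L hJL).lift)
        (h2 : (K.change J L hJL).ρ ⟨w.1, h1⟩ ∈ (K.change I J hIJ).lift),
        (K.change J L hJL).ρ ⟨w.1, h1⟩ ∈ S.V J ∧ (K.change I J hIJ).ρ ⟨_, h2⟩ =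
          (K.change I L (hIJ.trans hJL)).ρ w := by
    intro I J L hIJ hJL w hw
    have hd := lift_subset_deep _ w.2
    obtain ⟨h1, h1V⟩ := hV.image J L hJL w.1 hw (deep_mono hIJ.subset hd)
    obtain ⟨h2, -⟩ := hV.image I J hIJ _ h1V ((ρ_mem_deep hJL ⟨w.1, h1⟩).2 hd)
    exact ⟨h1, h2, h1V, (K.cocycle I J L hIJ hJL w.1 w.2 h1 h2).symm⟩
  constructor
  · intro I J L hIJ hIL
    obtain hIJ | hIJ := hIJ.eq_or_ssubset
    · rw [← hIJ, Finset.union_eq_right.2 hIL]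
      exact inter_eq_right.2 fun x _ => UIJ_self
    obtain hIL | hIL := hIL.eq_or_ssubset
    · rw [← hIL, Finset.union_eq_left.2 hIJ.subset]
      exact inter_eq_left.2 fun x _ => UIJ_self
    apply Subset.antisymm
    · rintro x ⟨hx, hx'⟩
      obtain ⟨y, hy, hyx⟩ := (mem_UIJ hIJ).1 hx
      obtain ⟨z, hz, hzx⟩ := (mem_UIJ hIL).1 hx'
      obtain ⟨M, hM, hIM, w, hw, hwx⟩ := hV.inter _ _ _ hIJ hIL y z hy hz (hyx.trans hzx.symm)
      rw [← hM]
      exact Or.inr ⟨S.idx _ M.2, hIM, w, hw, hwx.trans hyx⟩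
    · rintro x (e | ⟨hM, hIM, w, hw, hwx⟩)
      · exact absurd (e ▸ hIJ.trans_subset Finset.subset_union_left) (ssubset_irrefl _)
      have aux : ∀ J' : Idx S.F, I.1 ⊂ J'.1 → J'.1 ⊆ J.1 ∪ L.1 →
          x ∈ (K.restrict S).UIJ I J'.1 := by
        intro J' hIJ' hJ'
        obtain e | hJ' := hJ'.eq_or_ssubset
        · rw [e]
          exact Or.inr ⟨hM, hIM, w, hw, hwx⟩
        obtain ⟨h1, h2, h1V, h3⟩ := key (S.up I) (S.up J') (S.up ⟨_, hM⟩) hIJ' hJ' w hw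
        exact (mem_UIJ hIJ').2 ⟨⟨_, h2⟩, h1V, h3.trans hwx⟩
      exact ⟨aux J hIJ Finset.subset_union_left, aux L hIL Finset.subset_union_right⟩
  · intro I J L hIJ hJL y
    rw [← mem_deep_iff hIJ.subset]
    obtain e | hJL := hJL.eq_or_ssubset
    · constructor
      · rintro ⟨hy, -⟩
        exact ⟨Or.inl e.symm, lift_subset_deep hIJ hy⟩
      · rintro ⟨-, hy⟩
        obtain ⟨h1, h2⟩ := hV.image (S.up I) (S.up J) hIJ y.1 y.2 hy
        refine ⟨⟨h1, h2⟩, ?_⟩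
        rw [← e]
        exact (mem_UIJ hIJ).2 ⟨⟨y.1, h1⟩, y.2, rfl⟩
    · rw [mem_UIJ hJL]
      constructor
      · rintro ⟨hy, hyL⟩
        refine ⟨?_, lift_subset_deep hIJ hy⟩
        obtain ⟨w, hw, hwy⟩ := (mem_UIJ (hIJ.trans hJL)).1 hyL
        obtain ⟨h1, h2, h1V, h3⟩ := key (S.up I) (S.up J) (S.up L) hIJ hJL w hw
        obtain ⟨hy1, hy2⟩ := hy
        obtain ⟨g, hg, hgy⟩ :=
          ((K.change (S.up I) (S.up J) hIJ).ρ_fiber ⟨_, h2⟩ ⟨y.1, hy1⟩).1 (h3.trans hwy)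
        have h4 : (⟨_, h1V⟩ : (K.restrict S).U J) ∈ ((K.restrict S).change J L hJL).dom :=
          ⟨⟨w.1, h1⟩, hw, rfl⟩
        have h5 := ((K.restrict S).change J L hJL).dom_smul g _ h4
        have e : ∀ q : (K.restrict S).U J, q.1 = y.1 → q = y := fun q hq => Subtype.ext hq
        have h6 := e (((K.restrict S).chart J).act.smul g ⟨_, h1V⟩) hgy
        exact Eq.mp (congrArg (· ∈ ((K.restrict S).change J L hJL).dom) h6) h5
      · rintro ⟨⟨w, hw, hwy⟩, hyd⟩
        obtain ⟨h1, h1V⟩ := hV.image (S.up I) (S.up J) hIJ y.1 y.2 hyd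
        refine ⟨⟨h1, h1V⟩, (mem_UIJ (hIJ.trans hJL)).2 ?_⟩
        have hwd : w.1 ∈ K.deep (S.up L) I.1 :=
          (ρ_mem_deep (K := K) (I := S.up J) (J := S.up L) hJL w).1
          (by rw [hwy]; exact hyd)
        obtain ⟨h2, -⟩ := hV.image (S.up I) (S.up L) (hIJ.trans hJL) w.1 hw hwd
        obtain ⟨h3, h4, -, h5⟩ := key (S.up I) (S.up J) (S.up L) hIJ hJL ⟨w.1, h2⟩ hw
        refine ⟨⟨w.1, h2⟩, hw, h5.symm.trans ?_⟩
        exact congrArg _ (Subtype.ext hwy)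

namespace ShrinkMaps

variable {K₁ K₂ K₃ : WeakSystem.{u, v, w} P X d}

/-- A shrinking of a shrinking is a shrinking. -/
def comp (m : ShrinkMaps K₁ K₂) (m' : ShrinkMaps K₂ K₃) : ShrinkMaps K₁ K₃ where
  F_precompact i := ⟨(m.F_precompact i).1, (m.F_precompact i).2.trans
    (subset_closure.trans (m'.F_precompact i).2)⟩
  idx_iff I := (m'.idx_iff I).trans (m.idx_iff I)
  j I x := m'.j ⟨I.1, (m.idx_iff I.1).2 I.2⟩ (m.j I x)
  j_embedding I := (m'.j_embedding _).comp (m.j_embedding I)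
  j_diffeo I x := IsLocalDiffeomorphAt.comp (hf := m.j_diffeo I x)
    (hg := m'.j_diffeo ⟨I.1, (m.idx_iff I.1).2 I.2⟩ (m.j I x))
  j_equiv I g x := by rw [m.j_equiv, m'.j_equiv ⟨I.1, (m.idx_iff I.1).2 I.2⟩ g]
  j_s I x := (m'.j_s ⟨I.1, (m.idx_iff I.1).2 I.2⟩ _).trans (m.j_s I x)
  j_ψ I x h' h := (m'.j_ψ ⟨I.1, (m.idx_iff I.1).2 I.2⟩ _ ((m.j_s I x).trans h') h).trans
    (m.j_ψ I x h' _)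
  j_precompact I := by
    have := (K₃.chart ⟨I.1, (m'.idx_iff _).2 ((m.idx_iff I.1).2 I.2)⟩).t2
    refine ((m.j_precompact I).image (m'.j_embedding _).continuous).closure_of_subset ?_
    rintro _ ⟨x, rfl⟩
    exact ⟨_, subset_closure (mem_range_self x), rfl⟩
  j_lift I J h y := by
    rw [m.j_lift]
    constructor
    · rintro ⟨h1, x, hx⟩
      obtain ⟨h2, h3⟩ := (m'.j_lift ⟨I.1, (m.idx_iff I.1).2 I.2⟩ ⟨J.1, (m.idx_iff J.1).2 J.2⟩ h _).1
        h1
      refine ⟨h2, x, ?_⟩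
      exact (congrArg (m'.j _) hx).trans (m'.j_ρ _ _ h ⟨_, h1⟩ h2).symm
    · rintro ⟨h2, x, hx⟩
      have h1 := (m'.j_lift ⟨I.1, (m.idx_iff I.1).2 I.2⟩ ⟨J.1, (m.idx_iff J.1).2 J.2⟩ h (m.j J y)).2
        ⟨h2, _, hx⟩
      refine ⟨h1, x, (m'.j_embedding ⟨I.1, (m.idx_iff I.1).2 I.2⟩).injective ?_⟩
      exact Eq.trans hx (m'.j_ρ _ _ h ⟨_, h1⟩ h2)
  j_ρ I J h y hy := by
    have h1 := ((m.j_lift I J h y.1).1 y.2).1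
    refine (m'.j_ρ ⟨I.1, (m.idx_iff I.1).2 I.2⟩ ⟨J.1, (m.idx_iff J.1).2 J.2⟩ h ⟨_, h1⟩ hy).trans ?_
    exact congrArg _ (m.j_ρ I J h y h1)

/-- The index in the smaller system. -/
abbrev down (m : ShrinkMaps K₁ K₂) (I : Idx K₂.F) : Idx K₁.F := ⟨I.1, (m.idx_iff I.1).1 I.2⟩

/-- The images of the chart domains. -/
def dom (m : ShrinkMaps K₁ K₂) (I : Idx K₂.F) : Set (K₂.U I) := range (m.j (m.down I))

theorem mem_deep (m : ShrinkMaps K₁ K₂) {J : Idx K₂.F} {y : K₁.U (m.down J)} {H : Finset (Fin N)} :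
    m.j (m.down J) y ∈ K₂.deep J H ↔ y ∈ K₁.deep (m.down J) H := by
  refine forall₂_congr fun j _ => ?_
  rw [← congrFun (m.j_s (m.down J) y) j]

/-- The chart domains of a tame shrinking form a tame family. -/
theorem tameFam (m : ShrinkMaps K₁ K₂) (h₁ : K₁.IsTame) : TameFam K₂ m.dom where
  isOpen I := (m.j_embedding _).isOpen_range
  smul I g := by
    rintro _ ⟨x, rfl⟩
    exact ⟨g • x, m.j_equiv (m.down I) g x⟩
  image I J h := by
    rintro _ ⟨y, rfl⟩ hy
    have hy' : y ∈ (K₁.change (m.down I) (m.down J) h).lift :=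
      (h₁.mem_lift (I := m.down I) (J := m.down J) h).2 (m.mem_deep.1 hy)
    exact (m.j_lift (m.down I) (m.down J) h y).1 hy'
  inter I J L h h' y z := by
    rintro ⟨y', hy'⟩ ⟨z', hz'⟩ hyz
    obtain ⟨y, hyl⟩ := y
    obtain ⟨z, hzl⟩ := z
    simp only at hy' hz'
    subst hy' hz'
    have hy2 : y' ∈ (K₁.change (m.down I) (m.down J) h).lift :=
      (h₁.mem_lift (I := m.down I) (J := m.down J) h).2 (m.mem_deep.1 (lift_subset_deep h hyl))
    have hz2 : z' ∈ (K₁.change (m.down I) (m.down L) h').lift :=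
      (h₁.mem_lift (I := m.down I) (J := m.down L) h').2 (m.mem_deep.1 (lift_subset_deep h' hzl))
    have ey := m.j_ρ (m.down I) (m.down J) h ⟨y', hy2⟩ hyl
    have ez := m.j_ρ (m.down I) (m.down L) h' ⟨z', hz2⟩ hzl
    have e : (K₁.change (m.down I) (m.down J) h).ρ ⟨y', hy2⟩ =
        (K₁.change (m.down I) (m.down L) h').ρ ⟨z', hz2⟩ :=
      (m.j_embedding (m.down I)).injective (ey.symm.trans (Eq.trans hyz ez))
    have h1 : (K₁.change (m.down I) (m.down J) h).ρ ⟨y', hy2⟩ ∈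
        K₁.UIJ (m.down I) (m.down J).1 ∩ K₁.UIJ (m.down I) (m.down L).1 := by
      refine ⟨(mem_UIJ (I := m.down I) (J := m.down J) h).2
        (ρ_mem_dom (I := m.down I) (J := m.down J) h _), ?_⟩
      rw [e]
      exact (mem_UIJ (I := m.down I) (J := m.down L) h').2
        (ρ_mem_dom (I := m.down I) (J := m.down L) h' _)
    rw [h₁.inter (m.down I) (m.down J) (m.down L) h.subset h'.subset] at h1
    obtain e | ⟨hM, hIM, hx⟩ := h1
    · exact absurd (e ▸ h.trans_subset Finset.subset_union_left) (ssubset_irrefl _)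
    rw [← (K₁.change _ _ _).ρ_range] at hx
    obtain ⟨w, hw⟩ := hx
    have hw2 := ((m.j_lift (m.down I) ⟨_, hM⟩ hIM w.1).1 w.2).1
    refine ⟨⟨_, (m.idx_iff _).2 hM⟩, rfl, hIM, ⟨_, hw2⟩, ⟨w.1, rfl⟩, ?_⟩
    exact (m.j_ρ (m.down I) ⟨_, hM⟩ hIM w hw2).trans ((congrArg _ hw).trans ey.symm)

end ShrinkMaps

/-- The restriction to a precompact subdomain is a shrinking. -/
def restrictShrinkMaps (S : Subdomain K)
    (hF : ∀ i, IsCompact (closure (S.F i)) ∧ closure (S.F i) ⊆ K.F i)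
    (hV : ∀ I, IsCompact (closure (S.V I))) : ShrinkMaps (K.restrict S) K where
  F_precompact := hF
  idx_iff := S.idx_iff
  j _ x := x.1
  j_embedding I := (S.isOpen (S.up I)).isOpenEmbedding_subtypeVal
  j_diffeo I := SmoothStr.isLocalDiffeomorph_pullback _ _ _
  j_equiv _ _ _ := rfl
  j_s _ _ := rfl
  j_ψ _ _ _ _ := rfl
  j_precompact I := by
    have e : range (fun x : (K.restrict S).U I => x.1) = S.V (S.up I) := Subtype.range_coe
    rw [e]
    exact hV _
  j_lift I J h y := by
    refine exists_congr fun hy => ?_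
    have e : range (fun x : (K.restrict S).U I => x.1) = S.V (S.up I) := Subtype.range_coe
    rw [e]
  j_ρ _ _ _ _ _ := rfl

/-- The restriction to a subdomain is a shrinking of the restriction to a larger one that contains
it precompactly. -/
def restrictRestrictShrinkMaps (S S' : Subdomain K)
    (hF : ∀ i, IsCompact (closure (S.F i)) ∧ closure (S.F i) ⊆ S'.F i)
    (hc : ∀ I, IsCompact (closure (S.V I))) (hV : ∀ I, closure (S.V I) ⊆ S'.V I) :
    ShrinkMaps (K.restrict S) (K.restrict S') where
  F_precompact := hF
  idx_iff I := (S'.idx_iff I).symm.trans (S.idx_iff I)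
  j I x := ⟨x.1, hV (S.up I) (subset_closure x.2)⟩
  j_embedding I :=
    IsOpenEmbedding.of_comp _ (S'.isOpen (S.up I)).isOpenEmbedding_subtypeVal
      (S.isOpen (S.up I)).isOpenEmbedding_subtypeVal
  j_diffeo I := by
    refine IsLocalDiffeomorph.of_comp_left (SmoothStr.isLocalDiffeomorph_pullback _ Subtype.val
      (S'.isOpen (S.up I)).isOpenEmbedding_subtypeVal) (by fun_prop) ?_
    exact SmoothStr.isLocalDiffeomorph_pullback _ _ (S.isOpen (S.up I)).isOpenEmbedding_subtypeVal
  j_equiv _ _ _ := rfl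
  j_s _ _ := rfl
  j_ψ _ _ _ _ := rfl
  j_precompact I := by
    have h1 : IsCompact ((Subtype.val : S'.V (S.up I) → K.U (S.up I)) ⁻¹'
        closure (S.V (S.up I))) := by
      rw [IsInducing.subtypeVal.isCompact_iff, Subtype.image_preimage_coe,
        inter_eq_right.2 (hV (S.up I))]
      exact hc _
    have h2 : T2Space ((K.restrict S').U ⟨I.1, S'.idx _ (S.up I).2⟩) := Chart.t2 _
    refine IsCompact.closure_of_subset (X := (K.restrict S').U ⟨I.1, S'.idx _ (S.up I).2⟩) h1 ?_
    rintro _ ⟨x, rfl⟩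
    exact subset_closure x.2
  j_lift I J h y := by
    constructor
    · rintro ⟨h1, h2⟩
      exact ⟨⟨h1, hV (S.up I) (subset_closure h2)⟩, ⟨_, h2⟩, rfl⟩
    · rintro ⟨⟨h1, h2⟩, x, hx⟩
      refine ⟨h1, ?_⟩
      have e : x.1 = (K.change (S.up I) (S.up J) h).ρ ⟨y.1, h1⟩ :=
        congrArg (Subtype.val : S'.V (S.up I) → K.U (S.up I)) hx
      exact Eq.mp (congrArg (· ∈ S.V (S.up I)) e) x.2
  j_ρ _ _ _ _ _ := rfl

end WeakSystem

end

/-! ### Tame shrinkings of atlases -/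

/-- Functions whose positivity sets shrink an open cover, and that exceed `1/2` at finitely many
prescribed points of the members of the cover. -/
theorem exists_continuous_shrinking {X : Type*} [TopologicalSpace X] [NormalSpace X] [T1Space X]
    {N : ℕ} {F : Fin N → Set X} (hF : ∀ i, IsOpen (F i)) (hc : ⋃ i, F i = univ) {T : Set X}
    (hT : T.Finite) :
    ∃ ϑ : Fin N → X → ℝ, (∀ i, Continuous (ϑ i)) ∧ (∀ i p, 0 ≤ ϑ i p → p ∈ F i) ∧
      (∀ p, ∃ i, 1 / 2 < ϑ i p) ∧ ∀ p ∈ T, ∀ i, p ∈ F i → 1 / 2 < ϑ i p := by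
  obtain ⟨v, hv, hvc, hvF⟩ := exists_iUnion_eq_closed_subset hF (fun _ => toFinite _) hc
  have h1 : ∀ i, ∃ f : C(X, ℝ), EqOn f 0 (F i)ᶜ ∧ EqOn f 1 (v i ∪ (T ∩ F i)) ∧
      ∀ x, f x ∈ Icc (0 : ℝ) 1 := fun i => by
    refine exists_continuous_zero_one_of_isClosed (hF i).isClosed_compl
      ((hvc i).union (hT.inter_of_left _).isClosed) ?_
    rw [disjoint_compl_left_iff_subset]
    exact union_subset (hvF i) inter_subset_right
  choose f hf0 hf1 _ using h1
  refine ⟨fun i p => 2 * f i p - 1, fun i => by fun_prop, fun i p hp => ?_, fun p => ?_,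
    fun p hp i hi => ?_⟩
  · by_contra h
    have := hf0 i h
    simp only [Pi.zero_apply] at this
    simp only [this] at hp
    norm_num at hp
  · obtain ⟨i, hi⟩ := mem_iUnion.1 (hv ▸ mem_univ p)
    refine ⟨i, ?_⟩
    have := hf1 i (Or.inl hi)
    simp only [Pi.one_apply] at this
    simp only [this]
    norm_num
  · have := hf1 i (Or.inr ⟨hp, hi⟩)
    simp only [Pi.one_apply] at this
    simp only [this]
    norm_num

section

variable {N : ℕ} {P : BasicData.{w} N} {X : Type u} [TopologicalSpace X] {d : ℤ}
  {K : WeakSystem.{u, v, w} P X d}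

/-- The subdomain is precompact. -/
structure Subdomain.IsPrecompact (S : Subdomain K) : Prop where
  F : ∀ i, closure (S.F i) ⊆ K.F i
  V : ∀ I, IsCompact (closure (S.V I))

/-- The closure of the first subdomain is contained in the second one. -/
structure Subdomain.IsInside (S' S : Subdomain K) : Prop where
  F : ∀ i, closure (S'.F i) ⊆ S.F i
  V : ∀ I, closure (S'.V I) ⊆ S.V I

namespace WeakSystem

/-- There is a finite set that meets all footprints. -/
theorem exists_finite_idx {N : ℕ} {X : Type*} (F : Fin N → Set X) : ∃ T : Set X, T.Finite ∧
    ∀ I, IsIdx F I → ∃ p ∈ T, ∀ i ∈ I, p ∈ F i := by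
  classical
  have h : ∀ I : Idx F, ∃ p : X, ∀ i ∈ I.1, p ∈ F i := fun I => by
    obtain ⟨p, hp⟩ := I.2.2
    exact ⟨p, by simpa using hp⟩
  choose p hp using h
  exact ⟨range p, finite_range p, fun I hI => ⟨_, mem_range_self ⟨I, hI⟩, hp ⟨I, hI⟩⟩⟩

section

variable {ϑ : Fin N → X → ℝ} {θ : Fin N → ∀ I : Idx K.F, K.U I → ℝ}
  {U0 : ∀ I : Idx K.F, Set (K.U I)}

/-- The subdomain given by the family `fam`. -/
def famSubdomain (hϑ : ∀ i, Continuous (ϑ i)) (hF : ∀ i p, 0 ≤ ϑ i p → p ∈ K.F i)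
    (hθ : ∀ i I, IsExtension (ϑ i) (θ i) I) (hU : IsBase K (fun i => {p | 0 ≤ ϑ i p}) θ U0)
    {c ε : ℝ} (hc0 : 0 ≤ c) (hε : 0 < ε) (hc : ∀ p, ∃ i, c < ϑ i p)
    (hi : ∀ I, IsIdx K.F I → ∃ p, ∀ i ∈ I, c < ϑ i p) : Subdomain K where
  F i := {p | c < ϑ i p}
  cover := eq_univ_of_forall fun p => mem_iUnion.2 (hc p)
  F_open i := isOpen_lt continuous_const (hϑ i)
  F_subset i p hp := hF i p (hc0.trans (le_of_lt hp))
  idx I hI := ⟨hI.1, (hi I hI).imp fun p hp => mem_iInter₂.2 hp⟩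
  V := fam θ U0 c ε
  isOpen := isOpen_fam hθ hU c ε
  smul I g x hx := ⟨hU.smul I g x hx.1, fun i hi => by rw [(hθ i I).smul]; exact hx.2.1 i hi,
    by rw [nrm_smul]; exact hx.2.2⟩
  zero I z := mem_fam_zero (hU := hU) hθ hc0 hε z

end

/-- Given functions on the base whose positivity sets shrink the basic footprints, a system with
relatively open lifted domains has tame restrictions to two nested precompact subdomains, whose
footprints are superlevel sets.  They can be found in any neighbourhood of the zero set. -/
theorem exists_tameFam_within [CompactSpace X] [T2Space X] (hK : K.HasOpenLifts)
    {ϑ : Fin N → X → ℝ} (hϑ : ∀ i, Continuous (ϑ i)) (hF : ∀ i p, 0 ≤ ϑ i p → p ∈ K.F i)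
    (hc : ∀ p, ∃ i, 1 / 2 < ϑ i p) (hi : ∀ I, IsIdx K.F I → ∃ p, ∀ i ∈ I, 1 / 2 < ϑ i p)
    {O : ∀ I : Idx K.F, Set (K.U I)} (hO : ∀ I, IsOpen (O I))
    (hO0 : ∀ I (z : {u : K.U I // (K.chart I).s u = 0}),
      (∀ i ∈ I.1, 0 ≤ ϑ i ((K.chart I).ψ z)) → z.1 ∈ O I) :
    ∃ S' S : Subdomain K, (∀ i, S'.F i = {p | 1 / 2 < ϑ i p}) ∧ (∀ i, S.F i = {p | 0 < ϑ i p}) ∧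
      S'.IsInside S ∧ S.IsPrecompact ∧ TameFam K S'.V ∧ TameFam K S.V ∧ ∀ I, S.V I ⊆ O I := by
  have h1 : ∀ i, ∃ θ, ∀ I, IsExtension (ϑ i) θ I := fun i => exists_isExtension hK (hϑ i)
  choose θ hθ using h1
  obtain ⟨U0, hU⟩ := exists_isBase hK hθ (A := fun i => {p | 0 ≤ ϑ i p})
    (fun i => isClosed_le continuous_const (hϑ i)) (fun i p hp => hF i p hp)
  have h2 := eventually_tameFam hθ hF hU
  have h3 : ∀ᶠ ε in 𝓝[>] (0 : ℝ), ∀ I, ∀ x ∈ famClosure θ U0 0 I, nrm I x ≤ ε → x ∈ U0 I := by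
    rw [Filter.eventually_all]
    exact fun I => eventually_famClosure_subset hθ hU 0 I (hU.isOpen I) (hU.zero I)
  have h3' : ∀ᶠ ε in 𝓝[>] (0 : ℝ), ∀ I, ∀ x ∈ famClosure θ U0 0 I, nrm I x ≤ ε → x ∈ O I := by
    rw [Filter.eventually_all]
    exact fun I => eventually_famClosure_subset hθ hU 0 I (hO I) (hO0 I)
  have h4 : Filter.Tendsto (fun ε : ℝ => ε / 2) (𝓝[>] 0) (𝓝[>] 0) := by
    refine tendsto_nhdsWithin_iff.2 ⟨?_, ?_⟩
    · have : Filter.Tendsto (fun ε : ℝ => ε / 2) (𝓝 0) (𝓝 (0 / 2)) := Filter.tendsto_id.div_const 2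
      rw [zero_div] at this
      exact this.mono_left nhdsWithin_le_nhds
    · filter_upwards [self_mem_nhdsWithin] with ε hε
      exact half_pos (show (0 : ℝ) < ε from hε)
  obtain ⟨ε, ⟨⟨⟨ht, ht'⟩, hcl⟩, hclO⟩, hε⟩ :=
    ((((h2.and (h4.eventually h2)).and h3).and h3').and self_mem_nhdsWithin).exists
  have hε' : (0 : ℝ) < ε := hε
  have h0 : (0 : ℝ) < 1 / 2 := by norm_num
  refine ⟨famSubdomain hϑ hF hθ hU h0.le (half_pos hε') hc hi,
    famSubdomain hϑ hF hθ hU le_rfl hε' (fun p => (hc p).imp fun i hi => h0.trans hi)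
      (fun I hI => (hi I hI).imp fun p hp i hi => h0.trans (hp i hi)), fun _ => rfl, fun _ => rfl,
    ⟨?_, ?_⟩, ⟨?_, ?_⟩, ht' _ h0.le, ht 0 le_rfl, fun I x hx =>
      hclO I x (fam_subset_famClosure le_rfl I hx) hx.2.2.le⟩
  · intro i
    refine (closure_lt_subset_le continuous_const (hϑ i)).trans fun p hp => ?_
    exact h0.trans_le hp
  · intro I x hx
    have h5 : IsClosed (famClosure θ U0 (1 / 2) I ∩ {x | nrm I x ≤ ε / 2}) :=
      (isCompact_famClosure hθ hU _ I).isClosed.inter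
        (isClosed_le (continuous_nrm I) continuous_const)
    have h8 : fam θ U0 (1 / 2) (ε / 2) I ⊆ famClosure θ U0 (1 / 2) I ∩ {x | nrm I x ≤ ε / 2} :=
      fun y hy => ⟨fam_subset_famClosure le_rfl I hy, hy.2.2.le⟩
    have h6 := closure_minimal h8 h5 hx
    have h7 : nrm I x < ε := h6.2.trans_lt (half_lt_self hε')
    exact ⟨hcl I x ⟨h6.1.1, fun i hi => h0.le.trans (h6.1.2 i hi)⟩ h7.le,
      fun i hi => h0.trans_le (h6.1.2 i hi), h7⟩
  · intro i
    exact (closure_lt_subset_le continuous_const (hϑ i)).trans fun p hp => hF i p hp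
  · intro I
    have : T2Space (K.U I) := (K.chart I).t2
    exact (isCompact_famClosure hθ hU 0 I).closure_of_subset (fam_subset_famClosure le_rfl I)

/-- A system with relatively open lifted domains has tame restrictions to two nested precompact
subdomains.  Finitely many points of the basic footprints can be kept. -/
theorem exists_tameFam [CompactSpace X] [T2Space X] (hK : K.HasOpenLifts) {T : Set X}
    (hT : T.Finite) :
    ∃ S' S : Subdomain K, S'.IsInside S ∧ S.IsPrecompact ∧ TameFam K S'.V ∧ TameFam K S.V ∧
      ∀ p ∈ T, ∀ i, p ∈ K.F i → p ∈ S'.F i := by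
  obtain ⟨T₀, hT₀, hT₀'⟩ := exists_finite_idx K.F
  obtain ⟨ϑ, hϑ, hF, hc, hp⟩ := exists_continuous_shrinking K.F_open K.cover (hT₀.union hT)
  have hi : ∀ I, IsIdx K.F I → ∃ p, ∀ i ∈ I, 1 / 2 < ϑ i p := fun I hI => by
    obtain ⟨p, hpT, hpI⟩ := hT₀' I hI
    exact ⟨p, fun i hi => hp p (Or.inl hpT) i (hpI i hi)⟩
  obtain ⟨S', S, hS'F, -, hS', hS, ht', ht, -⟩ := exists_tameFam_within hK hϑ hF hc hi
    (fun _ => isOpen_univ) (fun _ _ _ => mem_univ _)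
  exact ⟨S', S, hS', hS, ht', ht, fun p hpT i hpi => by
    rw [hS'F]
    exact hp p (Or.inr hpT) i hpi⟩

/-- The domain of a restricted chart is an open subset, whose boundary is that of the original. -/
theorem mem_boundary_restrict {S : Subdomain K} {I : Idx S.F} (u : (K.restrict S).U I) :
    u ∈ ((K.restrict S).chart I).smooth.I.boundary ((K.restrict S).chart I).U ↔
      u.1 ∈ (K.chart (S.up I)).smooth.I.boundary (K.chart (S.up I)).U := by
  have h : IsLocalDiffeomorph ((K.restrict S).chart I).smooth.I (K.chart (S.up I)).smooth.I ∞
      (fun x => x.1 : (K.restrict S).U I → K.U (S.up I)) :=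
    SmoothStr.isLocalDiffeomorph_pullback _ Subtype.val
      (S.isOpen (S.up I)).isOpenEmbedding_subtypeVal
  exact (h u).isBoundaryPoint_iff (by simp)

end WeakSystem

namespace WeakAtlas

/-- The restriction of a weak atlas to a subdomain. -/
def restrict (K : WeakAtlas.{u, v, w} P X d) (S : Subdomain K.toWeakSystem) :
    WeakAtlas.{u, v, w} P X d where
  toWeakSystem := K.toWeakSystem.restrict S
  boundaryless I := eq_empty_of_forall_notMem fun u hu => by
    have h := (WeakSystem.mem_boundary_restrict (K := K.toWeakSystem) u).1 hu
    rw [K.boundaryless] at h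
    exact h

theorem exists_isPreshrunkTame [CompactSpace X] [T2Space X] (K : WeakAtlas.{u, v, w} P X d) :
    ∃ K' : WeakAtlas.{u, v, w} P X d, K'.IsPreshrunkTame K := by
  obtain ⟨S', S, hS', hS, ht', ht, -⟩ :=
    WeakSystem.exists_tameFam K.hasOpenLifts (T := ∅) finite_empty
  refine ⟨K.restrict S', ht'.isTame_restrict, K.restrict S, ht.isTame_restrict,
    ⟨WeakSystem.restrictShrinkMaps S (fun i => ⟨isClosed_closure.isCompact, hS.F i⟩) hS.V⟩,
    ⟨WeakSystem.restrictRestrictShrinkMaps S' S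
      (fun i => ⟨isClosed_closure.isCompact, hS'.F i⟩) (fun I => ?_) hS'.V⟩⟩
  exact (hS.V I).of_isClosed_subset isClosed_closure
    ((hS'.V I).trans subset_closure)

end WeakAtlas

end

/-! ### Restrictions of cobordisms -/

theorem A_mono (α : Bool) {δ ε : ℝ} (h : δ ≤ ε) : A α δ ⊆ A α ε := fun _ ht => lt_of_lt_of_le ht h

namespace WeakCobordism

variable {N : ℕ} {P : BasicData.{w} N} {Y : Type u} [TopologicalSpace Y] {B : Bool → Type u}
  [∀ α, TopologicalSpace (B α)] {C : CollaredCobordism Y B} {d : ℤ}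
  {K : WeakCobordism.{u, v, w} P C d}

theorem collar_injective {α : Bool} {I : Idx (K.bd α).F} {t t' : Icc (0 : ℝ) 1}
    (ht : t ∈ A α K.width) (ht' : t' ∈ A α K.width) {x x' : (K.bd α).U I}
    (h : K.collar α I (t, x) = K.collar α I (t', x')) : t = t' ∧ x = x' := by
  have h1 := @(K.collar_embedding α I).injective ⟨(t, x), ht, mem_univ _⟩
    ⟨(t', x'), ht', mem_univ _⟩ h
  exact Prod.ext_iff.1 (congrArg Subtype.val h1)

/-- A subdomain of a cobordism that has product form in collars of width `δ`, and weak atlases on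
the boundary components that are identified with the restrictions of the boundary atlases. -/
structure Collaring (K : WeakCobordism.{u, v, w} P C d) (S : Subdomain K.toWeakSystem) where
  δ : ℝ
  δ_pos : 0 < δ
  δ_le : δ ≤ K.width
  bd : ∀ α, WeakAtlas.{u, v, w} P (B α) d
  m : ∀ α, WeakSystem.ShrinkMaps (bd α).toWeakSystem (K.bd α).toWeakSystem
  mem_F : ∀ α, ∀ t ∈ A α δ, ∀ i b, C.collar α (t, b) ∈ S.F i ↔ b ∈ (bd α).F i
  mem_V : ∀ α, ∀ t ∈ A α δ, ∀ (I : Idx (K.bd α).F) x,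
    K.collar α I (t, x) ∈ S.V (K.idx I) ↔ x ∈ (m α).dom I

namespace Collaring

variable {S : Subdomain K.toWeakSystem} (c : Collaring K S)

/-- The time `t` if it belongs to the collar, and otherwise the endpoint. -/
def clamp (α : Bool) (t : Icc (0 : ℝ) 1) : Icc (0 : ℝ) 1 :=
  open Classical in if t ∈ A α c.δ then t else endpt α

theorem clamp_mem (α : Bool) (t : Icc (0 : ℝ) 1) : c.clamp α t ∈ A α c.δ := by
  unfold clamp
  split_ifs with h
  exacts [h, endpt_mem_A α c.δ_pos]

theorem clamp_of_mem {α : Bool} {t : Icc (0 : ℝ) 1} (h : t ∈ A α c.δ) : c.clamp α t = t := if_pos h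

/-- The index of the boundary atlas of the larger cobordism. -/
abbrev up {α : Bool} (I : Idx (c.bd α).F) : Idx (K.bd α).F := ⟨I.1, ((c.m α).idx_iff I.1).2 I.2⟩

theorem sub {α : Bool} {t : Icc (0 : ℝ) 1} (ht : t ∈ A α c.δ) : t ∈ A α K.width :=
  A_mono α c.δ_le ht

/-- The frame of the restricted cobordism. -/
def frame : CobordismFrame.{u, v, w} P C d where
  toWeakSystem := K.toWeakSystem.restrict S
  bd := c.bd
  width := c.δ
  width_pos := c.δ_pos
  width_le := c.δ_le.trans K.width_le
  F_collar := c.mem_F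

/-- The collar of a restricted chart domain. -/
def collar (α : Bool) (I : Idx (c.bd α).F) (p : Icc (0 : ℝ) 1 × (c.bd α).U I) :
    c.frame.U (c.frame.idx I) :=
  ⟨K.collar α (c.up I) (c.clamp α p.1, (c.m α).j I p.2),
    (c.mem_V α _ (c.clamp_mem α p.1) (c.up I) _).2 ⟨p.2, rfl⟩⟩

theorem val_collar {α : Bool} {I : Idx (c.bd α).F} {t : Icc (0 : ℝ) 1} (ht : t ∈ A α c.δ)
    (x : (c.bd α).U I) :
    (c.collar α I (t, x)).1 = K.collar α (c.up I) (t, (c.m α).j I x) := by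
  have h : (c.collar α I (t, x)).1 = K.collar α (c.up I) (c.clamp α t, (c.m α).j I x) := rfl
  rw [h, c.clamp_of_mem ht]

theorem eventually_val_collar {α : Bool} {I : Idx (c.bd α).F} {p : Icc (0 : ℝ) 1 × (c.bd α).U I}
    (hp : p.1 ∈ A α c.δ) : ∀ᶠ q in 𝓝 p, (c.collar α I q).1 =
      K.collar α (c.up I) (Prod.map id ((c.m α).j I) q) := by
  filter_upwards [((isOpen_A α c.δ).preimage continuous_fst).mem_nhds hp] with q hq
  exact c.val_collar hq q.2

theorem collar_embedding (α : Bool) (I : Idx (c.bd α).F) :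
    IsOpenEmbedding ((A α c.δ ×ˢ (univ : Set ((c.bd α).U I))).domRestrict (c.collar α I)) := by
  let k : (A α c.δ ×ˢ (univ : Set ((c.bd α).U I)) : Set (Icc (0 : ℝ) 1 × (c.bd α).U I)) →
      (A α K.width ×ˢ (univ : Set ((K.bd α).U (c.up I))) :
        Set (Icc (0 : ℝ) 1 × (K.bd α).U (c.up I))) :=
    fun p => ⟨(p.1.1, (c.m α).j I p.1.2), c.sub p.2.1, mem_univ _⟩
  have hk : IsOpenEmbedding k := by
    have h1 : IsOpenEmbedding (Prod.map id ((c.m α).j I) :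
        Icc (0 : ℝ) 1 × (c.bd α).U I → Icc (0 : ℝ) 1 × (K.bd α).U (c.up I)) :=
      IsOpenEmbedding.id.prodMap ((c.m α).j_embedding I)
    have h2 : IsOpen (A α c.δ ×ˢ (univ : Set ((c.bd α).U I))) := (isOpen_A α _).prod isOpen_univ
    have h3 : IsOpen (A α K.width ×ˢ (univ : Set ((K.bd α).U (c.up I)))) :=
      (isOpen_A α _).prod isOpen_univ
    exact IsOpenEmbedding.of_comp k h3.isOpenEmbedding_subtypeVal
      (h1.comp h2.isOpenEmbedding_subtypeVal)
  refine IsOpenEmbedding.of_comp (X := _) (Y := c.frame.U (c.frame.idx I)) _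
    (S.isOpen (K.idx (c.up I))).isOpenEmbedding_subtypeVal ?_
  have h4 := (K.collar_embedding α (c.up I)).comp hk
  convert h4 using 1
  funext p
  exact c.val_collar p.2.1 p.1.2

theorem continuousAt_collar {α : Bool} {I : Idx (c.bd α).F} {p : Icc (0 : ℝ) 1 × (c.bd α).U I}
    (hp : p.1 ∈ A α c.δ) : ContinuousAt (c.collar α I) p := by
  have h1 := continuousOn_iff_continuous_domRestrict.2 (c.collar_embedding α I).continuous
  exact h1.continuousAt (((isOpen_A α _).prod isOpen_univ).mem_nhds ⟨hp, mem_univ _⟩)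

theorem collar_diffeo (α : Bool) (I : Idx (c.bd α).F) :
    IsLocalDiffeomorphOn ((c.bd α).chart I).smooth.unitProd.I
      (c.frame.chart (c.frame.idx I)).smooth.I ∞ (c.collar α I) (A α c.δ ×ˢ univ) := by
  rintro ⟨p, hp, -⟩
  have h1 := SmoothStr.isLocalDiffeomorph_pullback (K.chart (K.idx (c.up I))).smooth Subtype.val
      (S.isOpen (K.idx (c.up I))).isOpenEmbedding_subtypeVal
  refine IsLocalDiffeomorphAt.of_comp_left (h1 (c.collar α I p)) (c.continuousAt_collar hp) ?_
  refine IsLocalDiffeomorphAt.congr_of_eventuallyEq ?_ (c.eventually_val_collar hp)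
  have h2 := IsLocalDiffeomorph.id_prodMap (𝓡∂ 1) (Icc (0 : ℝ) 1) ((c.m α).j_diffeo I) p
  have h3 := K.collar_diffeo α (c.up I) ⟨Prod.map id ((c.m α).j I) p, c.sub hp, mem_univ _⟩
  exact IsLocalDiffeomorphAt.comp (hf := h2) (hg := h3)

theorem collar_mem_lift {α : Bool} {I J : Idx (c.bd α).F} (h : I.1 ⊂ J.1) {t : Icc (0 : ℝ) 1}
    (ht : t ∈ A α c.δ) {y : (c.bd α).U J} (hy : y ∈ ((c.bd α).change I J h).lift) :
    c.collar α J (t, y) ∈ (c.frame.change (c.frame.idx I) (c.frame.idx J) h).lift ∧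
      ∀ hy' : c.collar α J (t, y) ∈ (c.frame.change (c.frame.idx I) (c.frame.idx J) h).lift,
        (c.frame.change (c.frame.idx I) (c.frame.idx J) h).ρ ⟨c.collar α J (t, y), hy'⟩ =
          c.collar α I (t, ((c.bd α).change I J h).ρ ⟨y, hy⟩) := by
  obtain ⟨h1, -⟩ := ((c.m α).j_lift I J h y).1 hy
  have h2 := (c.m α).j_ρ I J h ⟨y, hy⟩ h1
  have h3 := (K.collar_lift α (c.up I) (c.up J) h t (c.sub ht) _).2 h1
  have h4 := K.collar_ρ α (c.up I) (c.up J) h t (c.sub ht) _ h1 h3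
  have e : (K.change (K.idx (c.up I)) (K.idx (c.up J)) h).ρ ⟨_, h3⟩ =
      (c.collar α I (t, ((c.bd α).change I J h).ρ ⟨y, hy⟩)).1 := by
    rw [c.val_collar ht]
    exact h4.trans (congrArg (fun x => K.collar α (c.up I) (t, x)) h2)
  have key : ∀ q : K.U (K.idx (c.up J)), q = K.collar α (c.up J) (t, (c.m α).j J y) →
      ∃ hq : q ∈ (K.change (K.idx (c.up I)) (K.idx (c.up J)) h).lift,
        (K.change (K.idx (c.up I)) (K.idx (c.up J)) h).ρ ⟨q, hq⟩ =
          (c.collar α I (t, ((c.bd α).change I J h).ρ ⟨y, hy⟩)).1 := by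
    rintro _ rfl
    exact ⟨h3, e⟩
  obtain ⟨h5, h6⟩ := key _ (c.val_collar ht y)
  exact ⟨⟨h5, Eq.mpr (congrArg (· ∈ S.V (K.idx (c.up I))) h6) (Subtype.coe_prop _)⟩,
    fun hy' => Subtype.ext h6⟩

theorem mem_lift_of_collar {α : Bool} {I J : Idx (c.bd α).F} (h : I.1 ⊂ J.1) {t : Icc (0 : ℝ) 1}
    (ht : t ∈ A α c.δ) {y : (c.bd α).U J}
    (hy : c.collar α J (t, y) ∈ (c.frame.change (c.frame.idx I) (c.frame.idx J) h).lift) :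
    y ∈ ((c.bd α).change I J h).lift := by
  obtain ⟨h1, h2⟩ := hy
  have key : ∀ q : K.U (K.idx (c.up J)), q = K.collar α (c.up J) (t, (c.m α).j J y) →
      ∀ hq : q ∈ (K.change (K.idx (c.up I)) (K.idx (c.up J)) h).lift,
        (K.change (K.idx (c.up I)) (K.idx (c.up J)) h).ρ ⟨q, hq⟩ ∈ S.V (K.idx (c.up I)) →
        y ∈ ((c.bd α).change I J h).lift := by
    rintro _ rfl hq hqV
    have h3 := (K.collar_lift α (c.up I) (c.up J) h t (c.sub ht) _).1 hq
    rw [K.collar_ρ α (c.up I) (c.up J) h t (c.sub ht) _ h3 hq, c.mem_V α t ht] at hqV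
    exact ((c.m α).j_lift I J h y).2 ⟨h3, hqV⟩
  exact key _ (c.val_collar ht y) h1 h2

theorem collar_mem_dom {α : Bool} {I J : Idx (c.bd α).F} (h : I.1 ⊂ J.1) {t : Icc (0 : ℝ) 1}
    (ht : t ∈ A α c.δ) {x : (c.bd α).U I} :
    c.collar α I (t, x) ∈ (c.frame.change (c.frame.idx I) (c.frame.idx J) h).dom ↔
      x ∈ ((c.bd α).change I J h).dom := by
  constructor
  · rintro ⟨y, hyV, hy⟩
    have hy' := hy.trans (c.val_collar ht x)
    obtain ⟨z, hz, hzx⟩ := K.exists_collar_of_ρ_eq (I := c.up I) (J := c.up J) (h := h) (c.sub ht)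
      hy'
    have hyV' : y.1 ∈ S.V (K.idx (c.up J)) := hyV
    rw [hz, c.mem_V α t ht] at hyV'
    obtain ⟨z', hz'⟩ := hyV'
    have key : ∀ q : ((K.bd α).change (c.up I) (c.up J) h).lift, (c.m α).j J z' = q.1 →
        ((K.bd α).change (c.up I) (c.up J) h).ρ q = (c.m α).j I x →
        x ∈ ((c.bd α).change I J h).dom := by
      rintro ⟨q, hq⟩ hq' hqx
      simp only at hq'
      subst hq'
      have h1 := ((c.m α).j_lift I J h z').2 ⟨hq, x, hqx.symm⟩
      have h2 := (c.m α).j_ρ I J h ⟨z', h1⟩ hq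
      rw [← ((c.bd α).change I J h).ρ_range]
      exact ⟨⟨z', h1⟩, ((c.m α).j_embedding I).injective (h2.symm.trans hqx)⟩
    exact key z hz' hzx
  · intro hx
    rw [← ((c.bd α).change I J h).ρ_range] at hx
    obtain ⟨y, rfl⟩ := hx
    obtain ⟨h1, h2⟩ := c.collar_mem_lift h ht y.2
    rw [← (c.frame.change (c.frame.idx I) (c.frame.idx J) h).ρ_range]
    exact ⟨⟨_, h1⟩, h2 h1⟩

/-- The restriction of a cobordism to a collared subdomain, with prescribed boundary atlases. -/
def restrict : WeakCobordism.{u, v, w} P C d where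
  toCobordismFrame := c.frame
  collar := c.collar
  collar_embedding := c.collar_embedding
  collar_diffeo := c.collar_diffeo
  collar_disjoint I h0 h1 := by
    rw [Set.disjoint_left]
    rintro _ ⟨⟨t, x⟩, ⟨ht, -⟩, rfl⟩ ⟨⟨t', x'⟩, ⟨ht', -⟩, h⟩
    have h2 := congrArg Subtype.val h
    refine Set.disjoint_left.1 (K.collar_disjoint I (((c.m false).idx_iff I).2 h0)
      (((c.m true).idx_iff I).2 h1)) ⟨(t, (c.m false).j _ x), ⟨c.sub ht, mem_univ _⟩, rfl⟩
      ⟨(t', (c.m true).j _ x'), ⟨c.sub ht', mem_univ _⟩, ?_⟩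
    exact (c.val_collar ht' x').symm.trans (h2.trans (c.val_collar ht x))
  collar_closed α I ε h0 h1 := by
    have h2 := (K.collar_closed α (c.up I) ε h0 (h1.trans_le c.δ_le)).preimage
      (continuous_subtype_val (p := fun x => x ∈ S.V (K.idx (c.up I))))
    have e : c.collar α I '' {p | |(p.1 : ℝ) - endpt α| ≤ ε} = Subtype.val ⁻¹'
        (K.collar α (c.up I) '' {p | |(p.1 : ℝ) - endpt α| ≤ ε}) := ?_
    · exact Eq.mpr (congrArg IsClosed e) h2
    ext q
    constructor
    · rintro ⟨⟨t, x⟩, ht, rfl⟩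
      have ht' : t ∈ A α c.δ := lt_of_le_of_lt ht h1
      exact ⟨(t, (c.m α).j I x), ht, (c.val_collar ht' x).symm⟩
    · rintro ⟨⟨t, x⟩, ht, hq⟩
      have ht' : t ∈ A α c.δ := lt_of_le_of_lt ht h1
      have h3 : K.collar α (c.up I) (t, x) ∈ S.V (K.idx (c.up I)) :=
        Eq.mpr (congrArg (· ∈ S.V (K.idx (c.up I))) hq) q.2
      rw [c.mem_V α t ht'] at h3
      obtain ⟨x', rfl⟩ := h3
      exact ⟨(t, x'), ht, Subtype.ext ((c.val_collar ht' x').trans hq)⟩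
  boundary I q := by
    refine (WeakSystem.mem_boundary_restrict (K := K.toWeakSystem) q).trans ?_
    rw [K.boundary]
    constructor
    · rintro ⟨α, h, x, hq⟩
      have h3 : K.collar α ⟨I.1, h⟩ (endpt α, x) ∈ S.V (K.idx ⟨I.1, h⟩) :=
        Eq.mp (congrArg (· ∈ S.V (S.up I)) hq) q.2
      rw [c.mem_V α _ (endpt_mem_A α c.δ_pos)] at h3
      obtain ⟨x', rfl⟩ := h3
      exact ⟨α, ((c.m α).idx_iff I.1).1 h, x', Subtype.ext
        (hq.trans (c.val_collar (endpt_mem_A α c.δ_pos) x').symm)⟩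
    · rintro ⟨α, h, x, hq⟩
      exact ⟨α, ((c.m α).idx_iff I.1).2 h, (c.m α).j ⟨I.1, h⟩ x, (congrArg Subtype.val hq).trans
        (c.val_collar (endpt_mem_A α c.δ_pos) x)⟩
  collar_smul α I t ht g x := by
    refine Subtype.ext ((c.val_collar ht _).trans ?_)
    have h1 := (congrArg (fun y => K.collar α (c.up I) (t, y)) ((c.m α).j_equiv I g x)).trans
      (K.collar_smul α (c.up I) t (c.sub ht) g _)
    exact h1.trans <| congrArg (g • ·) (c.val_collar ht x).symm
  collar_s α I t ht x := by
    have h1 := congrArg (K.chart (K.idx (c.up I))).s (c.val_collar ht x)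
    exact h1.trans ((K.collar_s α (c.up I) t (c.sub ht) _).trans ((c.m α).j_s I x))
  collar_ψ α I t ht x h h' := by
    have h1 : ((K.bd α).chart (c.up I)).s ((c.m α).j I x) = 0 := ((c.m α).j_s I x).trans h
    have h2 : (K.chart (K.idx (c.up I))).s (K.collar α (c.up I) (t, (c.m α).j I x)) = 0 :=
      (K.collar_s α (c.up I) t (c.sub ht) _).trans h1
    have h3 := K.collar_ψ α (c.up I) t (c.sub ht) _ h1 h2
    rw [(c.m α).j_ψ I x h h1] at h3
    refine Eq.trans ?_ h3
    exact congrArg (K.chart (K.idx (c.up I))).ψ (Subtype.ext (c.val_collar ht x))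
  collar_dom α I J h t ht x := c.collar_mem_dom h ht
  collar_lift α I J h t ht y := ⟨c.mem_lift_of_collar h ht, fun hy => (c.collar_mem_lift h ht hy).1⟩
  collar_ρ α I J h t ht y hy hy' := (c.collar_mem_lift h ht hy).2 hy'
  collar_avoid α I J h hJ t ht x hx := by
    obtain ⟨y, -, hy⟩ := hx
    have hy' := hy.trans (c.val_collar ht x)
    exact hJ (((c.m α).idx_iff J.1).1
      (K.idx_of_mem_lift (I := c.up I) (J := S.up J) (h := h) (c.sub ht) hy'))

theorem isShrinking_restrict (hF : ∀ i, IsCompact (closure (S.F i)) ∧ closure (S.F i) ⊆ K.F i)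
    (hV : ∀ I, IsCompact (closure (S.V I))) : c.restrict.IsShrinking K := by
  refine ⟨WeakSystem.restrictShrinkMaps S hF hV, c.δ, c.δ_pos, c.δ_le, le_rfl,
    fun α I => ⟨fun h => ⟨(c.m α).j ⟨I.1, h⟩, fun t ht => ⟨fun x => c.val_collar ht x, fun x =>
      ?_⟩⟩,
      fun h => absurd (((c.m α).idx_iff I.1).1 I.2) h⟩⟩
  refine Iff.trans ?_ (c.mem_V α t ht I x)
  constructor
  · rintro ⟨y, hy⟩
    exact Eq.mp (congrArg (· ∈ S.V (K.idx I)) hy) y.2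
  · exact fun hx => ⟨⟨_, hx⟩, rfl⟩

/-- A restriction to a subdomain inside a larger one is a shrinking of the larger restriction. -/
theorem isShrinking_restrict_restrict {S' : Subdomain K.toWeakSystem} (c' : Collaring K S')
    (hδ : c'.δ ≤ c.δ)
    (hF : ∀ i, IsCompact (closure (S'.F i)) ∧ closure (S'.F i) ⊆ S.F i)
    (hc : ∀ I, IsCompact (closure (S'.V I))) (hV : ∀ I, closure (S'.V I) ⊆ S.V I) :
    c'.restrict.IsShrinking c.restrict := by
  refine ⟨WeakSystem.restrictRestrictShrinkMaps S' S hF hc hV, c'.δ, c'.δ_pos, hδ, le_rfl,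
    fun α I => ⟨fun h => ?_, fun h => absurd (((c'.m α).idx_iff I.1).1 (c.up I).2) h⟩⟩
  have h1 : ∀ x : (c'.bd α).U ⟨I.1, h⟩, ∃ y, (c.m α).j I y = (c'.m α).j ⟨I.1, h⟩ x := by
    intro x
    have h2 := (c'.mem_V α _ (endpt_mem_A α c'.δ_pos) (c.up I) ((c'.m α).j ⟨I.1, h⟩ x)).2 ⟨x, rfl⟩
    exact (c.mem_V α _ (endpt_mem_A α c.δ_pos) (c.up I) _).1 (hV _ (subset_closure h2))
  choose j hj using h1
  refine ⟨j, fun t ht => ⟨fun x => Subtype.ext ?_, fun x => ?_⟩⟩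
  · refine Eq.trans (c'.val_collar ht x) (Eq.trans ?_ (c.val_collar (A_mono α hδ ht) (j x)).symm)
    exact congrArg (fun y => K.collar α (c.up I) (t, y)) (hj x).symm
  · have h3 : c.collar α I (t, x) ∈ range (fun y : c'.frame.U (c'.frame.idx ⟨I.1, h⟩) =>
        (⟨y.1, hV _ (subset_closure y.2)⟩ : c.frame.U (c.frame.idx I))) ↔
        K.collar α (c.up I) (t, (c.m α).j I x) ∈ S'.V (K.idx (c.up I)) := by
      constructor
      · rintro ⟨y, hy⟩
        have hy' := (congrArg Subtype.val hy).trans (c.val_collar (A_mono α hδ ht) x)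
        exact Eq.mp (congrArg (· ∈ S'.V (K.idx (c.up I))) hy') y.2
      · exact fun hx => ⟨⟨_, hx⟩, Subtype.ext (c.val_collar (A_mono α hδ ht) x).symm⟩
    refine h3.trans ((c'.mem_V α t ht (c.up I) _).trans ?_)
    constructor
    · rintro ⟨y, hy⟩
      exact ⟨y, ((c.m α).j_embedding I).injective ((hj y).trans hy)⟩
    · rintro ⟨y, rfl⟩
      exact ⟨y, (hj y).symm⟩

end Collaring

end WeakCobordism

/-! ### Collapsing collars -/

/-- The self-map of `[0,1]` that collapses the closed interval of length `δ` at the endpoint `α`,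
and is the identity outside the interval of length `2 δ`. -/
def squeeze (α : Bool) (δ : ℝ) (t : Icc (0 : ℝ) 1) : Icc (0 : ℝ) 1 :=
  if α then ⟨1 - min (1 - (t : ℝ)) (max 0 (2 * (1 - t - δ))), by
    have h1 := t.2.1
    have h2 := t.2.2
    have h3 : 0 ≤ min (1 - (t : ℝ)) (max 0 (2 * (1 - t - δ))) :=
      le_min (by linarith) (le_max_left _ _)
    have h4 := min_le_left (1 - (t : ℝ)) (max 0 (2 * (1 - t - δ)))
    constructor <;> linarith⟩
  else ⟨min t (max 0 (2 * (t - δ))), le_min t.2.1 (le_max_left _ _), (min_le_left _ _).trans t.2.2⟩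

theorem abs_sub_endpt (α : Bool) (t : Icc (0 : ℝ) 1) :
    |(t : ℝ) - endpt α| = if α then 1 - (t : ℝ) else t := by
  have h1 := t.2.1
  have h2 := t.2.2
  cases α
  · simpa [endpt] using h1
  · simp only [endpt, if_true, Icc.coe_one]
    rw [abs_sub_comm, abs_of_nonneg (by linarith)]

theorem abs_squeeze_sub_endpt (α : Bool) (δ : ℝ) (t : Icc (0 : ℝ) 1) :
    |(squeeze α δ t : ℝ) - endpt α| =
      min |(t : ℝ) - endpt α| (max 0 (2 * (|(t : ℝ) - endpt α| - δ))) := by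
  rw [abs_sub_endpt, abs_sub_endpt]
  cases α <;> simp [squeeze]

theorem eq_of_abs_sub_endpt {α : Bool} {t t' : Icc (0 : ℝ) 1}
    (h : |(t : ℝ) - endpt α| = |(t' : ℝ) - endpt α|) : t = t' := by
  rw [abs_sub_endpt, abs_sub_endpt] at h
  apply Subtype.ext
  cases α
  · simpa using h
  · simpa using h

theorem continuous_squeeze (α : Bool) (δ : ℝ) : Continuous (squeeze α δ) := by
  cases α
  · exact Continuous.subtype_mk (by fun_prop) _
  · exact Continuous.subtype_mk (by fun_prop) _

theorem squeeze_of_le {α : Bool} {δ : ℝ} {t : Icc (0 : ℝ) 1} (h : |(t : ℝ) - endpt α| ≤ δ) :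
    squeeze α δ t = endpt α := by
  apply eq_of_abs_sub_endpt (α := α)
  rw [abs_squeeze_sub_endpt, max_eq_left (by linarith), min_eq_right (abs_nonneg _), sub_self,
    abs_zero]

theorem squeeze_of_ge {α : Bool} {δ : ℝ} {t : Icc (0 : ℝ) 1} (h : 2 * δ ≤ |(t : ℝ) - endpt α|) :
    squeeze α δ t = t := by
  apply eq_of_abs_sub_endpt (α := α)
  rw [abs_squeeze_sub_endpt, min_eq_left (le_max_of_le_right (by linarith))]

theorem squeeze_mem_A {α : Bool} {δ ε : ℝ} {t : Icc (0 : ℝ) 1} (h : t ∈ A α ε) :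
    squeeze α δ t ∈ A α ε := by
  have h1 : |(t : ℝ) - endpt α| < ε := h
  have h2 := abs_squeeze_sub_endpt α δ t
  exact (h2.trans_le (min_le_left _ _)).trans_lt h1

theorem isCompact_interval (α : Bool) (δ : ℝ) :
    IsCompact {t : Icc (0 : ℝ) 1 | |(t : ℝ) - endpt α| ≤ δ} :=
  (isClosed_le (by fun_prop) continuous_const).isCompact

section Collapse

variable {Z D : Type*} [TopologicalSpace Z] [TopologicalSpace D] {α : Bool} {ε δ : ℝ}
  {κ : Icc (0 : ℝ) 1 × D → Z}

open Classical in
/-- The self-map of a space that collapses a collar of width `ε` along `squeeze α δ`. -/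
def collapse (α : Bool) (ε δ : ℝ) (κ : Icc (0 : ℝ) 1 × D → Z) (z : Z) : Z :=
  if h : ∃ p : Icc (0 : ℝ) 1 × D, p.1 ∈ A α ε ∧ κ p = z then
    κ (squeeze α δ h.choose.1, h.choose.2) else z

theorem collapse_of_notMem {Z D : Type*} {α : Bool} {ε δ : ℝ} {κ : Icc (0 : ℝ) 1 × D → Z} {z : Z}
    (h : ∀ p : Icc (0 : ℝ) 1 × D, p.1 ∈ A α ε → κ p ≠ z) :
    collapse α ε δ κ z = z :=
  dif_neg fun ⟨p, hp, hz⟩ => h p hp hz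

variable (he : IsOpenEmbedding ((A α ε ×ˢ (univ : Set D)).domRestrict κ))

include he in
theorem collapse_apply {t : Icc (0 : ℝ) 1} (ht : t ∈ A α ε) (x : D) :
    collapse α ε δ κ (κ (t, x)) = κ (squeeze α δ t, x) := by
  have h : ∃ p : Icc (0 : ℝ) 1 × D, p.1 ∈ A α ε ∧ κ p = κ (t, x) := ⟨(t, x), ht, rfl⟩
  have h1 := @he.injective ⟨h.choose, h.choose_spec.1, mem_univ _⟩ ⟨(t, x), ht, mem_univ _⟩
    h.choose_spec.2
  have h2 : h.choose = (t, x) := congrArg Subtype.val h1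
  rw [collapse, dif_pos h, h2]

include he in
theorem collapse_of_notMem_tube {z : Z}
    (h : z ∉ κ '' {p | |(p.1 : ℝ) - endpt α| ≤ 2 * δ}) : collapse α ε δ κ z = z := by
  by_cases h1 : ∃ p : Icc (0 : ℝ) 1 × D, p.1 ∈ A α ε ∧ κ p = z
  · obtain ⟨p, hp, rfl⟩ := h1
    refine (collapse_apply he hp p.2).trans ?_
    rw [squeeze_of_ge]
    by_contra h2
    exact h ⟨p, (not_le.1 h2).le, rfl⟩
  · exact dif_neg h1

include he in
theorem continuous_collapse (hδ : 2 * δ < ε)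
    (hcl : IsClosed (κ '' {p | |(p.1 : ℝ) - endpt α| ≤ 2 * δ})) :
    Continuous (collapse α ε δ κ) := by
  rw [continuous_iff_continuousAt]
  intro z
  by_cases h : z ∈ κ '' {p | |(p.1 : ℝ) - endpt α| ≤ 2 * δ}
  · obtain ⟨p, hp, rfl⟩ := h
    have hp' : p.1 ∈ A α ε := lt_of_le_of_lt hp hδ
    have h1 : ContinuousAt (collapse α ε δ κ) ((A α ε ×ˢ (univ : Set D)).domRestrict κ
        ⟨p, hp', mem_univ _⟩) := by
      rw [← he.continuousAt_iff]
      refine Continuous.continuousAt ?_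
      have h2 : Continuous fun q : (A α ε ×ˢ (univ : Set D) : Set (Icc (0 : ℝ) 1 × D)) =>
          (⟨(squeeze α δ q.1.1, q.1.2), squeeze_mem_A q.2.1, mem_univ _⟩ :
            (A α ε ×ˢ (univ : Set D) : Set (Icc (0 : ℝ) 1 × D))) := by
        have := continuous_squeeze α δ
        fun_prop
      refine (he.continuous.comp h2).congr fun q => ?_
      exact (collapse_apply he q.2.1 q.1.2).symm
    exact h1
  · refine continuousAt_id.congr ?_
    filter_upwards [hcl.isOpen_compl.mem_nhds h] with y hy
    exact (collapse_of_notMem_tube he hy).symm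

include he in
/-- Collapsing a collar is a proper map. -/
theorem isCompact_preimage_collapse [T2Space Z] (hδ : 2 * δ < ε)
    (hcl : IsClosed (κ '' {p | |(p.1 : ℝ) - endpt α| ≤ 2 * δ})) {Q : Set Z} (hQ : IsCompact Q) :
    IsCompact (collapse α ε δ κ ⁻¹' Q) := by
  have h1 : IsCompact ((A α ε ×ˢ (univ : Set D)).domRestrict κ ⁻¹'
      (Q ∩ κ '' {p | |(p.1 : ℝ) - endpt α| ≤ 2 * δ})) := by
    rw [he.isInducing.isCompact_iff, image_preimage_eq_of_subset]
    · exact hQ.inter_right hcl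
    · rintro _ ⟨-, p, hp, rfl⟩
      exact ⟨⟨p, lt_of_le_of_lt hp hδ, mem_univ _⟩, rfl⟩
  have h2 := (isCompact_interval α (2 * δ)).prod
    (h1.image (continuous_snd.comp continuous_subtype_val))
  have h3 : ContinuousOn κ (A α ε ×ˢ (univ : Set D)) :=
    continuousOn_iff_continuous_domRestrict.2 he.continuous
  have h4 := h2.image_of_continuousOn (h3.mono fun p hp => ⟨lt_of_le_of_lt hp.1 hδ, mem_univ _⟩)
  refine (hQ.union h4).of_isClosed_subset
    (hQ.isClosed.preimage (continuous_collapse he hδ hcl)) fun z hz => ?_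
  by_cases h : z ∈ κ '' {p | |(p.1 : ℝ) - endpt α| ≤ 2 * δ}
  · right
    obtain ⟨⟨t, x⟩, hp, rfl⟩ := h
    have ht : t ∈ A α ε := lt_of_le_of_lt hp hδ
    have hz' : collapse α ε δ κ (κ (t, x)) ∈ Q := hz
    rw [collapse_apply he ht] at hz'
    refine ⟨(t, x), ⟨hp, ⟨(squeeze α δ t, x), squeeze_mem_A ht, mem_univ _⟩, ⟨hz', ?_⟩, rfl⟩, rfl⟩
    exact ⟨(squeeze α δ t, x), (abs_squeeze_sub_endpt α δ t).trans_le ((min_le_left _ _).trans hp),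
      rfl⟩
  · left
    have hz' : collapse α ε δ κ z ∈ Q := hz
    rwa [collapse_of_notMem_tube he h] at hz'

end Collapse

section SelfMap

variable {N : ℕ} {P : BasicData.{w} N} {X : Type u} [TopologicalSpace X] {d : ℤ}
  {K : WeakSystem.{u, v, w} P X d}

/-- Proper self-maps of the chart domains and of the underlying space, compatible with all
structure maps of a system.  The map on chart domains covers itself along `ρ` in the strong sense
that points of lifted domains can be lifted. -/
structure SelfMap (K : WeakSystem.{u, v, w} P X d) where
  r : ∀ I : Idx K.F, K.U I → K.U I
  continuous_r : ∀ I, Continuous (r I)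
  isCompact_preimage : ∀ I Q, IsCompact Q → IsCompact (r I ⁻¹' Q)
  smul : ∀ I (g : P.ΓI I.1) x, r I (g • x) = g • r I x
  s_r : ∀ I x, (K.chart I).s (r I x) = (K.chart I).s x
  mem_lift : ∀ (I J : Idx K.F) (h : I.1 ⊂ J.1) y (_ : r J y ∈ (K.change I J h).lift),
    y ∈ (K.change I J h).lift
  ρ_r : ∀ (I J : Idx K.F) (h : I.1 ⊂ J.1) (y : (K.change I J h).lift)
    (hy : r J y.1 ∈ (K.change I J h).lift),
    (K.change I J h).ρ ⟨r J y.1, hy⟩ = r I ((K.change I J h).ρ y)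
  exists_lift : ∀ (I J : Idx K.F) (h : I.1 ⊂ J.1) x (y : (K.change I J h).lift),
    (K.change I J h).ρ y = r I x → ∃ y' : (K.change I J h).lift,
      (K.change I J h).ρ y' = x ∧ r J y'.1 = y.1
  rX : X → X
  continuous_rX : Continuous rX
  ψ_r : ∀ I (x : {u : K.U I // (K.chart I).s u = 0}),
    (K.chart I).ψ ⟨r I x.1, (s_r I x.1).trans x.2⟩ = rX ((K.chart I).ψ x)
  mem_F : ∀ i p, rX p ∈ K.F i ↔ p ∈ K.F i

namespace SelfMap

/-- Composition of self-maps. -/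
def comp (f g : SelfMap K) : SelfMap K where
  r I := f.r I ∘ g.r I
  continuous_r I := (f.continuous_r I).comp (g.continuous_r I)
  isCompact_preimage I Q hQ := g.isCompact_preimage I _ (f.isCompact_preimage I Q hQ)
  smul I γ x := by rw [Function.comp_apply, g.smul, f.smul]; rfl
  s_r I x := (f.s_r I _).trans (g.s_r I x)
  mem_lift I J h y hy := g.mem_lift I J h y (f.mem_lift I J h _ hy)
  ρ_r I J h y hy := by
    have h1 := f.mem_lift I J h _ hy
    exact (f.ρ_r I J h ⟨_, h1⟩ hy).trans (congrArg _ (g.ρ_r I J h y h1))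
  exists_lift I J h x y hy := by
    obtain ⟨y₁, h1, h2⟩ := f.exists_lift I J h _ y hy
    obtain ⟨y₂, h3, h4⟩ := g.exists_lift I J h _ y₁ h1
    exact ⟨y₂, h3, (congrArg _ h4).trans h2⟩
  rX := f.rX ∘ g.rX
  continuous_rX := f.continuous_rX.comp g.continuous_rX
  ψ_r I x := (f.ψ_r I ⟨_, (g.s_r I x.1).trans x.2⟩).trans (congrArg f.rX (g.ψ_r I x))
  mem_F i p := (f.mem_F i _).trans (g.mem_F i p)

variable (f : SelfMap K) (S : Subdomain K)

/-- The preimage of a subdomain under a self-map. -/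
def pull (hi : ∀ I, IsIdx K.F I → ∃ p, ∀ i ∈ I, f.rX p ∈ S.F i) : Subdomain K where
  F i := f.rX ⁻¹' S.F i
  cover := by rw [← preimage_iUnion, S.cover, preimage_univ]
  F_open i := (S.F_open i).preimage f.continuous_rX
  F_subset i p hp := (f.mem_F i p).1 (S.F_subset i hp)
  idx I hI := ⟨hI.1, (hi I hI).imp fun p hp => mem_iInter₂.2 hp⟩
  V I := f.r I ⁻¹' S.V I
  isOpen I := (S.isOpen I).preimage (f.continuous_r I)
  smul I g x hx := by
    change f.r I (g • x) ∈ S.V I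
    rw [f.smul]
    exact S.smul I g _ hx
  zero I z := by
    refine (S.zero I ⟨f.r I z.1, (f.s_r I z.1).trans z.2⟩).trans ?_
    rw [f.ψ_r]
    rfl

/-- The map `f` commutes with `ρ` and preserves the sets `deep`, so preimages of tame families are
tame. -/
theorem tameFam_preimage {V : ∀ I : Idx K.F, Set (K.U I)} (hV : WeakSystem.TameFam K V) :
    WeakSystem.TameFam K fun I => f.r I ⁻¹' V I where
  isOpen I := (hV.isOpen I).preimage (f.continuous_r I)
  smul I g x hx := by
    change f.r I (g • x) ∈ V I
    rw [f.smul]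
    exact hV.smul I g _ hx
  image I J h y hy hd := by
    have hd' : f.r J y ∈ K.deep J I.1 := fun j hj => by
      rw [f.s_r]
      exact hd j hj
    obtain ⟨h1, h2⟩ := hV.image I J h _ hy hd'
    have h3 := f.mem_lift I J h y h1
    rw [f.ρ_r I J h ⟨y, h3⟩ h1] at h2
    exact ⟨h3, h2⟩
  inter I J L h h' y z hy hz hyz := by
    have hd : ∀ (J : Idx K.F) (h : I.1 ⊂ J.1) (y : (K.change I J h).lift), f.r J y.1 ∈ V J →
        ∃ hl : f.r J y.1 ∈ (K.change I J h).lift, True := fun J h y hy => by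
      have h1 := WeakSystem.lift_subset_deep h y.2
      have hd' : f.r J y.1 ∈ K.deep J I.1 := fun j hj => by
        rw [f.s_r]
        exact h1 j hj
      exact ⟨(hV.image I J h _ hy hd').1, trivial⟩
    obtain ⟨hyl, -⟩ := hd J h y hy
    obtain ⟨hzl, -⟩ := hd L h' z hz
    obtain ⟨M, hM, hIM, w, hw, hwy⟩ := hV.inter I J L h h' ⟨_, hyl⟩ ⟨_, hzl⟩ hy hz
      (by rw [f.ρ_r, f.ρ_r, hyz])
    rw [f.ρ_r] at hwy
    obtain ⟨w', h1, h2⟩ := f.exists_lift I M hIM _ w hwy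
    exact ⟨M, hM, hIM, w', by rw [mem_preimage, h2]; exact hw, h1⟩

variable {f S}

theorem isPrecompact_pull {hi} (hS : S.IsPrecompact) : (f.pull S hi).IsPrecompact where
  F i := (f.continuous_rX.closure_preimage_subset _).trans fun p hp => (f.mem_F i p).1 (hS.F i hp)
  V I := (f.isCompact_preimage I _ (hS.V I)).of_isClosed_subset isClosed_closure
    ((f.continuous_r I).closure_preimage_subset _)

theorem isInside_pull {S' : Subdomain K} {hi hi'} (hS : S'.IsInside S) :
    (f.pull S' hi').IsInside (f.pull S hi) where
  F i := (f.continuous_rX.closure_preimage_subset _).trans (preimage_mono (hS.F i))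
  V I := ((f.continuous_r I).closure_preimage_subset _).trans (preimage_mono (hS.V I))

end SelfMap

end SelfMap

/-! ### Tame shrinkings of cobordisms -/

namespace WeakCobordism

variable {N : ℕ} {P : BasicData.{w} N} {Y : Type u} [TopologicalSpace Y] {B : Bool → Type u}
  [∀ α, TopologicalSpace (B α)] {C : CollaredCobordism Y B} {d : ℤ}
  (K : WeakCobordism.{u, v, w} P C d)

/-- The map on a chart domain that collapses its collar. -/
def collapseU (α : Bool) (δ : ℝ) (I : Idx K.F) : K.U I → K.U I :=
  open Classical in
  if h : IsIdx (K.bd α).F I.1 then collapse α K.width δ (K.collar α ⟨I.1, h⟩) else id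

variable {K}

theorem collapseU_collar {α : Bool} {δ : ℝ} {I : Idx (K.bd α).F} {t : Icc (0 : ℝ) 1}
    (ht : t ∈ A α K.width) (x : (K.bd α).U I) :
    K.collapseU α δ (K.idx I) (K.collar α I (t, x)) = K.collar α I (squeeze α δ t, x) := by
  rw [collapseU, dif_pos I.2]
  exact collapse_apply (K.collar_embedding α I) ht x

theorem collapseU_of_notMem {α : Bool} {δ : ℝ} {I : Idx K.F} {z : K.U I}
    (h : ∀ (hI : IsIdx (K.bd α).F I.1), ∀ t ∈ A α K.width, ∀ x, K.collar α ⟨I.1, hI⟩ (t, x) ≠ z) :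
    K.collapseU α δ I z = z := by
  unfold collapseU
  split_ifs with hI
  · exact collapse_of_notMem fun p hp => h hI p.1 hp p.2
  · rfl

/-- A point of a chart domain either lies in the collar, or is fixed under collapsing. -/
theorem collar_or (α : Bool) (I : Idx K.F) (z : K.U I) :
    (∃ (hI : IsIdx (K.bd α).F I.1), ∃ t ∈ A α K.width, ∃ x, K.collar α ⟨I.1, hI⟩ (t, x) = z) ∨
      ∀ (hI : IsIdx (K.bd α).F I.1), ∀ t ∈ A α K.width, ∀ x, K.collar α ⟨I.1, hI⟩ (t, x) ≠ z := by
  by_cases h : ∃ (hI : IsIdx (K.bd α).F I.1), ∃ t ∈ A α K.width, ∃ x,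
      K.collar α ⟨I.1, hI⟩ (t, x) = z
  · exact Or.inl h
  · push Not at h
    exact Or.inr h

theorem isOpenEmbedding_base (α : Bool) {ε : ℝ} (hε : ε ≤ C.width) :
    IsOpenEmbedding ((A α ε ×ˢ (univ : Set (B α))).domRestrict (C.collar α)) := by
  have h1 : IsOpen (A α ε ×ˢ (univ : Set (B α))) := (isOpen_A α _).prod isOpen_univ
  have h2 : IsOpen (A α C.width ×ˢ (univ : Set (B α))) := (isOpen_A α _).prod isOpen_univ
  have h3 : IsOpenEmbedding (inclusion (prod_mono_left (A_mono α hε)) :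
      (A α ε ×ˢ (univ : Set (B α)) : Set (Icc (0 : ℝ) 1 × B α)) →
        (A α C.width ×ˢ (univ : Set (B α)) : Set (Icc (0 : ℝ) 1 × B α))) :=
    IsOpenEmbedding.of_comp _ h2.isOpenEmbedding_subtypeVal h1.isOpenEmbedding_subtypeVal
  exact (C.isCollar.isOpenEmbedding α).comp h3

/-- `ρ` detects the collars. -/
theorem ρ_ne_collar {α : Bool} {I J : Idx K.F} {h : I.1 ⊂ J.1} {y : (K.change I J h).lift}
    (hy : ∀ (hJ : IsIdx (K.bd α).F J.1), ∀ t ∈ A α K.width, ∀ x, K.collar α ⟨J.1, hJ⟩ (t, x) ≠ y.1)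
    (hI : IsIdx (K.bd α).F I.1) : ∀ t ∈ A α K.width, ∀ x,
      K.collar α ⟨I.1, hI⟩ (t, x) ≠ (K.change I J h).ρ y := by
  intro t ht x hx
  have hJ := K.idx_of_mem_lift (I := ⟨I.1, hI⟩) (J := J) (h := h) (y := y) ht hx.symm
  obtain ⟨z, hz, -⟩ := K.exists_collar_of_ρ_eq (I := ⟨I.1, hI⟩) (J := ⟨J.1, hJ⟩) (h := h) (y := y)
    ht hx.symm
  exact hy hJ t ht z.1 hz.symm

/-- Zeros outside the collar of `U_I` lie over points outside the collar of the base: zeros over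
the collar of the base are, up to the group, zeros in the collar of `U_I`. -/
theorem ψ_ne_collar {α : Bool} {I : Idx K.F} (z : {u : K.U I // (K.chart I).s u = 0})
    (hz : ∀ (hI : IsIdx (K.bd α).F I.1), ∀ t ∈ A α K.width, ∀ x, K.collar α ⟨I.1, hI⟩ (t, x) ≠ z.1)
    {t : Icc (0 : ℝ) 1} (ht : t ∈ A α K.width) (b : B α) : C.collar α (t, b) ≠ (K.chart I).ψ z := by
  intro h
  have hb : ∀ i ∈ I.1, b ∈ (K.bd α).F i := fun i hi => by
    rw [← K.F_collar α t ht, h]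
    exact WeakSystem.ψ_mem z hi
  have hI : IsIdx (K.bd α).F I.1 := ⟨I.2.1, b, mem_iInter₂.2 hb⟩
  obtain ⟨x, hx⟩ := (WeakSystem.mem_footprint (K := (K.bd α).toWeakSystem) (I := ⟨I.1, hI⟩)).2 hb
  have hs : (K.chart I).s (K.collar α ⟨I.1, hI⟩ (t, x.1)) = 0 :=
    (K.collar_s α ⟨I.1, hI⟩ t ht x.1).trans x.2
  have h1 : (K.chart I).ψ ⟨_, hs⟩ = (K.chart I).ψ z := by
    refine (K.collar_ψ α ⟨I.1, hI⟩ t ht x.1 x.2 hs).trans (Eq.trans ?_ h)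
    rw [← hx]
  obtain ⟨g, hg⟩ := ((K.chart I).ψ_eq_iff _ _).1 h1
  exact hz hI t ht (g • x.1) ((K.collar_smul α ⟨I.1, hI⟩ t ht g x.1).trans hg)

variable (K)

/-- The collapse commutes with `ρ` and preserves lifted domains in both directions, since lifted
domains and `ρ` are products over collars and `ρ` maps no other points into collars. -/
theorem collapseU_ρ {α : Bool} {δ : ℝ} {I J : Idx K.F} (h : I.1 ⊂ J.1) (y : K.U J)
    (hy : y ∈ (K.change I J h).lift ∨ K.collapseU α δ J y ∈ (K.change I J h).lift) :
    ∃ (h1 : y ∈ (K.change I J h).lift) (h2 : K.collapseU α δ J y ∈ (K.change I J h).lift),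
      (K.change I J h).ρ ⟨_, h2⟩ = K.collapseU α δ I ((K.change I J h).ρ ⟨y, h1⟩) := by
  obtain ⟨hJ, t, ht, x, rfl⟩ | hout := K.collar_or α J y
  · have hI : IsIdx (K.bd α).F I.1 := hJ.mono h.subset I.2.1
    have e := collapseU_collar (K := K) (δ := δ) (I := ⟨J.1, hJ⟩) ht x
    have ht' := squeeze_mem_A (δ := δ) ht
    have key : ∀ q : K.U J, q = K.collar α ⟨J.1, hJ⟩ (squeeze α δ t, x) →
        (K.collar α ⟨J.1, hJ⟩ (t, x) ∈ (K.change I J h).lift ∨ q ∈ (K.change I J h).lift) →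
        ∃ (h1 : K.collar α ⟨J.1, hJ⟩ (t, x) ∈ (K.change I J h).lift)
          (h2 : q ∈ (K.change I J h).lift), (K.change I J h).ρ ⟨_, h2⟩ =
            K.collapseU α δ I ((K.change I J h).ρ ⟨_, h1⟩) := by
      rintro _ rfl hq
      have h3 : x ∈ ((K.bd α).change ⟨I.1, hI⟩ ⟨J.1, hJ⟩ h).lift := by
        rcases hq with hq | hq
        · exact (K.collar_lift α ⟨I.1, hI⟩ ⟨J.1, hJ⟩ h t ht x).1 hq
        · exact (K.collar_lift α ⟨I.1, hI⟩ ⟨J.1, hJ⟩ h _ ht' x).1 hq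
      have h1 := (K.collar_lift α ⟨I.1, hI⟩ ⟨J.1, hJ⟩ h t ht x).2 h3
      have h2 := (K.collar_lift α ⟨I.1, hI⟩ ⟨J.1, hJ⟩ h _ ht' x).2 h3
      refine ⟨h1, h2, (K.collar_ρ α ⟨I.1, hI⟩ ⟨J.1, hJ⟩ h _ ht' x h3 h2).trans ?_⟩
      have h4 := K.collar_ρ α ⟨I.1, hI⟩ ⟨J.1, hJ⟩ h _ ht x h3 h1
      exact (collapseU_collar (I := ⟨I.1, hI⟩) ht _).symm.trans
        (congrArg (K.collapseU α δ I) h4).symm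
    exact key _ e hy
  · have e := collapseU_of_notMem (δ := δ) hout
    have key : ∀ q : K.U J, q = y → (y ∈ (K.change I J h).lift ∨ q ∈ (K.change I J h).lift) →
        ∃ (h1 : y ∈ (K.change I J h).lift)
          (h2 : q ∈ (K.change I J h).lift), (K.change I J h).ρ ⟨_, h2⟩ =
            K.collapseU α δ I ((K.change I J h).ρ ⟨_, h1⟩) := by
      rintro _ rfl hq
      have h1 := hq.elim id id
      exact ⟨h1, h1, (collapseU_of_notMem (ρ_ne_collar (y := ⟨_, h1⟩) hout)).symm⟩
    exact key _ e hy

/-- Collapsing the collars of a cobordism at one end. -/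
def collapseMap (α : Bool) {δ : ℝ} (hδ0 : 0 ≤ δ) (hδ : 2 * δ < K.width) :
    SelfMap K.toWeakSystem where
  r := K.collapseU α δ
  continuous_r I := by
    unfold collapseU
    split_ifs with hI
    · exact continuous_collapse (K.collar_embedding α ⟨I.1, hI⟩) hδ
        (K.collar_closed α ⟨I.1, hI⟩ _ (by linarith) hδ)
    · exact continuous_id
  isCompact_preimage I Q hQ := by
    unfold collapseU
    split_ifs with hI
    · have : T2Space (K.U (K.idx ⟨I.1, hI⟩)) := (K.chart I).t2
      exact isCompact_preimage_collapse (K.collar_embedding α ⟨I.1, hI⟩) hδ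
        (K.collar_closed α ⟨I.1, hI⟩ _ (by linarith) hδ) hQ
    · exact hQ
  smul I g z := by
    obtain ⟨hI, t, ht, x, rfl⟩ | hout := K.collar_or α I z
    · have h1 := K.collar_smul α ⟨I.1, hI⟩ t ht g x
      have h2 := K.collar_smul α ⟨I.1, hI⟩ _ (squeeze_mem_A (δ := δ) ht) g x
      have h3 := collapseU_collar (K := K) (δ := δ) (I := ⟨I.1, hI⟩) ht
      exact (congrArg (K.collapseU α δ I) h1).symm.trans ((h3 _).trans
        (h2.trans (congrArg (g • ·) (h3 x).symm)))
    · rw [collapseU_of_notMem hout]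
      refine collapseU_of_notMem fun hI t ht x hx => hout hI t ht (g⁻¹ • x) ?_
      exact (K.collar_smul α ⟨I.1, hI⟩ t ht g⁻¹ x).trans
        ((congrArg (g⁻¹ • ·) hx).trans (inv_smul_smul _ _))
  s_r I z := by
    obtain ⟨hI, t, ht, x, rfl⟩ | hout := K.collar_or α I z
    · have h3 := collapseU_collar (K := K) (δ := δ) (I := ⟨I.1, hI⟩) ht x
      exact (congrArg (K.chart I).s h3).trans ((K.collar_s α ⟨I.1, hI⟩ _ (squeeze_mem_A ht) x).trans
        (K.collar_s α ⟨I.1, hI⟩ t ht x).symm)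
    · rw [collapseU_of_notMem hout]
  mem_lift I J h y hy := (K.collapseU_ρ h y (Or.inr hy)).1
  ρ_r I J h y hy := by
    obtain ⟨h1, h2, h3⟩ := K.collapseU_ρ h y.1 (Or.inr hy)
    exact h3
  exists_lift I J h z y hy := by
    obtain ⟨hI, t, ht, x, rfl⟩ | hout := K.collar_or α I z
    · have ht' := squeeze_mem_A (δ := δ) ht
      have h3 := hy.trans (collapseU_collar (K := K) (δ := δ) (I := ⟨I.1, hI⟩) ht x)
      have hJ := K.idx_of_mem_lift (I := ⟨I.1, hI⟩) (J := J) (h := h) (y := y) ht' h3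
      obtain ⟨q, hq, hqx⟩ := K.exists_collar_of_ρ_eq (I := ⟨I.1, hI⟩) (J := ⟨J.1, hJ⟩) (h := h)
        (y := y) ht' h3
      have h4 := (K.collar_lift α ⟨I.1, hI⟩ ⟨J.1, hJ⟩ h t ht q.1).2 q.2
      refine ⟨⟨_, h4⟩, ?_, ?_⟩
      · refine (K.collar_ρ α ⟨I.1, hI⟩ ⟨J.1, hJ⟩ h t ht q.1 q.2 h4).trans ?_
        rw [← hqx]
      · exact (collapseU_collar (K := K) (δ := δ) (I := ⟨J.1, hJ⟩) ht q.1).trans hq.symm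
    · rw [collapseU_of_notMem hout] at hy
      refine ⟨y, hy, collapseU_of_notMem fun hJ t ht x hx => ?_⟩
      have hI : IsIdx (K.bd α).F I.1 := hJ.mono h.subset I.2.1
      have h4 : K.collar α ⟨J.1, hJ⟩ (t, x) ∈ (K.change I J h).lift := hx ▸ y.2
      have h5 := (K.collar_lift α ⟨I.1, hI⟩ ⟨J.1, hJ⟩ h t ht x).1 h4
      have h6 := K.collar_ρ α ⟨I.1, hI⟩ ⟨J.1, hJ⟩ h t ht x h5 h4
      refine hout hI t ht _ (h6.symm.trans (Eq.trans ?_ hy))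
      exact congrArg _ (Subtype.ext hx)
  rX := collapse α K.width δ (C.collar α)
  continuous_rX := continuous_collapse (isOpenEmbedding_base α K.width_le) hδ
    (C.isCollar.isClosed α _ (by linarith) (hδ.trans_le K.width_le))
  ψ_r I z := by
    obtain ⟨z, hz⟩ := z
    have key : ∀ q : K.U I, q = K.collapseU α δ I z → ∀ hq : (K.chart I).s q = 0,
        (K.chart I).ψ ⟨q, hq⟩ = collapse α K.width δ (C.collar α) ((K.chart I).ψ ⟨z, hz⟩) := by
      obtain ⟨hI, t, ht, x, rfl⟩ | hout := K.collar_or α I z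
      · rw [collapseU_collar (K := K) (δ := δ) (I := ⟨I.1, hI⟩) ht x]
        rintro _ rfl hq
        have hx : ((K.bd α).chart ⟨I.1, hI⟩).s x = 0 :=
          (K.collar_s α ⟨I.1, hI⟩ t ht x).symm.trans hz
        have h1 := K.collar_ψ α ⟨I.1, hI⟩ _ (squeeze_mem_A (δ := δ) ht) x hx hq
        have h2 := K.collar_ψ α ⟨I.1, hI⟩ t ht x hx hz
        refine h1.trans (Eq.symm ?_)
        refine (congrArg (collapse α K.width δ (C.collar α)) h2).trans ?_
        exact collapse_apply (isOpenEmbedding_base α K.width_le) ht _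
      · rw [collapseU_of_notMem hout]
        rintro _ rfl hq
        exact (collapse_of_notMem fun p hp => ψ_ne_collar ⟨_, hz⟩ hout hp p.2).symm
    exact key _ rfl _
  mem_F i p := by
    by_cases h : ∃ q : Icc (0 : ℝ) 1 × B α, q.1 ∈ A α K.width ∧ C.collar α q = p
    · obtain ⟨⟨t, b⟩, ht, rfl⟩ := h
      rw [collapse_apply (isOpenEmbedding_base α K.width_le) ht, K.F_collar α _ (squeeze_mem_A ht),
        K.F_collar α t ht]
    · rw [collapse_of_notMem fun q hq hqp => h ⟨q, hq, hqp⟩]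

end WeakCobordism

namespace WeakCobordism

variable {N : ℕ} {P : BasicData.{w} N} {Y : Type u} [TopologicalSpace Y] {B : Bool → Type u}
  [∀ α, TopologicalSpace (B α)] {C : CollaredCobordism Y B} {d : ℤ}

/-- A boundary component is a closed subspace. -/
theorem _root_.Kuranishi.IsCollar.isClosedEmbedding {Y : Type u} [TopologicalSpace Y]
    {B : Bool → Type v} [∀ α, TopologicalSpace (B α)] {ε : ℝ}
    {κ : ∀ α, Icc (0 : ℝ) 1 × B α → Y} (hε : 0 < ε) (α : Bool)
    (he : IsOpenEmbedding ((A α ε ×ˢ (univ : Set (B α))).domRestrict (κ α)))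
    (hcl : IsClosed (κ α '' {p | |(p.1 : ℝ) - endpt α| ≤ 0})) :
    IsClosedEmbedding fun b => κ α (endpt α, b) := by
  refine ⟨?_, ?_⟩
  · have h1 : IsEmbedding fun b : B α => ((⟨(endpt α, b), endpt_mem_A α hε, mem_univ _⟩ :
        (A α ε ×ˢ (univ : Set (B α)) : Set (Icc (0 : ℝ) 1 × B α)))) :=
      IsEmbedding.of_comp (by fun_prop) continuous_subtype_val (isEmbedding_prodMkRight _)
    exact he.isEmbedding.comp h1
  · convert hcl using 1
    ext y
    constructor
    · rintro ⟨b, rfl⟩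
      exact ⟨(endpt α, b), by simp, rfl⟩
    · rintro ⟨⟨t, b⟩, ht, rfl⟩
      have ht' : t = endpt α := Subtype.ext (by simpa [sub_eq_zero] using ht)
      exact ⟨b, by rw [ht']⟩

variable (K : WeakCobordism.{u, v, w} P C d)

theorem isClosedEmbedding_bd (α : Bool) (I : Idx (K.bd α).F) :
    IsClosedEmbedding fun x => K.collar α I (endpt α, x) :=
  IsCollar.isClosedEmbedding (B := fun _ => (K.bd α).U I) (κ := fun _ => K.collar α I) K.width_pos α
    (K.collar_embedding α I) (K.collar_closed α I 0 le_rfl K.width_pos)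

theorem isClosedEmbedding_bd_base (α : Bool) : IsClosedEmbedding fun b => C.collar α (endpt α, b) :=
  IsCollar.isClosedEmbedding C.width_pos α (C.isCollar.isOpenEmbedding α)
    (C.isCollar.isClosed α 0 le_rfl C.width_pos)

variable {K}

/-- The restriction of a subdomain to a boundary component. -/
def bdSubdomain (S : Subdomain K.toWeakSystem) (α : Bool)
    (hi : ∀ I, IsIdx (K.bd α).F I → ∃ b, ∀ i ∈ I, C.collar α (endpt α, b) ∈ S.F i) :
    Subdomain (K.bd α).toWeakSystem where
  F i := {b | C.collar α (endpt α, b) ∈ S.F i}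
  cover := eq_univ_of_forall fun b => by
    obtain ⟨i, hb⟩ := mem_iUnion.1 (S.cover ▸ mem_univ (C.collar α (endpt α, b)))
    exact mem_iUnion.2 ⟨i, hb⟩
  F_open i := (S.F_open i).preimage (isClosedEmbedding_bd_base α).continuous
  F_subset i b hb := (K.F_collar α _ (endpt_mem_A α K.width_pos) i b).1 (S.F_subset i hb)
  idx I hI := ⟨hI.1, (hi I hI).imp fun b hb => mem_iInter₂.2 hb⟩
  V I := {x | K.collar α I (endpt α, x) ∈ S.V (K.idx I)}
  isOpen I := (S.isOpen _).preimage (K.isClosedEmbedding_bd α I).continuous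
  smul I g x hx := by
    have h1 := K.collar_smul α I _ (endpt_mem_A α K.width_pos) g x
    exact Eq.mpr (congrArg (· ∈ S.V (K.idx I)) h1) (S.smul (K.idx I) g _ hx)
  zero I z := by
    have h0 : (K.chart (K.idx I)).s (K.collar α I (endpt α, z.1)) = 0 :=
      (K.collar_s α I _ (endpt_mem_A α K.width_pos) z.1).trans z.2
    refine (S.zero (K.idx I) ⟨_, h0⟩).trans (forall₂_congr fun i _ => ?_)
    rw [K.collar_ψ α I _ (endpt_mem_A α K.width_pos) z.1 z.2 h0]
    rfl

theorem isPrecompact_bdSubdomain {S : Subdomain K.toWeakSystem} (hS : S.IsPrecompact) {α : Bool}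
    {hi} : (bdSubdomain S α hi).IsPrecompact where
  F i := ((isClosedEmbedding_bd_base α).continuous.closure_preimage_subset _).trans fun b hb =>
    (K.F_collar α _ (endpt_mem_A α K.width_pos) i b).1 (hS.F i hb)
  V I := ((K.isClosedEmbedding_bd α I).isCompact_preimage (hS.V (K.idx I))).of_isClosed_subset
    isClosed_closure ((K.isClosedEmbedding_bd α I).continuous.closure_preimage_subset _)

/-- The collaring of a precompact subdomain that is of product form near the boundary. -/
def bdCollaring [CompactSpace Y] {S : Subdomain K.toWeakSystem} (hS : S.IsPrecompact) {δ : ℝ}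
    (hδ0 : 0 < δ) (hδ : δ ≤ K.width)
    (hi : ∀ α I, IsIdx (K.bd α).F I → ∃ b, ∀ i ∈ I, C.collar α (endpt α, b) ∈ S.F i)
    (hF : ∀ α, ∀ t ∈ A α δ, ∀ i b, C.collar α (t, b) ∈ S.F i ↔ C.collar α (endpt α, b) ∈ S.F i)
    (hV : ∀ α, ∀ t ∈ A α δ, ∀ (I : Idx (K.bd α).F) x,
      K.collar α I (t, x) ∈ S.V (K.idx I) ↔ K.collar α I (endpt α, x) ∈ S.V (K.idx I)) :
    Collaring K S where
  δ := δ
  δ_pos := hδ0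
  δ_le := hδ
  bd α := (K.bd α).restrict (bdSubdomain S α (hi α))
  m α := WeakSystem.restrictShrinkMaps _
    (fun i => ⟨by
      have : CompactSpace (B α) := (isClosedEmbedding_bd_base (C := C) α).compactSpace
      exact isClosed_closure.isCompact, (isPrecompact_bdSubdomain hS).F i⟩)
    (isPrecompact_bdSubdomain hS).V
  mem_F := hF
  mem_V α t ht I x := by
    refine (hV α t ht I x).trans ?_
    constructor
    · exact fun hx => ⟨⟨x, hx⟩, rfl⟩
    · rintro ⟨y, rfl⟩
      exact y.2

variable (K)

/-- Collapsing both collars of a cobordism. -/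
def collapseBoth : SelfMap K.toWeakSystem :=
  (K.collapseMap true (δ := K.width / 3) (by linarith [K.width_pos]) (by linarith
    [K.width_pos])).comp
    (K.collapseMap false (δ := K.width / 3) (by linarith [K.width_pos]) (by linarith [K.width_pos]))

variable {K}

theorem collapseBoth_collar {α : Bool} {t : Icc (0 : ℝ) 1} (ht : t ∈ A α (K.width / 3))
    (I : Idx (K.bd α).F) (x : (K.bd α).U I) :
    K.collapseBoth.r (K.idx I) (K.collar α I (t, x)) = K.collar α I (endpt α, x) := by
  have hw := K.width_pos
  have ht' : t ∈ A α K.width := A_mono α (by linarith) ht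
  have h1 : K.collapseU α (K.width / 3) (K.idx I) (K.collar α I (t, x)) =
      K.collar α I (endpt α, x) := by
    rw [collapseU_collar ht', squeeze_of_le (le_of_lt ht)]
  have h2 : ∀ β, β ≠ α → ∀ t ∈ A α K.width, K.collapseU β (K.width / 3) (K.idx I)
      (K.collar α I (t, x)) = K.collar α I (t, x) := by
    intro β hβ t ht
    refine collapseU_of_notMem fun hI t' ht' x' h => ?_
    cases α <;> cases β <;> try exact hβ rfl
    · exact Set.disjoint_left.1 (K.collar_disjoint I.1 I.2 hI)
        ⟨(t, x), ⟨ht, mem_univ _⟩, rfl⟩ ⟨(t', x'), ⟨ht', mem_univ _⟩, h⟩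
    · exact Set.disjoint_left.1 (K.collar_disjoint I.1 hI I.2)
        ⟨(t', x'), ⟨ht', mem_univ _⟩, h⟩ ⟨(t, x), ⟨ht, mem_univ _⟩, rfl⟩
  have h3 : ∀ z, K.collapseBoth.r (K.idx I) z = K.collapseU true (K.width / 3) (K.idx I)
      (K.collapseU false (K.width / 3) (K.idx I) z) := fun _ => rfl
  rw [h3]
  cases α
  · rw [h1, h2 true (by simp) _ (endpt_mem_A _ hw)]
  · rw [h2 false (by simp) _ ht', h1]

theorem collapseBoth_base {α : Bool} {t : Icc (0 : ℝ) 1} (ht : t ∈ A α (K.width / 3)) (b : B α) :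
    K.collapseBoth.rX (C.collar α (t, b)) = C.collar α (endpt α, b) := by
  have hw := K.width_pos
  have ht' : t ∈ A α K.width := A_mono α (by linarith) ht
  have h1 : collapse α K.width (K.width / 3) (C.collar α) (C.collar α (t, b)) =
      C.collar α (endpt α, b) := by
    rw [collapse_apply (isOpenEmbedding_base α K.width_le) ht', squeeze_of_le (le_of_lt ht)]
  have h2 : ∀ β, β ≠ α → ∀ t ∈ A α K.width, collapse β K.width (K.width / 3) (C.collar β)
      (C.collar α (t, b)) = C.collar α (t, b) := by
    intro β hβ t ht
    refine collapse_of_notMem fun p hp h => ?_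
    have ht2 := A_mono α K.width_le ht
    have hp2 := A_mono β K.width_le hp
    cases α <;> cases β <;> try exact hβ rfl
    · exact Set.disjoint_left.1 C.isCollar.disjoint ⟨(t, b), ⟨ht2, mem_univ _⟩, rfl⟩
        ⟨p, ⟨hp2, mem_univ _⟩, h⟩
    · exact Set.disjoint_left.1 C.isCollar.disjoint ⟨p, ⟨hp2, mem_univ _⟩, h⟩
        ⟨(t, b), ⟨ht2, mem_univ _⟩, rfl⟩
  have h3 : ∀ z, K.collapseBoth.rX z = collapse true K.width (K.width / 3) (C.collar true)
      (collapse false K.width (K.width / 3) (C.collar false) z) := fun _ => rfl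
  rw [h3]
  cases α
  · rw [h1, h2 true (by simp) _ (endpt_mem_A _ hw)]
  · rw [h2 false (by simp) _ ht', h1]

/-- The nested tame subdomains that exist without regard to collars are pulled back along the
collapse of both collars, which makes them products near the boundary. -/
theorem exists_isPreshrunkTame [CompactSpace Y] [T2Space Y] (K : WeakCobordism.{u, v, w} P C d) :
    ∃ K' : WeakCobordism.{u, v, w} P C d, K'.IsPreshrunkTame K := by
  have hw := K.width_pos
  obtain ⟨T, hT, hTi⟩ := WeakSystem.exists_finite_idx K.F
  have h1 : ∀ α, ∃ T : Set (B α), T.Finite ∧ ∀ I, IsIdx (K.bd α).F I → ∃ p ∈ T, ∀ i ∈ I,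
      p ∈ (K.bd α).F i := fun α => WeakSystem.exists_finite_idx (K.bd α).F
  choose Tb hTb hTbi using h1
  -- collapsing the collars must not lose any index, for the cobordism and for its boundary
  obtain ⟨S', S, hS', hS, ht', ht, hp⟩ := WeakSystem.exists_tameFam K.hasOpenLifts
    ((hT.image K.collapseBoth.rX).union (finite_iUnion fun α =>
      (hTb α).image fun b => C.collar α (endpt α, b)))
  have hi' : ∀ I, IsIdx K.F I → ∃ p, ∀ i ∈ I, K.collapseBoth.rX p ∈ S'.F i := fun I hI => by
    obtain ⟨p, hpT, hpI⟩ := hTi I hI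
    exact ⟨p, fun i hi => hp _ (Or.inl ⟨p, hpT, rfl⟩) i ((K.collapseBoth.mem_F i p).2 (hpI i hi))⟩
  have hS'F : ∀ i, S'.F i ⊆ S.F i := fun i => subset_closure.trans (hS'.F i)
  have hi : ∀ I, IsIdx K.F I → ∃ p, ∀ i ∈ I, K.collapseBoth.rX p ∈ S.F i := fun I hI =>
    (hi' I hI).imp fun p hp i hi => hS'F i (hp i hi)
  have hb' : ∀ α I, IsIdx (K.bd α).F I → ∃ b, ∀ i ∈ I, C.collar α (endpt α, b) ∈ S'.F i :=
    fun α I hI => by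
      obtain ⟨b, hbT, hbI⟩ := hTbi α I hI
      exact ⟨b, fun i hi => hp _ (Or.inr (mem_iUnion.2 ⟨α, b, hbT, rfl⟩)) i
        ((K.F_collar α _ (endpt_mem_A α hw) i b).2 (hbI i hi))⟩
  have hδ : 0 < K.width / 3 := by linarith
  have hδ' : K.width / 3 ≤ K.width := by linarith
  have hcF : ∀ (S : Subdomain K.toWeakSystem) (hi) α, ∀ t ∈ A α (K.width / 3), ∀ i b,
      C.collar α (t, b) ∈ (K.collapseBoth.pull S hi).F i ↔
        C.collar α (endpt α, b) ∈ (K.collapseBoth.pull S hi).F i := by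
    intro S hi α t ht i b
    change K.collapseBoth.rX _ ∈ S.F i ↔ K.collapseBoth.rX _ ∈ S.F i
    rw [collapseBoth_base ht, collapseBoth_base (endpt_mem_A α hδ)]
  have hcV : ∀ (S : Subdomain K.toWeakSystem) (hi) α, ∀ t ∈ A α (K.width / 3),
      ∀ (I : Idx (K.bd α).F) x, K.collar α I (t, x) ∈ (K.collapseBoth.pull S hi).V (K.idx I) ↔
        K.collar α I (endpt α, x) ∈ (K.collapseBoth.pull S hi).V (K.idx I) := by
    intro S hi α t ht I x
    change K.collapseBoth.r _ _ ∈ S.V _ ↔ K.collapseBoth.r _ _ ∈ S.V _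
    rw [collapseBoth_collar ht, collapseBoth_collar (endpt_mem_A α hδ)]
  have hcb : ∀ (S : Subdomain K.toWeakSystem) (hi) α (b : B α) i,
      C.collar α (endpt α, b) ∈ (K.collapseBoth.pull S hi).F i ↔
        C.collar α (endpt α, b) ∈ S.F i := by
    intro S hi α b i
    change K.collapseBoth.rX _ ∈ S.F i ↔ _
    rw [collapseBoth_base (endpt_mem_A α hδ)]
  have hpS : (K.collapseBoth.pull S hi).IsPrecompact := SelfMap.isPrecompact_pull hS
  have hpi : (K.collapseBoth.pull S' hi').IsInside (K.collapseBoth.pull S hi) :=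
    SelfMap.isInside_pull hS'
  have hpS' : (K.collapseBoth.pull S' hi').IsPrecompact :=
    ⟨fun i => (hpi.F i).trans (subset_closure.trans (hpS.F i)), fun I =>
      (hpS.V I).of_isClosed_subset isClosed_closure ((hpi.V I).trans subset_closure)⟩
  let c := bdCollaring hpS hδ hδ' (fun α I hI => (hb' α I hI).imp fun b hb i hi' =>
    (hcb S hi α b i).2 (hS'F i (hb i hi'))) (hcF S hi) (hcV S hi)
  let c' := bdCollaring hpS' hδ hδ' (fun α I hI => (hb' α I hI).imp fun b hb i h =>
    (hcb S' hi' α b i).2 (hb i h)) (hcF S' hi') (hcV S' hi')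
  refine ⟨c'.restrict, (K.collapseBoth.tameFam_preimage ht').isTame_restrict, c.restrict,
    (K.collapseBoth.tameFam_preimage ht).isTame_restrict,
    c.isShrinking_restrict (fun i => ⟨isClosed_closure.isCompact, hpS.F i⟩) hpS.V,
    c.isShrinking_restrict_restrict c' le_rfl (fun i => ⟨isClosed_closure.isCompact, hpi.F i⟩)
      hpS'.V hpi.V⟩

end WeakCobordism

/-! ### Admissible metrics -/

namespace WeakSystem

variable {N : ℕ} {P : BasicData.{w} N} {X : Type u} [TopologicalSpace X] {d : ℤ}
  {K' K : WeakSystem.{u, v, w} P X d}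

theorem continuous_π (I : Idx K.F) : Continuous (K.π I) :=
  continuous_quot_mk.comp continuous_sigmaMk

namespace ShrinkMaps

variable (m : ShrinkMaps K' K)

/-- The index in the larger system. -/
abbrev up (I : Idx K'.F) : Idx K.F := ⟨I.1, (m.idx_iff I.1).2 I.2⟩

theorem exists_lift {I J : Idx K'.F} (h : I.1 ⊂ J.1) (y : (K'.change I J h).lift) :
    ∃ hy : m.j J y.1 ∈ (K.change (m.up I) (m.up J) h).lift,
      (K.change (m.up I) (m.up J) h).ρ ⟨_, hy⟩ = m.j I ((K'.change I J h).ρ y) := by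
  obtain ⟨hy, -⟩ := (m.j_lift I J h y.1).1 y.2
  exact ⟨hy, m.j_ρ I J h y hy⟩

/-- The map between realizations that is induced by a shrinking. -/
def realMap : K'.Real → K.Real :=
  Quot.map (fun p => ⟨m.up p.1, m.j p.1 p.2⟩) (by
    rintro _ _ (⟨I, γ, x⟩ | ⟨I, J, h, y, γ⟩)
    · simp only
      rw [m.j_equiv]
      exact Mor.act (K := K) (m.up I) γ (m.j I x)
    · obtain ⟨hy, e⟩ := m.exists_lift h y
      simp only
      rw [m.j_equiv, ← e]
      exact Mor.change (K := K) (m.up I) (m.up J) h ⟨_, hy⟩ γ)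

/-- The inclusion of a shrinking preserves the relation of coming from a smaller index. -/
theorem down_map (h' : K'.IsTame) (h : K.IsTame) {H I : Idx K'.F} {v : K'.U H} {x : K'.U I}
    (hd : (K'.tameSpaces h').Down H I v x) :
    (K.tameSpaces h).Down (m.up H) (m.up I) (m.j H v) (m.j I x) := by
  rcases hd with ⟨rfl, g, hg⟩ | ⟨hHI, hx, g, hg⟩
  · exact Or.inl ⟨rfl, g, (m.j_equiv I g x).symm.trans (congrArg (m.j I) hg)⟩
  · obtain ⟨hy, e⟩ := m.exists_lift hHI ⟨x, hx⟩
    refine Or.inr ⟨hHI, hy, g, ?_⟩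
    let k : P.ΓI H.1 := g
    exact (congrArg (fun z : K.U (m.up H) => k • z) e).trans
      ((m.j_equiv H g _).symm.trans (congrArg (m.j H) hg))

/-- The realization of a tame shrinking of a tame system injects into the realization of the
system. -/
theorem injective_realMap (h' : K'.IsTame) (h : K.IsTame) : Function.Injective m.realMap := by
  rintro ⟨I, x⟩ ⟨J, y⟩ hxy
  have toReal : ∀ p q : Σ I, K'.U I, (K'.tameSpaces h').rel p q →
      (Quot.mk K'.Mor p : K'.Real) = Quot.mk K'.Mor q := by
    intro p q hpq
    refine Quot.eqvGen_sound (Relation.EqvGen.mono (fun a b => ?_) _ _ hpq)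
    exact (mor_iff h' a b).2
  have h1 : (K.tameSpaces h).rel ⟨m.up I, m.j I x⟩ ⟨m.up J, m.j J y⟩ := by
    refine Relation.EqvGen.mono (fun a b => ?_) _ _ (Quot.eqvGen_exact hxy)
    exact (mor_iff h a b).1
  have hdeep : ∀ (I : Idx K'.F) (x : K'.U I) H, m.j I x ∈ K.deep (m.up I) H → x ∈ K'.deep I H :=
    fun I x H hx => (m.mem_deep (J := m.up I)).1 hx
  rcases TameSpaces.rel_iff_equ.1 h1 with ⟨hp, hq, e⟩ | ⟨S, v, hS, hx, hy⟩
  · refine toReal _ _ (TameSpaces.rel_of_ψ (T := K'.tameSpaces h') (hdeep I x _ hp)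
      (hdeep J y _ hq) ?_)
    exact (m.j_ψ I x _ _).symm.trans (Eq.trans e (m.j_ψ J y _ _))
  · have hxd := hx.mem_deep
    have hyd := hy.mem_deep
    obtain ⟨v₁, h3⟩ := TameSpaces.exists_down (T := K'.tameSpaces h') (H := m.down S) (I := I)
      hx.subset (hdeep I x _ hxd)
    obtain ⟨v₂, h4⟩ := TameSpaces.exists_down (T := K'.tameSpaces h') (H := m.down S) (I := J)
      hy.subset (hdeep J y _ hyd)
    obtain ⟨g₁, hg₁⟩ := (m.down_map h' h h3).orbit hx
    obtain ⟨g₂, hg₂⟩ := hy.orbit (m.down_map h' h h4)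
    let k₁ : P.ΓI S.1 := g₁
    let k₂ : P.ΓI S.1 := g₂
    let w₁ : K'.U (m.down S) := v₁
    have h5 : m.j (m.down S) ((k₂ * k₁) • w₁) = m.j (m.down S) v₂ :=
      (m.j_equiv (m.down S) _ w₁).trans ((mul_smul k₂ k₁ (m.j (m.down S) w₁)).trans
        ((congrArg (fun z : K.U S => k₂ • z) hg₁).trans hg₂))
    have h6 := (m.j_embedding (m.down S)).injective h5
    have h7 := (TameSpaces.rel_smul (T := K'.tameSpaces h') (m.down S) (k₂ * k₁) v₁)
    have h8 : (K'.tameSpaces h').rel ⟨m.down S, v₂⟩ ⟨m.down S, v₁⟩ := h6 ▸ h7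
    exact toReal _ _ ((h3.rel.symm _ _).trans _ _ _ ((h8.symm _ _).trans _ _ _ h4.rel))

/-- The map between intermediate domains that is induced by a shrinking. -/
def ubarMap (I : Idx K'.F) : K'.Ubar I → K.Ubar (m.up I) :=
  Quotient.map (m.j I) fun _ y ⟨g, hg⟩ => ⟨g, (m.j_equiv I g y).symm.trans (congrArg (m.j I) hg)⟩

theorem isOpenEmbedding_ubarMap (I : Idx K'.F) : IsOpenEmbedding (m.ubarMap I) := by
  have hact : ContinuousConstSMul (P.ΓI I.1) (K.U (m.up I)) :=
    ⟨fun g => (K.chart (m.up I)).continuous_smul g⟩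
  refine .of_continuous_injective_isOpenMap ?_ ?_ fun O hO => ?_
  · exact (continuous_quotient_mk'.comp (m.j_embedding I).continuous).quotient_lift _
  · rintro ⟨x⟩ ⟨y⟩ hxy
    obtain ⟨g, hg⟩ := Quotient.exact hxy
    have h1 : m.j I (g • y) = m.j I x := (m.j_equiv I g y).trans hg
    exact Quotient.sound ⟨g, (m.j_embedding I).injective h1⟩
  · have h1 := (isOpenMap_quotient_mk'_mul (Γ := P.ΓI I.1) (T := K.U (m.up I))) _
      ((m.j_embedding I).isOpenMap _ (hO.preimage continuous_quotient_mk'))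
    convert h1 using 1
    ext q
    constructor
    · rintro ⟨⟨x⟩, hx, rfl⟩
      exact ⟨_, ⟨x, hx, rfl⟩, rfl⟩
    · rintro ⟨_, ⟨x, hx, rfl⟩, rfl⟩
      exact ⟨_, hx, rfl⟩

/-- A tame shrinking of a tame system carries an admissible metric: its realization injects into a
compact metrizable subset of the realization of the system. -/
theorem exists_isAdmissible [T2Space X] (m : ShrinkMaps K' K) (h' : K'.IsTame) (h : K.IsTame) :
    ∃ D : K'.Real → K'.Real → ℝ, K'.IsAdmissible D := by
  have := h.t2Space_real
  let Q : Set K.Real := ⋃ I : Idx K'.F, K.π (m.up I) '' closure (range (m.j I))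
  have hQ : IsCompact Q := isCompact_iUnion fun I => (m.j_precompact I).image (continuous_π _)
  have : CompactSpace Q := isCompact_iff_compactSpace.1 hQ
  let q : (Σ I : Idx K'.F, closure (range (m.j I))) → Q := fun p =>
    ⟨K.π (m.up p.1) p.2.1, mem_iUnion.2 ⟨p.1, p.2.1, p.2.2, rfl⟩⟩
  have hq : Continuous q := by
    refine Continuous.subtype_mk (continuous_sigma fun I => ?_) _
    exact (continuous_π (m.up I)).comp continuous_subtype_val
  have hqs : Function.Surjective q := by
    rintro ⟨p, hp⟩
    obtain ⟨I, x, hx, rfl⟩ := mem_iUnion.1 hp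
    exact ⟨⟨I, x, hx⟩, rfl⟩
  have : ∀ I : Idx K'.F, CompactSpace (closure (range (m.j I))) := fun I =>
    isCompact_iff_compactSpace.1 (m.j_precompact I)
  have : SecondCountableTopology Q := secondCountableTopology_of_surjective hq hqs
  let _ : MetricSpace Q := metrizableSpaceMetric Q
  have hmem : ∀ p : K'.Real, m.realMap p ∈ Q := by
    rintro ⟨I, x⟩
    exact mem_iUnion.2 ⟨I, m.j I x, subset_closure (mem_range_self x), rfl⟩
  let e : K'.Real → Q := fun p => ⟨m.realMap p, hmem p⟩
  have he : Function.Injective e := fun p p' hp =>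
    m.injective_realMap h' h (congrArg Subtype.val hp)
  refine ⟨fun p p' => dist (e p) (e p'), ⟨fun p p' => dist_eq_zero.trans he.eq_iff,
    fun _ _ => dist_comm _ _, fun _ _ _ => dist_triangle _ _ _, ?_, fun I x => ?_⟩⟩
  · obtain ⟨C, hC⟩ := Metric.isBounded_iff.1 (isCompact_univ (X := Q)).isBounded
    exact ⟨C, fun p p' => hC (mem_univ _) (mem_univ _)⟩
  · have h1 : IsEmbedding fun x : K'.Ubar I => e (K'.πbar I x) := by
      have h2 : IsEmbedding ((Subtype.val : Q → K.Real) ∘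
        fun x : K'.Ubar I => e (K'.πbar I x)) := by
        have h3 := (h.isEmbedding_πbar (m.up I)).comp (m.isOpenEmbedding_ubarMap I).isEmbedding
        convert h3 using 1
        funext x
        obtain ⟨x⟩ := x
        rfl
      exact ⟨IsInducing.subtypeVal.of_comp_iff.1 h2.isInducing, h2.injective.of_comp⟩
    rw [h1.isInducing.nhds_eq_comap]
    have h2 := (Metric.nhds_basis_ball (x := e (K'.πbar I x))).comap fun y => e (K'.πbar I y)
    refine h2.congr (fun _ => Iff.rfl) fun r _ => ?_
    ext y
    exact Metric.mem_ball'

end ShrinkMaps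

end WeakSystem

/-! ### Collars of realizations -/

instance {X : Type u} [TopologicalSpace X] {G : Type w} [Group G] {E : Type w}
    [NormedAddCommGroup E] [NormedSpace ℝ E] {τ : Representation ℝ G E}
    (c : Chart.{u, v, w} X τ) : ContinuousConstSMul G c.U := ⟨c.continuous_smul⟩

namespace WeakCobordism

variable {N : ℕ} {P : BasicData.{w} N} {Y : Type u} [TopologicalSpace Y] {B : Bool → Type u}
  [∀ α, TopologicalSpace (B α)] {C : CollaredCobordism Y B} {d : ℤ}
  (K : WeakCobordism.{u, v, w} P C d)

open Classical in
/-- The coordinates of a point of a collar of a chart domain, with values in the realization of the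
boundary. -/
def posU (α : Bool) (I : Idx K.F) (z : K.U I) : Option (Icc (0 : ℝ) 1 × (K.bd α).Real) :=
  if h : ∃ (hI : IsIdx (K.bd α).F I.1) (p : Icc (0 : ℝ) 1 × (K.bd α).U ⟨I.1, hI⟩),
    p.1 ∈ A α K.width ∧ K.collar α ⟨I.1, hI⟩ p = z then
    some (h.choose_spec.choose.1, (K.bd α).π ⟨I.1, h.choose⟩ h.choose_spec.choose.2) else none

theorem posU_collar {α : Bool} {I : Idx (K.bd α).F} {t : Icc (0 : ℝ) 1} (ht : t ∈ A α K.width)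
    (x : (K.bd α).U I) : K.posU α (K.idx I) (K.collar α I (t, x)) = some (t, (K.bd α).π I x) := by
  have h : ∃ (hI : IsIdx (K.bd α).F I.1) (p : Icc (0 : ℝ) 1 × (K.bd α).U ⟨I.1, hI⟩),
    p.1 ∈ A α K.width ∧ K.collar α ⟨I.1, hI⟩ p = K.collar α I (t, x) := ⟨I.2, (t, x), ht, rfl⟩
  obtain ⟨h1, h2⟩ := K.collar_injective h.choose_spec.choose_spec.1 ht h.choose_spec.choose_spec.2
  rw [posU, dif_pos h, h1]
  refine congrArg (fun q => some (t, q)) ?_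
  exact congrArg ((K.bd α).π I) h2

theorem posU_of_notMem {α : Bool} {I : Idx K.F} {z : K.U I}
    (h : ∀ (hI : IsIdx (K.bd α).F I.1), ∀ t ∈ A α K.width, ∀ x, K.collar α ⟨I.1, hI⟩ (t, x) ≠ z) :
    K.posU α I z = none :=
  dif_neg fun ⟨hI, p, hp, hz⟩ => h hI p.1 hp p.2 hz

theorem posU_smul (α : Bool) (I : Idx K.F) (g : P.ΓI I.1) (z : K.U I) :
    K.posU α I (g • z) = K.posU α I z := by
  obtain ⟨hI, t, ht, x, rfl⟩ | hout := K.collar_or α I z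
  · have h1 := K.collar_smul α ⟨I.1, hI⟩ t ht g x
    have h2 : (K.bd α).π ⟨I.1, hI⟩ (g • x) = (K.bd α).π ⟨I.1, hI⟩ x := by
      have h3 := Quot.sound (WeakSystem.Mor.act (K := (K.bd α).toWeakSystem) ⟨I.1, hI⟩ g⁻¹ x)
      rwa [inv_inv] at h3
    exact (congrArg (K.posU α I) h1).symm.trans ((K.posU_collar (I := ⟨I.1, hI⟩) ht _).trans
      ((congrArg (fun q => some (t, q)) h2).trans (K.posU_collar (I := ⟨I.1, hI⟩) ht x).symm))
  · rw [K.posU_of_notMem hout]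
    refine K.posU_of_notMem fun hI t ht x hx => hout hI t ht (g⁻¹ • x) ?_
    exact (K.collar_smul α ⟨I.1, hI⟩ t ht g⁻¹ x).trans
      ((congrArg (g⁻¹ • ·) hx).trans (inv_smul_smul _ _))

theorem posU_ρ (α : Bool) {I J : Idx K.F} (h : I.1 ⊂ J.1) (y : (K.change I J h).lift) :
    K.posU α I ((K.change I J h).ρ y) = K.posU α J y.1 := by
  obtain ⟨y, hy⟩ := y
  obtain ⟨hJ, t, ht, x, rfl⟩ | hout := K.collar_or α J y
  · have hI : IsIdx (K.bd α).F I.1 := hJ.mono h.subset I.2.1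
    have h1 := (K.collar_lift α ⟨I.1, hI⟩ ⟨J.1, hJ⟩ h t ht x).1 hy
    have h2 := K.collar_ρ α ⟨I.1, hI⟩ ⟨J.1, hJ⟩ h t ht x h1 hy
    have h3 := Quot.sound (WeakSystem.Mor.change (K := (K.bd α).toWeakSystem) ⟨I.1, hI⟩ ⟨J.1, hJ⟩ h
      ⟨x, h1⟩ 1)
    rw [inv_one, one_smul] at h3
    exact (congrArg (K.posU α I) h2).trans ((K.posU_collar (I := ⟨I.1, hI⟩) ht _).trans
      ((congrArg (fun q => some (t, q)) h3).trans (K.posU_collar (I := ⟨J.1, hJ⟩) ht x).symm))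
  · rw [K.posU_of_notMem hout]
    exact K.posU_of_notMem (ρ_ne_collar (y := ⟨y, hy⟩) hout)

/-- The coordinates of a point of a collar of the realization. -/
def pos (α : Bool) : K.Real → Option (Icc (0 : ℝ) 1 × (K.bd α).Real) :=
  Quot.lift (fun p => K.posU α p.1 p.2) (by
    rintro _ _ (⟨I, γ, x⟩ | ⟨I, J, h, y, γ⟩)
    · exact K.posU_smul α I _ x
    · exact (K.posU_smul α I _ _).trans (K.posU_ρ α h y))

theorem pos_realCollar {α : Bool} {t : Icc (0 : ℝ) 1} (ht : t ∈ A α K.width) (q : (K.bd α).Real) :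
    K.pos α (K.realCollar α t ht q) = some (t, q) := by
  obtain ⟨I, x⟩ := q
  exact K.posU_collar ht x

theorem exists_of_pos {α : Bool} {z : K.Real} {t : Icc (0 : ℝ) 1} {q : (K.bd α).Real}
    (h : K.pos α z = some (t, q)) : ∃ ht : t ∈ A α K.width, z = K.realCollar α t ht q := by
  obtain ⟨I, z⟩ := z
  change K.posU α I z = _ at h
  obtain ⟨hI, t', ht', x, rfl⟩ | hout := K.collar_or α I z
  · have h1 := (K.posU_collar (I := ⟨I.1, hI⟩) ht' x).symm.trans h
    simp only [Option.some.injEq, Prod.mk.injEq] at h1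
    obtain ⟨rfl, rfl⟩ := h1
    exact ⟨ht', rfl⟩
  · rw [K.posU_of_notMem hout] at h
    exact absurd h (by simp)

theorem pos_realCollar_of_ne {α β : Bool} (hβ : β ≠ α) {t : Icc (0 : ℝ) 1} (ht : t ∈ A α K.width)
    (q : (K.bd α).Real) : K.pos β (K.realCollar α t ht q) = none := by
  obtain ⟨I, x⟩ := q
  refine K.posU_of_notMem (I := K.idx I) fun hI t' ht' x' h => ?_
  cases α <;> cases β <;> try exact hβ rfl
  · exact Set.disjoint_left.1 (K.collar_disjoint I.1 I.2 hI)
      ⟨(t, x), ⟨ht, mem_univ _⟩, rfl⟩ ⟨(t', x'), ⟨ht', mem_univ _⟩, h⟩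
  · exact Set.disjoint_left.1 (K.collar_disjoint I.1 hI I.2)
      ⟨(t', x'), ⟨ht', mem_univ _⟩, h⟩ ⟨(t, x), ⟨ht, mem_univ _⟩, rfl⟩

/-- The collar of an intermediate domain. -/
def ubarCollar (α : Bool) (I : Idx (K.bd α).F) (p : A α K.width × (K.bd α).Ubar I) :
    K.Ubar (K.idx I) :=
  Quotient.map (sa := MulAction.orbitRel (P.ΓI I.1) ((K.bd α).U I))
    (sb := MulAction.orbitRel (P.ΓI I.1) (K.U (K.idx I))) (fun x => K.collar α I (p.1.1, x))
    (fun _ y ⟨g, hg⟩ => ⟨g, (K.collar_smul α I _ p.1.2 g y).symm.trans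
      (congrArg (fun x => K.collar α I (p.1.1, x)) hg)⟩) p.2

theorem isOpenEmbedding_ubarCollar (α : Bool) (I : Idx (K.bd α).F) :
    IsOpenEmbedding (K.ubarCollar α I) := by
  let mk : (K.bd α).U I → (K.bd α).Ubar I := fun x => Quotient.mk _ x
  have hmk : IsOpenQuotientMap mk := MulAction.isOpenQuotientMap_quotientMk
  have hq : IsOpenQuotientMap (Prod.map id mk : A α K.width × (K.bd α).U I → _) :=
    IsOpenQuotientMap.id.prodMap hmk
  let k : A α K.width × (K.bd α).U I →
      (A α K.width ×ˢ (univ : Set ((K.bd α).U I)) : Set (Icc (0 : ℝ) 1 × (K.bd α).U I)) :=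
    fun p => ⟨(p.1.1, p.2), p.1.2, mem_univ _⟩
  have hk : IsOpenEmbedding k := by
    have h1 : IsOpen (A α K.width ×ˢ (univ : Set ((K.bd α).U I))) :=
      (isOpen_A α _).prod isOpen_univ
    exact IsOpenEmbedding.of_comp k h1.isOpenEmbedding_subtypeVal
      ((isOpen_A α _).isOpenEmbedding_subtypeVal.prodMap IsOpenEmbedding.id)
  have hc := (K.collar_embedding α I).comp hk
  have hmk' : IsOpenQuotientMap (fun x : K.U (K.idx I) => (Quotient.mk _ x : K.Ubar (K.idx I))) :=
    MulAction.isOpenQuotientMap_quotientMk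
  refine .of_continuous_injective_isOpenMap ?_ ?_ ?_
  · rw [← hq.continuous_comp_iff]
    exact hmk'.continuous.comp hc.continuous
  · rintro ⟨t, ⟨x⟩⟩ ⟨t', ⟨x'⟩⟩ h
    obtain ⟨g, hg⟩ := Quotient.exact h
    obtain ⟨h1, h2⟩ := K.collar_injective t'.2 t.2 ((K.collar_smul α I _ t'.2 g x').trans hg)
    exact Prod.ext (Subtype.ext h1.symm) (Quotient.sound ⟨g, h2⟩)
  · intro O hO
    have h1 := hmk'.isOpenMap _ (hc.isOpenMap _ (hO.preimage hq.continuous))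
    convert h1 using 1
    ext q
    constructor
    · rintro ⟨⟨t, ⟨x⟩⟩, hx, rfl⟩
      exact ⟨_, ⟨(t, x), hx, rfl⟩, rfl⟩
    · rintro ⟨_, ⟨⟨t, x⟩, hx, rfl⟩, rfl⟩
      exact ⟨_, hx, rfl⟩

theorem πbar_ubarCollar {α : Bool} {I : Idx (K.bd α).F} (t : A α K.width) (x : (K.bd α).Ubar I) :
    K.πbar (K.idx I) (K.ubarCollar α I (t, x)) = K.realCollar α t.1 t.2 ((K.bd α).πbar I x) := by
  obtain ⟨x⟩ := x
  rfl

/-- A point of an intermediate domain either lies in the collar, or outside the collar of the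
realization. -/
theorem ubarCollar_or (α : Bool) (I : Idx K.F) (x : K.Ubar I) :
    (∃ (hI : IsIdx (K.bd α).F I.1) (p : A α K.width × (K.bd α).Ubar ⟨I.1, hI⟩),
      K.ubarCollar α ⟨I.1, hI⟩ p = x) ∨ K.pos α (K.πbar I x) = none := by
  obtain ⟨z⟩ := x
  obtain ⟨hI, t, ht, x, rfl⟩ | hout := K.collar_or α I z
  · exact Or.inl ⟨hI, (⟨t, ht⟩, Quotient.mk _ x), rfl⟩
  · exact Or.inr (K.posU_of_notMem hout)

/-- The distance to a boundary component, as measured by the collar. -/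
def time (α : Bool) (z : K.Real) : ℝ :=
  match K.pos α z with
  | some p => |(p.1 : ℝ) - endpt α|
  | none => K.width

variable {K}

theorem time_of_pos {α : Bool} {z : K.Real} {p : Icc (0 : ℝ) 1 × (K.bd α).Real}
    (h : K.pos α z = some p) : K.time α z = |(p.1 : ℝ) - endpt α| := by
  rw [time, h]

theorem time_of_none {α : Bool} {z : K.Real} (h : K.pos α z = none) : K.time α z = K.width := by
  rw [time, h]

theorem time_realCollar {α : Bool} {t : Icc (0 : ℝ) 1} (ht : t ∈ A α K.width) (q : (K.bd α).Real) :
    K.time α (K.realCollar α t ht q) = |(t : ℝ) - endpt α| :=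
  time_of_pos (K.pos_realCollar ht q)

theorem time_nonneg (α : Bool) (z : K.Real) : 0 ≤ K.time α z := by
  rw [time]
  split
  exacts [abs_nonneg _, K.width_pos.le]

theorem time_le (α : Bool) (z : K.Real) : K.time α z ≤ K.width := by
  rcases h : K.pos α z with _ | ⟨t, q⟩
  · exact (time_of_none h).le
  · rw [time_of_pos h]
    exact le_of_lt (K.exists_of_pos h).1

theorem exists_pos_of_time_lt {α : Bool} {z : K.Real} (h : K.time α z < K.width) :
    ∃ p, K.pos α z = some p := by
  rcases h' : K.pos α z with _ | p
  · exact absurd (time_of_none h') h.ne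
  · exact ⟨p, rfl⟩

variable (K)

/-- Inside the collar, `time` is a coordinate.  It is continuous at the outer end because the closed
tubes are closed in `U_I`. -/
theorem continuous_time (α : Bool) (I : Idx K.F) : Continuous fun x : K.Ubar I =>
    K.time α (K.πbar I x) := by
  rw [continuous_iff_continuousAt]
  intro x
  obtain ⟨hI, ⟨t, q⟩, rfl⟩ | hx := K.ubarCollar_or α I x
  · have h1 := (K.isOpenEmbedding_ubarCollar α ⟨I.1, hI⟩).continuousAt_iff
      (g := fun x => K.time α (K.πbar I x)) (x := (t, q))
    refine h1.1 (Continuous.continuousAt ?_)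
    have h2 : ((fun x => K.time α (K.πbar I x)) ∘ K.ubarCollar α ⟨I.1, hI⟩) =
        fun p => |(p.1.1 : ℝ) - endpt α| := by
      funext p
      exact (congrArg (K.time α) (K.πbar_ubarCollar p.1 p.2)).trans (time_realCollar p.1.2 _)
    rw [h2]
    fun_prop
  · rw [ContinuousAt, time_of_none hx, tendsto_order]
    refine ⟨fun c hc => ?_, fun c hc => Filter.Eventually.of_forall fun y => (time_le α _).trans_lt
      hc⟩
    by_cases hI : IsIdx (K.bd α).F I.1
    · have hmk : IsOpenQuotientMap (fun x : K.U I => (Quotient.mk _ x : K.Ubar I)) :=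
        MulAction.isOpenQuotientMap_quotientMk
      obtain ⟨z⟩ := x
      have hcl := K.collar_closed α ⟨I.1, hI⟩ (max c 0) (le_max_right _ _) (max_lt hc K.width_pos)
      have hz : z ∉ K.collar α ⟨I.1, hI⟩ '' {p | |(p.1 : ℝ) - endpt α| ≤ max c 0} := by
        rintro ⟨⟨t, y⟩, ht, rfl⟩
        have h1 : t ∈ A α K.width := lt_of_le_of_lt ht (max_lt hc K.width_pos)
        have h2 := (K.posU_collar (I := ⟨I.1, hI⟩) h1 y).symm.trans hx
        simp at h2
      have h3 : ∀ᶠ y in 𝓝 z, c < K.time α (K.π I y) := by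
        filter_upwards [hcl.isOpen_compl.mem_nhds hz] with y hy
        obtain ⟨hI₁, t, ht, y, rfl⟩ | hout := K.collar_or α I y
        · have h4 : K.time α (K.π I (K.collar α ⟨I.1, hI⟩ (t, y))) = |(t : ℝ) - endpt α| :=
            time_of_pos (show K.pos α (K.π I _) = some _ from K.posU_collar (I := ⟨I.1, hI⟩) ht y)
          rw [h4]
          by_contra h5
          exact hy ⟨(t, y), (not_lt.1 h5).trans (le_max_left _ _), rfl⟩
        · have h4 : K.time α (K.π I y) = K.width :=
            time_of_none (show K.pos α (K.π I y) = none from K.posU_of_notMem hout)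
          rw [h4]
          exact hc
      have h4 := hmk.isOpenMap.map_nhds_eq hmk.continuous.continuousAt (x := z)
      exact h4 ▸ Filter.eventually_map.2 h3
    · refine Filter.Eventually.of_forall fun y => ?_
      obtain ⟨hI', -⟩ | hy := K.ubarCollar_or α I y
      · exact absurd hI' hI
      · rw [time_of_none hy]
        exact hc

end WeakCobordism

/-! ### Collared metrics -/

theorem abs_abs_sub_endpt (α : Bool) (t t' : Icc (0 : ℝ) 1) :
    abs (|(t : ℝ) - endpt α| - |(t' : ℝ) - endpt α|) = |(t : ℝ) - t'| := by
  have h : ∀ t : Icc (0 : ℝ) 1, |(t : ℝ) - endpt α| = if α then 1 - (t : ℝ) else t := by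
    intro t
    cases α
    · simp [endpt, abs_of_nonneg t.2.1]
    · simp only [endpt, if_true]
      rw [abs_of_nonpos (by simpa using t.2.2)]
      simp
  rw [h, h]
  cases α
  · simp
  · simp only [if_true]
    rw [abs_sub_comm]
    congr 1
    ring

/-- The triangle inequality for the metric `|f x - f y| + min (β x) (β y) * δ x y` of a cone. A path
through a point `y` with small `β y` may save on the second summand, but has to pay for it with the
first. -/
theorem cone_triangle {R : Type*} {f β : R → ℝ} {δ : R → R → ℝ} {c : ℝ} (hβ : ∀ x, 0 ≤ β x)
    (hf : ∀ x y, β y < β x → c * (β x - β y) ≤ f y - f x) (h0 : ∀ x y, 0 ≤ δ x y)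
    (hc : ∀ x y, δ x y ≤ c)
    (hδ : ∀ x y z, 0 < β x → 0 < β y → 0 < β z → δ x z ≤ δ x y + δ y z) (x y z : R) :
    |f x - f z| + min (β x) (β z) * δ x z ≤
      (|f x - f y| + min (β x) (β y) * δ x y) + (|f y - f z| + min (β y) (β z) * δ y z) := by
  have hc0 : 0 ≤ c := (h0 x x).trans (hc x x)
  have key : ∀ s : ℝ, 0 ≤ s → s ≤ β x → s ≤ β y → s ≤ β z → s * δ x z ≤
      min (β x) (β y) * δ x y + min (β y) (β z) * δ y z := by
    intro s hs hx hy hz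
    rcases hs.eq_or_lt with rfl | hs
    · rw [zero_mul]
      exact add_nonneg (mul_nonneg (le_min (hβ _) (hβ _)) (h0 _ _))
        (mul_nonneg (le_min (hβ _) (hβ _)) (h0 _ _))
    · calc s * δ x z ≤ s * δ x y + s * δ y z := by
            rw [← mul_add]
            exact mul_le_mul_of_nonneg_left
              (hδ x y z (hs.trans_le hx) (hs.trans_le hy) (hs.trans_le hz)) hs.le
        _ ≤ _ := add_le_add (mul_le_mul_of_nonneg_right (le_min hx hy) (h0 _ _))
            (mul_le_mul_of_nonneg_right (le_min hy hz) (h0 _ _))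
  rcases le_or_gt (min (β x) (β z)) (β y) with h | h
  · have h1 := key _ (le_min (hβ x) (hβ z)) (min_le_left _ _) h (min_le_right _ _)
    have h2 := abs_sub_le (f x) (f y) (f z)
    linarith
  · obtain ⟨hx, hz⟩ := lt_min_iff.1 h
    have h1 := key (β y) (hβ y) hx.le le_rfl hz.le
    have h2 := hf x y hx
    have h3 := hf z y hz
    set s := min (β x) (β z) with hs
    have h4 : c * (s - β y) ≤ f y - f x :=
      (mul_le_mul_of_nonneg_left (sub_le_sub_right (min_le_left _ _) _) hc0).trans h2
    have h5 : c * (s - β y) ≤ f y - f z :=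
      (mul_le_mul_of_nonneg_left (sub_le_sub_right (min_le_right _ _) _) hc0).trans h3
    have h6 : (s - β y) * δ x z ≤ c * (s - β y) := by
      rw [mul_comm]
      exact mul_le_mul_of_nonneg_right (hc x z) (sub_pos.2 h).le
    have h7 : 0 ≤ c * (s - β y) := mul_nonneg hc0 (sub_pos.2 h).le
    have h8 : |f x - f y| = f y - f x := by
      rw [abs_sub_comm]
      exact abs_of_nonneg (h7.trans h4)
    have h9 : |f y - f z| = f y - f z := abs_of_nonneg (h7.trans h5)
    have h10 : |f x - f z| ≤ (f y - f x) + (f y - f z) - c * (s - β y) := by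
      rw [abs_le]
      constructor <;> linarith
    rw [h8, h9]
    nlinarith [h6, h1, h10]

/-- The triangle inequality for the metric obtained by collapsing the zero set of a function. -/
theorem collapse_triangle {R : Type*} {d : R → R → ℝ} {g : R → ℝ} (hg : ∀ x, 0 ≤ g x)
    (hd : ∀ x y z, d x z ≤ d x y + d y z) (hl : ∀ x y, g x ≤ d x y + g y)
    (hs : ∀ x y, d x y = d y x) (x y z : R) :
    min (d x z) (g x + g z) ≤ min (d x y) (g x + g y) + min (d y z) (g y + g z) := by
  have h1 := hl x y
  have h2 := hl z y
  have h3 := hd x y z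
  have h4 := hg y
  rw [hs z y] at h2
  rcases le_total (d x y) (g x + g y) with h | h <;> rcases le_total (d y z) (g y + g z)
    with h' | h'
  · rw [min_eq_left h, min_eq_left h']
    exact (min_le_left _ _).trans h3
  all_goals
    first
    | rw [min_eq_left h]
    | rw [min_eq_right h]
    first
    | rw [min_eq_left h']
    | rw [min_eq_right h']
    refine (min_le_right _ _).trans ?_
    linarith

theorem WeakSystem.IsAdmissible.nonneg {N : ℕ} {P : BasicData.{w} N} {X : Type u}
    [TopologicalSpace X] {d : ℤ} {K : WeakSystem.{u, v, w} P X d} {D : K.Real → K.Real → ℝ}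
    (h : K.IsAdmissible D) (p q : K.Real) : 0 ≤ D p q := by
  have h1 := h.triangle p q p
  rw [(h.eq_zero_iff p p).2 rfl, h.symm q p] at h1
  linarith

namespace WeakCobordism

variable {N : ℕ} {P : BasicData.{w} N} {Y : Type u} [TopologicalSpace Y] {B : Bool → Type u}
  [∀ α, TopologicalSpace (B α)] {C : CollaredCobordism Y B} {d : ℤ}
  (K : WeakCobordism.{u, v, w} P C d)

/-- A cutoff function on the realization, which is `1` on the collar of a quarter of the width and
`0` outside the collar of half the width. -/
def ramp (α : Bool) (z : K.Real) : ℝ := max 0 (min 1 (2 - K.time α z / (K.width / 4)))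

/-- The distance of the boundary components of two points of a collar. -/
def distBd (e : ∀ α, (K.bd α).Real → (K.bd α).Real → ℝ) (α : Bool) (z z' : K.Real) : ℝ :=
  match K.pos α z, K.pos α z' with
  | some p, some p' => e α p.2 p'.2
  | _, _ => 0

/-- A radial coordinate of a collar. -/
def radius (c : ℝ) (α : Bool) (z : K.Real) : ℝ := K.time α z + c * (1 - K.ramp α z)

/-- A pseudometric that is the product metric on a collar and a multiple of the metric `e` of the
boundary component, decreasing to zero, further out. -/
def collarDist (e : ∀ α, (K.bd α).Real → (K.bd α).Real → ℝ) (c : ℝ) (α : Bool)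
    (z z' : K.Real) : ℝ :=
  |K.radius c α z - K.radius c α z'| + min (K.ramp α z) (K.ramp α z') * K.distBd e α z z'

/-- A function that vanishes on the collars of a quarter of the width only. -/
def depth (z : K.Real) : ℝ :=
  max 0 (min (K.time false z - K.width / 4) (K.time true z - K.width / 4))

/-- A metric with respect to which `depth` is Lipschitz. -/
def midDist (D : K.Real → K.Real → ℝ) (z z' : K.Real) : ℝ :=
  D z z' + (|K.time false z - K.time false z'| + |K.time true z - K.time true z'|)

/-- The metric which is the product of the metrics `e α` with an interval on the collars, and is
comparable to `D` outside. -/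
def glueDist (D : K.Real → K.Real → ℝ) (e : ∀ α, (K.bd α).Real → (K.bd α).Real → ℝ) (c : ℝ)
    (z z' : K.Real) : ℝ :=
  K.collarDist e c false z z' + K.collarDist e c true z z' +
    min (K.midDist D z z') (K.depth z + K.depth z')

variable {K} {D : K.Real → K.Real → ℝ} {e : ∀ α, (K.bd α).Real → (K.bd α).Real → ℝ} {c : ℝ}

theorem ramp_nonneg (α : Bool) (z : K.Real) : 0 ≤ K.ramp α z := le_max_left _ _

theorem ramp_le_one (α : Bool) (z : K.Real) : K.ramp α z ≤ 1 :=
  max_le zero_le_one (min_le_left _ _)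

theorem ramp_eq_one {α : Bool} {z : K.Real} (h : K.time α z ≤ K.width / 4) : K.ramp α z = 1 := by
  have h1 : K.time α z / (K.width / 4) ≤ 1 :=
    (div_le_one (div_pos K.width_pos (by norm_num))).2 h
  rw [ramp, min_eq_left (by linarith), max_eq_right zero_le_one]

theorem time_lt_of_ramp_pos {α : Bool} {z : K.Real} (h : 0 < K.ramp α z) :
    K.time α z < K.width / 2 := by
  by_contra h'
  have h1 : 2 ≤ K.time α z / (K.width / 4) := by
    rw [le_div_iff₀ (div_pos K.width_pos (by norm_num))]
    linarith
  rw [ramp, max_eq_left ((min_le_right _ _).trans (by linarith))] at h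
  exact lt_irrefl _ h

theorem ramp_pos {α : Bool} {z : K.Real} (h : K.time α z < K.width / 2) : 0 < K.ramp α z := by
  refine lt_max_of_lt_right (lt_min one_pos ?_)
  rw [sub_pos, div_lt_iff₀ (div_pos K.width_pos (by norm_num))]
  linarith

theorem exists_pos_of_ramp_pos {α : Bool} {z : K.Real} (h : 0 < K.ramp α z) :
    ∃ p, K.pos α z = some p :=
  exists_pos_of_time_lt ((time_lt_of_ramp_pos h).trans (half_lt_self K.width_pos))

theorem ramp_anti {α : Bool} {z z' : K.Real} (h : K.time α z ≤ K.time α z') :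
    K.ramp α z' ≤ K.ramp α z := by
  have h1 := div_le_div_of_nonneg_right h (div_pos K.width_pos (by norm_num : (0 : ℝ) < 4)).le
  exact max_le_max_left _ (min_le_min_left _ (by linarith))

theorem abs_ramp_sub_le (α : Bool) (z z' : K.Real) :
    |K.ramp α z - K.ramp α z'| ≤ |K.time α z - K.time α z'| / (K.width / 4) := by
  have h0 : 0 < K.width / 4 := div_pos K.width_pos (by norm_num)
  refine (abs_max_sub_max_le_max _ _ _ _).trans ?_
  rw [sub_self, abs_zero, max_eq_right (abs_nonneg _)]
  refine (abs_min_sub_min_le_max _ _ _ _).trans ?_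
  rw [sub_self, abs_zero, max_eq_right (abs_nonneg _)]
  rw [sub_sub_sub_cancel_left, ← sub_div, abs_div, abs_of_pos h0, abs_sub_comm]

/-- The radial coordinate expands the time coordinate. -/
theorem abs_time_sub_le (hc : 0 ≤ c) (α : Bool) (z z' : K.Real) :
    |K.time α z - K.time α z'| ≤ |K.radius c α z - K.radius c α z'| := by
  rcases le_total (K.time α z) (K.time α z') with h | h
  · have h1 := mul_le_mul_of_nonneg_left (ramp_anti h) hc
    rw [abs_sub_comm, abs_sub_comm (K.radius c α z), abs_of_nonneg (by linarith)]
    refine le_trans ?_ (le_abs_self _)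
    rw [radius, radius]
    linarith
  · have h1 := mul_le_mul_of_nonneg_left (ramp_anti h) hc
    rw [abs_of_nonneg (by linarith)]
    refine le_trans ?_ (le_abs_self _)
    rw [radius, radius]
    linarith

theorem distBd_of_pos {α : Bool} {z z' : K.Real} {p p' : Icc (0 : ℝ) 1 × (K.bd α).Real}
    (h : K.pos α z = some p) (h' : K.pos α z' = some p') : K.distBd e α z z' = e α p.2 p'.2 := by
  rw [distBd, h, h']

theorem distBd_of_none {α : Bool} {z z' : K.Real}
    (h : K.pos α z = none ∨ K.pos α z' = none) : K.distBd e α z z' = 0 := by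
  rw [distBd]
  split
  · rename_i h1 h2
    rcases h with h | h
    · rw [h] at h1
      exact absurd h1 (by simp)
    · rw [h] at h2
      exact absurd h2 (by simp)
  · rfl

/-- A property of `distBd` that holds for `0` and the values of `e` holds always. -/
theorem distBd_cases {α : Bool} (Q : ℝ → Prop) (h0 : Q 0) (h : ∀ p q, Q (e α p q)) (z z' : K.Real) :
    Q (K.distBd e α z z') := by
  rw [distBd]
  split
  exacts [h _ _, h0]

section Admissible

variable (hD : K.IsAdmissible D) (he : ∀ α, (K.bd α).IsAdmissible (e α))
  (hc : ∀ α p q, e α p q ≤ c) (hc0 : 0 ≤ c)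

include he in
theorem distBd_nonneg (α : Bool) (z z' : K.Real) : 0 ≤ K.distBd e α z z' :=
  distBd_cases (0 ≤ ·) le_rfl (he α).nonneg z z'

include he in
theorem distBd_comm (α : Bool) (z z' : K.Real) : K.distBd e α z z' = K.distBd e α z' z := by
  rcases h : K.pos α z with _ | p
  · rw [distBd_of_none (Or.inl h), distBd_of_none (Or.inr h)]
  · rcases h' : K.pos α z' with _ | p'
    · rw [distBd_of_none (Or.inl h'), distBd_of_none (Or.inr h')]
    · rw [distBd_of_pos h h', distBd_of_pos h' h, (he α).symm]

include he hc hc0 in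
theorem collarDist_triangle (α : Bool) (x y z : K.Real) :
    K.collarDist e c α x z ≤ K.collarDist e c α x y + K.collarDist e c α y z := by
  refine cone_triangle (ramp_nonneg α) (fun x y h => ?_) (distBd_nonneg he α)
    (distBd_cases (· ≤ c) hc0 (hc α)) (fun x y z hx hy hz => ?_) x y z
  · rw [radius, radius]
    have h1 : K.time α x ≤ K.time α y := by
      by_contra h'
      exact absurd (ramp_anti (not_le.1 h').le) h.not_ge
    linarith
  · obtain ⟨p, hp⟩ := exists_pos_of_ramp_pos hx
    obtain ⟨q, hq⟩ := exists_pos_of_ramp_pos hy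
    obtain ⟨r, hr⟩ := exists_pos_of_ramp_pos hz
    rw [distBd_of_pos hp hr, distBd_of_pos hp hq, distBd_of_pos hq hr]
    exact (he α).triangle _ _ _

include he in
theorem collarDist_nonneg (α : Bool) (x y : K.Real) : 0 ≤ K.collarDist e c α x y :=
  add_nonneg (abs_nonneg _) (mul_nonneg (le_min (ramp_nonneg _ _) (ramp_nonneg _ _))
    (distBd_nonneg he α x y))

include he in
theorem collarDist_comm (α : Bool) (x y : K.Real) :
    K.collarDist e c α x y = K.collarDist e c α y x := by
  rw [collarDist, collarDist, abs_sub_comm, min_comm, distBd_comm he]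

include he in
theorem collarDist_self (α : Bool) (x : K.Real) : K.collarDist e c α x x = 0 := by
  rw [collarDist, sub_self, abs_zero, zero_add]
  refine mul_eq_zero_of_right _ ?_
  rcases h : K.pos α x with _ | p
  · exact distBd_of_none (Or.inl h)
  · rw [distBd_of_pos h h]
    exact ((he α).eq_zero_iff _ _).2 rfl

include he in
theorem abs_radius_sub_le_collarDist (α : Bool) (x y : K.Real) :
    |K.radius c α x - K.radius c α y| ≤ K.collarDist e c α x y :=
  le_add_of_nonneg_right (mul_nonneg (le_min (ramp_nonneg _ _) (ramp_nonneg _ _))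
    (distBd_nonneg he α x y))

theorem min_ramp_mul_le_collarDist (α : Bool) (x y : K.Real) :
    min (K.ramp α x) (K.ramp α y) * K.distBd e α x y ≤ K.collarDist e c α x y :=
  le_add_of_nonneg_left (abs_nonneg _)

theorem depth_nonneg (z : K.Real) : 0 ≤ K.depth z := le_max_left _ _

theorem depth_eq_zero {α : Bool} {z : K.Real} (h : K.time α z ≤ K.width / 4) : K.depth z = 0 := by
  refine max_eq_left ?_
  cases α
  · exact (min_le_left _ _).trans (sub_nonpos.2 h)
  · exact (min_le_right _ _).trans (sub_nonpos.2 h)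

theorem le_depth {z : K.Real} (h : ∀ α, K.width / 2 ≤ K.time α z) : K.width / 4 ≤ K.depth z := by
  refine le_max_of_le_right (le_min ?_ ?_)
  · linarith [h false]
  · linarith [h true]

theorem abs_depth_sub_le (z z' : K.Real) : |K.depth z - K.depth z'| ≤
    |K.time false z - K.time false z'| + |K.time true z - K.time true z'| := by
  refine (abs_max_sub_max_le_max _ _ _ _).trans ?_
  rw [sub_self, abs_zero, max_eq_right (abs_nonneg _)]
  refine (abs_min_sub_min_le_max _ _ _ _).trans ?_
  rw [sub_sub_sub_cancel_right, sub_sub_sub_cancel_right]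
  exact max_le (le_add_of_nonneg_right (abs_nonneg _)) (le_add_of_nonneg_left (abs_nonneg _))

include hD in
theorem midDist_nonneg (z z' : K.Real) : 0 ≤ K.midDist D z z' :=
  add_nonneg (hD.nonneg _ _) (add_nonneg (abs_nonneg _) (abs_nonneg _))

theorem le_midDist (z z' : K.Real) : D z z' ≤ K.midDist D z z' :=
  le_add_of_nonneg_right (add_nonneg (abs_nonneg _) (abs_nonneg _))

include hD in
theorem midDist_comm (z z' : K.Real) : K.midDist D z z' = K.midDist D z' z := by
  rw [midDist, midDist, hD.symm, abs_sub_comm, abs_sub_comm (K.time true z)]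

include hD in
theorem midDist_self (z : K.Real) : K.midDist D z z = 0 := by
  simp [midDist, (hD.eq_zero_iff z z).2 rfl]

include hD in
theorem midDist_triangle (x y z : K.Real) :
    K.midDist D x z ≤ K.midDist D x y + K.midDist D y z := by
  have h1 := hD.triangle x y z
  have h2 := abs_sub_le (K.time false x) (K.time false y) (K.time false z)
  have h3 := abs_sub_le (K.time true x) (K.time true y) (K.time true z)
  rw [midDist, midDist, midDist]
  linarith

include hD in
theorem depth_le (x y : K.Real) : K.depth x ≤ K.midDist D x y + K.depth y := by
  have h1 := (le_abs_self _).trans (abs_depth_sub_le x y)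
  have h2 := hD.nonneg x y
  rw [midDist]
  linarith

include hD in
theorem min_midDist_nonneg (x y : K.Real) :
    0 ≤ min (K.midDist D x y) (K.depth x + K.depth y) :=
  le_min (midDist_nonneg hD x y) (add_nonneg (depth_nonneg x) (depth_nonneg y))

include hD he in
theorem collarDist_le_glueDist (α : Bool) (x y : K.Real) :
    K.collarDist e c α x y ≤ K.glueDist D e c x y := by
  have h1 := collarDist_nonneg he (c := c) false x y
  have h2 := collarDist_nonneg he (c := c) true x y
  have h3 := min_midDist_nonneg hD x y
  rw [glueDist]
  cases α <;> linarith

include he in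
theorem min_midDist_le_glueDist (x y : K.Real) :
    min (K.midDist D x y) (K.depth x + K.depth y) ≤ K.glueDist D e c x y := by
  have h1 := collarDist_nonneg he (c := c) false x y
  have h2 := collarDist_nonneg he (c := c) true x y
  rw [glueDist]
  linarith

include hD he hc0 in
/-- Points at distance zero that lie in a collar are equal by the product metric there, and

otherwise by the metric `D`. -/
theorem eq_of_glueDist_eq_zero {x y : K.Real} (h : K.glueDist D e c x y = 0) : x = y := by
  by_cases hx : ∃ α, K.time α x < K.width / 2
  · obtain ⟨α, hx⟩ := hx
    have h1 := (collarDist_le_glueDist hD he (c := c) α x y).trans h.le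
    have h2 : |K.time α x - K.time α y| ≤ 0 := ((abs_time_sub_le hc0 α x y).trans
      (abs_radius_sub_le_collarDist he α x y)).trans h1
    have h3 : K.time α x = K.time α y := sub_eq_zero.1 (abs_nonpos_iff.1 h2)
    have hx' := ramp_pos hx
    have hy' := ramp_pos (h3 ▸ hx)
    have h4 := (min_ramp_mul_le_collarDist α x y).trans h1
    have h5 : K.distBd e α x y ≤ 0 :=
      nonpos_of_mul_nonpos_right h4 (lt_min hx' hy')
    obtain ⟨⟨t, p⟩, hp⟩ := exists_pos_of_ramp_pos hx'
    obtain ⟨⟨t', p'⟩, hp'⟩ := exists_pos_of_ramp_pos hy'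
    rw [distBd_of_pos hp hp'] at h5
    obtain rfl := ((he α).eq_zero_iff _ _).1 (le_antisymm h5 ((he α).nonneg _ _))
    rw [time_of_pos hp, time_of_pos hp', ← sub_eq_zero, ← abs_eq_zero, abs_abs_sub_endpt,
      abs_eq_zero, sub_eq_zero] at h3
    obtain rfl := Subtype.ext h3
    obtain ⟨_, rfl⟩ := K.exists_of_pos hp
    obtain ⟨_, rfl⟩ := K.exists_of_pos hp'
    rfl
  · push Not at hx
    have h1 := (min_midDist_le_glueDist he (c := c) (D := D) x y).trans h.le
    have h2 : K.midDist D x y ≤ 0 := by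
      refine (min_le_iff.1 h1).resolve_right fun h3 => ?_
      have h4 := le_depth hx
      have h5 := depth_nonneg y
      have h6 := K.width_pos
      linarith
    exact (hD.eq_zero_iff _ _).1 (le_antisymm ((le_midDist x y).trans h2) (hD.nonneg _ _))

include he hc0 in
theorem exists_glueDist_le (hc : ∀ α p q, e α p q ≤ c) :
    ∃ M, ∀ x y, K.glueDist D e c x y ≤ M := by
  have h1 : ∀ α x y, K.collarDist e c α x y ≤ K.width + c + c := by
    intro α x y
    have h2 : ∀ z, 0 ≤ K.radius c α z ∧ K.radius c α z ≤ K.width + c := by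
      intro z
      have h3 := time_nonneg α z
      have h4 := time_le α z
      have h5 := mul_nonneg hc0 (sub_nonneg.2 (ramp_le_one α z))
      have h6 := mul_nonneg hc0 (ramp_nonneg α z)
      rw [radius]
      constructor <;> linarith
    refine add_le_add ?_ ?_
    · rw [abs_le]
      constructor <;> linarith [(h2 x).1, (h2 x).2, (h2 y).1, (h2 y).2]
    · calc _ ≤ 1 * c := mul_le_mul ((min_le_left _ _).trans (ramp_le_one α x))
            (distBd_cases (· ≤ c) hc0 (hc α) x y) (distBd_nonneg he α x y) zero_le_one
        _ = c := one_mul c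
  have h2 : ∀ z : K.Real, K.depth z ≤ K.width := by
    intro z
    refine max_le K.width_pos.le ((min_le_left _ _).trans ?_)
    linarith [time_le false z, K.width_pos]
  refine ⟨(K.width + c + c) + (K.width + c + c) + (K.width + K.width), fun x y => ?_⟩
  exact add_le_add (add_le_add (h1 _ _ _) (h1 _ _ _))
    ((min_le_right _ _).trans (add_le_add (h2 x) (h2 y)))

end Admissible
end WeakCobordism

namespace WeakCobordism

variable {N : ℕ} {P : BasicData.{w} N} {Y : Type u} [TopologicalSpace Y] {B : Bool → Type u}
  [∀ α, TopologicalSpace (B α)] {C : CollaredCobordism Y B} {d : ℤ}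
  {K : WeakCobordism.{u, v, w} P C d}
  {D : K.Real → K.Real → ℝ} {e : ∀ α, (K.bd α).Real → (K.bd α).Real → ℝ} {c : ℝ}

theorem continuous_ramp (α : Bool) (I : Idx K.F) : Continuous fun x : K.Ubar I =>
    K.ramp α (K.πbar I x) := by
  have h := K.continuous_time α I
  unfold ramp
  fun_prop

theorem continuous_radius (α : Bool) (I : Idx K.F) : Continuous fun x : K.Ubar I =>
    K.radius c α (K.πbar I x) := by
  have h := K.continuous_time α I
  have h' := continuous_ramp (K := K) α I
  unfold radius
  fun_prop

theorem _root_.Kuranishi.WeakSystem.IsAdmissible.tendsto {X : Type u} [TopologicalSpace X]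
    {d : ℤ} {K : WeakSystem.{u, v, w} P X d} {D : K.Real → K.Real → ℝ} (h : K.IsAdmissible D)
    (I : Idx K.F) (x : K.Ubar I) :
    Filter.Tendsto (fun y => D (K.πbar I x) (K.πbar I y)) (𝓝 x) (𝓝 0) := by
  rw [tendsto_order]
  refine ⟨fun a ha => Filter.Eventually.of_forall fun y => ha.trans_le (h.nonneg _ _), fun a ha =>
    ?_⟩
  exact (h.topology I x).mem_of_mem ha

section Admissible

variable (hD : K.IsAdmissible D) (he : ∀ α, (K.bd α).IsAdmissible (e α))
  (hc : ∀ α p q, e α p q ≤ c) (hc0 : 0 ≤ c)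

include he in
theorem tendsto_collarDist (α : Bool) (I : Idx K.F) (x : K.Ubar I) :
    Filter.Tendsto (fun y => K.collarDist e c α (K.πbar I x) (K.πbar I y)) (𝓝 x) (𝓝 0) := by
  have h1 : Filter.Tendsto (fun y => |K.radius c α (K.πbar I x) - K.radius c α (K.πbar I y)|)
      (𝓝 x) (𝓝 0) := by
    have h2 : Continuous fun y => |K.radius c α (K.πbar I x) - K.radius c α (K.πbar I y)| := by
      have h3 := continuous_radius (K := K) (c := c) α I
      fun_prop
    simpa using h2.tendsto x
  rw [← add_zero (0 : ℝ)]
  refine h1.add ?_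
  obtain ⟨hI, ⟨t, q⟩, rfl⟩ | hx := K.ubarCollar_or α I x
  · have h2 : Filter.Tendsto (fun y => K.distBd e α
        (K.πbar I (K.ubarCollar α ⟨I.1, hI⟩ (t, q))) (K.πbar I y))
        (𝓝 (K.ubarCollar α ⟨I.1, hI⟩ (t, q))) (𝓝 0) := by
      have h3 := (K.isOpenEmbedding_ubarCollar α ⟨I.1, hI⟩).map_nhds_eq (t, q)
      have h4 : Filter.Tendsto (fun p : A α K.width × (K.bd α).Ubar ⟨I.1, hI⟩ =>
          e α ((K.bd α).πbar ⟨I.1, hI⟩ q) ((K.bd α).πbar ⟨I.1, hI⟩ p.2)) (𝓝 (t, q)) (𝓝 0) :=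
        ((he α).tendsto ⟨I.1, hI⟩ q).comp (continuous_snd.tendsto (t, q))
      have h5 : ∀ p : A α K.width × (K.bd α).Ubar ⟨I.1, hI⟩,
          K.pos α (K.πbar (K.idx ⟨I.1, hI⟩) (K.ubarCollar α ⟨I.1, hI⟩ p)) =
            some (p.1.1, (K.bd α).πbar ⟨I.1, hI⟩ p.2) := fun p =>
        (congrArg (K.pos α) (K.πbar_ubarCollar p.1 p.2)).trans (K.pos_realCollar p.1.2 _)
      have h6 := h4.congr fun p => (distBd_of_pos (e := e) (h5 (t, q)) (h5 p)).symm
      have h7 := Filter.tendsto_map'_iff (f := fun y => K.distBd e α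
        (K.πbar I (K.ubarCollar α ⟨I.1, hI⟩ (t, q))) (K.πbar I y)).2 h6
      exact h3 ▸ h7
    have h3 := h2
    refine squeeze_zero (fun y => mul_nonneg (le_min (ramp_nonneg _ _) (ramp_nonneg _ _))
      (distBd_nonneg he α _ _)) (fun y => ?_) h3
    exact mul_le_of_le_one_left (distBd_nonneg he α _ _) ((min_le_left _ _).trans (ramp_le_one _ _))
  · simp [distBd_of_none (Or.inl hx)]

include hD he in
/-- Convergence in the quotient topology of `U_I / Γ_I` implies convergence in the glued metric. -/
theorem tendsto_glueDist (I : Idx K.F) (x : K.Ubar I) :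
    Filter.Tendsto (fun y => K.glueDist D e c (K.πbar I x) (K.πbar I y)) (𝓝 x) (𝓝 0) := by
  have h1 := ((tendsto_collarDist he (c := c) false I x).add
    (tendsto_collarDist he (c := c) true I x))
  have h2 : Filter.Tendsto (fun y => K.midDist D (K.πbar I x) (K.πbar I y)) (𝓝 x) (𝓝 0) := by
    have h3 : Continuous fun y => |K.time false (K.πbar I x) - K.time false (K.πbar I y)| +
        |K.time true (K.πbar I x) - K.time true (K.πbar I y)| := by
      have h4 := K.continuous_time false I
      have h5 := K.continuous_time true I
      fun_prop
    have h4 := (hD.tendsto I x).add (h3.tendsto x)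
    rw [sub_self, abs_zero, sub_self, abs_zero, add_zero, add_zero] at h4
    exact h4
  have h3 := h1.add (squeeze_zero (fun y => min_midDist_nonneg hD _ _)
    (fun y => min_le_left _ (K.depth (K.πbar I x) + K.depth (K.πbar I y))) h2)
  rw [add_zero, add_zero] at h3
  exact h3

include hD he hc0 in
/-- The glued metric controls the topology: on the inner half of a collar the coordinates are
controlled by the metric of the collar, and elsewhere the given metric is. -/
theorem exists_glueDist_subset (I : Idx K.F) (x : K.Ubar I) {O : Set (K.Ubar I)} (hO : O ∈ 𝓝 x) :
    ∃ r : ℝ, 0 < r ∧ ∀ y, K.glueDist D e c (K.πbar I x) (K.πbar I y) < r → y ∈ O := by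
  have hw := K.width_pos
  by_cases hx : ∃ α, K.time α (K.πbar I x) < K.width / 2
  · obtain ⟨α, hx⟩ := hx
    obtain ⟨hI, ⟨t, q⟩, rfl⟩ | hx' := K.ubarCollar_or α I x
    swap
    · rw [time_of_none hx'] at hx
      linarith
    have hpos : ∀ p : A α K.width × (K.bd α).Ubar ⟨I.1, hI⟩,
        K.pos α (K.πbar I (K.ubarCollar α ⟨I.1, hI⟩ p)) =
          some (p.1.1, (K.bd α).πbar ⟨I.1, hI⟩ p.2) := fun p =>
      (congrArg (K.pos α) (K.πbar_ubarCollar p.1 p.2)).trans (K.pos_realCollar p.1.2 _)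
    have h1 : K.ubarCollar α ⟨I.1, hI⟩ ⁻¹' O ∈ 𝓝 (t, q) :=
      (K.isOpenEmbedding_ubarCollar α ⟨I.1, hI⟩).continuous.continuousAt hO
    rw [nhds_prod_eq] at h1
    obtain ⟨r₁, h₁, r₂, h₂, hO'⟩ : ∃ r₁ > 0, ∃ r₂ > 0,
        ∀ p : A α K.width × (K.bd α).Ubar ⟨I.1, hI⟩, |(t.1 : ℝ) - p.1.1| < r₁ →
          e α ((K.bd α).πbar ⟨I.1, hI⟩ q) ((K.bd α).πbar ⟨I.1, hI⟩ p.2) < r₂ →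
            K.ubarCollar α ⟨I.1, hI⟩ p ∈ O := by
      obtain ⟨⟨r₁, r₂⟩, ⟨h₁, h₂⟩, hs⟩ :=
        (Metric.nhds_basis_ball.prod ((he α).topology ⟨I.1, hI⟩ q)).mem_iff.1 h1
      refine ⟨r₁, h₁, r₂, h₂, fun p hp hp' => @hs p ⟨?_, hp'⟩⟩
      rw [Metric.mem_ball, dist_comm]
      exact hp
    set z := K.πbar I (K.ubarCollar α ⟨I.1, hI⟩ (t, q)) with hz
    have hr := ramp_pos hx
    refine ⟨min (min r₁ (K.width / 2 - K.time α z))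
      (min (K.width / 4 * (K.ramp α z / 2)) (r₂ * (K.ramp α z / 2))), ?_, fun y hy => ?_⟩
    · refine lt_min (lt_min h₁ (sub_pos.2 hx)) (lt_min ?_ ?_) <;> positivity
    · simp only [lt_min_iff] at hy
      obtain ⟨⟨hy1, hy2⟩, hy3, hy4⟩ := hy
      set z' := K.πbar I y with hz'
      have h3 := collarDist_le_glueDist hD he (c := c) α z z'
      have h4 : |K.time α z - K.time α z'| ≤ K.glueDist D e c z z' :=
        ((abs_time_sub_le hc0 α z z').trans (abs_radius_sub_le_collarDist he α z z')).trans h3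
      have h5 : K.time α z' < K.width / 2 := by
        have h6 := (abs_le.1 h4).1
        linarith
      obtain ⟨hI', ⟨t', q'⟩, rfl⟩ | hy' := K.ubarCollar_or α I y
      swap
      · rw [hz', time_of_none hy'] at h5
        linarith
      refine hO' (t', q') ?_ ?_
      · have h6 := h4
        rw [time_of_pos (hpos (t, q)), hz', time_of_pos (hpos (t', q')), abs_abs_sub_endpt] at h6
        exact h6.trans_lt hy1
      · have h6 : K.ramp α z / 2 ≤ K.ramp α z' := by
          have h7 := (le_abs_self _).trans (abs_ramp_sub_le α z z')
          have h8 : |K.time α z - K.time α z'| / (K.width / 4) ≤ K.ramp α z / 2 := by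
            rw [div_le_iff₀ (by linarith)]
            linarith [h4.trans hy3.le]
          linarith
        have h7 : K.ramp α z / 2 ≤ min (K.ramp α z) (K.ramp α z') := le_min (by linarith) h6
        have h8 := (min_ramp_mul_le_collarDist (e := e) (c := c) α z z').trans h3
        have h9 := (mul_le_mul_of_nonneg_right h7 (distBd_nonneg he α z z')).trans h8
        rw [distBd_of_pos (hpos (t, q)) (hpos (t', q'))] at h9
        have h10 := h9.trans_lt hy4
        rw [mul_comm] at h10
        exact lt_of_mul_lt_mul_right h10 (by positivity)
  · push Not at hx
    obtain ⟨r, hr, hO'⟩ := (hD.topology I x).mem_iff.1 hO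
    refine ⟨min r (K.width / 4), lt_min hr (by linarith), fun y hy => hO' ?_⟩
    obtain ⟨hy1, hy2⟩ := lt_min_iff.1 hy
    have h1 := min_midDist_le_glueDist he (c := c) (D := D) (K.πbar I x) (K.πbar I y)
    have h2 := le_depth hx
    have h3 := depth_nonneg (K.πbar I y)
    rcases min_le_iff.1 h1 with h4 | h4
    · exact ((le_midDist _ _).trans h4).trans_lt hy1
    · linarith

include hD he hc hc0 in
theorem isAdmissible_glueDist : K.IsAdmissible (K.glueDist D e c) where
  eq_zero_iff p q := by
    refine ⟨eq_of_glueDist_eq_zero hD he hc0, ?_⟩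
    rintro rfl
    rw [glueDist, collarDist_self he, collarDist_self he, midDist_self hD, min_eq_left
      (add_nonneg (depth_nonneg _) (depth_nonneg _))]
    norm_num
  symm p q := by
    rw [glueDist, glueDist, collarDist_comm he, collarDist_comm he true, midDist_comm hD, add_comm
      (K.depth p)]
  triangle p q r := by
    have h1 := collarDist_triangle he hc hc0 false p q r
    have h2 := collarDist_triangle he hc hc0 true p q r
    have h3 := collapse_triangle (depth_nonneg (K := K)) (midDist_triangle hD) (depth_le hD)
      (midDist_comm hD) p q r
    rw [glueDist, glueDist, glueDist]
    linarith
  bounded := exists_glueDist_le he hc0 hc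
  topology I x := by
    refine Filter.hasBasis_iff.2 fun O => ⟨fun hO => ?_, ?_⟩
    · obtain ⟨r, hr, h⟩ := exists_glueDist_subset hD he hc0 I x hO
      exact ⟨r, hr, h⟩
    · rintro ⟨r, hr, h⟩
      exact Filter.mem_of_superset
        ((tendsto_order.1 (tendsto_glueDist hD he (c := c) I x)).2 r hr) h

include hD in
theorem glueDist_realCollar {α : Bool} {t t' : Icc (0 : ℝ) 1} (ht : t ∈ A α K.width)
    (ht' : t' ∈ A α K.width) (h : t ∈ A α (K.width / 4)) (h' : t' ∈ A α (K.width / 4))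
    (p q : (K.bd α).Real) :
    K.glueDist D e c (K.realCollar α t ht p) (K.realCollar α t' ht' q) =
      |(t : ℝ) - t'| + e α p q := by
  have h1 : K.time α (K.realCollar α t ht p) ≤ K.width / 4 := (time_realCollar ht p).trans_le h.le
  have h1' : K.time α (K.realCollar α t' ht' q) ≤ K.width / 4 :=
    (time_realCollar ht' q).trans_le h'.le
  have h2 : K.collarDist e c α (K.realCollar α t ht p) (K.realCollar α t' ht' q) =
      |(t : ℝ) - t'| + e α p q := by
    rw [collarDist, radius, radius, ramp_eq_one h1, ramp_eq_one h1', distBd_of_pos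
      (K.pos_realCollar ht p) (K.pos_realCollar ht' q), time_realCollar, time_realCollar]
    simp [abs_abs_sub_endpt]
  have h3 : ∀ β, β ≠ α →
      K.collarDist e c β (K.realCollar α t ht p) (K.realCollar α t' ht' q) = 0 := by
    intro β hβ
    have h4 := K.pos_realCollar_of_ne hβ ht p
    have h5 := K.pos_realCollar_of_ne hβ ht' q
    have h6 : K.ramp β (K.realCollar α t ht p) = K.ramp β (K.realCollar α t' ht' q) := by
      rw [ramp, ramp, time_of_none h4, time_of_none h5]
    rw [collarDist, radius, radius, h6, time_of_none h4, time_of_none h5,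
      distBd_of_none (Or.inl h4)]
    simp
  rw [glueDist, depth_eq_zero h1, depth_eq_zero h1', add_zero, min_eq_right (midDist_nonneg hD _ _),
    add_zero]
  cases α
  · rw [h2, h3 true (by simp), add_zero]
  · rw [h2, h3 false (by simp), zero_add]

include hD in
theorem bdDist_glueDist (α : Bool) : K.bdDist (K.glueDist D e c) α = e α := by
  have h := endpt_mem_A α (div_pos K.width_pos (by norm_num : (0 : ℝ) < 4))
  funext p q
  rw [bdDist, glueDist_realCollar hD _ _ h h, sub_self, abs_zero, zero_add]

end Admissible

/-- Given admissible metrics on the realizations of a cobordism and of its boundary components,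
there is a collared admissible metric that restricts to the given ones on the boundary. -/
theorem exists_isCollaredAdmissible (hD : K.IsAdmissible D)
    (he : ∀ α, (K.bd α).IsAdmissible (e α)) :
    ∃ D', K.IsCollaredAdmissible D' ∧ ∀ α, K.bdDist D' α = e α := by
  have hw := K.width_pos
  obtain ⟨c, hc0, hc⟩ : ∃ c : ℝ, 0 ≤ c ∧ ∀ α p q, e α p q ≤ c := by
    choose M hM using fun α => (he α).bounded
    refine ⟨max 0 (max (M false) (M true)), le_max_left _ _, fun α p q => (hM α p q).trans ?_⟩
    cases α
    · exact (le_max_left _ _).trans (le_max_right _ _)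
    · exact (le_max_right _ _).trans (le_max_right _ _)
  refine ⟨K.glueDist D e c, ⟨isAdmissible_glueDist hD he hc hc0, K.width / 4, by linarith,
    by linarith, fun α => ⟨fun t h t' h' ht ht' p q => ?_, fun z hz t h ht p => ?_⟩⟩,
    bdDist_glueDist hD⟩
  · rw [glueDist_realCollar hD ht ht' h h', bdDist_glueDist hD]
  · have h1 : K.width / 4 ≤ K.time α z := by
      by_contra h2
      obtain ⟨⟨t', q⟩, hq⟩ := exists_pos_of_time_lt (K := K) (α := α) (z := z) (by linarith)
      obtain ⟨ht', e⟩ := K.exists_of_pos hq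
      rw [time_of_pos hq] at h2
      exact hz t' (not_le.1 h2) ht' q e
    have h2 := collarDist_le_glueDist hD he (c := c) α z (K.realCollar α t ht p)
    have h3 := (abs_time_sub_le hc0 α z (K.realCollar α t ht p)).trans
      (abs_radius_sub_le_collarDist he α _ _)
    rw [time_realCollar] at h3
    have h4 := (le_abs_self _).trans (h3.trans h2)
    linarith

/-- An admissible metric restricts to admissible metrics on the boundary components. -/
theorem isAdmissible_bdDist (hD : K.IsAdmissible D) (α : Bool) :
    (K.bd α).IsAdmissible (K.bdDist D α) where
  eq_zero_iff p q := by
    rw [bdDist, hD.eq_zero_iff]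
    refine ⟨fun h => ?_, fun h => h ▸ rfl⟩
    have h1 := K.pos_realCollar (endpt_mem_A α K.width_pos) p
    rw [h, K.pos_realCollar] at h1
    simp only [Option.some.injEq, Prod.mk.injEq, true_and] at h1
    exact h1.symm
  symm p q := hD.symm _ _
  triangle p q r := hD.triangle _ _ _
  bounded := hD.bounded.imp fun M h p q => h _ _
  topology I x := by
    have h1 : IsInducing fun q : (K.bd α).Ubar I =>
        K.ubarCollar α I (⟨endpt α, endpt_mem_A α K.width_pos⟩, q) :=
      (K.isOpenEmbedding_ubarCollar α I).isInducing.comp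
        (isEmbedding_prodMkRight _).isInducing
    have h2 := (hD.topology (K.idx I)
      (K.ubarCollar α I (⟨endpt α, endpt_mem_A α K.width_pos⟩, x))).comap
      fun q : (K.bd α).Ubar I => K.ubarCollar α I (⟨endpt α, endpt_mem_A α K.width_pos⟩, q)
    rw [h1.nhds_eq_comap]
    convert h2 using 2 with r
    ext y
    exact iff_of_eq (congrArg (· < r) (congrArg₂ D
      (K.πbar_ubarCollar ⟨endpt α, endpt_mem_A α K.width_pos⟩ x).symm
      (K.πbar_ubarCollar ⟨endpt α, endpt_mem_A α K.width_pos⟩ y).symm))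

end WeakCobordism

/-! ### Product cobordisms -/

namespace WeakAtlas

variable {N : ℕ} {P : BasicData.{w} N} {X : Type u} [TopologicalSpace X] {d : ℤ}

theorem isIdx_univ_prod {N : ℕ} {X : Type u} {F : Fin N → Set X} {I : Finset (Fin N)} :
    IsIdx (fun i => (univ : Set (Icc (0 : ℝ) 1)) ×ˢ F i) I ↔ IsIdx F I := by
  refine and_congr_right fun _ => ?_
  constructor
  · rintro ⟨p, hp⟩
    exact ⟨p.2, mem_iInter₂.2 fun i hi => (mem_iInter₂.1 hp i hi).2⟩
  · rintro ⟨p, hp⟩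
    exact ⟨(0, p), mem_iInter₂.2 fun i hi => ⟨mem_univ _, mem_iInter₂.1 hp i hi⟩⟩

theorem _root_.Kuranishi.SmoothStr.isLocalDiffeomorph_id {M : Type v} [TopologicalSpace M]
    (S : SmoothStr M) : IsLocalDiffeomorph S.I S.I ∞ (id : M → M) :=
  (Diffeomorph.refl S.I _ ∞).isLocalDiffeomorph

/-- Transport along an equality of charts is a local diffeomorphism. -/
theorem _root_.Kuranishi.Chart.isLocalDiffeomorph_cast {G : Type w} [Group G] {E : Type w}
    [NormedAddCommGroup E] [NormedSpace ℝ E] {τ : Representation ℝ G E}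
    {c : Chart.{u, v, w} X τ} {c' : Chart.{u, v, w} (Icc (0 : ℝ) 1 × X) τ} (h : c' = c.unitProd) :
    IsLocalDiffeomorph c.smooth.unitProd.I c'.smooth.I ∞
      (fun p : Icc (0 : ℝ) 1 × c.U => (cast (congrArg Chart.U h.symm) p : c'.U)) := by
  subst h
  exact SmoothStr.isLocalDiffeomorph_id c.smooth.unitProd

theorem _root_.Kuranishi.SmoothStr.boundary_unitProd {M : Type v} [TopologicalSpace M]
    (S : SmoothStr M) (h : S.I.boundary M = ∅) (p : Icc (0 : ℝ) 1 × M) :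
    p ∈ S.unitProd.I.boundary (Icc (0 : ℝ) 1 × M) ↔ ∃ α, p.1 = endpt α := by
  have h1 : S.unitProd.I.boundary (Icc (0 : ℝ) 1 × M) =
      (univ : Set (Icc (0 : ℝ) 1)) ×ˢ S.I.boundary M ∪ (𝓡∂ 1).boundary (Icc (0 : ℝ) 1) ×ˢ univ :=
    ModelWithCorners.boundary_prod (I := 𝓡∂ 1) (J := S.I)
  rw [h1, h, prod_empty, empty_union, boundary_Icc]
  constructor
  · rintro ⟨h2 | h2, -⟩
    exacts [⟨false, h2⟩, ⟨true, h2⟩]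
  · rintro ⟨_ | _, h2⟩
    exacts [⟨Or.inl h2, mem_univ _⟩, ⟨Or.inr h2, mem_univ _⟩]

variable (K : WeakAtlas.{u, v, w} P X d)

/-- The index of the factor. -/
abbrev base (I : Idx fun i => (univ : Set (Icc (0 : ℝ) 1)) ×ˢ K.F i) : Idx K.F :=
  ⟨I.1, isIdx_univ_prod.1 I.2⟩

/-- The product of an atlas with the unit interval, as a system of charts. -/
def unitProdSystem : WeakSystem.{u, v, w} P (Icc (0 : ℝ) 1 × X) (d + 1) where
  F i := univ ×ˢ K.F i
  cover := by rw [← prod_iUnion, K.cover, univ_prod_univ]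
  F_open i := isOpen_univ.prod (K.F_open i)
  chart I := (K.chart (K.base I)).unitProd
  chart_foot I := by
    ext p
    have h1 : p.2 ∈ (K.chart (K.base I)).footprint ↔ ∀ i ∈ I.1, p.2 ∈ K.F i := by
      rw [K.chart_foot]
      simp
    have h2 : p ∈ (K.chart (K.base I)).unitProd.footprint ↔
        p.2 ∈ (K.chart (K.base I)).footprint := by
      constructor
      · rintro ⟨z, rfl⟩
        exact ⟨_, rfl⟩
      · rintro ⟨z, hz⟩
        exact ⟨⟨(p.1, z.1), z.2⟩, Prod.ext rfl hz⟩
    rw [h2, h1]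
    simp
  chart_dim I := by
    have h := K.chart_dim (K.base I)
    have h1 : Module.finrank ℝ (EuclideanSpace ℝ (Fin 1) × (K.chart (K.base I)).smooth.V) =
        1 + Module.finrank ℝ (K.chart (K.base I)).smooth.V := by
      rw [Module.finrank_prod]
      simp
    have h2 : Module.finrank ℝ (K.chart (K.base I)).unitProd.smooth.V =
        1 + Module.finrank ℝ (K.chart (K.base I)).smooth.V := h1
    rw [h2]
    push_cast
    linarith
  change I J h := (K.change (K.base I) (K.base J) h).unitProd
  cocycle I J L hIJ hJL z hIL hz hy :=
    Prod.ext rfl (K.cocycle (K.base I) (K.base J) (K.base L) hIJ hJL z.2 hIL hz hy)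

/-- The frame of the product cobordism. -/
def unitProdFrame : CobordismFrame.{u, v, w} P (trivialCobordism X) d where
  toWeakSystem := K.unitProdSystem
  bd _ := K
  width := 1 / 4
  width_pos := by norm_num
  width_le := le_rfl
  F_collar α t ht i b := ⟨fun h => h.2, fun h => ⟨mem_univ _, h⟩⟩

/-- The collars of the domains of the product cobordism. -/
def unitProdCollar (α : Bool) (I : Idx (K.unitProdFrame.bd α).F)
    (p : Icc (0 : ℝ) 1 × (K.unitProdFrame.bd α).U I) :
    K.unitProdFrame.U (K.unitProdFrame.idx (α := α) I) := p

theorem isLocalDiffeomorph_unitProdCollar (α : Bool) (I : Idx (K.unitProdFrame.bd α).F) :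
    IsLocalDiffeomorph ((K.unitProdFrame.bd α).chart I).smooth.unitProd.I
      (K.unitProdFrame.chart (K.unitProdFrame.idx (α := α) I)).smooth.I ∞ (K.unitProdCollar α I) :=
  Chart.isLocalDiffeomorph_cast (c := (K.unitProdFrame.bd α).chart I)
      (c' := K.unitProdFrame.chart (K.unitProdFrame.idx (α := α) I)) rfl

/-- The product of an atlas with the unit interval, as a cobordism. -/
def unitProd : WeakCobordism.{u, v, w} P (trivialCobordism X) d where
  toCobordismFrame := K.unitProdFrame
  collar := K.unitProdCollar
  collar_embedding α I :=
    ((isOpen_A α _).prod isOpen_univ).isOpenEmbedding_subtypeVal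
  collar_diffeo α I p := K.isLocalDiffeomorph_unitProdCollar α I p.1
  collar_disjoint I h0 h1 := (trivialCobordism (K.U ⟨I, h0⟩)).isCollar.disjoint
  collar_closed α I δ h h' := (trivialCobordism (K.U I)).isCollar.isClosed α δ h h'
  boundary I p := by
    refine (SmoothStr.boundary_unitProd _ (K.boundaryless (K.base I)) p).trans ?_
    constructor
    · rintro ⟨α, h⟩
      exact ⟨α, (K.base I).2, p.2, Prod.ext h rfl⟩
    · rintro ⟨α, h, x, rfl⟩
      exact ⟨α, rfl⟩
  collar_smul _ _ _ _ _ _ := rfl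
  collar_s _ _ _ _ _ := rfl
  collar_ψ _ _ _ _ _ _ _ := rfl
  collar_dom _ _ _ _ _ _ _ := Iff.rfl
  collar_lift _ _ _ _ _ _ _ := Iff.rfl
  collar_ρ _ _ _ _ _ _ _ _ _ := rfl
  collar_avoid α I J h hJ := absurd (K.base J).2 hJ

end WeakAtlas

/-! ### Interpolation of subdomains -/

theorem mem_A_false {ε : ℝ} {t : Icc (0 : ℝ) 1} : t ∈ A false ε ↔ (t : ℝ) < ε := by
  change |(t : ℝ) - endpt false| < ε ↔ _
  rw [abs_sub_endpt]
  simp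

theorem mem_A_true {ε : ℝ} {t : Icc (0 : ℝ) 1} : t ∈ A true ε ↔ 1 - (t : ℝ) < ε := by
  change |(t : ℝ) - endpt true| < ε ↔ _
  rw [abs_sub_endpt]
  simp

open Classical in
/-- The step function on the unit interval with values `D false`, `Q false`, `M`, `Q true`,
`D true`, whose jumps are at distance `a` and `1 - b` from the endpoints. -/
def interpolate {T : Type*} (a b : ℝ) (D Q : Bool → T) (M : T) (t : Icc (0 : ℝ) 1) : T :=
  if t ∈ A false a then D false else if t ∈ A true a then D true
  else if ∀ α, t ∈ A α b then M else if t ∈ A false b then Q false else Q true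

theorem interpolate_of {T : Type*} {a b : ℝ} {D Q : Bool → T} {M : T} {R : T → Prop}
    (hD : ∀ α, R (D α)) (hQ : ∀ α, R (Q α)) (hM : R M) (t : Icc (0 : ℝ) 1) :
    R (interpolate a b D Q M t) := by
  unfold interpolate
  split_ifs
  exacts [hD _, hD _, hM, hQ _, hQ _]

theorem interpolate_of_mem {T : Type*} {a b : ℝ} {D Q : Bool → T} {M : T} (ha : a ≤ 1 / 2)
    {α : Bool} {t : Icc (0 : ℝ) 1} (ht : t ∈ A α a) : interpolate a b D Q M t = D α := by
  cases α
  · exact if_pos ht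
  · have h : t ∉ A false a := by
      rw [mem_A_true] at ht
      rw [mem_A_false]
      linarith
    rw [interpolate, if_neg h, if_pos ht]

/-- If the values `Q α` are smaller than `D α` and `M`, then the interpolation is the union of

constant families over open subsets of the unit interval. -/
theorem interpolate_iff {T : Type*} {a b : ℝ} {D Q : Bool → T} {M : T} (hab : a + b ≤ 1)
    (hb : 1 / 2 < b) (R : T → Prop) (hD : ∀ α, R (Q α) → R (D α)) (hM : ∀ α, R (Q α) → R M)
    (t : Icc (0 : ℝ) 1) : R (interpolate a b D Q M t) ↔
      (∃ α, t ∈ A α a ∧ R (D α)) ∨ (∃ α, t ∈ A α b ∧ R (Q α)) ∨ ((∀ α, t ∈ A α b) ∧ R M) := by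
  have hD0 := hD false
  have hD1 := hD true
  have hM0 := hM false
  have hM1 := hM true
  unfold interpolate
  simp only [Bool.exists_bool, Bool.forall_bool, mem_A_false, mem_A_true]
  split_ifs with h1 h2 h3 h4
  · have e1 : ¬ 1 - (t : ℝ) < a := by linarith
    have e2 : ¬ 1 - (t : ℝ) < b := by linarith
    tauto
  · have e2 : ¬ (t : ℝ) < b := by linarith
    tauto
  · tauto
  · tauto
  · have e2 : 1 - (t : ℝ) < b := by linarith
    tauto

section

variable {Z : Type*} [TopologicalSpace Z] {a b : ℝ} {D Q : Bool → Set Z} {M : Set Z}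

theorem isOpen_interpolate (hab : a + b ≤ 1) (hb : 1 / 2 < b) (hQD : ∀ α, Q α ⊆ D α)
    (hQM : ∀ α, Q α ⊆ M) (hD : ∀ α, IsOpen (D α)) (hQ : ∀ α, IsOpen (Q α)) (hM : IsOpen M) :
    IsOpen {p : Icc (0 : ℝ) 1 × Z | p.2 ∈ interpolate a b D Q M p.1} := by
  have e : {p : Icc (0 : ℝ) 1 × Z | p.2 ∈ interpolate a b D Q M p.1} =
      (⋃ α, A α a ×ˢ D α) ∪ ((⋃ α, A α b ×ˢ Q α) ∪ (⋂ α, A α b) ×ˢ M) := by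
    ext p
    refine (interpolate_iff hab hb (p.2 ∈ ·) (fun α h => hQD α h) (fun α h => hQM α h) p.1).trans ?_
    simp
  rw [e]
  exact (isOpen_iUnion fun α => (isOpen_A α a).prod (hD α)).union
    ((isOpen_iUnion fun α => (isOpen_A α b).prod (hQ α)).union
      ((isOpen_iInter_of_finite fun α => isOpen_A α b).prod hM))

theorem closure_interpolate_subset {a' b' : ℝ} {D' Q' : Bool → Set Z} {M' : Set Z}
    (hab : a + b ≤ 1) (hb : 1 / 2 < b) (hQD : ∀ α, Q α ⊆ D α) (hQM : ∀ α, Q α ⊆ M)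
    (hab' : a' + b' ≤ 1) (hb' : 1 / 2 < b') (hQD' : ∀ α, Q' α ⊆ D' α) (hQM' : ∀ α, Q' α ⊆ M')
    (ha : a' < a) (hbb : b' < b) (hD : ∀ α, closure (D' α) ⊆ D α) (hQ : ∀ α, closure (Q' α) ⊆ Q α)
    (hM : closure M' ⊆ M) :
    closure {p : Icc (0 : ℝ) 1 × Z | p.2 ∈ interpolate a' b' D' Q' M' p.1} ⊆
      {p | p.2 ∈ interpolate a b D Q M p.1} := by
  let G : Bool → ℝ → Set (Icc (0 : ℝ) 1) := fun α r => {t | |(t : ℝ) - endpt α| ≤ r}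
  have hG : ∀ α r, IsClosed (G α r) := fun α r => isClosed_le (by fun_prop) continuous_const
  have hAG : ∀ α r t, t ∈ A α r → t ∈ G α r := fun α r t (h : |(t : ℝ) - endpt α| < r) => h.le
  have h1 : IsClosed ((⋃ α, G α a' ×ˢ closure (D' α)) ∪
      ((⋃ α, G α b' ×ˢ closure (Q' α)) ∪ (⋂ α, G α b') ×ˢ closure M')) :=
    (isClosed_iUnion_of_finite fun α => (hG α a').prod isClosed_closure).union
      ((isClosed_iUnion_of_finite fun α => (hG α b').prod isClosed_closure).union
        ((isClosed_iInter fun α => hG α b').prod isClosed_closure))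
  refine (closure_minimal ?_ h1).trans ?_
  · intro p hp
    have h2 := (interpolate_iff hab' hb' (p.2 ∈ ·) (fun α h => hQD' α h) (fun α h => hQM' α h)
      p.1).1 hp
    refine h2.imp ?_ (Or.imp ?_ ?_)
    · rintro ⟨α, h, h'⟩
      exact mem_iUnion.2 ⟨α, hAG _ _ _ h, subset_closure h'⟩
    · rintro ⟨α, h, h'⟩
      exact mem_iUnion.2 ⟨α, hAG _ _ _ h, subset_closure h'⟩
    · rintro ⟨h, h'⟩
      exact ⟨mem_iInter.2 fun α => hAG _ _ _ (h α), subset_closure h'⟩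
  · intro p hp
    refine (interpolate_iff hab hb (p.2 ∈ ·) (fun α h => hQD α h) (fun α h => hQM α h) p.1).2 ?_
    refine hp.imp ?_ (Or.imp ?_ ?_)
    · intro h
      obtain ⟨α, h, h'⟩ := mem_iUnion.1 h
      exact ⟨α, lt_of_le_of_lt h ha, hD α h'⟩
    · intro h
      obtain ⟨α, h, h'⟩ := mem_iUnion.1 h
      exact ⟨α, lt_of_le_of_lt h hbb, hQ α h'⟩
    · rintro ⟨h, h'⟩
      exact ⟨fun α => lt_of_le_of_lt (mem_iInter.1 h α) hbb, hM h'⟩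

theorem isCompact_closure_interpolate [T2Space Z] (hD : ∀ α, IsCompact (closure (D α)))
    (hQ : ∀ α, IsCompact (closure (Q α))) (hM : IsCompact (closure M)) :
    IsCompact (closure {p : Icc (0 : ℝ) 1 × Z | p.2 ∈ interpolate a b D Q M p.1}) := by
  have h1 := isCompact_univ (X := Icc (0 : ℝ) 1) |>.prod
    ((isCompact_iUnion hD).union ((isCompact_iUnion hQ).union hM))
  refine h1.closure_of_subset fun p hp => ⟨mem_univ _, ?_⟩
  have h2 : ∀ S : Set Z, (S ⊆ (⋃ α, closure (D α)) ∪ ((⋃ α, closure (Q α)) ∪ closure M)) →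
      p.2 ∈ S → p.2 ∈ (⋃ α, closure (D α)) ∪ ((⋃ α, closure (Q α)) ∪ closure M) :=
    fun S hS h => hS h
  refine h2 _ ?_ hp
  refine interpolate_of (R := (· ⊆ (⋃ α, closure (D α)) ∪ ((⋃ α, closure (Q α)) ∪ closure M)))
    (fun α => ?_) (fun α => ?_) ?_ p.1
  · exact subset_union_of_subset_left (subset_iUnion_of_subset α subset_closure) _
  · exact subset_union_of_subset_right (subset_union_of_subset_left
      (subset_iUnion_of_subset α subset_closure) _) _
  · exact subset_union_of_subset_right (subset_union_of_subset_right subset_closure _) _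

end

theorem interpolate_map {T T' : Type*} (f : T → T') {a b : ℝ} {D Q : Bool → T} {M : T}
    (t : Icc (0 : ℝ) 1) : f (interpolate a b D Q M t) =
      interpolate a b (fun α => f (D α)) (fun α => f (Q α)) (f M) t := by
  unfold interpolate
  split_ifs <;> rfl

namespace WeakAtlas

variable {N : ℕ} {P : BasicData.{w} N} {X : Type u} [TopologicalSpace X] {d : ℤ}
  (K : WeakAtlas.{u, v, w} P X d)

/-- The subdomain of a product cobordism with prescribed slices. -/
def sliceSubdomain (S : Icc (0 : ℝ) 1 → Subdomain K.toWeakSystem)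
    (hF : ∀ i, IsOpen {p : Icc (0 : ℝ) 1 × X | p.2 ∈ (S p.1).F i})
    (hV : ∀ I, IsOpen {p : Icc (0 : ℝ) 1 × K.U I | p.2 ∈ (S p.1).V I}) :
    Subdomain K.unitProd.toWeakSystem where
  F i := {p | p.2 ∈ (S p.1).F i}
  cover := eq_univ_of_forall fun p => by
    obtain ⟨i, hi⟩ := mem_iUnion.1 ((S p.1).cover ▸ mem_univ p.2)
    exact mem_iUnion.2 ⟨i, hi⟩
  F_open := hF
  F_subset i p hp := ⟨mem_univ _, (S p.1).F_subset i hp⟩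
  idx I hI := by
    obtain ⟨h1, p, hp⟩ := (S 0).idx I (isIdx_univ_prod.1 hI)
    exact ⟨h1, (0, p), mem_iInter₂.2 fun i hi => mem_iInter₂.1 hp i hi⟩
  V I := {p : Icc (0 : ℝ) 1 × K.U (K.base I) | p.2 ∈ (S p.1).V (K.base I)}
  isOpen I := hV (K.base I)
  smul I g p hp := (S p.1).smul (K.base I) g p.2 hp
  zero I z := (S z.1.1).zero (K.base I) ⟨z.1.2, z.2⟩

/-- A family of subdomains of a product cobordism is tame if its slices are. -/
theorem tameFam_sliceSubdomain (S : Icc (0 : ℝ) 1 → Subdomain K.toWeakSystem)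
    (hF : ∀ i, IsOpen {p : Icc (0 : ℝ) 1 × X | p.2 ∈ (S p.1).F i})
    (hV : ∀ I, IsOpen {p : Icc (0 : ℝ) 1 × K.U I | p.2 ∈ (S p.1).V I})
    (h : ∀ t, WeakSystem.TameFam K.toWeakSystem (S t).V) :
    WeakSystem.TameFam K.unitProd.toWeakSystem (K.sliceSubdomain S hF hV).V where
  isOpen := (K.sliceSubdomain S hF hV).isOpen
  smul := (K.sliceSubdomain S hF hV).smul
  image I J hIJ y hy hd := (h y.1).image (K.base I) (K.base J) hIJ y.2 hy hd
  inter I J L hIJ hIL y z hy hz e := by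
    obtain ⟨⟨t, y⟩, hyl⟩ := y
    obtain ⟨⟨t', z⟩, hzl⟩ := z
    have e1 : t = t' := congrArg Prod.fst e
    subst e1
    have e2 : (K.change (K.base I) (K.base J) hIJ).ρ ⟨y, hyl⟩ =
      (K.change (K.base I) (K.base L) hIL).ρ ⟨z, hzl⟩ := congrArg Prod.snd e
    obtain ⟨M, hM, hIM, w, hw, e3⟩ := (h t).inter (K.base I) (K.base J) (K.base L) hIJ hIL
      ⟨y, hyl⟩ ⟨z, hzl⟩ hy hz e2
    exact ⟨⟨M.1, isIdx_univ_prod.2 M.2⟩, hM, hIM, ⟨(t, w.1), w.2⟩, hw, Prod.ext rfl e3⟩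

end WeakAtlas

namespace WeakSystem.ShrinkMaps

variable {N : ℕ} {P : BasicData.{w} N} {X : Type u} [TopologicalSpace X] {d : ℤ}
  {K' K'' K : WeakSystem.{u, v, w} P X d}

/-- The subdomain that corresponds to a shrinking. -/
def subdomain (m : ShrinkMaps K' K) : Subdomain K where
  F := K'.F
  cover := K'.cover
  F_open := K'.F_open
  F_subset i := subset_closure.trans (m.F_precompact i).2
  idx I := (m.idx_iff I).1
  V := m.dom
  isOpen I := (m.j_embedding _).isOpen_range
  smul I g := by
    rintro _ ⟨x, rfl⟩
    exact ⟨g • x, m.j_equiv (m.down I) g x⟩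
  zero I z := by
    constructor
    · rintro ⟨x, hx⟩
      have key : ∀ y : {u : K.U I // (K.chart I).s u = 0}, m.j (m.down I) x = y.1 →
          ∀ i ∈ I.1, (K.chart I).ψ y ∈ K'.F i := by
        rintro ⟨_, hy⟩ rfl i hi
        have h1 : (K'.chart (m.down I)).s x = 0 := (m.j_s (m.down I) x).symm.trans hy
        have h2 := m.j_ψ (m.down I) x h1 hy
        exact Eq.mpr (congrArg (· ∈ K'.F i) h2) (K'.ψ_mem (I := m.down I) ⟨x, h1⟩ hi)
      exact key z hx
    · intro h
      obtain ⟨x, hx⟩ := (mem_footprint (K := K') (I := m.down I)).2 h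
      have h1 : (K.chart I).s (m.j (m.down I) x.1) = 0 := (m.j_s (m.down I) x.1).trans x.2
      have h2 : (K.chart I).ψ ⟨m.j (m.down I) x.1, h1⟩ = (K.chart I).ψ z :=
        (m.j_ψ (m.down I) x.1 x.2 h1).trans hx
      obtain ⟨g, hg⟩ := ((K.chart I).ψ_eq_iff _ _).1 h2
      exact ⟨g • x.1, (m.j_equiv (m.down I) g x.1).trans hg⟩

theorem isCompact_closure_subdomain (m : ShrinkMaps K' K) (I : Idx K.F) :
    IsCompact (closure (m.subdomain.V I)) := m.j_precompact (m.down I)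

theorem closure_subdomain_comp (m : ShrinkMaps K' K'') (m' : ShrinkMaps K'' K) (I : Idx K.F) :
    closure ((m.comp m').subdomain.V I) ⊆ m'.subdomain.V I := by
  have := (K.chart I).t2
  have h1 : IsCompact (m'.j (m'.down I) '' closure (range (m.j (m.down (m'.down I))))) :=
    (m.j_precompact (m.down (m'.down I))).image (m'.j_embedding (m'.down I)).continuous
  refine (closure_minimal ?_ h1.isClosed).trans (image_subset_range _ _)
  rintro _ ⟨x, rfl⟩
  exact ⟨_, subset_closure (mem_range_self x), rfl⟩

end WeakSystem.ShrinkMaps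

/-! ### Concordances -/

/-- Subdomains that can be interpolated: the inner ones are contained in those at the ends and in
the one in the middle. -/
structure Interpolation {N : ℕ} {P : BasicData.{w} N} {X : Type u} [TopologicalSpace X] {d : ℤ}
    (K : WeakAtlas.{u, v, w} P X d) where
  D : Bool → Subdomain K.toWeakSystem
  Q : Bool → Subdomain K.toWeakSystem
  M : Subdomain K.toWeakSystem
  F_D : ∀ i α, (Q α).F i ⊆ (D α).F i
  F_M : ∀ i α, (Q α).F i ⊆ M.F i
  V_D : ∀ I α, (Q α).V I ⊆ (D α).V I
  V_M : ∀ I α, (Q α).V I ⊆ M.V I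

namespace Interpolation

variable {N : ℕ} {P : BasicData.{w} N} {X : Type u} [TopologicalSpace X] {d : ℤ}
  {K : WeakAtlas.{u, v, w} P X d} (T : Interpolation K) {a b : ℝ}

theorem setOf_F (a b : ℝ) (i : Fin N) :
    {p : Icc (0 : ℝ) 1 × X | p.2 ∈ (interpolate a b T.D T.Q T.M p.1).F i} =
      {p | p.2 ∈ interpolate a b (fun α => (T.D α).F i) (fun α => (T.Q α).F i) (T.M.F i) p.1} := by
  ext p
  exact iff_of_eq (congrArg (p.2 ∈ ·)
    (interpolate_map (fun S : Subdomain K.toWeakSystem => S.F i) p.1))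

theorem setOf_V (a b : ℝ) (I : Idx K.F) :
    {p : Icc (0 : ℝ) 1 × K.U I | p.2 ∈ (interpolate a b T.D T.Q T.M p.1).V I} =
      {p | p.2 ∈ interpolate a b (fun α => (T.D α).V I) (fun α => (T.Q α).V I) (T.M.V I) p.1} := by
  ext p
  exact iff_of_eq (congrArg (p.2 ∈ ·)
    (interpolate_map (fun S : Subdomain K.toWeakSystem => S.V I) p.1))

/-- The subdomain of the product cobordism that interpolates between the given subdomains. -/
def subdomain (hab : a + b ≤ 1) (hb : 1 / 2 < b) : Subdomain K.unitProd.toWeakSystem :=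
  K.sliceSubdomain (interpolate a b T.D T.Q T.M)
    (fun i => by
      rw [T.setOf_F]
      exact isOpen_interpolate hab hb (T.F_D i) (T.F_M i) (fun α => (T.D α).F_open i)
        (fun α => (T.Q α).F_open i) (T.M.F_open i))
    (fun I => by
      rw [T.setOf_V]
      exact isOpen_interpolate hab hb (T.V_D I) (T.V_M I) (fun α => (T.D α).isOpen I)
        (fun α => (T.Q α).isOpen I) (T.M.isOpen I))

theorem tameFam_subdomain (hab : a + b ≤ 1) (hb : 1 / 2 < b)
    (hD : ∀ α, WeakSystem.TameFam K.toWeakSystem (T.D α).V)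
    (hQ : ∀ α, WeakSystem.TameFam K.toWeakSystem (T.Q α).V)
    (hM : WeakSystem.TameFam K.toWeakSystem T.M.V) :
    WeakSystem.TameFam K.unitProd.toWeakSystem (T.subdomain hab hb).V :=
  K.tameFam_sliceSubdomain _ _ _ fun t => interpolate_of
    (R := fun S : Subdomain K.toWeakSystem => WeakSystem.TameFam K.toWeakSystem S.V) hD hQ hM t

theorem isInside_subdomain {T' : Interpolation K} {a' b' : ℝ} (hab : a + b ≤ 1) (hb : 1 / 2 < b)
    (hab' : a' + b' ≤ 1) (hb' : 1 / 2 < b') (ha : a' < a) (hbb : b' < b)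
    (hD : ∀ α, (T'.D α).IsInside (T.D α)) (hQ : ∀ α, (T'.Q α).IsInside (T.Q α))
    (hM : T'.M.IsInside T.M) : (T'.subdomain hab' hb').IsInside (T.subdomain hab hb) where
  F i := by
    have h := closure_interpolate_subset hab hb (T.F_D i) (T.F_M i) hab' hb' (T'.F_D i) (T'.F_M i)
      ha hbb (fun α => (hD α).F i) (fun α => (hQ α).F i) (hM.F i)
    rw [← T.setOf_F, ← T'.setOf_F] at h
    exact h
  V I := by
    have h := closure_interpolate_subset hab hb (T.V_D (K.base I)) (T.V_M (K.base I)) hab' hb'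
      (T'.V_D (K.base I)) (T'.V_M (K.base I)) ha hbb (fun α => (hD α).V (K.base I))
      (fun α => (hQ α).V (K.base I)) (hM.V (K.base I))
    rw [← T.setOf_V, ← T'.setOf_V] at h
    exact h

theorem isCompact_closure_subdomain (hab : a + b ≤ 1) (hb : 1 / 2 < b)
    (hD : ∀ α I, IsCompact (closure ((T.D α).V I))) (hQ : ∀ α I, IsCompact (closure ((T.Q α).V I)))
    (hM : ∀ I, IsCompact (closure (T.M.V I))) (I : Idx K.unitProd.F) :
    IsCompact (closure ((T.subdomain hab hb).V I)) := by
  have := (K.chart (K.base I)).t2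
  have h := isCompact_closure_interpolate (a := a) (b := b) (fun α => hD α (K.base I))
    (fun α => hQ α (K.base I)) (hM (K.base I))
  rw [← T.setOf_V] at h
  exact h

end Interpolation

namespace WeakAtlas

variable {N : ℕ} {P : BasicData.{w} N} {X : Type u} [TopologicalSpace X] {d : ℤ}

/-- Functions on the base whose superlevel sets lie between the footprints of shrinkings and those
of the system. -/
theorem exists_continuous_between [NormalSpace X] {F : Fin N → Set X} (hF : ∀ i, IsOpen (F i))
    {F' : Bool → Fin N → Set X} (hF' : ∀ α i, closure (F' α i) ⊆ F i) :
    ∃ ϑ : Fin N → X → ℝ, (∀ i, Continuous (ϑ i)) ∧ (∀ i p, 0 ≤ ϑ i p → p ∈ F i) ∧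
      ∀ α i p, p ∈ F' α i → 1 / 2 < ϑ i p := by
  have h1 : ∀ i, ∃ f : C(X, ℝ), EqOn f 0 (F i)ᶜ ∧ EqOn f 1 (⋃ α, closure (F' α i)) ∧
      ∀ x, f x ∈ Icc (0 : ℝ) 1 := fun i => by
    refine exists_continuous_zero_one_of_isClosed (hF i).isClosed_compl
      (isClosed_iUnion_of_finite fun α => isClosed_closure) ?_
    rw [disjoint_compl_left_iff_subset]
    exact iUnion_subset fun α => hF' α i
  choose f hf0 hf1 _ using h1
  refine ⟨fun i p => 2 * f i p - 1, fun i => by fun_prop, fun i p hp => ?_, fun α i p hp => ?_⟩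
  · by_contra h
    have := hf0 i h
    simp only [Pi.zero_apply] at this
    simp only [this] at hp
    norm_num at hp
  · have := hf1 i (mem_iUnion.2 ⟨α, subset_closure hp⟩)
    simp only [Pi.one_apply] at this
    simp only [this]
    norm_num

/-- Two tame shrinkings of tame shrinkings are joined by nested interpolations. -/
theorem exists_interpolation [CompactSpace X] [T2Space X] (K : WeakAtlas.{u, v, w} P X d)
    {K' K'' : Bool → WeakAtlas.{u, v, w} P X d}
    (m' : ∀ α, WeakSystem.ShrinkMaps (K' α).toWeakSystem (K'' α).toWeakSystem)
    (m'' : ∀ α, WeakSystem.ShrinkMaps (K'' α).toWeakSystem K.toWeakSystem) :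
    ∃ T' T : Interpolation K, (∀ α, T'.D α = ((m' α).comp (m'' α)).subdomain) ∧
      (∀ α, T.D α = (m'' α).subdomain) ∧
      (∀ α, (T'.Q α).IsInside (T.Q α)) ∧ T'.M.IsInside T.M ∧
      (∀ α, (T.Q α).IsPrecompact) ∧ T.M.IsPrecompact ∧
      (∀ α, WeakSystem.TameFam K.toWeakSystem (T'.Q α).V) ∧
      (∀ α, WeakSystem.TameFam K.toWeakSystem (T.Q α).V) ∧
      WeakSystem.TameFam K.toWeakSystem T'.M.V ∧ WeakSystem.TameFam K.toWeakSystem T.M.V := by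
  let m := fun α => (m' α).comp (m'' α)
  have h1 : ∀ α, ∃ ϑ : Fin N → X → ℝ, (∀ i, Continuous (ϑ i)) ∧
      (∀ i p, 0 ≤ ϑ i p → p ∈ (K' α).F i) ∧ (∀ p, ∃ i, 1 / 2 < ϑ i p) ∧
      ∀ I, IsIdx K.F I → ∃ p, ∀ i ∈ I, 1 / 2 < ϑ i p := fun α => by
    obtain ⟨T, hT, hTi⟩ := WeakSystem.exists_finite_idx (K' α).F
    obtain ⟨ϑ, hϑ, hF, hc, hp⟩ := exists_continuous_shrinking (K' α).F_open (K' α).cover hT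
    refine ⟨ϑ, hϑ, hF, hc, fun I hI => ?_⟩
    obtain ⟨p, hpT, hpI⟩ := hTi I (((m α).idx_iff I).1 hI)
    exact ⟨p, fun i hi => hp p hpT i (hpI i hi)⟩
  choose ϑ hϑ hϑF hϑc hϑi using h1
  obtain ⟨η, hη, hηF, hη'⟩ := exists_continuous_between K.F_open
    (F' := fun α => (K' α).F) fun α i => ((m α).F_precompact i).2
  have hle : ∀ α i p, 1 / 2 < ϑ α i p → 1 / 2 < η i p := fun α i p hp =>
    hη' α i p (hϑF α i p (by linarith))
  obtain ⟨M', M, hM'F, hMF, hM', hM, hM't, hMt, -⟩ := WeakSystem.exists_tameFam_within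
    K.hasOpenLifts
    hη hηF (fun p => (hϑc false p).imp fun i => hle false i p)
    (fun I hI => (hϑi false I hI).imp fun p hp i hi => hle false i p (hp i hi))
    (fun _ => isOpen_univ) (fun _ _ _ => mem_univ _)
  have h2 : ∀ α, ∃ S' S : Subdomain K.toWeakSystem, (∀ i, S'.F i = {p | 1 / 2 < ϑ α i p}) ∧
      (∀ i, S.F i = {p | 0 < ϑ α i p}) ∧ S'.IsInside S ∧ S.IsPrecompact ∧
      WeakSystem.TameFam K.toWeakSystem S'.V ∧ WeakSystem.TameFam K.toWeakSystem S.V ∧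
      ∀ I, S.V I ⊆ (m α).subdomain.V I ∩ M'.V I := fun α => by
    refine WeakSystem.exists_tameFam_within K.hasOpenLifts (hϑ α) (fun i p hp => ?_) (hϑc α) (hϑi α)
      (fun I => ((m α).subdomain.isOpen I).inter (M'.isOpen I)) (fun I z hz => ⟨?_, ?_⟩)
    · exact ((m α).F_precompact i).2 (subset_closure (hϑF α i p hp))
    · exact ((m α).subdomain.zero I z).2 fun i hi => hϑF α i _ (hz i hi)
    · refine (M'.zero I z).2 fun i hi => ?_
      rw [hM'F]
      exact hη' α i _ (hϑF α i _ (hz i hi))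
  choose Q' Q hQ'F hQF hQ' hQ hQ't hQt hQO using h2
  have hQ'V : ∀ I α, (Q' α).V I ⊆ (Q α).V I := fun I α => subset_closure.trans ((hQ' α).V I)
  have hM'V : ∀ I, M'.V I ⊆ M.V I := fun I => subset_closure.trans (hM'.V I)
  refine ⟨⟨fun α => (m α).subdomain, Q', M', ?_, ?_, ?_, ?_⟩, ⟨fun α => (m'' α).subdomain, Q, M,
    ?_, ?_, ?_, ?_⟩, fun _ => rfl, fun _ => rfl, hQ', hM', hQ, hM, hQ't, hQt, hM't, hMt⟩
  · intro i α
    rw [hQ'F]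
    exact fun p (hp : 1 / 2 < ϑ α i p) => hϑF α i p (by linarith)
  · intro i α
    rw [hQ'F, hM'F]
    exact fun p hp => hle α i p hp
  · exact fun I α => (hQ'V I α).trans fun x hx => (hQO α I hx).1
  · exact fun I α => (hQ'V I α).trans fun x hx => (hQO α I hx).2
  · intro i α
    rw [hQF]
    exact fun p (hp : 0 < ϑ α i p) => ((m' α).F_precompact i).2 (subset_closure (hϑF α i p hp.le))
  · intro i α
    rw [hQF, hMF]
    exact fun p (hp : 0 < ϑ α i p) => (by norm_num : (0 : ℝ) < 1 / 2).trans
      (hη' α i p (hϑF α i p hp.le))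
  · exact fun I α x hx => (m' α).closure_subdomain_comp (m'' α) I (subset_closure (hQO α I hx).1)
  · exact fun I α x hx => hM'V I (hQO α I hx).2

/-- Any two preshrunk tame shrinkings of an atlas, with admissible metrics, are metric tame
concordant.  The interpolation with the larger slices supplies the tame system in which the one
with the smaller slices is a shrinking. -/
theorem metricTameConcordant [CompactSpace X] [T2Space X] {K : WeakAtlas.{u, v, w} P X d}
    {K' : Bool → WeakAtlas.{u, v, w} P X d} {D : ∀ α, (K' α).Real → (K' α).Real → ℝ}
    (hK : ∀ α, (K' α).IsPreshrunkTame K) (hD : ∀ α, (K' α).IsAdmissible (D α)) :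
    MetricTameConcordant fun α => ⟨K' α, D α⟩ := by
  have h1 : ∀ α, ∃ K'' : WeakAtlas.{u, v, w} P X d, K''.IsTame ∧
      Nonempty (WeakSystem.ShrinkMaps K''.toWeakSystem K.toWeakSystem) ∧
      Nonempty (WeakSystem.ShrinkMaps (K' α).toWeakSystem K''.toWeakSystem) := fun α => (hK α).2
  choose K'' hK'' m'' m' using h1
  let m'' := fun α => (m'' α).some
  let m' := fun α => (m' α).some
  let m := fun α => (m' α).comp (m'' α)
  obtain ⟨T', T, hT'D, hTD, hQ, hM, hQc, hMc, hQ't, hQt, hM't, hMt⟩ := K.exists_interpolation m' m''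
  have hD't : ∀ α, WeakSystem.TameFam K.toWeakSystem (T'.D α).V := fun α => by
    rw [hT'D]
    exact (m α).tameFam (hK α).1
  have hDt : ∀ α, WeakSystem.TameFam K.toWeakSystem (T.D α).V := fun α => by
    rw [hTD]
    exact (m'' α).tameFam (hK'' α)
  have hDi : ∀ α, (T'.D α).IsInside (T.D α) := fun α => by
    rw [hT'D, hTD]
    exact ⟨fun i => ((m' α).F_precompact i).2, (m' α).closure_subdomain_comp (m'' α)⟩
  -- The larger interpolation uses its ends for times less than `1 / 5` and its middle in
  -- `(2 / 5, 3 / 5)`.  The closures of the corresponding intervals `[0, 3 / 20)` and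
  -- `(9 / 20, 11 / 20)` of the smaller one are contained in these.
  have hab : (1 / 5 : ℝ) + 3 / 5 ≤ 1 := by norm_num
  have hb : (1 / 2 : ℝ) < 3 / 5 := by norm_num
  have hab' : (3 / 20 : ℝ) + 11 / 20 ≤ 1 := by norm_num
  have hb' : (1 / 2 : ℝ) < 11 / 20 := by norm_num
  let S := T.subdomain hab hb
  let S' := T'.subdomain hab' hb'
  have hS : S'.IsInside S :=
    T.isInside_subdomain hab hb hab' hb' (by norm_num) (by norm_num) hDi hQ hM
  have hSc : ∀ I, IsCompact (closure (S'.V I)) := T'.isCompact_closure_subdomain hab' hb'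
    (fun α I => by
      rw [hT'D]
      exact (m α).isCompact_closure_subdomain I)
    (fun α I => ((hQc α).V I).of_isClosed_subset isClosed_closure
      (((hQ α).V I).trans subset_closure))
    (fun I => (hMc.V I).of_isClosed_subset isClosed_closure ((hM.V I).trans subset_closure))
  let c : WeakCobordism.Collaring K.unitProd S' :=
    { δ := 3 / 20
      δ_pos := by norm_num
      δ_le := by
        change (3 / 20 : ℝ) ≤ 1 / 4
        norm_num
      bd := K'
      m := m
      mem_F := fun α t ht i b => by
        have h2 : interpolate (3 / 20) (11 / 20) T'.D T'.Q T'.M t = T'.D α :=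
          interpolate_of_mem (by norm_num) ht
        rw [hT'D] at h2
        exact iff_of_eq (congrArg (fun S : Subdomain K.toWeakSystem => b ∈ S.F i) h2)
      mem_V := fun α t ht I x => by
        have h2 : interpolate (3 / 20) (11 / 20) T'.D T'.Q T'.M t = T'.D α :=
          interpolate_of_mem (by norm_num) ht
        rw [hT'D] at h2
        exact iff_of_eq (congrArg (fun S : Subdomain K.toWeakSystem => x ∈ S.V I) h2) }
  have hL : c.restrict.IsTame :=
    (T'.tameFam_subdomain hab' hb' hD't hQ't hM't).isTame_restrict
  have hL' : (K.unitProd.toWeakSystem.restrict S).IsTame :=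
    (T.tameFam_subdomain hab hb hDt hQt hMt).isTame_restrict
  obtain ⟨D₀, hD₀⟩ := (WeakSystem.restrictRestrictShrinkMaps S' S
    (fun i => ⟨isClosed_closure.isCompact, hS.F i⟩) hSc hS.V).exists_isAdmissible hL hL'
  obtain ⟨D', hD', he⟩ :=
    WeakCobordism.exists_isCollaredAdmissible (K := c.restrict) (e := D) hD₀ hD
  exact ⟨c.restrict, D', hL, hD', fun α => congrArg (Sigma.mk (K' α)) (he α)⟩

end WeakAtlas

end Kuranishi

end

theorem mainTheorem3 {N : ℕ} (P : Kuranishi.BasicData.{w} N) (d : ℤ)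
    {X : Type u} [TopologicalSpace X] [CompactSpace X] [MetrizableSpace X]
    {Y : Type u} [TopologicalSpace Y] [CompactSpace Y] [MetrizableSpace Y]
    {B : Bool → Type u} [∀ α, TopologicalSpace (B α)] (C : Kuranishi.CollaredCobordism Y B) :
    /- (i) existence of preshrunk tame shrinkings -/
    ((∀ K : Kuranishi.WeakAtlas.{u, v, w} P X d,
        ∃ K' : Kuranishi.WeakAtlas.{u, v, w} P X d, K'.IsPreshrunkTame K) ∧
      (∀ K : Kuranishi.WeakCobordism.{u, v, w} P C d,
        ∃ K' : Kuranishi.WeakCobordism.{u, v, w} P C d, K'.IsPreshrunkTame K)) ∧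
    /- (ii) realizations of tame atlases and cobordisms -/
    ((∀ K : Kuranishi.WeakAtlas.{u, v, w} P X d, K.IsTame →
        T2Space K.Real ∧ T2Space K.RealE ∧
        ∀ I, IsEmbedding (K.πbar I) ∧ IsEmbedding (K.πEbar I)) ∧
      (∀ K : Kuranishi.WeakCobordism.{u, v, w} P C d, K.IsTame →
        T2Space K.Real ∧ T2Space K.RealE ∧
        ∀ I, IsEmbedding (K.πbar I) ∧ IsEmbedding (K.πEbar I))) ∧
    /- (iii) existence of admissible metrics, collared for cobordisms -/
    ((∀ K K' : Kuranishi.WeakAtlas.{u, v, w} P X d, K'.IsPreshrunkTame K →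
        ∃ D : K'.Real → K'.Real → ℝ, K'.IsAdmissible D) ∧
      (∀ K K' : Kuranishi.WeakCobordism.{u, v, w} P C d, K'.IsPreshrunkTame K →
        ∃ D : K'.Real → K'.Real → ℝ, K'.IsCollaredAdmissible D)) ∧
    /- (iv) uniqueness of metric preshrunk tame shrinkings up to metric tame concordance -/
    (∀ (K : Kuranishi.WeakAtlas.{u, v, w} P X d)
        (K' : Bool → Kuranishi.WeakAtlas.{u, v, w} P X d)
        (D : ∀ α, (K' α).Real → (K' α).Real → ℝ),
        (∀ α, (K' α).IsPreshrunkTame K ∧ (K' α).IsAdmissible (D α)) →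
          Kuranishi.MetricTameConcordant fun α => ⟨K' α, D α⟩) := by
  refine ⟨⟨fun K => K.exists_isPreshrunkTame, fun K => K.exists_isPreshrunkTame⟩,
    ⟨fun K hK => ⟨hK.t2Space_real, hK.t2Space_realE,
      fun I => ⟨hK.isEmbedding_πbar I, hK.isEmbedding_πEbar I⟩⟩,
    fun K hK => ⟨hK.t2Space_real, hK.t2Space_realE,
      fun I => ⟨hK.isEmbedding_πbar I, hK.isEmbedding_πEbar I⟩⟩⟩, ⟨?_, ?_⟩, ?_⟩
  · rintro K K' ⟨h', K'', h'', -, ⟨m⟩⟩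
    exact m.exists_isAdmissible h' h''
  · rintro K K' ⟨h', K'', h'', -, m, -⟩
    obtain ⟨D, hD⟩ := m.exists_isAdmissible h' h''
    obtain ⟨D', hD', -⟩ := Kuranishi.WeakCobordism.exists_isCollaredAdmissible hD
      (Kuranishi.WeakCobordism.isAdmissible_bdDist hD)
    exact ⟨D', hD'⟩
  · exact fun K K' D h => Kuranishi.WeakAtlas.metricTameConcordant (fun α => (h α).1)
      fun α => (h α).2
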